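/- **Conventions.** For a compact space $Z$ let $C(Z)=[0,\infty)\times Z/(\{0\}\times Z)$ and $C_R(Z)=\{r<R\}\subset C(Z)$, where $C(\emptyset)$ is a point. A *compact smoothly stratified space* $X$ of dimension $n$ is a compact Hausdorff space decomposed into strata $Y_0,\dots,Y_n$, where $Y_j$ is a smooth $j$-manifold, $Y_{n-1}=\emptyset$ and $X^{reg}=Y_n$ is dense, together with a finite cover by open sets $W_\alpha$ and homeomorphisms $\varphi_\alpha: W_\alpha\to U_\alpha\times C_{R_\alpha}(Z_\alpha)$, with $U_\alpha\subset\mathbb R^{d_\alpha}$ non-empty, open and bounded. Here $Z_\alpha$ is a compact smoothly stratified space of dimension $n-d_\alpha-1$ (defined recursively; $Z_\alpha=\emptyset$ if and only if $d_\alpha=n$), and $\varphi_\alpha$ maps $Y_{d_\alpha}\cap W_\alpha$ diffeomorphically onto $U_\alpha\times\{0\}$ and the strata of larger dimension diffeomorphically onto the sets $U_\alpha\times(0,R_\alpha)\times(\text{stratum of }Z_\alpha)$. The depth of $\emptyset$ is $0$, and the depth of a non-empty $X$ is one more than the largest depth of a link $Z_\alpha$; let $\ell_\alpha$ be the depth of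 $Z_\alpha$. For quadratic forms, $|A-B|\le\varepsilon$ means $|A(v)-B(v)|\le\varepsilon B(v)$ for all $v$. Let $\gamma\in(0,1]$. For a subset $Q$ of a finite-dimensional normed space, a Riemannian metric $G$ on $Q\times X^{reg}$ is a *$\gamma$-Hölder iterated edge metric with constant $C$ on $Q\times X$* if for each $\alpha$ there are, for $(b,y)\in Q\times U_\alpha$, a quadratic form $H(b,y)$ on the tangent space of $Q\times U_\alpha$, a number $a(b,y)>0$ and a metric $k(b,y)$ on $Z_\alpha^{reg}$ such that: (i) $C^{-1}|v|^2\le H(v)\le C|v|^2$, $C^{-1}\le a\le C$, and $H$ and $a$ are $\gamma$-Hölder with constant $C$; (ii) each $k(b,y)$ is a $\gamma$-Hölder iterated edge metric with constant $C$ on $Z_\alpha$, and $|k(p)-k(p')|\le C|p-p'|^\gamma$; (iii) if $d_\alpha=n$, then $G=H$ in the chart; (iv) if $d_\alpha<n$, then in the chart $|G-(H+a\,dr^2+r^2k)|\le Cr^\gamma$, and for every $b_0\in Q$, $y_0\in U_\alpha$, $r_0\in(0,R_\alpha)$ the metric $r_0^{-2}G$, written in the coordinates $u=(u_1,u_2,u_3)$,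 $b=b_0+r_0u_1$, $y=y_0+r_0u_2$, $r=r_0(1+u_3)$, is a $\gamma$-Hölder iterated edge metric with constant $C$ on $Q'\times Z_\alpha$, where $Q'$ is the set of the $u$ with $|u|<1/2$ that correspond to points of $Q\times U_\alpha\times(0,R_\alpha)$. An *iterated edge metric* (of exponent $\gamma$) on $X$ is a metric on $X^{reg}$ satisfying this, for some $C$, with $Q$ a point. The geodesic distance on $X$ is the infimum of the lengths of curves made of finitely many $C^1$ curves lying in $X^{reg}$ except for their ends; $B(m,r)$ denotes its open balls. **Proposition 2.1.** Let $(M,g)$ be a compact smoothly stratified space, with charts $\varphi_\alpha:W_\alpha\to U_\alpha\times C_{R_\alpha}(Z_\alpha)$ as above, and with an iterated edge metric $g$ of exponent $\gamma\in(0,1]$. Assume that the tangent spheres are connected, that is, for each $\alpha$ the unit sphere $\{(v,(r,z)):|v|^2+r^2=1\}$ of $\mathbb R^{d_\alpha}\times C(Z_\alpha)$ is connected. Then there are constants $\Lambda>0$, $\delta_0\in(0,1]$, $\kappa\ge1$ with $\Lambda\delta_0<1$ such that for every $\delta\in(0,\delta_0)$, $m\in M$ and $\alpha$ with $B(m,\delta)\subset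 W_\alpha$, there are numbers $\rho_1,\dots,\rho_{\ell_\alpha}\in(0,1)$ and $\rho_{\ell_\alpha+1}=0$, and for every $j\in\{1,\dots,\ell_\alpha+1\}$ a connected compact smoothly stratified space $S=S_{m,j,\alpha}$ with an iterated edge metric $h=h_{m,j,\alpha}$ of exponent $\gamma$ (depending on $\delta,m,j,\alpha$ only), with the following property. For every $\tau>0$ with $2\kappa\tau\le\delta$ and $$\tau_j\le\tau<\tau_{j-1},\qquad \tau_i:=\rho_1\rho_2\cdots\rho_i,\quad \tau_0:=1,$$ there are an open set $\Omega\subset M$ and a homeomorphism $\Omega\to C_{\kappa\tau}(S)$, which is a stratum-preserving diffeomorphism away from the vertex, such that $$B(m,\tau)\subset\Omega\subset B(m,2\kappa\tau),\qquad |g-(dt^2+t^2h)|\le\Lambda\left(\frac{\tau}{\rho_1\rho_2\cdots\rho_{j-1}}\right)^{\gamma}\ \text{ on the regular part of }\Omega\text{ away from the vertex}.$$ Moreover the set of all the spaces $(S,h)$ so obtained, as $\delta,m,j,\alpha$ vary, consists of compact metric spaces (for the geodesic distance of $h$, which induces the topology of $S$), and it is precompact in the bi-Lipschitz topology: every sequence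 in it has a subsequence converging to a compact metric space for the distance $\inf\{\log K: X,Y\text{ are }K\text{-bi-Lipschitz}\}$. In particular there are finitely many compact metric spaces $(Y_\beta,d_\beta)$, $\beta=1,\dots,N$, and a constant $K>1$ such that each of the $(S,h)$ is $K$-bi-Lipschitz to at least one $(Y_\beta,d_\beta)$. -/

import Mathlib

open Set Filter Topology MeasureTheory
open scoped Manifold ContDiff ENNReal

universe u

noncomputable section

namespace Stratified

/-- Euclidean space of dimension `n`. -/
abbrev E (n : ℕ) : Type := EuclideanSpace ℝ (Fin n)

/-! ### Cones -/

/-- The open cone `C(Z)`: the vertex, and the points `(r, z)` with `r > 0`, `z ∈ Z`.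
The cone over the empty space is a point. -/
def Cone (Z : Type u) : Type u := Option (Ioi (0 : ℝ) × Z)

namespace Cone

/-- The vertex of the cone. -/
def vertex {Z : Type u} : Cone Z := none

/-- The point with polar coordinates `p = (r, z)`, `r > 0`. -/
def off {Z : Type u} (p : Ioi (0 : ℝ) × Z) : Cone Z := some p

/-- The point with polar coordinates `(r, z)` (the vertex if `r ≤ 0`). -/
def pt {Z : Type u} (r : ℝ) (z : Z) : Cone Z :=
  if h : 0 < r then off (⟨r, h⟩, z) else vertex

/-- The radial coordinate. -/
def radius {Z : Type u} : Cone Z → ℝ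
  | none => 0
  | some p => p.1

/-- The cone topology: the product topology away from the vertex, and the truncated cones
`{radius < ε}` as a neighbourhood basis at the vertex (for compact `Z` this is the quotient
topology of `[0, ∞) × Z`). -/
instance {Z : Type u} [TopologicalSpace Z] : TopologicalSpace (Cone Z) where
  IsOpen s := IsOpen {p : Ioi (0 : ℝ) × Z | off p ∈ s} ∧
    ((vertex : Cone Z) ∈ s → ∃ ε > 0, ∀ x : Cone Z, radius x < ε → x ∈ s)
  isOpen_univ := ⟨by simp, fun _ => ⟨1, one_pos, fun _ _ => mem_univ _⟩⟩
  isOpen_inter s t hs ht := by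
    refine ⟨hs.1.inter ht.1, fun h => ?_⟩
    obtain ⟨a, ha, h1⟩ := hs.2 h.1
    obtain ⟨b, hb, h2⟩ := ht.2 h.2
    exact ⟨min a b, lt_min ha hb, fun x hx =>
      ⟨h1 x (hx.trans_le (min_le_left _ _)), h2 x (hx.trans_le (min_le_right _ _))⟩⟩
  isOpen_sUnion S hS := by
    refine ⟨?_, ?_⟩
    · have : {p : Ioi (0 : ℝ) × Z | off p ∈ ⋃₀ S} =
          ⋃ t ∈ S, {p : Ioi (0 : ℝ) × Z | off p ∈ t} := by
        ext p
        simp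
      rw [this]
      exact isOpen_biUnion fun t ht => (hS t ht).1
    · rintro ⟨t, ht, hv⟩
      obtain ⟨ε, hε, h⟩ := (hS t ht).2 hv
      exact ⟨ε, hε, fun x hx => ⟨t, ht, h x hx⟩⟩

end Cone

/-- The unit sphere of `ℝᵈ × C(Z)`, that is the `d`-fold spherical suspension of `Z`: the tangent
sphere at a point of a `d`-dimensional stratum with link `Z`. -/
def tangentSphere (d : ℕ) (Z : Type u) : Set (E d × Cone Z) :=
  {p | ‖p.1‖ ^ 2 + p.2.radius ^ 2 = 1}

/-! ### Smoothly stratified spaces -/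

/-- A topological space decomposed into the strata `{x | dim x = j}`, each of which carries charts
in `ℝʲ`; `n` is the dimension of the space. -/
structure StratSpace : Type (u + 1) where
  carrier : Type u
  [top : TopologicalSpace carrier]
  n : ℕ
  dim : carrier → ℕ
  [charted : ∀ j : ℕ, ChartedSpace (E j) {x : carrier // dim x = j}]

attribute [instance] StratSpace.top StratSpace.charted

/-- The `j`-dimensional stratum. -/
abbrev StratSpace.Stratum (X : StratSpace.{u}) (j : ℕ) : Type u := {x : X.carrier // X.dim x = j}

/-- The regular set: the stratum of top dimension. -/
abbrev StratSpace.Reg (X : StratSpace.{u}) : Type u := X.Stratum X.n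

/-- A homeomorphism `φ` from an open set of `X` onto `U × C_R(Z)`, with `U ⊆ ℝᵈ` open and bounded,
which away from `U × {vertex}` maps strata diffeomorphically to strata: `param` is the
inverse of `φ` on `U × (0, R) × Z_j`, with values in the stratum of dimension `d + 1 + j`. -/
structure ConeChart (X Z : StratSpace.{u}) : Type u where
  d : ℕ
  U : Set (E d)
  isOpen_U : IsOpen U
  nonempty_U : U.Nonempty
  bounded_U : Bornology.IsBounded U
  R : ℝ
  R_pos : 0 < R
  φ : OpenPartialHomeomorph X.carrier (E d × Cone Z.carrier)
  target_eq : φ.target = {p | p.1 ∈ U ∧ p.2.radius < R}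
  param : ∀ {j i : ℕ}, d + 1 + j = i → E d × (ℝ × Z.Stratum j) → X.Stratum i
  param_eq : ∀ {j i : ℕ} (h : d + 1 + j = i), ∀ y ∈ U, ∀ r ∈ Ioo 0 R, ∀ z : Z.Stratum j,
    (param h (y, (r, z))).1 = φ.symm (y, Cone.pt r z.1)
  param_diffeo : ∀ {j i : ℕ} (h : d + 1 + j = i),
    IsLocalDiffeomorphOn (𝓘(ℝ, E d).prod (𝓘(ℝ, ℝ).prod 𝓘(ℝ, E j))) 𝓘(ℝ, E i) ∞ (param h)
      {p | p.1 ∈ U ∧ p.2.1 ∈ Ioo 0 R}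

/-- A distinguished chart `W ≅ U × C_R(Z)` of a stratified space: moreover `U × {vertex}` is mapped
diffeomorphically onto the part in `W` of the `d`-dimensional stratum. -/
structure EdgeChart (X Z : StratSpace.{u}) : Type u extends ConeChart X Z where
  tip : ∀ {i : ℕ}, d = i → E d → X.Stratum i
  tip_eq : ∀ {i : ℕ} (h : d = i), ∀ y ∈ U, (tip h y).1 = φ.symm (y, Cone.vertex)
  tip_diffeo : ∀ {i : ℕ} (h : d = i),
    IsLocalDiffeomorphOn 𝓘(ℝ, E d) 𝓘(ℝ, E i) ∞ (tip h) U

/-- `X` is a compact Hausdorff space, its strata are smooth manifolds of dimension at most `n`, the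
regular set is dense, there is no stratum of codimension one, and the given finitely many
distinguished charts cover `X`. The link of a chart with `d = n` is empty, that of a chart
with `d < n` is non-empty and has dimension `n - d - 1`. -/
structure IsAtlas (X : StratSpace.{u}) {N : ℕ} (Z : Fin N → StratSpace.{u})
    (c : ∀ i, EdgeChart X (Z i)) : Prop where
  compact : CompactSpace X.carrier
  t2 : T2Space X.carrier
  manifold : ∀ j, IsManifold 𝓘(ℝ, E j) ∞ (X.Stratum j)
  dim_le : ∀ x, X.dim x ≤ X.n
  dense_reg : Dense {x | X.dim x = X.n}
  no_codim_one : ∀ x, X.dim x + 1 ≠ X.n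
  cover : ∀ x, ∃ i, x ∈ (c i).φ.source
  link : ∀ i, ((c i).d = X.n ∧ IsEmpty (Z i).carrier) ∨
    ((c i).d + 1 + (Z i).n = X.n ∧ Nonempty (Z i).carrier)

/-- A structure of compact smoothly stratified space on `X`: a finite atlas of distinguished charts
whose links are themselves compact smoothly stratified spaces. -/
inductive IterAtlas : StratSpace.{u} → Type (u + 1)
  | mk {X : StratSpace.{u}} (N : ℕ) (Z : Fin N → StratSpace.{u}) (c : ∀ i, EdgeChart X (Z i))
      (isAtlas : IsAtlas X Z c) (sub : ∀ i, IterAtlas (Z i)) : IterAtlas X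

namespace IterAtlas

/-- The number of charts. -/
def size {X : StratSpace.{u}} : IterAtlas X → ℕ
  | mk N _ _ _ _ => N

/-- The link of a chart. -/
def link {X : StratSpace.{u}} : (A : IterAtlas X) → Fin A.size → StratSpace.{u}
  | mk _ Z _ _ _ => Z

/-- The charts. -/
def chart {X : StratSpace.{u}} : (A : IterAtlas X) → (i : Fin A.size) → EdgeChart X (A.link i)
  | mk _ _ c _ _ => c

/-- The stratified structure of the link of a chart. -/
def sub {X : StratSpace.{u}} : (A : IterAtlas X) → (i : Fin A.size) → IterAtlas (A.link i)
  | mk _ _ _ _ s => s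

/-- The depth, counted by the number of strata in a chain: `0` for the empty space, `1` for a
non-empty smooth manifold, and one more than the maximal depth of a link in general. -/
def depth {X : StratSpace.{u}} : IterAtlas X → ℕ
  | mk _ _ _ _ s => Finset.univ.sup fun i => (s i).depth + 1

end IterAtlas

/-! ### Metrics -/

/-- A field of quadratic forms on the manifold `V × X^reg`, with `V` a vector space. The tangent
space of `X^reg` at `x` is `ℝⁿ`, read in the preferred chart at `x`. -/
abbrev Tensor (V : Type) [NormedAddCommGroup V] [NormedSpace ℝ V] (X : StratSpace.{u}) : Type u :=
  V → X.Reg → QuadraticForm ℝ (V × E X.n)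

/-- A field of quadratic forms on `X^reg`. -/
abbrev Metric (X : StratSpace.{u}) : Type u := X.Reg → QuadraticForm ℝ (E X.n)

/-- A field of quadratic forms on `X^reg`, seen on `ℝ⁰ × X^reg`. -/
def Metric.lift {X : StratSpace.{u}} (g : Metric X) : Tensor (E 0) X :=
  fun _ x => (g x).comp (LinearMap.snd ℝ (E 0) (E X.n))

/-- `|A - B|_B ≤ ε`, for quadratic forms `A` and `B`. -/
def Close {W : Type} (ε : ℝ) (A B : W → ℝ) : Prop := ∀ v, |A v - B v| ≤ ε * B v

section pull

variable {X Z : StratSpace.{u}} {V : Type} [NormedAddCommGroup V] [NormedSpace ℝ V]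

/-- The pull-back of `G` to `V × U × (0, R) × Z^reg`, at the point `(b, y, r, z)`. -/
def ConeChart.pull (c : ConeChart X Z) (h : c.d + 1 + Z.n = X.n) (G : Tensor V X)
    (b : V) (y : E c.d) (r : ℝ) (z : Z.Reg) : QuadraticForm ℝ (V × (E c.d × (ℝ × E Z.n))) :=
  let D : E c.d × (ℝ × E Z.n) →L[ℝ] E X.n :=
    mfderiv (𝓘(ℝ, E c.d).prod (𝓘(ℝ, ℝ).prod 𝓘(ℝ, E Z.n))) 𝓘(ℝ, E X.n) (c.param h) (y, (r, z))
  (G b (c.param h (y, (r, z)))).comp (LinearMap.prodMap LinearMap.id D.toLinearMap)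

/-- The pull-back of `G` to `V × U`, at the point `(b, y)`, for a chart of the regular set. -/
def EdgeChart.pullTip (c : EdgeChart X Z) (h : c.d = X.n) (G : Tensor V X)
    (b : V) (y : E c.d) : QuadraticForm ℝ (V × E c.d) :=
  let D : E c.d →L[ℝ] E X.n := mfderiv 𝓘(ℝ, E c.d) 𝓘(ℝ, E X.n) (c.tip h) y
  (G b (c.tip h y)).comp (LinearMap.prodMap LinearMap.id D.toLinearMap)

/-- The model metric `H + a dr² + r² k`. -/
def model {d l : ℕ} (H : QuadraticForm ℝ (V × E d)) (a r : ℝ) (k : QuadraticForm ℝ (E l)) :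
    V × (E d × (ℝ × E l)) → ℝ :=
  fun v => H (v.1, v.2.1) + a * v.2.2.1 ^ 2 + r ^ 2 * k v.2.2.2

/-- The linear map `(w, ζ) ↦ (s w, ζ)`. -/
def scaleMap (V : Type) [NormedAddCommGroup V] [NormedSpace ℝ V] (d l : ℕ) (s : ℝ) :
    (V × (E d × ℝ)) × E l →ₗ[ℝ] V × (E d × (ℝ × E l)) where
  toFun p := (s • p.1.1, (s • p.1.2.1, (s * p.1.2.2, p.2)))
  map_add' p q := by simp [mul_add]
  map_smul' t p := by
    simp only [Prod.smul_fst, Prod.smul_snd, smul_eq_mul, RingHom.id_apply, Prod.smul_mk,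
      smul_comm s t, mul_left_comm s t]

/-- The metric `r₀⁻² G` near `(b₀, y₀, r₀)`, in the dilated coordinates
`b = b₀ + r₀ u₁`, `y = y₀ + r₀ u₂`, `r = r₀ (1 + u₃)`. -/
def ConeChart.rescale (c : ConeChart X Z) (h : c.d + 1 + Z.n = X.n) (G : Tensor V X)
    (b₀ : V) (y₀ : E c.d) (r₀ : ℝ) : Tensor (V × (E c.d × ℝ)) Z :=
  fun u z => (r₀ ^ 2)⁻¹ •
    (c.pull h G (b₀ + r₀ • u.1) (y₀ + r₀ • u.2.1) (r₀ * (1 + u.2.2)) z).comp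
      (scaleMap V c.d Z.n r₀)

/-- The domain of the dilated coordinates: the part of the ball of radius `1/2` that
corresponds to points of `Q × U × (0, R)`. -/
def ConeChart.box (c : ConeChart X Z) (Q : Set V) (b₀ : V) (y₀ : E c.d) (r₀ : ℝ) :
    Set (V × (E c.d × ℝ)) :=
  {u | ‖u‖ < 1 / 2 ∧ b₀ + r₀ • u.1 ∈ Q ∧ y₀ + r₀ • u.2.1 ∈ U c ∧ r₀ * (1 + u.2.2) < c.R}

end pull

/-- `G` is a `γ`-Hölder iterated edge metric, with constant `C`, on `Q × X`, where `Q ⊆ V`.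

It is a Riemannian metric on `Q × X^reg`, and in each chart `Q × U × C_R(Z)` there are a metric
`H` on `Q × U`, a positive function `a` on `Q × U` and metrics `k (b, y)` on `Z`, with
* `H` and `a` bounded above and below, and `γ`-Hölder, with constant `C`;
* `k` a uniformly `γ`-Hölder family of iterated edge metrics on `Z`;
* if `d = n` (so that `Z` is empty), then `G = H`;
* if `d < n`, then `|G - (H + a dr² + r² k)| ≤ C r ^ γ`, and `G` is `γ`-Hölder with respect to
  the model up to the strata of larger dimension, at the scale `r` and uniformly: in the coordinates
  dilated by `1 / r₀` about any point at radius `r₀`, the metric `r₀⁻² G` is again a `γ`-Hölder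
  iterated edge metric with constant `C`, on (a box) `× Z`.

The case `a = 1` is that of a normalized radial coordinate (`√a r` in place of `r`); a general
`a` occurs as soon as several metrics are described in the same charts, as for the metrics
`c k`, `c > 0`. -/
def IsEdgeOn (γ C : ℝ) : {X : StratSpace.{u}} → IterAtlas X →
    (V : Type) → [NormedAddCommGroup V] → [NormedSpace ℝ V] → Set V → Tensor V X → Prop
  | X, .mk N Z c _ sub, V, _, _, Q, G =>
    (∀ b ∈ Q, ∀ x, (G b x).PosDef) ∧
    ∀ i : Fin N,
      ∃ (H : V × E (c i).d → QuadraticForm ℝ (V × E (c i).d)) (a : V × E (c i).d → ℝ)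
        (k : V × E (c i).d → Metric (Z i)),
        (∀ p ∈ Q ×ˢ (c i).U, (∀ v, C⁻¹ * ‖v‖ ^ 2 ≤ H p v ∧ H p v ≤ C * ‖v‖ ^ 2) ∧
          C⁻¹ ≤ a p ∧ a p ≤ C ∧
          IsEdgeOn γ C (sub i) (E 0) univ (k p).lift) ∧
        (∀ p ∈ Q ×ˢ (c i).U, ∀ p' ∈ Q ×ˢ (c i).U,
          (∀ v, |H p v - H p' v| ≤ C * ‖p - p'‖ ^ γ * ‖v‖ ^ 2) ∧
          |a p - a p'| ≤ C * ‖p - p'‖ ^ γ ∧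
          ∀ z, Close (C * ‖p - p'‖ ^ γ) (k p z) (k p' z)) ∧
        (∀ h : (c i).d = X.n, ∀ b ∈ Q, ∀ y ∈ (c i).U, (c i).pullTip h G b y = H (b, y)) ∧
        (∀ h : (c i).d + 1 + (Z i).n = X.n, ∀ b ∈ Q, ∀ y ∈ (c i).U, ∀ r ∈ Ioo 0 (c i).R,
          (∀ z, Close (C * r ^ γ) ((c i).pull h G b y r z)
            (model (H (b, y)) (a (b, y)) r (k (b, y) z))) ∧
          IsEdgeOn γ C (sub i) (V × (E (c i).d × ℝ)) ((c i).box Q b y r)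
            ((c i).rescale h G b y r))

/-- `g` is an iterated edge metric, of Hölder exponent `γ`, on the compact smoothly stratified space
`X`. -/
def IsIteratedEdge (γ : ℝ) {X : StratSpace.{u}} (A : IterAtlas X) (g : Metric X) : Prop :=
  ∃ C > 0, IsEdgeOn γ C A (E 0) univ g.lift

/-! ### The geodesic distance -/

/-- The infimum of the lengths of the `C¹` curves `σ : (0, 1) → X^reg` which tend, in `X`, to `x` at
`0` and to `y` at `1`. -/
def segLength {X : StratSpace.{u}} (g : Metric X) (x y : X.carrier) : ℝ≥0∞ :=
  ⨅ (σ : ℝ → X.Reg) (_ : ContMDiffOn 𝓘(ℝ, ℝ) 𝓘(ℝ, E X.n) 1 σ (Ioo 0 1))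
    (_ : Tendsto (fun t => (σ t).1) (𝓝[>] 0) (𝓝 x))
    (_ : Tendsto (fun t => (σ t).1) (𝓝[<] 1) (𝓝 y)),
    ∫⁻ t in Ioo (0 : ℝ) 1,
      ENNReal.ofReal (√(g (σ t) (mfderiv 𝓘(ℝ, ℝ) 𝓘(ℝ, E X.n) σ t (1 : ℝ))))

/-- The geodesic distance on `X`: the infimum of the lengths of the curves that are the union of
finitely many curves of class `C¹` which lie in the regular set, except for their ends. -/
def geodEDist {X : StratSpace.{u}} (g : Metric X) (x y : X.carrier) : ℝ≥0∞ :=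
  ⨅ (N : ℕ) (p : ℕ → X.carrier) (_ : p 0 = x) (_ : p N = y),
    ∑ i ∈ Finset.range N, segLength g (p i) (p (i + 1))

/-- The open geodesic ball. -/
def geodBall {X : StratSpace.{u}} (g : Metric X) (x : X.carrier) (r : ℝ) : Set X.carrier :=
  {y | geodEDist g x y < ENNReal.ofReal r}

/-! ### The bi-Lipschitz topology on compact metric spaces -/

/-- A compact metric space. -/
structure CompactMet : Type (u + 1) where
  carrier : Type u
  [metric : MetricSpace carrier]
  [compact : CompactSpace carrier]

attribute [instance] CompactMet.metric CompactMet.compact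

/-- There is a `K`-bi-Lipschitz bijection between the two spaces. -/
def BiLip (K : ℝ) (X Y : CompactMet.{u}) : Prop :=
  ∃ e : X.carrier ≃ Y.carrier, ∀ a b,
    dist (e a) (e b) ≤ K * dist a b ∧ dist a b ≤ K * dist (e a) (e b)

/-- Precompactness for the Lipschitz distance `inf {log K | X and Y are K-bi-Lipschitz}`: every
sequence in `𝒮` has a subsequence that converges to some compact metric space. -/
def BiLipPrecompact (𝒮 : Set CompactMet.{u}) : Prop :=
  ∀ s : ℕ → CompactMet.{u}, (∀ n, s n ∈ 𝒮) →
    ∃ (ψ : ℕ → ℕ) (Y : CompactMet.{u}), StrictMono ψ ∧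
      ∀ K : ℝ, 1 < K → ∀ᶠ n in atTop, BiLip K (s (ψ n)) Y

/-- The metric space `(S, h)`, that is `S` with the geodesic distance of `h`, is isometric to `Y`
(by a homeomorphism: the geodesic distance defines the topology of `S`). -/
def IsMetricSpaceOf (Y : CompactMet.{u}) {S : StratSpace.{u}} (h : Metric S) : Prop :=
  ∃ e : Y.carrier ≃ₜ S.carrier, ∀ a b, edist a b = geodEDist h (e a) (e b)

/-- `Φ` identifies its domain, an open set `Ω` of `X`, with the truncated cone `C_t(S)` (times the
point `ℝ⁰`), by a homeomorphism that is a stratum-preserving diffeomorphism away from the vertex,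
and `|g - (dr² + r² h)| ≤ ε` on the regular part of `Ω`, the norm being that of the cone metric. -/
def IsConeApprox {X S : StratSpace.{u}} (Φ : ConeChart X S) (t ε : ℝ) (g : Metric X)
    (h : Metric S) : Prop :=
  Φ.d = 0 ∧ Φ.R = t ∧ ∃ hn : Φ.d + 1 + S.n = X.n,
    ∀ y ∈ Φ.U, ∀ r ∈ Ioo 0 t, ∀ z, Close ε (Φ.pull hn g.lift 0 y r z) (model 0 1 r (h z))

end Stratified

end

noncomputable section

namespace Stratified

/-! ### Structural lemmas on atlases and edge metrics -/

theorem IterAtlas.isAtlas {X : StratSpace.{u}} (A : IterAtlas X) : IsAtlas X A.link A.chart := by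
  cases A; assumption

theorem IterAtlas.ind {P : ∀ X : StratSpace.{u}, IterAtlas X → Prop}
    (h : ∀ X A, (∀ i, P (IterAtlas.link A i) (A.sub i)) → P X A) {X : StratSpace.{u}}
    (A : IterAtlas X) : P X A := by
  induction A with
  | mk N Z c hA sub ih => exact h _ (IterAtlas.mk N Z c hA sub) ih

theorem IterAtlas.depth_sub_lt {X : StratSpace.{u}} (A : IterAtlas X) (i : Fin A.size) :
    (A.sub i).depth + 1 ≤ A.depth := by
  cases A with
  | mk N Z c hA sub =>
    simp only [IterAtlas.depth]
    exact Finset.le_sup (f := fun i => (sub i).depth + 1) (Finset.mem_univ i)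

/-- The conditions of `IsEdgeOn` in a single chart. -/
def ChartEdge (γ C : ℝ) {X Z : StratSpace.{u}} (c : EdgeChart X Z) (A : IterAtlas Z)
    (V : Type) [NormedAddCommGroup V] [NormedSpace ℝ V] (Q : Set V) (G : Tensor V X) : Prop :=
  ∃ (H : V × E c.d → QuadraticForm ℝ (V × E c.d)) (a : V × E c.d → ℝ)
    (k : V × E c.d → Metric Z),
    (∀ p ∈ Q ×ˢ c.U, (∀ v, C⁻¹ * ‖v‖ ^ 2 ≤ H p v ∧ H p v ≤ C * ‖v‖ ^ 2) ∧
      C⁻¹ ≤ a p ∧ a p ≤ C ∧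
      IsEdgeOn γ C A (E 0) univ (k p).lift) ∧
    (∀ p ∈ Q ×ˢ c.U, ∀ p' ∈ Q ×ˢ c.U,
      (∀ v, |H p v - H p' v| ≤ C * ‖p - p'‖ ^ γ * ‖v‖ ^ 2) ∧
      |a p - a p'| ≤ C * ‖p - p'‖ ^ γ ∧
      ∀ z, Close (C * ‖p - p'‖ ^ γ) (k p z) (k p' z)) ∧
    (∀ h : c.d = X.n, ∀ b ∈ Q, ∀ y ∈ c.U, c.pullTip h G b y = H (b, y)) ∧
    (∀ h : c.d + 1 + Z.n = X.n, ∀ b ∈ Q, ∀ y ∈ c.U, ∀ r ∈ Ioo 0 c.R,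
      (∀ z, Close (C * r ^ γ) (c.pull h G b y r z)
        (model (H (b, y)) (a (b, y)) r (k (b, y) z))) ∧
      IsEdgeOn γ C A (V × (E c.d × ℝ)) (c.box Q b y r) (c.rescale h G b y r))

theorem isEdgeOn_iff {γ C : ℝ} {X : StratSpace.{u}} (A : IterAtlas X)
    {V : Type} [NormedAddCommGroup V] [NormedSpace ℝ V] {Q : Set V} {G : Tensor V X} :
    IsEdgeOn γ C A V Q G ↔ (∀ b ∈ Q, ∀ x, (G b x).PosDef) ∧
      ∀ i, ChartEdge γ C (A.chart i) (A.sub i) V Q G := by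
  cases A with
  | mk N Z c hA sub =>
    rw [IsEdgeOn]
    rfl

section points

variable {X Z : StratSpace.{u}}

theorem Cone.cases (c : Cone Z.carrier) :
    c = Cone.vertex ∨ ∃ r > 0, ∃ z : Z.carrier, c = Cone.pt r z := by
  rcases c with _ | ⟨⟨r, hr⟩, z⟩
  · exact Or.inl rfl
  · refine Or.inr ⟨r, hr, z, ?_⟩
    have hr' : 0 < r := hr
    simp [Cone.pt, hr', Cone.off]
    rfl

theorem Cone.radius_pt {Z : Type u} {r : ℝ} (hr : 0 ≤ r) (z : Z) :
    Cone.radius (Cone.pt r z) = r := by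
  unfold Cone.pt
  split_ifs with h
  · rfl
  · exact le_antisymm hr (not_lt.1 h)

theorem Cone.radius_vertex {Z : Type u} : Cone.radius (Cone.vertex : Cone Z) = 0 := rfl

theorem ConeChart.mem_target (c : ConeChart X Z) {p : E c.d × Cone Z.carrier} :
    p ∈ c.φ.target ↔ p.1 ∈ c.U ∧ p.2.radius < c.R := by
  rw [c.target_eq]; rfl

theorem EdgeChart.point_cases (c : EdgeChart X Z) {x : X.carrier} (hx : x ∈ c.φ.source) :
    (∃ y ∈ c.U, x = c.φ.symm (y, Cone.vertex)) ∨
    ∃ y ∈ c.U, ∃ r ∈ Ioo 0 c.R, ∃ z : Z.carrier, x = c.φ.symm (y, Cone.pt r z) := by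
  have h1 := (c.mem_target).1 (c.φ.map_source hx)
  have h2 := c.φ.left_inv hx
  rcases Cone.cases (c.φ x).2 with h | ⟨r, hr, z, h⟩
  · exact Or.inl ⟨_, h1.1, by rw [← h, Prod.mk.eta, h2]⟩
  · refine Or.inr ⟨_, h1.1, r, ⟨hr, ?_⟩, z, by rw [← h, Prod.mk.eta, h2]⟩
    have := h1.2
    rwa [h, Cone.radius_pt hr.le] at this

theorem EdgeChart.dim_vertex (c : EdgeChart X Z) {y : E c.d} (hy : y ∈ c.U) :
    X.dim (c.φ.symm (y, Cone.vertex)) = c.d := by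
  rw [← c.tip_eq rfl y hy]; exact (c.tip rfl y).2

theorem ConeChart.dim_pt (c : ConeChart X Z) {y : E c.d} (hy : y ∈ c.U) {r : ℝ}
    (hr : r ∈ Ioo 0 c.R) (z : Z.carrier) :
    X.dim (c.φ.symm (y, Cone.pt r z)) = c.d + 1 + Z.dim z := by
  rw [← c.param_eq rfl y hy r hr ⟨z, rfl⟩]; exact (c.param rfl (y, (r, ⟨z, rfl⟩))).2

/-- A regular point in the domain of a chart is in the image of the parametrization. -/
theorem EdgeChart.reg_cases (c : EdgeChart X Z)
    (hl : (c.d = X.n ∧ IsEmpty Z.carrier) ∨ (c.d + 1 + Z.n = X.n ∧ Nonempty Z.carrier))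
    (x : X.Reg) (hi : x.1 ∈ c.φ.source) :
    (∃ h : c.d = X.n, IsEmpty Z.carrier ∧ ∃ y ∈ c.U, x = c.tip h y) ∨
    ∃ h : c.d + 1 + Z.n = X.n, ∃ y ∈ c.U, ∃ r ∈ Ioo 0 c.R, ∃ z : Z.Reg,
      x = c.param h (y, (r, z)) := by
  have hx := x.2
  rcases hl with ⟨h, he⟩ | ⟨h, hne⟩
  · left
    refine ⟨h, he, ?_⟩
    rcases c.point_cases hi with ⟨y, hy, e⟩ | ⟨y, hy, r, hr, z, e⟩
    · exact ⟨y, hy, Subtype.ext (by rw [c.tip_eq h y hy, e])⟩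
    · exact he.elim z
  · right
    refine ⟨h, ?_⟩
    rcases c.point_cases hi with ⟨y, hy, e⟩ | ⟨y, hy, r, hr, z, e⟩
    · have := c.dim_vertex hy
      rw [← e] at this
      omega
    · have := c.dim_pt hy hr z
      rw [← e] at this
      refine ⟨y, hy, r, hr, ⟨z, by omega⟩, Subtype.ext ?_⟩
      rw [c.param_eq h y hy r hr, e]

/-- Every regular point is in the image of the parametrization of a chart. -/
theorem IterAtlas.reg_cases (A : IterAtlas X) (x : X.Reg) : ∃ i,
    (∃ h : (A.chart i).d = X.n, IsEmpty (A.link i).carrier ∧ ∃ y ∈ (A.chart i).U,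
      x = (A.chart i).tip h y) ∨
    ∃ h : (A.chart i).d + 1 + (A.link i).n = X.n, ∃ y ∈ (A.chart i).U,
      ∃ r ∈ Ioo 0 (A.chart i).R, ∃ z : (A.link i).Reg,
      x = (A.chart i).param h (y, (r, z)) := by
  obtain ⟨i, hi⟩ := A.isAtlas.cover x.1
  exact ⟨i, (A.chart i).reg_cases (A.isAtlas.link i) x hi⟩

end points

section pull

variable {X Z : StratSpace.{u}} {V : Type} [NormedAddCommGroup V] [NormedSpace ℝ V]

theorem ConeChart.param_mfderiv_surj (c : ConeChart X Z) (h : c.d + 1 + Z.n = X.n) {y : E c.d}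
    (hy : y ∈ c.U) {r : ℝ} (hr : r ∈ Ioo 0 c.R) (z : Z.Reg) (ξ : E X.n) :
    ∃ w : E c.d × (ℝ × E Z.n),
      (mfderiv (𝓘(ℝ, E c.d).prod (𝓘(ℝ, ℝ).prod 𝓘(ℝ, E Z.n))) 𝓘(ℝ, E X.n) (c.param h)
        (y, (r, z)) : E c.d × (ℝ × E Z.n) →L[ℝ] E X.n) w = ξ :=
  ((c.param_diffeo h ⟨(y, (r, z)), hy, hr⟩).mfderivToContinuousLinearEquiv (by simp)).surjective ξ

theorem EdgeChart.tip_mfderiv_surj (c : EdgeChart X Z) (h : c.d = X.n) {y : E c.d}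
    (hy : y ∈ c.U) (ξ : E X.n) :
    ∃ w : E c.d,
      (mfderiv 𝓘(ℝ, E c.d) 𝓘(ℝ, E X.n) (c.tip h) y : E c.d →L[ℝ] E X.n) w = ξ :=
  ((c.tip_diffeo h ⟨y, hy⟩).mfderivToContinuousLinearEquiv (by simp)).surjective ξ

theorem ConeChart.pull_apply (c : ConeChart X Z) (h : c.d + 1 + Z.n = X.n) (G : Tensor V X)
    (b : V) (y : E c.d) (r : ℝ) (z : Z.Reg) (v : V × (E c.d × (ℝ × E Z.n))) :
    c.pull h G b y r z v = G b (c.param h (y, (r, z))) (v.1,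
      (mfderiv (𝓘(ℝ, E c.d).prod (𝓘(ℝ, ℝ).prod 𝓘(ℝ, E Z.n))) 𝓘(ℝ, E X.n) (c.param h)
        (y, (r, z)) : E c.d × (ℝ × E Z.n) →L[ℝ] E X.n) v.2) := rfl

theorem EdgeChart.pullTip_apply (c : EdgeChart X Z) (h : c.d = X.n) (G : Tensor V X)
    (b : V) (y : E c.d) (v : V × E c.d) :
    c.pullTip h G b y v = G b (c.tip h y) (v.1,
      (mfderiv 𝓘(ℝ, E c.d) 𝓘(ℝ, E X.n) (c.tip h) y : E c.d →L[ℝ] E X.n) v.2) := rfl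

theorem ConeChart.rescale_apply (c : ConeChart X Z) (h : c.d + 1 + Z.n = X.n) (G : Tensor V X)
    (b : V) (y : E c.d) (r : ℝ) (u : V × (E c.d × ℝ)) (z : Z.Reg)
    (v : (V × (E c.d × ℝ)) × E Z.n) :
    c.rescale h G b y r u z v = (r ^ 2)⁻¹ *
      c.pull h G (b + r • u.1) (y + r • u.2.1) (r * (1 + u.2.2)) z
        (r • v.1.1, (r • v.1.2.1, (r * v.1.2.2, v.2))) := rfl

theorem ConeChart.pull_eq_rescale (c : ConeChart X Z) (h : c.d + 1 + Z.n = X.n) (G : Tensor V X)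
    (b : V) (y : E c.d) {r : ℝ} (hr : 0 < r) (z : Z.Reg) (v : V) (w : E c.d) (t : ℝ)
    (ζ : E Z.n) :
    c.pull h G b y r z (v, (w, (t, ζ))) =
      r ^ 2 * c.rescale h G b y r 0 z ((r⁻¹ • v, (r⁻¹ • w, r⁻¹ * t)), ζ) := by
  rw [ConeChart.rescale_apply]
  simp only [Prod.fst_zero, Prod.snd_zero, smul_zero, add_zero, mul_one]
  rw [smul_inv_smul₀ hr.ne', smul_inv_smul₀ hr.ne', mul_inv_cancel_left₀ hr.ne',
    mul_inv_cancel_left₀ (pow_ne_zero 2 hr.ne')]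

theorem ConeChart.zero_mem_box (c : ConeChart X Z) {Q : Set V} {b : V} (hb : b ∈ Q) {y : E c.d}
    (hy : y ∈ c.U) {r : ℝ} (hr : r ∈ Ioo 0 c.R) : 0 ∈ c.box Q b y r := by
  refine ⟨by simp, by simpa using hb, by simpa using hy, by simpa using hr.2⟩

end pull

theorem Close.mono_mul {W : Type} {C C' t : ℝ} {A B : W → ℝ} (hC : 0 < C) (hCC : C ≤ C')
    (h : Close (C * t) A B) : Close (C' * t) A B := by
  intro v
  refine (h v).trans ?_
  have h0 : 0 ≤ C * t * B v := (abs_nonneg _).trans (h v)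
  have h1 : 0 ≤ t * B v := by
    rw [mul_assoc] at h0
    exact nonneg_of_mul_nonneg_right h0 hC
  rw [mul_assoc, mul_assoc]
  gcongr

theorem ChartEdge.mono {γ C C' : ℝ} (hC : 0 < C) (hCC : C ≤ C') {X Z : StratSpace.{u}}
    {c : EdgeChart X Z} {A : IterAtlas Z}
    (ih : ∀ (V : Type) [NormedAddCommGroup V] [NormedSpace ℝ V] (Q : Set V) (G : Tensor V Z),
      IsEdgeOn γ C A V Q G → IsEdgeOn γ C' A V Q G)
    {V : Type} [NormedAddCommGroup V] [NormedSpace ℝ V] {Q : Set V} {G : Tensor V X}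
    (h : ChartEdge γ C c A V Q G) : ChartEdge γ C' c A V Q G := by
  obtain ⟨H, a, k, h1, h2, h3, h4⟩ := h
  have hinv : C'⁻¹ ≤ C⁻¹ := inv_anti₀ hC hCC
  refine ⟨H, a, k, fun p hp => ⟨fun v => ⟨?_, ?_⟩, ?_, ?_, ?_⟩, fun p hp p' hp' => ⟨fun v => ?_, ?_,
    fun z => ?_⟩, h3, fun h b hb y hy r hr => ⟨fun z => ?_, ?_⟩⟩
  · refine le_trans ?_ ((h1 p hp).1 v).1; gcongr
  · refine ((h1 p hp).1 v).2.trans ?_; gcongr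
  · exact hinv.trans (h1 p hp).2.1
  · exact (h1 p hp).2.2.1.trans hCC
  · exact ih _ _ _ (h1 p hp).2.2.2
  · refine ((h2 p hp p' hp').1 v).trans ?_; gcongr
  · refine ((h2 p hp p' hp').2.1).trans ?_; gcongr
  · exact ((h2 p hp p' hp').2.2 z).mono_mul hC hCC
  · exact ((h4 h b hb y hy r hr).1 z).mono_mul hC hCC
  · exact ih _ _ _ (h4 h b hb y hy r hr).2

theorem IsEdgeOn.mono {γ C C' : ℝ} (hC : 0 < C) (hCC : C ≤ C') {X : StratSpace.{u}}
    (A : IterAtlas X) {V : Type} [NormedAddCommGroup V] [NormedSpace ℝ V] {Q : Set V}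
    {G : Tensor V X} (h : IsEdgeOn γ C A V Q G) : IsEdgeOn γ C' A V Q G := by
  refine IterAtlas.ind (P := fun X A => ∀ (V : Type) [NormedAddCommGroup V] [NormedSpace ℝ V]
    (Q : Set V) (G : Tensor V X), IsEdgeOn γ C A V Q G → IsEdgeOn γ C' A V Q G) ?_ A V Q G h
  intro X A ih V _ _ Q G h
  rw [isEdgeOn_iff] at h ⊢
  exact ⟨h.1, fun i => (h.2 i).mono hC hCC (fun V _ _ Q G => ih i V Q G)⟩

section warp

variable {X Z : StratSpace.{u}} {V W : Type} [NormedAddCommGroup V] [NormedSpace ℝ V]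
  [NormedAddCommGroup W] [NormedSpace ℝ W]

/-- The tensor `H₀ + f L^* G`. -/
def warp (L : W →L[ℝ] V) (H₀ : W → QuadraticForm ℝ W) (f : W → ℝ) (G : Tensor V X) : Tensor W X :=
  fun w x => (H₀ w).comp (LinearMap.fst ℝ W (E X.n)) +
    f w • (G (L w) x).comp (L.toLinearMap.prodMap LinearMap.id)

theorem warp_apply (L : W →L[ℝ] V) (H₀ : W → QuadraticForm ℝ W) (f : W → ℝ) (G : Tensor V X)
    (w : W) (x : X.Reg) (v : W × E X.n) :
    warp L H₀ f G w x v = H₀ w v.1 + f w * G (L w) x (L v.1, v.2) := rfl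

/-- Uniform bounds on the coefficients of a warped tensor. -/
structure WarpBound (γ c : ℝ) (L : W →L[ℝ] V) (Q : Set W) (H₀ : W → QuadraticForm ℝ W)
    (f : W → ℝ) : Prop where
  norm_le : ∀ w, ‖L w‖ ≤ ‖w‖
  nonneg : ∀ w ∈ Q, ∀ v, 0 ≤ H₀ w v
  upper : ∀ w ∈ Q, ∀ v, H₀ w v ≤ c * ‖v‖ ^ 2
  coercive : ∀ w ∈ Q, ∀ v, c⁻¹ * ‖v‖ ^ 2 ≤ H₀ w v + ‖L v‖ ^ 2
  f_lower : ∀ w ∈ Q, c⁻¹ ≤ f w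
  f_upper : ∀ w ∈ Q, f w ≤ c
  holder : ∀ w ∈ Q, ∀ w' ∈ Q, ∀ v, |H₀ w v - H₀ w' v| ≤ c * ‖w - w'‖ ^ γ * ‖v‖ ^ 2
  f_holder : ∀ w ∈ Q, ∀ w' ∈ Q, |f w - f w'| ≤ c * ‖w - w'‖ ^ γ

theorem ConeChart.rescale_warp (c : ConeChart X Z) (h : c.d + 1 + Z.n = X.n) (L : W →L[ℝ] V)
    (H₀ : W → QuadraticForm ℝ W) (f : W → ℝ) (G : Tensor V X) (w : W) (y : E c.d) {r : ℝ}
    (hr : r ≠ 0) : c.rescale h (warp L H₀ f G) w y r =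
      warp (L.prodMap (ContinuousLinearMap.id ℝ (E c.d × ℝ)))
        (fun u => (H₀ (w + r • u.1)).comp (LinearMap.fst ℝ W (E c.d × ℝ)))
        (fun u => f (w + r • u.1)) (c.rescale h G (L w) y r) := by
  funext u z
  ext v
  rw [ConeChart.rescale_apply, ConeChart.pull_apply, warp_apply, warp_apply,
    ConeChart.rescale_apply, ConeChart.pull_apply]
  have hL : ∀ u, (L.prodMap (ContinuousLinearMap.id ℝ (E c.d × ℝ))) u = (L u.1, u.2) :=
    fun _ => rfl
  simp only [hL, QuadraticMap.comp_apply, LinearMap.fst_apply, QuadraticMap.map_smul, map_add, map_smul,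
    smul_eq_mul]
  field_simp
  rfl

theorem WarpBound.box {γ c : ℝ} (hγ : 0 < γ) (hγ1 : γ ≤ 1) (hc : 1 ≤ c) {L : W →L[ℝ] V}
    {Q : Set W} {H₀ : W → QuadraticForm ℝ W} {f : W → ℝ} (hw : WarpBound γ c L Q H₀ f)
    (ch : ConeChart X Z) (w : W) (y : E ch.d) {r : ℝ} (hr : r ∈ Ioo 0 ch.R) :
    WarpBound γ (c * max 1 ch.R) (L.prodMap (ContinuousLinearMap.id ℝ (E ch.d × ℝ)))
      (ch.box Q w y r)
      (fun u => (H₀ (w + r • u.1)).comp (LinearMap.fst ℝ W (E ch.d × ℝ)))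
      (fun u => f (w + r • u.1)) := by
  have hm : 1 ≤ max 1 ch.R := le_max_left _ _
  have hcc : c ≤ c * max 1 ch.R := le_mul_of_one_le_right (by linarith) hm
  have hinv : (c * max 1 ch.R)⁻¹ ≤ c⁻¹ := inv_anti₀ (by linarith) hcc
  have hinv1 : c⁻¹ ≤ 1 := inv_le_one_of_one_le₀ hc
  have key : ∀ u u' : W × (E ch.d × ℝ),
      c * ‖w + r • u.1 - (w + r • u'.1)‖ ^ γ ≤ c * max 1 ch.R * ‖u - u'‖ ^ γ := by
    intro u u'
    rw [add_sub_add_left_eq_sub, ← smul_sub, norm_smul, Real.norm_of_nonneg hr.1.le,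
      Real.mul_rpow hr.1.le (norm_nonneg _), mul_assoc]
    have h1 : ‖u.1 - u'.1‖ ≤ ‖u - u'‖ := norm_fst_le (u - u')
    have h2 : r ^ γ ≤ max 1 ch.R := by
      rcases le_total r 1 with h | h
      · exact (Real.rpow_le_one hr.1.le h hγ.le).trans hm
      · calc r ^ γ ≤ r ^ (1 : ℝ) := Real.rpow_le_rpow_of_exponent_le h hγ1
          _ = r := Real.rpow_one r
          _ ≤ _ := hr.2.le.trans (le_max_right _ _)
    gcongr
  have hfst : ∀ v : W × (E ch.d × ℝ), ‖v.1‖ ^ 2 ≤ ‖v‖ ^ 2 := fun v => by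
    have := norm_fst_le v
    gcongr
  refine ⟨fun u => ?_, fun u hu v => hw.nonneg _ hu.2.1 _, fun u hu v => ?_, fun u hu v => ?_,
    fun u hu => hinv.trans (hw.f_lower _ hu.2.1), fun u hu => (hw.f_upper _ hu.2.1).trans hcc,
    fun u hu u' hu' v => ?_, fun u hu u' hu' => ?_⟩
  · exact max_le_max (hw.norm_le u.1) le_rfl
  · refine (hw.upper _ hu.2.1 v.1).trans ?_
    have := hfst v
    gcongr
  · have h1 := hw.coercive _ hu.2.1 v.1
    have h2 := hw.nonneg _ hu.2.1 v.1
    change _ ≤ H₀ _ v.1 + ‖(L v.1, v.2)‖ ^ 2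
    have h3 : ‖L v.1‖ ^ 2 ≤ ‖(L v.1, v.2)‖ ^ 2 := by
      have : ‖L v.1‖ ≤ ‖(L v.1, v.2)‖ := le_max_left _ _
      gcongr
    have h4 : ‖v.2‖ ^ 2 ≤ ‖(L v.1, v.2)‖ ^ 2 := by
      have : ‖v.2‖ ≤ ‖(L v.1, v.2)‖ := le_max_right _ _
      gcongr
    refine (mul_le_mul_of_nonneg_right hinv (sq_nonneg _)).trans ?_
    rcases le_total ‖v.1‖ ‖v.2‖ with h | h
    · rw [Prod.norm_def v, max_eq_right h]
      have := mul_le_mul_of_nonneg_right hinv1 (sq_nonneg ‖v.2‖)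
      linarith
    · rw [Prod.norm_def v, max_eq_left h]
      linarith
  · refine (hw.holder _ hu.2.1 _ hu'.2.1 v.1).trans ?_
    have := hfst v
    have := key u u'
    gcongr
  · exact (hw.f_holder _ hu.2.1 _ hu'.2.1).trans (key u u')

theorem warp_const_lift (k : Metric X) (s : ℝ) :
    (Metric.lift (fun z => s • k z) : Tensor (E 0) X) =
      warp (ContinuousLinearMap.id ℝ (E 0)) (fun _ => 0) (fun _ => s) k.lift := by
  funext u z
  ext v
  rw [warp_apply]
  simp [Metric.lift]

theorem warpBound_const {γ c s : ℝ} (hc : 1 ≤ c) (h1 : c⁻¹ ≤ s) (h2 : s ≤ c) :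
    WarpBound γ c (ContinuousLinearMap.id ℝ (E 0)) univ (fun _ => 0) (fun _ => s) := by
  have h0 : ∀ v : E 0, v = 0 := fun v => Subsingleton.elim _ _
  have hc0 : 0 ≤ c := by linarith
  refine ⟨fun w => le_rfl, by simp, fun w _ v => ?_, fun w _ v => ?_, fun _ _ => h1, fun _ _ => h2,
    fun w _ w' _ v => ?_, fun w _ w' _ => ?_⟩
  · simpa using by positivity
  · simp [h0 v]
  · simp [h0 v]
  · simpa using by positivity

theorem edge_zero_le {γ C : ℝ} {A : IterAtlas X} {Q : Set V} {G : Tensor V X}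
    (hG : IsEdgeOn γ C A V Q G) {b : V} (hb : b ∈ Q) (x : X.Reg) (v : V × E X.n) :
    0 ≤ G b x v := (((isEdgeOn_iff A).1 hG).1 b hb x).nonneg v

theorem metric_zero_le {γ C : ℝ} {A : IterAtlas X} {k : Metric X}
    (hk : IsEdgeOn γ C A (E 0) univ k.lift) (x : X.Reg) (v : E X.n) :
    0 ≤ k x v := edge_zero_le hk (mem_univ 0) x (0, v)

/-- Warped tensors in a chart. -/
theorem ChartEdge.warp {γ C c C' : ℝ} (hγ : 0 < γ) (hC : 1 ≤ C) (hc : 1 ≤ c)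
    (hC' : 4 * c ^ 2 * C ≤ C') {ch : EdgeChart X Z} {A : IterAtlas Z}
    {L : W →L[ℝ] V} {Q : Set V} {Q' : Set W} (hQ : MapsTo L Q' Q)
    {H₀ : W → QuadraticForm ℝ W} {f : W → ℝ} (hw : WarpBound γ c L Q' H₀ f) {G : Tensor V X}
    (hG : ChartEdge γ C ch A V Q G)
    (hk : ∀ (k : Metric Z) (s : ℝ), c⁻¹ ≤ s → s ≤ c → IsEdgeOn γ C A (E 0) univ k.lift →
      IsEdgeOn γ C' A (E 0) univ (Metric.lift fun z => s • k z))
    (hres : ∀ (h : ch.d + 1 + Z.n = X.n), ∀ w ∈ Q', ∀ y ∈ ch.U, ∀ r ∈ Ioo 0 ch.R,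
      IsEdgeOn γ C' A (W × (E ch.d × ℝ)) (ch.box Q' w y r)
        (ch.rescale h (Stratified.warp L H₀ f G) w y r)) :
    ChartEdge γ C' ch A W Q' (Stratified.warp L H₀ f G) := by
  obtain ⟨H, a, k, h1, h2, h3, h4⟩ := hG
  have hc0 : 0 < c := by linarith
  have hC0 : 0 < C := by linarith
  have hcC : 1 ≤ c * C := one_le_mul_of_one_le_of_one_le hc hC
  have hc2 : c ≤ c ^ 2 := by nlinarith
  have hb1 : c ^ 2 * C ≤ C' := by nlinarith [mul_pos (pow_pos hc0 2) hC0]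
  have hb2 : c + 2 * (c * C) ≤ C' := by
    have : c ≤ c ^ 2 * C := by nlinarith [mul_le_mul hc2 hC zero_le_one (by positivity)]
    have : c * C ≤ c ^ 2 * C := by gcongr
    nlinarith [mul_pos (pow_pos hc0 2) hC0]
  have hb3 : c ^ 2 * C + c ^ 2 ≤ C' := by
    have : c ^ 2 ≤ c ^ 2 * C := le_mul_of_one_le_right (by positivity) hC
    nlinarith [mul_pos (pow_pos hc0 2) hC0]
  have hb0 : c * C ≤ C' := le_trans (by gcongr) hb1
  have hC'0 : 0 < C' := by nlinarith
  have hlow : ∀ w ∈ Q', 0 < f w := fun w hw' => (inv_pos.2 hc0).trans_le (hw.f_lower w hw')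
  have hLQ : ∀ p ∈ Q' ×ˢ ch.U, (L p.1, p.2) ∈ Q ×ˢ ch.U := fun p hp => ⟨hQ hp.1, hp.2⟩
  have hdist : ∀ p p' : W × E ch.d, ‖((L p.1, p.2) : V × E ch.d) - (L p'.1, p'.2)‖ ^ γ ≤
      ‖p - p'‖ ^ γ := by
    intro p p'
    refine Real.rpow_le_rpow (norm_nonneg _) (max_le_max ?_ le_rfl) hγ.le
    change ‖L p.1 - L p'.1‖ ≤ ‖p.1 - p'.1‖
    rw [← map_sub]; exact hw.norm_le _
  have hdist1 : ∀ p p' : W × E ch.d, ‖p.1 - p'.1‖ ^ γ ≤ ‖p - p'‖ ^ γ := fun p p' =>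
    Real.rpow_le_rpow (norm_nonneg _) (le_max_left _ _) hγ.le
  have hLn : ∀ v : W × E ch.d, ‖((L v.1, v.2) : V × E ch.d)‖ ^ 2 ≤ ‖v‖ ^ 2 := fun v => by
    have : ‖((L v.1, v.2) : V × E ch.d)‖ ≤ ‖v‖ := max_le_max (hw.norm_le _) le_rfl
    gcongr
  have hn1 : ∀ v : W × E ch.d, ‖v.1‖ ^ 2 ≤ ‖v‖ ^ 2 := fun v => by
    have := norm_fst_le v
    gcongr
  refine ⟨fun p => (H₀ p.1).comp (LinearMap.fst ℝ W (E ch.d)) +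
    f p.1 • (H (L p.1, p.2)).comp (L.toLinearMap.prodMap LinearMap.id),
    fun p => f p.1 * a (L p.1, p.2), fun p z => f p.1 • k (L p.1, p.2) z,
    fun p hp => ⟨fun v => ⟨?_, ?_⟩, ?_, ?_, ?_⟩, fun p hp p' hp' => ⟨fun v => ?_, ?_,
    fun z ζ => ?_⟩, fun h b hb y hy => ?_, fun h b hb y hy r hr => ⟨fun z v => ?_, hres h b hb y hy r hr⟩⟩
  · change _ ≤ H₀ p.1 v.1 + f p.1 * H (L p.1, p.2) (L v.1, v.2)
    have e1 := ((h1 _ (hLQ p hp)).1 (L v.1, v.2)).1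
    have e2 := hw.coercive p.1 hp.1 v.1
    have e3 := hw.f_lower p.1 hp.1
    have e4 := hw.nonneg p.1 hp.1 v.1
    have e5 : (c * C)⁻¹ * ‖((L v.1, v.2) : V × E ch.d)‖ ^ 2 ≤
        f p.1 * H (L p.1, p.2) (L v.1, v.2) := by
      rw [mul_inv, mul_assoc]
      exact mul_le_mul e3 e1 (by positivity) (hlow _ hp.1).le
    have e6 : (c * C)⁻¹ ≤ 1 := inv_le_one_of_one_le₀ hcC
    have e7 : C'⁻¹ ≤ (c * C)⁻¹ * c⁻¹ := by
      rw [← mul_inv]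
      exact inv_anti₀ (by positivity) (by nlinarith)
    have e8 : (c * C)⁻¹ * c⁻¹ ≤ (c * C)⁻¹ :=
      mul_le_of_le_one_right (by positivity) (inv_le_one_of_one_le₀ hc)
    rcases le_total ‖v.1‖ ‖v.2‖ with h | h
    · rw [Prod.norm_def v, max_eq_right h]
      have : ‖v.2‖ ^ 2 ≤ ‖((L v.1, v.2) : V × E ch.d)‖ ^ 2 := by
        have : ‖v.2‖ ≤ ‖((L v.1, v.2) : V × E ch.d)‖ := le_max_right _ _
        gcongr
      have : C'⁻¹ * ‖v.2‖ ^ 2 ≤ (c * C)⁻¹ * ‖((L v.1, v.2) : V × E ch.d)‖ ^ 2 := by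
        have := e7.trans e8
        gcongr
      linarith
    · rw [Prod.norm_def v, max_eq_left h]
      have : ‖L v.1‖ ^ 2 ≤ ‖((L v.1, v.2) : V × E ch.d)‖ ^ 2 := by
        have : ‖L v.1‖ ≤ ‖((L v.1, v.2) : V × E ch.d)‖ := le_max_left _ _
        gcongr
      calc C'⁻¹ * ‖v.1‖ ^ 2 ≤ (c * C)⁻¹ * c⁻¹ * ‖v.1‖ ^ 2 := by gcongr
        _ = (c * C)⁻¹ * (c⁻¹ * ‖v.1‖ ^ 2) := by ring
        _ ≤ (c * C)⁻¹ * (H₀ p.1 v.1 + ‖L v.1‖ ^ 2) := by gcongr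
        _ = (c * C)⁻¹ * H₀ p.1 v.1 + (c * C)⁻¹ * ‖L v.1‖ ^ 2 := by ring
        _ ≤ 1 * H₀ p.1 v.1 + (c * C)⁻¹ * ‖((L v.1, v.2) : V × E ch.d)‖ ^ 2 := by gcongr
        _ ≤ _ := by linarith
  · change H₀ p.1 v.1 + f p.1 * H (L p.1, p.2) (L v.1, v.2) ≤ _
    have e1 := ((h1 _ (hLQ p hp)).1 (L v.1, v.2)).2
    have e2 := hw.upper p.1 hp.1 v.1
    have e3 := hw.f_upper p.1 hp.1
    have e4 := (hlow _ hp.1).le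
    calc _ ≤ c * ‖v.1‖ ^ 2 + c * (C * ‖((L v.1, v.2) : V × E ch.d)‖ ^ 2) := by
          refine add_le_add e2 ((mul_le_mul_of_nonneg_left e1 e4).trans ?_)
          gcongr
      _ ≤ c * ‖v‖ ^ 2 + c * (C * ‖v‖ ^ 2) := by
          have := hn1 v
          have := hLn v
          gcongr
      _ = (c + c * C) * ‖v‖ ^ 2 := by ring
      _ ≤ _ := by
          gcongr
          nlinarith
  · have e1 := (h1 _ (hLQ p hp)).2.1
    refine le_trans (inv_anti₀ (by positivity) hb0) ?_
    rw [mul_inv]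
    exact mul_le_mul (hw.f_lower p.1 hp.1) e1 (by positivity) (hlow _ hp.1).le
  · have e1 := (h1 _ (hLQ p hp)).2.2.1
    have e2 : 0 ≤ a (L p.1, p.2) := (inv_nonneg.2 hC0.le).trans (h1 _ (hLQ p hp)).2.1
    exact (mul_le_mul (hw.f_upper p.1 hp.1) e1 e2 hc0.le).trans hb0
  · exact hk _ _ (hw.f_lower p.1 hp.1) (hw.f_upper p.1 hp.1) (h1 _ (hLQ p hp)).2.2.2
  · change |H₀ p.1 v.1 + f p.1 * H (L p.1, p.2) (L v.1, v.2) -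
      (H₀ p'.1 v.1 + f p'.1 * H (L p'.1, p'.2) (L v.1, v.2))| ≤ _
    set T := ‖p - p'‖ ^ γ
    have hT : 0 ≤ T := Real.rpow_nonneg (norm_nonneg _) _
    have e0 := hn1 v
    have e00 := hLn v
    have e1 : |H₀ p.1 v.1 - H₀ p'.1 v.1| ≤ c * T * ‖v‖ ^ 2 := by
      refine (hw.holder p.1 hp.1 p'.1 hp'.1 v.1).trans ?_
      have := hdist1 p p'
      gcongr
    have e2 : |f p.1 - f p'.1| ≤ c * T := by
      refine (hw.f_holder p.1 hp.1 p'.1 hp'.1).trans ?_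
      have := hdist1 p p'
      gcongr
    have e3 : |H (L p.1, p.2) (L v.1, v.2) - H (L p'.1, p'.2) (L v.1, v.2)| ≤
        C * T * ‖v‖ ^ 2 := by
      refine ((h2 _ (hLQ p hp) _ (hLQ p' hp')).1 _).trans ?_
      have := hdist p p'
      gcongr
    have e4 : |H (L p.1, p.2) (L v.1, v.2)| ≤ C * ‖v‖ ^ 2 := by
      have e := (h1 _ (hLQ p hp)).1 (L v.1, v.2)
      rw [abs_of_nonneg (le_trans (by positivity) e.1)]
      refine e.2.trans ?_
      gcongr
    have e5 : |f p'.1| ≤ c := by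
      rw [abs_of_pos (hlow _ hp'.1)]; exact hw.f_upper _ hp'.1
    have e6 : H₀ p.1 v.1 + f p.1 * H (L p.1, p.2) (L v.1, v.2) -
      (H₀ p'.1 v.1 + f p'.1 * H (L p'.1, p'.2) (L v.1, v.2)) =
      (H₀ p.1 v.1 - H₀ p'.1 v.1) + ((f p.1 - f p'.1) * H (L p.1, p.2) (L v.1, v.2) +
       f p'.1 * (H (L p.1, p.2) (L v.1, v.2) - H (L p'.1, p'.2) (L v.1, v.2))) := by ring
    rw [e6]
    calc _ ≤ c * T * ‖v‖ ^ 2 + (c * T * (C * ‖v‖ ^ 2) + c * (C * T * ‖v‖ ^ 2)) := by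
          refine (abs_add_le _ _).trans (add_le_add e1 ((abs_add_le _ _).trans ?_))
          rw [abs_mul, abs_mul]
          gcongr
      _ = (c + 2 * (c * C)) * T * ‖v‖ ^ 2 := by ring
      _ ≤ _ := by gcongr
  · set T := ‖p - p'‖ ^ γ
    have hT : 0 ≤ T := Real.rpow_nonneg (norm_nonneg _) _
    have e2 : |f p.1 - f p'.1| ≤ c * T := by
      refine (hw.f_holder p.1 hp.1 p'.1 hp'.1).trans ?_
      have := hdist1 p p'
      gcongr
    have e3 : |a (L p.1, p.2) - a (L p'.1, p'.2)| ≤ C * T := by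
      refine ((h2 _ (hLQ p hp) _ (hLQ p' hp')).2.1).trans ?_
      have := hdist p p'
      gcongr
    have e4 : |a (L p.1, p.2)| ≤ C := by
      have e := (h1 _ (hLQ p hp)).2
      rw [abs_of_nonneg (le_trans (by positivity) e.1)]
      exact e.2.1
    have e5 : |f p'.1| ≤ c := by
      rw [abs_of_pos (hlow _ hp'.1)]; exact hw.f_upper _ hp'.1
    have e6 : f p.1 * a (L p.1, p.2) - f p'.1 * a (L p'.1, p'.2) =
      (f p.1 - f p'.1) * a (L p.1, p.2) + f p'.1 * (a (L p.1, p.2) - a (L p'.1, p'.2)) := by ring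
    rw [e6]
    calc _ ≤ c * T * C + c * (C * T) := by
          refine (abs_add_le _ _).trans ?_
          rw [abs_mul, abs_mul]
          gcongr
      _ = (2 * (c * C)) * T := by ring
      _ ≤ _ := by
        gcongr
        linarith
  · change |f p.1 * k (L p.1, p.2) z ζ - f p'.1 * k (L p'.1, p'.2) z ζ| ≤
      C' * _ * (f p'.1 * k (L p'.1, p'.2) z ζ)
    set T := ‖p - p'‖ ^ γ
    have hT : 0 ≤ T := Real.rpow_nonneg (norm_nonneg _) _
    have e2 : |f p.1 - f p'.1| ≤ c * T := by
      refine (hw.f_holder p.1 hp.1 p'.1 hp'.1).trans ?_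
      have := hdist1 p p'
      gcongr
    have e0 : 0 ≤ k (L p'.1, p'.2) z ζ := metric_zero_le (h1 _ (hLQ p' hp')).2.2.2 z ζ
    have e3 : |k (L p.1, p.2) z ζ - k (L p'.1, p'.2) z ζ| ≤ C * T * k (L p'.1, p'.2) z ζ := by
      refine ((h2 _ (hLQ p hp) _ (hLQ p' hp')).2.2 z ζ).trans ?_
      have := hdist p p'
      gcongr
    have e5 : |f p.1| ≤ c := by
      rw [abs_of_pos (hlow _ hp.1)]; exact hw.f_upper _ hp.1
    have e6 : f p.1 * k (L p.1, p.2) z ζ - f p'.1 * k (L p'.1, p'.2) z ζ =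
      f p.1 * (k (L p.1, p.2) z ζ - k (L p'.1, p'.2) z ζ) +
        (f p.1 - f p'.1) * k (L p'.1, p'.2) z ζ := by ring
    have e7 : c⁻¹ * k (L p'.1, p'.2) z ζ ≤ f p'.1 * k (L p'.1, p'.2) z ζ :=
      mul_le_mul_of_nonneg_right (hw.f_lower _ hp'.1) e0
    rw [e6]
    calc _ ≤ c * (C * T * k (L p'.1, p'.2) z ζ) + c * T * k (L p'.1, p'.2) z ζ := by
          refine (abs_add_le _ _).trans ?_
          rw [abs_mul, abs_mul, abs_of_nonneg e0]
          gcongr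
      _ = (c ^ 2 * C + c ^ 2) * T * (c⁻¹ * k (L p'.1, p'.2) z ζ) := by field_simp
      _ ≤ _ := by gcongr
  · have := h3 h (L b) (hQ hb) y hy
    ext v
    change H₀ b v.1 + f b * G (L b) _ (L v.1, _) = H₀ b v.1 + f b * H (L b, y) (L v.1, v.2)
    rw [← this]; rfl
  · have e := (h4 h (L b) (hQ hb) y hy r hr).1 z (L v.1, v.2)
    change |H₀ b v.1 + f b * G (L b) _ (L v.1, _) -
      (H₀ b v.1 + f b * H (L b, y) (L v.1, v.2.1) + f b * a (L b, y) * v.2.2.1 ^ 2 +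
        r ^ 2 * (f b * k (L b, y) z v.2.2.2))| ≤ C' * r ^ γ * (H₀ b v.1 +
        f b * H (L b, y) (L v.1, v.2.1) + f b * a (L b, y) * v.2.2.1 ^ 2 +
        r ^ 2 * (f b * k (L b, y) z v.2.2.2))
    rw [ConeChart.pull_apply] at e
    set P := G (L b) (ch.param h (y, (r, z))) (L v.1, _)
    set m := model (H (L b, y)) (a (L b, y)) r (k (L b, y) z) (L v.1, v.2) with hm
    have hm' : H₀ b v.1 + f b * H (L b, y) (L v.1, v.2.1) + f b * a (L b, y) * v.2.2.1 ^ 2 +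
        r ^ 2 * (f b * k (L b, y) z v.2.2.2) = H₀ b v.1 + f b * m := by
      rw [hm]; simp only [model]; ring
    have hrγ : 0 < r ^ γ := Real.rpow_pos_of_pos hr.1 _
    have hm0 : 0 ≤ m := by
      have : 0 ≤ C * r ^ γ * m := (abs_nonneg _).trans e
      exact nonneg_of_mul_nonneg_right this (by positivity)
    rw [hm']
    have e9 : H₀ b v.1 + f b * P - (H₀ b v.1 + f b * m) = f b * (P - m) := by ring
    change |H₀ b v.1 + f b * P - _| ≤ _
    rw [e9, abs_mul, abs_of_pos (hlow b hb)]
    have e10 := hw.nonneg b hb v.1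
    have e11 := (hlow b hb).le
    have hCC' : C ≤ C' := le_trans (le_mul_of_one_le_left hC0.le hc) hb0
    calc f b * |P - m| ≤ f b * (C * r ^ γ * m) := mul_le_mul_of_nonneg_left e e11
      _ = C * r ^ γ * (f b * m) := by ring
      _ ≤ C' * r ^ γ * (H₀ b v.1 + f b * m) := by
        gcongr
        linarith

/-- A warped tensor `H₀ + f L^* G` is an edge metric if `G` is one. -/
theorem warp_edge {γ : ℝ} (hγ : 0 < γ) (hγ1 : γ ≤ 1) (A : IterAtlas X) (C c : ℝ) (hC : 1 ≤ C)
    (hc : 1 ≤ c) : ∃ C' ≥ 1, ∀ (V W : Type) [NormedAddCommGroup V] [NormedSpace ℝ V]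
    [NormedAddCommGroup W] [NormedSpace ℝ W] (L : W →L[ℝ] V) (Q : Set V) (Q' : Set W),
    MapsTo L Q' Q → ∀ (H₀ : W → QuadraticForm ℝ W) (f : W → ℝ), WarpBound γ c L Q' H₀ f →
    ∀ G : Tensor V X, IsEdgeOn γ C A V Q G → IsEdgeOn γ C' A W Q' (warp L H₀ f G) := by
  refine IterAtlas.ind (P := fun X A => ∀ C c : ℝ, 1 ≤ C → 1 ≤ c → ∃ C' ≥ 1,
    ∀ (V W : Type) [NormedAddCommGroup V] [NormedSpace ℝ V]
    [NormedAddCommGroup W] [NormedSpace ℝ W] (L : W →L[ℝ] V) (Q : Set V) (Q' : Set W),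
    MapsTo L Q' Q → ∀ (H₀ : W → QuadraticForm ℝ W) (f : W → ℝ), WarpBound γ c L Q' H₀ f →
    ∀ G : Tensor V X, IsEdgeOn γ C A V Q G → IsEdgeOn γ C' A W Q' (warp L H₀ f G))
    ?_ A C c hC hc
  clear! X
  intro X A ih C c hC hc
  have hc0 : 0 < c := by linarith
  have hC0 : 0 < C := by linarith
  choose C₁ hC₁ h₁ using fun i => ih i C c hC hc
  choose C₂ hC₂ h₂ using fun i => ih i C (c * max 1 (A.chart i).R) hC
    (one_le_mul_of_one_le_of_one_le hc (le_max_left _ _))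
  have hs : ∀ i, C₁ i ≤ ∑ j, (C₁ j + C₂ j) ∧ C₂ i ≤ ∑ j, (C₁ j + C₂ j) := by
    intro i
    have : C₁ i + C₂ i ≤ ∑ j, (C₁ j + C₂ j) :=
      Finset.single_le_sum (f := fun j => C₁ j + C₂ j)
        (fun j _ => by linarith [hC₁ j, hC₂ j]) (Finset.mem_univ i)
    constructor <;> linarith [hC₁ i, hC₂ i]
  have hs0 : 0 ≤ ∑ j, (C₁ j + C₂ j) :=
    Finset.sum_nonneg fun j _ => by linarith [hC₁ j, hC₂ j]
  have h4 : 1 ≤ 4 * c ^ 2 * C := by nlinarith [mul_le_mul hc hc zero_le_one hc0.le]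
  refine ⟨4 * c ^ 2 * C + ∑ j, (C₁ j + C₂ j), by linarith, ?_⟩
  intro V W _ _ _ _ L Q Q' hQ H₀ f hw G hG
  rw [isEdgeOn_iff] at hG ⊢
  refine ⟨fun w hw' x => ?_, fun i => (hG.2 i).warp hγ hC hc (by linarith) hQ hw ?_ ?_⟩
  · intro v hv
    rw [warp_apply]
    have hf : 0 < f w := (inv_pos.2 hc0).trans_le (hw.f_lower w hw')
    have h1 := hw.nonneg w hw' v.1
    by_cases h0 : ((L v.1, v.2) : V × E X.n) = 0
    · have hv1 : v.1 ≠ 0 := by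
        rintro h
        apply hv
        ext1
        · exact h
        · exact (Prod.mk_eq_zero.1 h0).2
      have h2 := hw.coercive w hw' v.1
      rw [(Prod.mk_eq_zero.1 h0).1, norm_zero] at h2
      have : 0 < c⁻¹ * ‖v.1‖ ^ 2 := by positivity
      rw [h0, QuadraticMap.map_zero]
      linarith
    · have := mul_pos hf (hG.1 (L w) (hQ hw') x _ h0)
      linarith
  · intro k s hs1 hs2 hk
    rw [warp_const_lift]
    exact (h₁ i _ _ _ univ univ (mapsTo_univ _ _) _ _ (warpBound_const hc hs1 hs2) _ hk).mono
      (by linarith [hC₁ i]) (by linarith [(hs i).1])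
  · intro h w hw' y hy r hr
    rw [ConeChart.rescale_warp _ _ _ _ _ _ _ _ hr.1.ne']
    obtain ⟨H, a, k, g1, g2, g3, g4⟩ := hG.2 i
    refine (h₂ i _ _ _ ((A.chart i).box Q (L w) y r) _ ?_ _ _
      (hw.box hγ hγ1 hc (A.chart i).toConeChart w y hr) _ (g4 h (L w) (hQ hw') y hy r hr).2).mono
      (by linarith [hC₂ i]) (by linarith [(hs i).2])
    intro u hu
    refine ⟨lt_of_le_of_lt (max_le_max (hw.norm_le u.1) le_rfl) hu.1, ?_, hu.2.2.1, hu.2.2.2⟩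
    have := hQ hu.2.1
    simpa using this

end warp

/-! ### Total boundedness of the set of edge metrics -/

/-- There is a finite colouring such that any two elements of the same colour are related. -/
def FinColor {α : Type*} (R : α → α → Prop) : Prop :=
  ∃ (κ : Type) (_ : Finite κ) (col : α → κ), ∀ a a', col a = col a' → R a a'

theorem FinColor.mono {α : Type*} {R R' : α → α → Prop} (h : FinColor R)
    (hR : ∀ a a', R a a' → R' a a') : FinColor R' := by
  obtain ⟨κ, hκ, col, hc⟩ := h
  exact ⟨κ, hκ, col, fun a a' e => hR _ _ (hc _ _ e)⟩

theorem FinColor.comap {α β : Type*} {R : β → β → Prop} (h : FinColor R) (f : α → β) :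
    FinColor fun a a' => R (f a) (f a') := by
  obtain ⟨κ, hκ, col, hc⟩ := h
  exact ⟨κ, hκ, col ∘ f, fun a a' e => hc _ _ e⟩

theorem FinColor.forall {α : Type*} {ι : Type*} [Finite ι] {R : ι → α → α → Prop}
    (h : ∀ i, FinColor (R i)) : FinColor fun a a' => ∀ i, R i a a' := by
  choose κ hκ col hc using h
  obtain ⟨n, ⟨e⟩⟩ := Finite.exists_equiv_fin ι
  refine ⟨∀ j : Fin n, κ (e.symm j), inferInstance, fun a j => col (e.symm j) a, fun a a' h i => ?_⟩
  obtain ⟨j, rfl⟩ := e.symm.surjective i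
  exact hc _ _ _ (congrFun h j)

theorem FinColor.and {α : Type*} {R R' : α → α → Prop} (h : FinColor R) (h' : FinColor R') :
    FinColor fun a a' => R a a' ∧ R' a a' := by
  obtain ⟨κ, hκ, col, hc⟩ := h
  obtain ⟨κ', hκ', col', hc'⟩ := h'
  exact ⟨κ × κ', inferInstance, fun a => (col a, col' a), fun a a' e =>
    ⟨hc _ _ (Prod.ext_iff.1 e).1, hc' _ _ (Prod.ext_iff.1 e).2⟩⟩

theorem finColor_trivial {α : Type*} {R : α → α → Prop} (h : ∀ a a', R a a') : FinColor R :=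
  ⟨Unit, inferInstance, fun _ => (), fun a a' _ => h a a'⟩

theorem finColor_of_totallyBounded {α : Type*} [PseudoMetricSpace α] {s : Set α}
    (hs : TotallyBounded s) {ε : ℝ} (hε : 0 < ε) :
    FinColor fun a a' : s => dist (a : α) a' < ε := by
  obtain ⟨t, ht, hst⟩ := Metric.totallyBounded_iff.1 hs (ε / 2) (by linarith)
  have : ∀ a : s, ∃ b : t, dist (a : α) b < ε / 2 := by
    intro a
    obtain ⟨b, hb, h⟩ := mem_iUnion₂.1 (hst a.2)
    exact ⟨⟨b, hb⟩, h⟩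
  choose f hf using this
  have := ht.to_subtype
  obtain ⟨n, ⟨e⟩⟩ := Finite.exists_equiv_fin t
  refine ⟨Fin n, inferInstance, fun a => e (f a), fun a a' h => ?_⟩
  have h1 := hf a
  have h2 := hf a'
  rw [← e.injective h] at h2
  calc dist (a : α) a' ≤ dist (a : α) (f a) + dist (a' : α) (f a) := dist_triangle_right _ _ _
    _ < ε := by linarith

theorem totallyBounded_of_isBounded {α : Type*} [PseudoMetricSpace α] [ProperSpace α] {s : Set α}
    (hs : Bornology.IsBounded s) : TotallyBounded s :=
  hs.isCompact_closure.totallyBounded.subset subset_closure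

/-- Colouring of a family of maps on a totally bounded set. -/
theorem FinColor.net {α β T : Type*} [PseudoMetricSpace T] {P : Set T} (hP : TotallyBounded P)
    {R : β → β → Prop} (h : FinColor R) (F : α → P → β) {η : ℝ} (hη : 0 < η) :
    FinColor fun a a' => ∀ p : P, ∃ q : P, dist (p : T) q < η ∧ R (F a q) (F a' q) := by
  obtain ⟨t, htP, ht, hst⟩ := totallyBounded_iff_subset.1 hP _ (Metric.dist_mem_uniformity hη)
  have := ht.to_subtype
  refine (FinColor.forall (ι := t) (R := fun q a a' => R (F a ⟨q, htP q.2⟩) (F a' ⟨q, htP q.2⟩))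
    fun q => h.comap fun a => F a ⟨q, htP q.2⟩).mono ?_
  intro a a' haa p
  obtain ⟨b, hb, h⟩ := mem_iUnion₂.1 (hst p.2)
  exact ⟨⟨b, htP hb⟩, h, haa ⟨b, hb⟩⟩

section quad

variable {W : Type} [NormedAddCommGroup W] [NormedSpace ℝ W]

theorem quad_lipschitz_sphere {C : ℝ} (hC : 0 ≤ C) {q : QuadraticForm ℝ W}
    (hq : ∀ v, |q v| ≤ C * ‖v‖ ^ 2) {v w : W} (hv : ‖v‖ = 1) (hw : ‖w‖ = 1) :
    |q v - q w| ≤ 8 * C * ‖v - w‖ := by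
  rcases eq_or_ne v w with rfl | hvw
  · simp
  set t := ‖v - w‖ with ht
  have ht0 : 0 < t := norm_pos_iff.2 (sub_ne_zero.2 hvw)
  have ht2 : t ≤ 2 := (norm_sub_le v w).trans (by rw [hv, hw]; norm_num)
  set e := t⁻¹ • (v - w) with he
  have hen : ‖e‖ = 1 := by
    rw [he, norm_smul, norm_inv, norm_norm, inv_mul_cancel₀ ht0.ne']
  have hve : v = w + t • e := by rw [he, smul_inv_smul₀ ht0.ne']; abel
  have hp : |QuadraticMap.polar q w e| ≤ 6 * C := by
    have h1 := hq (w + e)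
    have h2 := hq w
    have h3 := hq e
    have h4 : ‖w + e‖ ≤ 2 := (norm_add_le w e).trans (by rw [hen, hw]; norm_num)
    have h5 : ‖w + e‖ ^ 2 ≤ 4 := by nlinarith [norm_nonneg (w + e)]
    have h6 : C * ‖w + e‖ ^ 2 ≤ C * 4 := by gcongr
    rw [hw] at h2
    rw [hen] at h3
    rw [QuadraticMap.polar]
    rw [abs_le] at *
    constructor <;> linarith [h1.1, h1.2, h2.1, h2.2, h3.1, h3.2]
  have hexp : q v - q w = t * t * q e + t * QuadraticMap.polar q w e := by
    have := QuadraticMap.map_add q w (t • e)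
    rw [QuadraticMap.polar_smul_right, QuadraticMap.map_smul] at this
    rw [hve, this]; simp only [smul_eq_mul]; ring
  rw [hexp]
  have h3 := hq e
  rw [hen] at h3
  calc _ ≤ |t * t * q e| + |t * QuadraticMap.polar q w e| := abs_add_le _ _
    _ = t * t * |q e| + t * |QuadraticMap.polar q w e| := by
      rw [abs_mul, abs_mul, abs_mul, abs_of_pos ht0]
    _ ≤ t * t * (C * 1 ^ 2) + t * (6 * C) := by gcongr
    _ ≤ t * 2 * C + t * (6 * C) := by
      have : t * t ≤ t * 2 := by gcongr
      nlinarith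
    _ = _ := by ring

theorem finColor_quad [FiniteDimensional ℝ W] {C ε : ℝ} (hC : 0 ≤ C) (hε : 0 < ε) :
    FinColor fun q q' : {q : QuadraticForm ℝ W // ∀ v, |q v| ≤ C * ‖v‖ ^ 2} =>
      ∀ v, |q.1 v - q'.1 v| ≤ ε * ‖v‖ ^ 2 := by
  have hP : TotallyBounded (Metric.sphere (0 : W) 1) := by
    have : ProperSpace W := FiniteDimensional.proper ℝ W
    exact (isCompact_sphere 0 1).totallyBounded
  have hI := finColor_of_totallyBounded (isCompact_Icc (a := -C) (b := C)).totallyBounded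
    (half_pos hε)
  set η := ε / (32 * (C + 1)) with hη
  have hη0 : 0 < η := by positivity
  refine (hI.net hP (fun (q : {q : QuadraticForm ℝ W // ∀ v, |q v| ≤ C * ‖v‖ ^ 2}) v =>
    ⟨q.1 v, by
      have h1 := q.2 v
      have h2 : ‖(v : W)‖ = 1 := by simp
      rw [h2] at h1
      simpa using abs_le.1 h1⟩) hη0).mono ?_
  intro q q' h v
  rcases eq_or_ne v 0 with rfl | hv
  · simp
  have hvn : 0 < ‖v‖ := norm_pos_iff.2 hv
  set e := ‖v‖⁻¹ • v with he
  have hen : ‖e‖ = 1 := by rw [he, norm_smul, norm_inv, norm_norm, inv_mul_cancel₀ hvn.ne']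
  have hve : v = ‖v‖ • e := by rw [he, smul_inv_smul₀ hvn.ne']
  obtain ⟨⟨w, hw⟩, h1, h2⟩ := h ⟨e, by simpa using hen⟩
  have hw : ‖w‖ = 1 := by simpa using hw
  rw [dist_eq_norm] at h1
  rw [Real.dist_eq] at h2
  simp only at h2
  have h3 := quad_lipschitz_sphere hC q.2 hen hw
  have h4 := quad_lipschitz_sphere hC q'.2 hen hw
  have h5 : 8 * C * ‖e - w‖ ≤ ε / 4 := by
    have : 8 * C * ‖e - w‖ ≤ 8 * (C + 1) * η := by
      gcongr
      linarith
    refine this.trans (le_of_eq ?_)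
    rw [hη]; field_simp; norm_num
  have h6 : |q.1 e - q'.1 e| ≤ ε := by
    rw [abs_le] at *
    rw [abs_lt] at h2
    constructor <;> linarith [h2.1, h2.2, h3.1, h3.2, h4.1, h4.2]
  have hq : ∀ q : QuadraticForm ℝ W, q v = ‖v‖ * ‖v‖ * q e := fun q => by
    conv_lhs => rw [hve, QuadraticMap.map_smul, smul_eq_mul]
  rw [hq q.1, hq q'.1, ← mul_sub, abs_mul, abs_of_pos (mul_pos hvn hvn)]
  nlinarith [mul_pos hvn hvn]

end quad

theorem Close.triangle {W : Type} {A M M' A' : W → ℝ} {e : ℝ} (he0 : 0 ≤ e) (he : e ≤ 1 / 2)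
    (hM : ∀ v, 0 ≤ M' v) (h1 : Close e A M) (h2 : Close e M M') (h3 : Close e A' M') :
    Close (7 * e) A A' := by
  intro v
  have a1 := h1 v
  have a2 := h2 v
  have a3 := h3 v
  have hm := hM v
  have b1 : e * M v ≤ 3 / 2 * (e * M' v) := by
    rw [abs_le] at a2
    nlinarith [mul_le_mul_of_nonneg_left a2.2 he0, mul_nonneg he0 hm,
      mul_le_mul_of_nonneg_right he (mul_nonneg he0 hm)]
  have b2 : M' v ≤ 2 * A' v := by
    rw [abs_le] at a3
    nlinarith [a3.1]
  have b3 : e * M' v ≤ e * (2 * A' v) := by gcongr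
  rw [abs_le] at *
  constructor <;> linarith [a1.1, a1.2, a2.1, a2.2, a3.1, a3.2]

theorem Close.mono {W : Type} {ε ε' : ℝ} {A B : W → ℝ} (h : Close ε A B) (hB : ∀ v, 0 ≤ B v)
    (hε : ε ≤ ε') : Close ε' A B :=
  fun v => (h v).trans (mul_le_mul_of_nonneg_right hε (hB v))

section coloring

variable {X Z : StratSpace.{u}} {V : Type} [NormedAddCommGroup V] [NormedSpace ℝ V]

theorem ConeChart.pull_eq_rescale_of_mem (c : ConeChart X Z) (h : c.d + 1 + Z.n = X.n)
    (G : Tensor V X) {r₀ : ℝ} (hr : 0 < r₀) (b b₀ : V) (y y₀ : E c.d) (r : ℝ) (z : Z.Reg)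
    (v : V × (E c.d × (ℝ × E Z.n))) :
    c.pull h G b y r z v =
      r₀ ^ 2 * c.rescale h G b₀ y₀ r₀ (r₀⁻¹ • (b - b₀), (r₀⁻¹ • (y - y₀), r₀⁻¹ * (r - r₀))) z
        ((r₀⁻¹ • v.1, (r₀⁻¹ • v.2.1, r₀⁻¹ * v.2.2.1)), v.2.2.2) := by
  rw [ConeChart.rescale_apply]
  simp only [smul_inv_smul₀ hr.ne', mul_inv_cancel_left₀ hr.ne', add_sub_cancel]
  rw [mul_inv_cancel_left₀ (pow_ne_zero 2 hr.ne')]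
  have : r₀ * (1 + r₀⁻¹ * (r - r₀)) = r := by field_simp; ring
  rw [this]

theorem model_close {d l : ℕ} {H H' : QuadraticForm ℝ (V × E d)} {a a' r e : ℝ}
    {k k' : QuadraticForm ℝ (E l)} (h1 : ∀ v, |H v - H' v| ≤ e * H' v) (h2 : |a - a'| ≤ e * a')
    (h3 : Close e k k') : Close e (model H a r k) (model H' a' r k') := by
  intro v
  have e1 := h1 (v.1, v.2.1)
  have e3 := h3 v.2.2.2
  simp only [model]
  have : H (v.1, v.2.1) + a * v.2.2.1 ^ 2 + r ^ 2 * k v.2.2.2 -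
      (H' (v.1, v.2.1) + a' * v.2.2.1 ^ 2 + r ^ 2 * k' v.2.2.2) =
      (H (v.1, v.2.1) - H' (v.1, v.2.1)) + ((a - a') * v.2.2.1 ^ 2 +
        r ^ 2 * (k v.2.2.2 - k' v.2.2.2)) := by ring
  rw [this]
  calc _ ≤ e * H' (v.1, v.2.1) + (e * a' * v.2.2.1 ^ 2 + r ^ 2 * (e * k' v.2.2.2)) := by
        refine (abs_add_le _ _).trans (add_le_add e1 ((abs_add_le _ _).trans ?_))
        rw [abs_mul, abs_mul, abs_of_nonneg (sq_nonneg v.2.2.1), abs_of_nonneg (sq_nonneg r)]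
        gcongr
    _ = _ := by ring

theorem model_nonneg {d l : ℕ} {H : QuadraticForm ℝ (V × E d)} {a r : ℝ}
    {k : QuadraticForm ℝ (E l)} (h1 : ∀ v, 0 ≤ H v) (h2 : 0 ≤ a) (h3 : ∀ v, 0 ≤ k v)
    (v : V × (E d × (ℝ × E l))) : 0 ≤ model H a r k v := by
  have := h1 (v.1, v.2.1)
  have := h3 v.2.2.2
  simp only [model]
  positivity

theorem exists_rpow_le {γ : ℝ} (hγ : 0 < γ) (C : ℝ) {e : ℝ} (he : 0 < e) :
    ∃ η > 0, ∀ t, 0 ≤ t → t ≤ η → C * t ^ γ ≤ e := by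
  have hc : Continuous fun t : ℝ => C * t ^ γ :=
    continuous_const.mul (Real.continuous_rpow_const hγ.le)
  have h0 : Tendsto (fun t : ℝ => C * t ^ γ) (𝓝 0) (𝓝 0) := by
    have := hc.tendsto 0
    rwa [Real.zero_rpow hγ.ne', mul_zero] at this
  obtain ⟨η, hη, h⟩ := Metric.eventually_nhds_iff.1 (h0.eventually (Iio_mem_nhds he))
  refine ⟨η / 2, by linarith, fun t ht ht' => (h ?_).le⟩
  rw [Real.dist_eq, sub_zero, abs_of_nonneg ht]
  linarith

/-- Colouring of edge metrics away from the singular stratum of a chart. -/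
theorem finColor_far {γ C : ℝ} {c : EdgeChart X Z} {A : IterAtlas Z} [FiniteDimensional ℝ V]
    {Q : Set V} (hQ : Bornology.IsBounded Q) {α : Type*} {F : α → Tensor V X}
    (ih : ∀ ε > 0, ∀ (V : Type) [NormedAddCommGroup V] [NormedSpace ℝ V] [FiniteDimensional ℝ V]
      (Q : Set V), Bornology.IsBounded Q →
      FinColor fun G G' : {G : Tensor V Z // IsEdgeOn γ C A V Q G} =>
        ∀ b ∈ Q, ∀ x, Close ε (G.1 b x) (G'.1 b x)) {ε : ℝ} (hε : 0 < ε)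
    (h : c.d + 1 + Z.n = X.n) {s : ℝ} (hs : 0 < s)
    (hF : ∀ a, ∀ b ∈ Q, ∀ y ∈ c.U, ∀ r ∈ Ico s c.R,
      IsEdgeOn γ C A (V × (E c.d × ℝ)) (c.box Q b y r) (c.rescale h (F a) b y r)) :
    FinColor fun G G' => ∀ b ∈ Q, ∀ y ∈ c.U, ∀ r ∈ Ico s c.R, ∀ z,
        Close ε (c.pull h (F G) b y r z) (c.pull h (F G') b y r z) := by
  have : ProperSpace V := FiniteDimensional.proper ℝ V
  have hP : TotallyBounded (Q ×ˢ (c.U ×ˢ Ico s c.R)) :=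
    totallyBounded_of_isBounded (hQ.prod (c.bounded_U.prod (Metric.isBounded_Ico _ _)))
  obtain ⟨t, htP, ht, hst⟩ := totallyBounded_iff_subset.1 hP _
    (Metric.dist_mem_uniformity (show 0 < s / 3 by linarith))
  have := ht.to_subtype
  have hcol : ∀ q : t, FinColor fun G G' : α =>
      ∀ b ∈ c.box Q q.1.1 q.1.2.1 q.1.2.2, ∀ x,
        Close ε (c.rescale h (F G) q.1.1 q.1.2.1 q.1.2.2 b x)
          (c.rescale h (F G') q.1.1 q.1.2.1 q.1.2.2 b x) := by
    intro q
    have hq := htP q.2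
    have hb : Bornology.IsBounded (c.box Q q.1.1 q.1.2.1 q.1.2.2) :=
      (Metric.isBounded_ball (x := 0) (r := 1 / 2)).subset fun u hu => by simpa using hu.1
    exact (ih ε hε _ _ hb).comap fun G =>
      ⟨c.rescale h (F G) q.1.1 q.1.2.1 q.1.2.2, hF G _ hq.1 _ hq.2.1 _ hq.2.2⟩
  refine (FinColor.forall hcol).mono ?_
  intro G G' hGG b hb y hy r hr z v
  obtain ⟨⟨b₀, y₀, r₀⟩, hq, hd⟩ := mem_iUnion₂.1 (hst (show (b, (y, r)) ∈ _ from ⟨hb, hy, hr⟩))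
  have hq' : r₀ ∈ Ico s c.R := (htP hq).2.2
  have hr₀ : 0 < r₀ := hs.trans_le hq'.1
  have hd' : dist (b, (y, r)) (b₀, (y₀, r₀)) < s / 3 := hd
  have hbox : (r₀⁻¹ • (b - b₀), (r₀⁻¹ • (y - y₀), r₀⁻¹ * (r - r₀))) ∈ c.box Q b₀ y₀ r₀ := by
    refine ⟨?_, ?_, ?_, ?_⟩
    · have : (r₀⁻¹ • (b - b₀), (r₀⁻¹ • (y - y₀), r₀⁻¹ * (r - r₀))) =
        r₀⁻¹ • ((b, (y, r)) - (b₀, (y₀, r₀))) := rfl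
      rw [this, norm_smul, ← dist_eq_norm, norm_inv, Real.norm_of_nonneg hr₀.le,
        inv_mul_lt_iff₀ hr₀]
      linarith [hq'.1]
    · simpa [smul_inv_smul₀ hr₀.ne'] using hb
    · simpa [smul_inv_smul₀ hr₀.ne'] using hy
    · have : r₀ * (1 + r₀⁻¹ * (r - r₀)) = r := by field_simp; ring
      simp only [this]
      exact hr.2
  have := hGG ⟨_, hq⟩ _ hbox z ((r₀⁻¹ • v.1, (r₀⁻¹ • v.2.1, r₀⁻¹ * v.2.2.1)), v.2.2.2)
  rw [c.pull_eq_rescale_of_mem h (F G) hr₀ b b₀ y y₀, c.pull_eq_rescale_of_mem h (F G') hr₀ b b₀ y y₀,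
    ← mul_sub, abs_mul, abs_of_nonneg (sq_nonneg r₀), mul_left_comm]
  exact mul_le_mul_of_nonneg_left this (sq_nonneg r₀)

/-- The relation between two edge metrics given by the data in a chart being close. -/
theorem finColor_chartEdge {γ C : ℝ} (hγ : 0 < γ) (hC : 1 ≤ C) {c : EdgeChart X Z}
    {A : IterAtlas Z} [FiniteDimensional ℝ V] {Q : Set V} (hQ : Bornology.IsBounded Q)
    (ih : ∀ ε > 0, ∀ (V : Type) [NormedAddCommGroup V] [NormedSpace ℝ V] [FiniteDimensional ℝ V]
      (Q : Set V), Bornology.IsBounded Q →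
      FinColor fun G G' : {G : Tensor V Z // IsEdgeOn γ C A V Q G} =>
        ∀ b ∈ Q, ∀ x, Close ε (G.1 b x) (G'.1 b x)) {ε : ℝ} (hε : 0 < ε) :
    FinColor fun G G' : {G : Tensor V X // ChartEdge γ C c A V Q G ∧ ∀ b ∈ Q, ∀ x v, 0 ≤ G b x v} =>
      ∀ b ∈ Q, ∀ y ∈ c.U,
        (∀ h : c.d = X.n, Close ε (c.pullTip h G.1 b y) (c.pullTip h G'.1 b y)) ∧
        ∀ (h : c.d + 1 + Z.n = X.n), ∀ r ∈ Ioo 0 c.R, ∀ z,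
          Close ε (c.pull h G.1 b y r z) (c.pull h G'.1 b y r z) := by
  have hC0 : 0 < C := by linarith
  have : ProperSpace V := FiniteDimensional.proper ℝ V
  choose H a k h1 h2 h3 h4 using
    fun G : {G : Tensor V X // ChartEdge γ C c A V Q G ∧ ∀ b ∈ Q, ∀ x v, 0 ≤ G b x v} => G.2.1
  set e : ℝ := min (ε / 7) (1 / 2) with he
  have he0 : 0 < e := by positivity
  have heε : 7 * e ≤ ε := by linarith [min_le_left (ε / 7) (1 / 2)]
  have he2 : e ≤ 1 / 2 := min_le_right _ _
  have hP : TotallyBounded (Q ×ˢ c.U) := totallyBounded_of_isBounded (hQ.prod c.bounded_U)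
  set e' : ℝ := e / (7 * C) with he'
  have he'0 : 0 < e' := by positivity
  have he'2 : e' ≤ 1 / 2 := by
    rw [he', div_le_iff₀ (by positivity)]
    nlinarith
  have he'e : 7 * e' ≤ e := by
    rw [he', mul_div_assoc', div_le_iff₀ (by positivity)]
    nlinarith
  have he'C : 3 * e' * C ≤ e := by
    rw [he', mul_div_assoc', div_mul_eq_mul_div, div_le_iff₀ (by positivity)]
    nlinarith [mul_pos he0 hC0]
  obtain ⟨η, hη, hη'⟩ := exists_rpow_le hγ C he'0
  have hab : ∀ G p, p ∈ Q ×ˢ c.U → a G p ∈ Icc (-C) C := fun G p hp =>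
    ⟨by linarith [(h1 G p hp).2.1, inv_pos.2 hC0], (h1 G p hp).2.2.1⟩
  have cH := (finColor_quad (W := V × E c.d) hC0.le he'0).net hP
    (fun G p => ⟨H G p, fun v => by
      have := (h1 G p p.2).1 v
      rw [abs_of_nonneg (le_trans (by positivity) this.1)]; exact this.2⟩) hη
  have ca := (finColor_of_totallyBounded (isCompact_Icc (a := -C) (b := C)).totallyBounded
    he'0).net hP (fun G p => ⟨a G p, hab G p p.2⟩) hη
  have ck := (ih e' he'0 (E 0) univ (Set.toFinite _).isBounded).net hP
    (fun G p => ⟨(k G p).lift, (h1 G p p.2).2.2.2⟩) hη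
  have hdist : ∀ p q : V × E c.d, dist p q < η → C * ‖p - q‖ ^ γ ≤ e' := fun p q h =>
    hη' _ (norm_nonneg _) (by rw [← dist_eq_norm]; exact h.le)
  have hHpos : ∀ G p, p ∈ Q ×ˢ c.U → ∀ v, 0 ≤ H G p v := fun G p hp v =>
    le_trans (by positivity) ((h1 G p hp).1 v).1
  have hHC : ∀ G p, p ∈ Q ×ˢ c.U → ∀ v, ‖v‖ ^ 2 ≤ C * H G p v := fun G p hp v => by
    have := mul_le_mul_of_nonneg_left ((h1 G p hp).1 v).1 hC0.le
    rwa [mul_inv_cancel_left₀ hC0.ne'] at this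
  have haC : ∀ G p, p ∈ Q ×ˢ c.U → 1 ≤ C * a G p := fun G p hp => by
    have := mul_le_mul_of_nonneg_left (h1 G p hp).2.1 hC0.le
    rwa [mul_inv_cancel₀ hC0.ne'] at this
  obtain ⟨rε, hrε, hrε'⟩ := exists_rpow_le hγ C he0
  have cr' : FinColor fun G G' : {G : Tensor V X //
      ChartEdge γ C c A V Q G ∧ ∀ b ∈ Q, ∀ x v, 0 ≤ G b x v} => ∀ h : c.d + 1 + Z.n = X.n,
      ∀ b ∈ Q, ∀ y ∈ c.U, ∀ r ∈ Ico rε c.R, ∀ z,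
        Close ε (c.pull h G.1 b y r z) (c.pull h G'.1 b y r z) := by
    by_cases h : c.d + 1 + Z.n = X.n
    · refine (finColor_far (F := Subtype.val) hQ ih hε h hrε fun G b hb y hy r hr =>
        (h4 G h b hb y hy r ⟨hrε.trans_le hr.1, hr.2⟩).2).mono fun G G' hg _ => hg
    · exact finColor_trivial fun _ _ h' => absurd h' h
  refine (((cH.and ca).and ck).and cr').mono ?_
  rintro G G' ⟨⟨⟨gH, ga⟩, gk⟩, gr⟩ b hb y hy
  have hp : (b, y) ∈ Q ×ˢ c.U := ⟨hb, hy⟩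
  have eH : ∀ v, |H G (b, y) v - H G' (b, y) v| ≤ e * H G' (b, y) v := by
    intro v
    obtain ⟨⟨q, hq⟩, hd, hR⟩ := gH ⟨(b, y), hp⟩
    have hd := hdist _ _ hd
    have i1 := (h2 G _ hp _ hq).1 v
    have i2 := (h2 G' _ hp _ hq).1 v
    have i3 := hR v
    have i4 : C * ‖(b, y) - q‖ ^ γ * ‖v‖ ^ 2 ≤ e' * ‖v‖ ^ 2 := by gcongr
    have i5 : |H G (b, y) v - H G' (b, y) v| ≤ 3 * e' * ‖v‖ ^ 2 := by
      simp only at i3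
      rw [abs_le] at *
      constructor <;> linarith [i1.1, i1.2, i2.1, i2.2, i3.1, i3.2]
    calc _ ≤ 3 * e' * ‖v‖ ^ 2 := i5
      _ ≤ 3 * e' * (C * H G' (b, y) v) := by
        have := hHC G' _ hp v
        gcongr
      _ = 3 * e' * C * H G' (b, y) v := by ring
      _ ≤ _ := by
        have := hHpos G' _ hp v
        gcongr
  have ea : |a G (b, y) - a G' (b, y)| ≤ e * a G' (b, y) := by
    obtain ⟨⟨q, hq⟩, hd, hR⟩ := ga ⟨(b, y), hp⟩
    have hd := hdist _ _ hd
    have i1 := (h2 G _ hp _ hq).2.1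
    have i2 := (h2 G' _ hp _ hq).2.1
    have i3 := hR.le
    rw [Real.dist_eq] at i3
    have i5 : |a G (b, y) - a G' (b, y)| ≤ 3 * e' * 1 := by
      simp only at i3
      rw [abs_le] at *
      constructor <;> linarith [i1.1, i1.2, i2.1, i2.2, i3.1, i3.2]
    have i6 := haC G' _ hp
    calc _ ≤ 3 * e' * 1 := i5
      _ ≤ 3 * e' * (C * a G' (b, y)) := by gcongr
      _ = 3 * e' * C * a G' (b, y) := by ring
      _ ≤ _ := by
        have : 0 ≤ a G' (b, y) := by nlinarith
        gcongr
  have ekz : ∀ z, Close e (k G (b, y) z) (k G' (b, y) z) := by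
    intro z
    obtain ⟨⟨q, hq⟩, hd, hR⟩ := gk ⟨(b, y), hp⟩
    have hd := hdist _ _ hd
    have pos : ∀ G p, p ∈ Q ×ˢ c.U → ∀ v, 0 ≤ k G p z v := fun G p hp v =>
      metric_zero_le (h1 G p hp).2.2.2 z v
    have i1 := ((h2 G _ hp _ hq).2.2 z).mono (pos _ _ hq) hd
    have i2 := ((h2 G' _ hp _ hq).2.2 z).mono (pos _ _ hq) hd
    have i3 : Close e' (k G q z) (k G' q z) := fun v => hR 0 (mem_univ _) z (0, v)
    exact (Close.triangle he'0.le he'2 (pos _ _ hq) i1 i3 i2).mono (pos _ _ hp) he'e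
  refine ⟨fun h v => ?_, fun h r hr z => ?_⟩
  · rw [h3 G h b hb y hy, h3 G' h b hb y hy]
    refine (eH v).trans (mul_le_mul_of_nonneg_right ?_ (hHpos G' _ hp v))
    linarith
  · rcases lt_or_ge r rε with hlt | hge
    · have hCr : C * r ^ γ ≤ e := hrε' r hr.1.le hlt.le
      have mpos : ∀ G : {G : Tensor V X // ChartEdge γ C c A V Q G ∧ ∀ b ∈ Q, ∀ x v, 0 ≤ G b x v},
          ∀ v, 0 ≤ model (H G (b, y)) (a G (b, y)) r (k G (b, y) z) v := fun G =>
        model_nonneg (hHpos G _ hp) ((inv_nonneg.2 hC0.le).trans (h1 G _ hp).2.1)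
          fun v => metric_zero_le (h1 G _ hp).2.2.2 z v
      have i1 := ((h4 G h b hb y hy r hr).1 z).mono (mpos G) hCr
      have i2 := ((h4 G' h b hb y hy r hr).1 z).mono (mpos G') hCr
      exact (Close.triangle he0.le he2 (mpos G') i1 (model_close eH ea (ekz z)) i2).mono
        (fun v => G'.2.2 b hb _ _) heε
    · exact gr h b hb y hy r ⟨hge, hr.2⟩ z

/-- The set of edge metrics with a given constant is totally bounded. -/
theorem finColor_edge {γ C : ℝ} (hγ : 0 < γ) (hC : 1 ≤ C) (A : IterAtlas X) {ε : ℝ} (hε : 0 < ε)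
    [FiniteDimensional ℝ V] {Q : Set V} (hQ : Bornology.IsBounded Q) :
    FinColor fun G G' : {G : Tensor V X // IsEdgeOn γ C A V Q G} =>
      ∀ b ∈ Q, ∀ x, Close ε (G.1 b x) (G'.1 b x) := by
  refine IterAtlas.ind (P := fun X A => ∀ ε > 0, ∀ (V : Type) [NormedAddCommGroup V]
    [NormedSpace ℝ V] [FiniteDimensional ℝ V] (Q : Set V), Bornology.IsBounded Q →
      FinColor fun G G' : {G : Tensor V X // IsEdgeOn γ C A V Q G} =>
        ∀ b ∈ Q, ∀ x, Close ε (G.1 b x) (G'.1 b x)) ?_ A ε hε V Q hQ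
  clear! X V
  intro X A ih ε hε V _ _ _ Q hQ
  refine (FinColor.forall fun i => (finColor_chartEdge hγ hC (c := A.chart i) hQ (ih i) hε).comap
    fun G : {G : Tensor V X // IsEdgeOn γ C A V Q G} =>
      ⟨G.1, ((isEdgeOn_iff A).1 G.2).2 i, fun b hb x v => edge_zero_le G.2 hb x v⟩).mono ?_
  intro G G' h b hb x v
  obtain ⟨i, ⟨hd, he, y, hy, rfl⟩ | ⟨hd, y, hy, r, hr, z, rfl⟩⟩ := A.reg_cases x
  · obtain ⟨w, hw⟩ := (A.chart i).tip_mfderiv_surj hd hy v.2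
    have := ((h i b hb y hy).1 hd) (v.1, w)
    rw [(A.chart i).pullTip_apply, (A.chart i).pullTip_apply] at this
    simp only [hw] at this
    exact this
  · obtain ⟨w, hw⟩ := (A.chart i).param_mfderiv_surj hd hy hr z v.2
    have := ((h i b hb y hy).2 hd r hr z) (v.1, w)
    rw [(A.chart i).pull_apply, (A.chart i).pull_apply] at this
    simp only [hw] at this
    exact this

end coloring

/-! ### Completeness for the bi-Lipschitz distance -/

theorem exists_limit_dist (d : ℕ → ℝ) (h0 : ∀ n, 0 ≤ d n)
    (h : ∀ n, d (n + 1) ≤ Real.exp ((1 / 2) ^ n) * d n ∧ d n ≤ Real.exp ((1 / 2) ^ n) * d (n + 1)) :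
    ∃ D, Tendsto d atTop (𝓝 D) ∧ ∀ n, D ≤ Real.exp (2 * (1 / 2) ^ n) * d n ∧
      d n ≤ Real.exp (2 * (1 / 2) ^ n) * D := by
  have hexp : ∀ n : ℕ, (2 : ℝ) * (1 / 2) ^ n = (1 / 2) ^ n + 2 * (1 / 2) ^ (n + 1) := fun n => by
    rw [pow_succ]; ring
  set p : ℕ → ℝ := fun n => Real.exp (2 * (1 / 2) ^ n) * d n with hp
  set q : ℕ → ℝ := fun n => Real.exp (-(2 * (1 / 2) ^ n)) * d n with hq
  have pa : Antitone p := antitone_nat_of_succ_le fun n => by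
    simp only [hp]
    rw [hexp n, Real.exp_add]
    have := (h n).1
    calc _ ≤ Real.exp (2 * (1 / 2) ^ (n + 1)) * (Real.exp ((1 / 2) ^ n) * d n) := by gcongr
      _ = _ := by ring
  have qm : Monotone q := monotone_nat_of_le_succ fun n => by
    simp only [hq]
    rw [hexp n, neg_add, Real.exp_add]
    have := (h n).2
    calc _ ≤ Real.exp (-(1 / 2) ^ n) * Real.exp (-(2 * (1 / 2) ^ (n + 1))) *
        (Real.exp ((1 / 2) ^ n) * d (n + 1)) := by gcongr
      _ = Real.exp (-(1 / 2) ^ n) * Real.exp ((1 / 2) ^ n) *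
        (Real.exp (-(2 * (1 / 2) ^ (n + 1))) * d (n + 1)) := by ring
      _ = _ := by rw [← Real.exp_add]; simp
  have hb : BddBelow (range p) := ⟨0, by
    rintro _ ⟨n, rfl⟩
    exact mul_nonneg (Real.exp_pos _).le (h0 n)⟩
  have hlim := tendsto_atTop_ciInf pa hb
  set D := ⨅ n, p n
  have h2 : Tendsto (fun n : ℕ => (2 : ℝ) * (1 / 2) ^ n) atTop (𝓝 0) := by
    have := (tendsto_pow_atTop_nhds_zero_of_lt_one (r := (1 / 2 : ℝ)) (by norm_num)
      (by norm_num)).const_mul 2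
    rwa [mul_zero] at this
  have h3 : Tendsto (fun n : ℕ => Real.exp (-((2 : ℝ) * (1 / 2) ^ n))) atTop (𝓝 1) := by
    have := (Real.continuous_exp.tendsto (-0)).comp h2.neg
    rwa [neg_zero, Real.exp_zero] at this
  have hd : Tendsto d atTop (𝓝 D) := by
    have := h3.mul hlim
    rw [one_mul] at this
    refine this.congr fun n => ?_
    simp only [hp]
    rw [← mul_assoc, ← Real.exp_add, neg_add_cancel, Real.exp_zero, one_mul]
  refine ⟨D, hd, fun n => ⟨ciInf_le hb n, ?_⟩⟩
  have hqD : Tendsto q atTop (𝓝 D) := by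
    have := h3.mul hd
    rwa [one_mul] at this
  have := qm.ge_of_tendsto hqD n
  calc d n = Real.exp (2 * (1 / 2) ^ n) * q n := by
        simp only [hq]
        rw [← mul_assoc, ← Real.exp_add, add_neg_cancel, Real.exp_zero, one_mul]
    _ ≤ _ := by gcongr

/-- A copy of a type, without its metric. -/
structure Relabel (α : Type u) : Type u where
  val : α

theorem exists_biLip_limit (X : ℕ → CompactMet.{u})
    (h : ∀ n, BiLip (Real.exp ((1 / 2) ^ n)) (X n) (X (n + 1))) :
    ∃ Y : CompactMet.{u}, ∀ n, BiLip (Real.exp (2 * (1 / 2) ^ n)) (X n) Y := by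
  choose e he using h
  let f : ∀ n, (X 0).carrier ≃ (X n).carrier := fun n =>
    Nat.rec (Equiv.refl _) (fun n g => g.trans (e n)) n
  have hf : ∀ n a, f (n + 1) a = e n (f n a) := fun n a => rfl
  have hd := fun a b : (X 0).carrier => exists_limit_dist (fun n => dist (f n a) (f n b))
    (fun n => dist_nonneg) (fun n => by simp only [hf]; exact he n (f n a) (f n b))
  choose D hD hD' using hd
  let m : MetricSpace (Relabel (X 0).carrier) :=
    { dist := fun a b => D a.val b.val
      dist_self := fun a => by
        refine tendsto_nhds_unique (hD a.val a.val) ?_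
        simp
      dist_comm := fun a b => by
        refine tendsto_nhds_unique (hD a.val b.val) ?_
        simp_rw [dist_comm (f _ a.val)]
        exact hD b.val a.val
      dist_triangle := fun a b c => le_of_tendsto_of_tendsto' (hD a.val c.val)
        ((hD a.val b.val).add (hD b.val c.val)) fun n => dist_triangle _ _ _
      eq_of_dist_eq_zero := fun {a b} hab => by
        have h1 := (hD' a.val b.val 0).2
        have h2 : D a.val b.val = 0 := hab
        rw [h2, mul_zero] at h1
        have h3 : f 0 a.val = f 0 b.val := dist_le_zero.1 h1
        have h4 := (f 0).injective h3
        cases a; cases b; simpa using h4 }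
  have hcont : Continuous (Relabel.mk : (X 0).carrier → Relabel (X 0).carrier) := by
    refine (LipschitzWith.of_dist_le_mul (K := ⟨Real.exp (2 * (1 / 2) ^ 0), (Real.exp_pos _).le⟩)
      fun a b => ?_).continuous
    exact (hD' a b 0).1
  have hcomp : CompactSpace (Relabel (X 0).carrier) :=
    Function.Surjective.compactSpace (f := Relabel.mk) hcont (fun a => ⟨a.val, rfl⟩)
  refine ⟨⟨Relabel (X 0).carrier⟩, fun n => ⟨(f n).symm.trans
    ⟨Relabel.mk, Relabel.val, fun _ => rfl, fun _ => rfl⟩, fun a b => ?_⟩⟩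
  have := hD' ((f n).symm a) ((f n).symm b) n
  simp only [Equiv.apply_symm_apply] at this
  exact this

theorem biLipPrecompact_of_finColor {𝒮 : Set CompactMet.{u}}
    (h : ∀ K : ℝ, 1 < K → FinColor fun X Y : 𝒮 => BiLip K X.1 Y.1) : BiLipPrecompact 𝒮 := by
  intro s hs
  have hK : ∀ n : ℕ, 1 < Real.exp ((1 / 2) ^ n) := fun n =>
    Real.one_lt_exp_iff.2 (by positivity)
  choose κ hκ col hcol using fun n : ℕ => h _ (hK n)
  let 𝒰 : Ultrafilter ℕ := hyperfilter ℕ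
  have hc : ∀ n, ∃ c, ∀ᶠ k in (𝒰 : Filter ℕ), col n ⟨s k, hs k⟩ = c := by
    intro n
    obtain ⟨c, hc⟩ := Ultrafilter.eq_pure_of_finite (𝒰.map fun k => col n ⟨s k, hs k⟩)
    refine ⟨c, ?_⟩
    have : {c} ∈ 𝒰.map fun k => col n ⟨s k, hs k⟩ := by rw [hc]; exact rfl
    exact this
  choose c hc using hc
  have hfreq : ∀ n, ∃ᶠ k in atTop, ∀ m ≤ n, col m ⟨s k, hs k⟩ = c m := by
    intro n
    have h1 : ∀ᶠ k in (𝒰 : Filter ℕ), ∀ m ≤ n, col m ⟨s k, hs k⟩ = c m :=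
      (Filter.eventually_all_finite (finite_le_nat n)).2 fun m _ => hc m
    have h2 : (𝒰 : Filter ℕ) ≤ atTop := Nat.cofinite_eq_atTop ▸ hyperfilter_le_cofinite
    exact h1.frequently.filter_mono h2
  obtain ⟨ψ, hψ, hψc⟩ := Filter.extraction_forall_of_frequently hfreq
  obtain ⟨Y, hY⟩ := exists_biLip_limit (fun n => s (ψ n)) fun n => hcol n ⟨_, hs _⟩ ⟨_, hs _⟩ <| by
    rw [hψc n n le_rfl, hψc (n + 1) n (Nat.le_succ n)]
  refine ⟨ψ, Y, hψ, fun K hK => ?_⟩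
  have hlim : Tendsto (fun n : ℕ => Real.exp (2 * (1 / 2) ^ n)) atTop (𝓝 1) := by
    have h2 := (tendsto_pow_atTop_nhds_zero_of_lt_one (r := (1 / 2 : ℝ)) (by norm_num)
      (by norm_num)).const_mul 2
    have := (Real.continuous_exp.tendsto _).comp h2
    rwa [mul_zero, Real.exp_zero] at this
  filter_upwards [hlim.eventually (Iio_mem_nhds hK)] with n hn
  obtain ⟨e, he⟩ := hY n
  have hn : Real.exp (2 * (1 / 2) ^ n) < K := hn
  refine ⟨e, fun a b => ⟨(he a b).1.trans ?_, (he a b).2.trans ?_⟩⟩ <;>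
  exact mul_le_mul_of_nonneg_right hn.le dist_nonneg

theorem finite_cover_of_finColor {𝒮 : Set CompactMet.{u}} {K : ℝ}
    (h : FinColor fun X Y : 𝒮 => BiLip K X.1 Y.1) :
    ∃ (N : ℕ) (Y : Fin N → CompactMet.{u}), ∀ X ∈ 𝒮, ∃ β, BiLip K X (Y β) := by
  obtain ⟨κ, hκ, col, hcol⟩ := h
  obtain ⟨N, ⟨e⟩⟩ := Finite.exists_equiv_fin (range col)
  choose r hr using fun c : range col => c.2
  refine ⟨N, fun β => (r (e.symm β)).1, fun X hX => ⟨e ⟨col ⟨X, hX⟩, mem_range_self _⟩, ?_⟩⟩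
  simp only [Equiv.symm_apply_apply]
  exact hcol ⟨X, hX⟩ _ (hr ⟨col ⟨X, hX⟩, mem_range_self _⟩).symm

/-! ### The topology of cones and tangent spheres -/

namespace Cone

variable {Z : Type u}

theorem radius_nonneg (c : Cone Z) : 0 ≤ radius c := by
  rcases c with _ | ⟨⟨r, hr⟩, z⟩
  · exact le_rfl
  · exact le_of_lt hr

theorem eq_vertex_of_radius {c : Cone Z} (h : radius c = 0) : c = vertex := by
  rcases c with _ | ⟨⟨r, hr⟩, z⟩
  · rfl
  · exact absurd h (ne_of_gt hr)

theorem pt_of_pos {r : ℝ} (hr : 0 < r) (z : Z) : pt r z = off (⟨r, hr⟩, z) := dif_pos hr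

theorem pt_of_nonpos {r : ℝ} (hr : r ≤ 0) (z : Z) : pt r z = vertex := dif_neg (not_lt.2 hr)

theorem radius_pt_eq (r : ℝ) (z : Z) : radius (pt r z) = max r 0 := by
  rcases lt_or_ge 0 r with h | h
  · rw [pt_of_pos h, max_eq_left h.le]; rfl
  · rw [pt_of_nonpos h, max_eq_right h]; rfl

/-- The dilation by a factor `t` (the constant map to the vertex if `t ≤ 0`). -/
def dil (t : ℝ) : Cone Z → Cone Z
  | none => vertex
  | some p => pt (t * p.1) p.2

@[simp] theorem dil_vertex (t : ℝ) : dil t (vertex : Cone Z) = vertex := rfl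

theorem dil_off (t : ℝ) (p : Ioi (0 : ℝ) × Z) : dil t (off p) = pt (t * p.1) p.2 := rfl

theorem dil_pt {t : ℝ} (ht : 0 ≤ t) (r : ℝ) (z : Z) : dil t (pt r z) = pt (t * r) z := by
  rcases lt_or_ge 0 r with h | h
  · rw [pt_of_pos h, dil_off]
  · rw [pt_of_nonpos h, pt_of_nonpos (mul_nonpos_of_nonneg_of_nonpos ht h)]; rfl

theorem radius_dil {t : ℝ} (ht : 0 ≤ t) (c : Cone Z) : radius (dil t c) = t * radius c := by
  rcases c with _ | ⟨⟨r, hr⟩, z⟩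
  · exact (mul_zero t).symm
  · exact radius_pt (mul_nonneg ht (le_of_lt hr)) z

theorem dil_dil {s t : ℝ} (hs : 0 ≤ s) (c : Cone Z) :
    dil s (dil t c) = dil (s * t) c := by
  rcases c with _ | ⟨⟨r, hr⟩, z⟩
  · rfl
  · change dil s (pt (t * r) z) = pt (s * t * r) z
    rw [dil_pt hs, mul_assoc]

theorem dil_one (c : Cone Z) : dil 1 c = c := by
  rcases c with _ | ⟨⟨r, hr⟩, z⟩
  · rfl
  · change pt (1 * r) z = _
    rw [one_mul, pt_of_pos hr]; rfl

theorem off_injective : Function.Injective (off : Ioi (0 : ℝ) × Z → Cone Z) :=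
  fun _ _ h => Option.some.inj h

variable [TopologicalSpace Z]

theorem isOpen_iff {s : Set (Cone Z)} : IsOpen s ↔ IsOpen {p : Ioi (0 : ℝ) × Z | off p ∈ s} ∧
    ((vertex : Cone Z) ∈ s → ∃ ε > 0, ∀ x : Cone Z, radius x < ε → x ∈ s) := Iff.rfl

theorem isOpenEmbedding_off : IsOpenEmbedding (off : Ioi (0 : ℝ) × Z → Cone Z) := by
  refine IsOpenEmbedding.of_continuous_injective_isOpenMap
    ⟨fun s hs => (isOpen_iff.1 hs).1⟩ off_injective fun s hs => isOpen_iff.2 ⟨?_, ?_⟩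
  · convert hs using 1
    ext p
    exact ⟨fun ⟨q, hq, h⟩ => off_injective h ▸ hq, fun h => ⟨p, h, rfl⟩⟩
  · rintro ⟨q, hq, h⟩
    cases h

theorem nhds_off (p : Ioi (0 : ℝ) × Z) : 𝓝 (off p) = map off (𝓝 p) :=
  (isOpenEmbedding_off.map_nhds_eq p).symm

theorem isOpen_radius_lt (ε : ℝ) : IsOpen {c : Cone Z | radius c < ε} := by
  refine isOpen_iff.2 ⟨?_, fun h => ⟨ε, h, fun x hx => hx⟩⟩
  exact isOpen_lt (continuous_subtype_val.comp continuous_fst) continuous_const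

theorem nhds_vertex : 𝓝 (vertex : Cone Z) = comap radius (𝓝 0) := by
  refine le_antisymm (tendsto_iff_comap.1 ?_) fun s hs => ?_
  · rw [(nhds_basis_zero_abs_lt ℝ).tendsto_right_iff]
    intro ε hε
    filter_upwards [(isOpen_radius_lt ε).mem_nhds (show (vertex : Cone Z) ∈ _ from hε)] with c hc
    change |radius c| < ε
    rwa [abs_of_nonneg (radius_nonneg c)]
  · obtain ⟨t, hts, ht, hv⟩ := mem_nhds_iff.1 hs
    obtain ⟨ε, hε, h⟩ := (isOpen_iff.1 ht).2 hv
    exact ⟨Iio ε, Iio_mem_nhds hε, fun c hc => hts (h c hc)⟩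

theorem continuous_radius : Continuous (radius : Cone Z → ℝ) := by
  refine continuous_iff_continuousAt.2 fun c => ?_
  rcases c with _ | p
  · change Tendsto radius (𝓝 (vertex : Cone Z)) (𝓝 0)
    rw [nhds_vertex]; exact tendsto_comap
  · change Tendsto radius (𝓝 (off p)) (𝓝 (p.1 : ℝ))
    rw [nhds_off, tendsto_map'_iff]
    exact (continuous_subtype_val.comp continuous_fst).tendsto p

theorem continuous_pt : Continuous fun p : ℝ × Z => pt p.1 p.2 := by
  refine continuous_iff_continuousAt.2 fun p => ?_
  rcases lt_or_ge 0 p.1 with h | h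
  · have h1 : ContinuousOn (fun p : ℝ × Z => pt p.1 p.2) {p | 0 < p.1} := by
      rw [continuousOn_iff_continuous_domRestrict]
      have : ({p : ℝ × Z | 0 < p.1}.domRestrict fun p : ℝ × Z => pt p.1 p.2) =
          fun q => off (⟨q.1.1, q.2⟩, q.1.2) := by
        funext q
        exact pt_of_pos q.2 _
      rw [this]
      refine isOpenEmbedding_off.continuous.comp ?_
      fun_prop
    exact h1.continuousAt ((isOpen_lt continuous_const continuous_fst).mem_nhds h)
  · change Tendsto _ _ (𝓝 (pt p.1 p.2))
    rw [pt_of_nonpos h, nhds_vertex, tendsto_comap_iff]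
    have : (radius ∘ fun p : ℝ × Z => pt p.1 p.2) = fun p => max p.1 0 :=
      funext fun p => radius_pt_eq _ _
    rw [this]
    have h1 : Continuous fun p : ℝ × Z => max p.1 0 := continuous_fst.max continuous_const
    have h2 := h1.tendsto p
    rwa [max_eq_right h] at h2

theorem continuous_dil : Continuous fun p : ℝ × Cone Z => dil p.1 p.2 := by
  refine continuous_iff_continuousAt.2 fun ⟨t, c⟩ => ?_
  rcases c with _ | q
  · change Tendsto _ (𝓝 (t, vertex)) (𝓝 vertex)
    rw [nhds_vertex, tendsto_comap_iff]
    have h1 : Tendsto (fun p : ℝ × Cone Z => |p.1| * radius p.2) (𝓝 (t, vertex)) (𝓝 0) := by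
      have : Continuous fun p : ℝ × Cone Z => |p.1| * radius p.2 :=
        continuous_fst.abs.mul (continuous_radius.comp continuous_snd)
      have := this.tendsto (t, vertex)
      simpa [radius_vertex] using this
    refine squeeze_zero (fun p => radius_nonneg _) (fun p => ?_) h1
    rcases p with ⟨s, _ | ⟨⟨r, hr⟩, z⟩⟩
    · exact (mul_zero |s|).ge
    · change radius (pt (s * r) z) ≤ |s| * r
      have hr' : 0 < r := hr
      rw [radius_pt_eq]
      exact max_le (by gcongr; exact le_abs_self s) (by positivity)
  · change Tendsto _ (𝓝 (t, off q)) (𝓝 (dil t (off q)))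
    rw [nhds_prod_eq, nhds_off, ← map_id (f := 𝓝 t), prod_map_map_eq, tendsto_map'_iff,
      ← nhds_prod_eq]
    have : Continuous fun p : ℝ × (Ioi (0 : ℝ) × Z) => pt (p.1 * p.2.1) p.2.2 := by
      refine continuous_pt.comp (f := fun p : ℝ × (Ioi (0 : ℝ) × Z) => ((p.1 * p.2.1 : ℝ), p.2.2)) ?_
      fun_prop
    exact this.tendsto (t, q)

instance [T2Space Z] : T2Space (Cone Z) := by
  refine ⟨fun c c' h => ?_⟩
  by_cases hr : radius c = radius c'
  · rcases c with _ | p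
    · exact absurd (eq_vertex_of_radius (c := c') hr.symm).symm h
    rcases c' with _ | q
    · exact absurd (eq_vertex_of_radius (c := some p) hr) h
    have hpq : p ≠ q := fun e => h (by rw [e])
    obtain ⟨u, v, hu, hv, hpu, hqv, huv⟩ := t2_separation hpq
    exact ⟨off '' u, off '' v, isOpenEmbedding_off.isOpenMap u hu,
      isOpenEmbedding_off.isOpenMap v hv, ⟨p, hpu, rfl⟩, ⟨q, hqv, rfl⟩,
      (disjoint_image_iff off_injective).2 huv⟩
  · obtain ⟨u, v, hu, hv, hpu, hqv, huv⟩ := t2_separation hr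
    exact ⟨radius ⁻¹' u, radius ⁻¹' v, hu.preimage continuous_radius,
      hv.preimage continuous_radius, hpu, hqv, huv.preimage _⟩

end Cone

/-- The tangent sphere, as a space. -/
abbrev Sus (D : ℕ) (Z : Type u) : Type u := tangentSphere D Z

namespace Sus

variable {D : ℕ} {Z : Type u}

/-- The linear component. -/
def v (s : Sus D Z) : E D := s.1.1

/-- The radial component. -/
def r (s : Sus D Z) : ℝ := s.1.2.radius

theorem v_r (s : Sus D Z) : ‖s.v‖ ^ 2 + s.r ^ 2 = 1 := s.2

theorem r_nonneg (s : Sus D Z) : 0 ≤ s.r := Cone.radius_nonneg _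

theorem sqrt_pos (w : E D) : 0 < √(1 + ‖w‖ ^ 2) := Real.sqrt_pos.2 (by positivity)

theorem inv_sqrt_sq (w : E D) : (√(1 + ‖w‖ ^ 2))⁻¹ ^ 2 * (1 + ‖w‖ ^ 2) = 1 := by
  rw [inv_pow, Real.sq_sqrt (by positivity), inv_mul_cancel₀ (by positivity)]

/-- The point with projective coordinates `[w : 1 : z]`. -/
def emb (p : E D × Z) : Sus D Z :=
  ⟨((√(1 + ‖p.1‖ ^ 2))⁻¹ • p.1, Cone.pt (√(1 + ‖p.1‖ ^ 2))⁻¹ p.2), by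
    have h := sqrt_pos p.1
    change ‖(√(1 + ‖p.1‖ ^ 2))⁻¹ • p.1‖ ^ 2 + _ ^ 2 = 1
    rw [Cone.radius_pt (inv_nonneg.2 h.le), norm_smul, norm_inv, Real.norm_of_nonneg h.le]
    have := inv_sqrt_sq p.1
    rw [mul_pow]; linarith⟩

/-- The point of the tangent sphere in the direction of `e`. -/
def tipPt (e : E D) (he : ‖e‖ = 1) : Sus D Z := ⟨(e, Cone.vertex), by
  change ‖e‖ ^ 2 + 0 ^ 2 = 1
  rw [he]; norm_num⟩

theorem emb_r (p : E D × Z) : (emb p).r = (√(1 + ‖p.1‖ ^ 2))⁻¹ :=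
  Cone.radius_pt (inv_nonneg.2 (sqrt_pos p.1).le) _

theorem emb_v (p : E D × Z) : (emb p).v = (√(1 + ‖p.1‖ ^ 2))⁻¹ • p.1 := rfl

theorem emb_r_pos (p : E D × Z) : 0 < (emb p).r := by
  rw [emb_r]; exact inv_pos.2 (sqrt_pos _)

theorem r_inv_eq {s : Sus D Z} (hs : 0 < s.r) : √(1 + ‖s.r⁻¹ • s.v‖ ^ 2) = s.r⁻¹ := by
  rw [Real.sqrt_eq_iff_mul_self_eq_of_pos (inv_pos.2 hs), norm_smul, norm_inv,
    Real.norm_of_nonneg hs.le]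
  have := s.v_r
  field_simp
  linarith

theorem emb_surj {s : Sus D Z} (hs : 0 < s.r) : ∃ z, s.1.2 = Cone.pt s.r z ∧
    emb (s.r⁻¹ • s.v, z) = s := by
  have hr := r_inv_eq hs
  rcases s with ⟨⟨v, _ | ⟨⟨r, hr'⟩, z⟩⟩, h⟩
  · exact absurd hs (lt_irrefl 0)
  · have hr0 : 0 < r := hr'
    have hrr : Sus.r (⟨(v, some (⟨r, hr'⟩, z)), h⟩ : Sus D Z) = r := rfl
    refine ⟨z, by rw [hrr, Cone.pt_of_pos hr0]; rfl, Subtype.ext ?_⟩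
    simp only [emb, hr, inv_inv]
    rw [smul_inv_smul₀ hs.ne', hrr, Cone.pt_of_pos hr0]
    rfl

theorem emb_injective : Function.Injective (emb : E D × Z → Sus D Z) := by
  rintro ⟨w, z⟩ ⟨w', z'⟩ h
  have h1 : (√(1 + ‖w‖ ^ 2))⁻¹ = (√(1 + ‖w'‖ ^ 2))⁻¹ := by
    rw [← emb_r (w, z), ← emb_r (w', z'), h]
  have h2 := congrArg v h
  rw [emb_v, emb_v] at h2
  simp only at h2
  rw [h1] at h2
  have h3 := smul_right_injective (E D) (inv_ne_zero (sqrt_pos w').ne') h2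
  have h4 := congrArg (fun s : Sus D Z => s.1.2) h
  simp only [emb, h1, Cone.pt_of_pos (inv_pos.2 (sqrt_pos w'))] at h4
  have h5 := congrArg Prod.snd (Option.some.inj h4)
  exact Prod.ext h3 h5

theorem eq_of_r_zero {s : Sus D Z} (hs : s.r = 0) : ∃ h : ‖s.v‖ = 1, s = tipPt s.v h := by
  have h1 := s.v_r
  rw [hs] at h1
  have h : ‖s.v‖ = 1 := by
    have : ‖s.v‖ ^ 2 = 1 := by linarith
    nlinarith [norm_nonneg s.v]
  refine ⟨h, Subtype.ext (Prod.ext rfl ?_)⟩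
  exact Cone.eq_vertex_of_radius hs

/-- The distance of a point of `ℝᵈ × C(Z)` to the vertex. -/
def size (p : E D × Cone Z) : ℝ := √(‖p.1‖ ^ 2 + p.2.radius ^ 2)

theorem size_sq (p : E D × Cone Z) : size p ^ 2 = ‖p.1‖ ^ 2 + p.2.radius ^ 2 :=
  Real.sq_sqrt (by positivity)

theorem size_nonneg (p : E D × Cone Z) : 0 ≤ size p := Real.sqrt_nonneg _

theorem norm_le_size (p : E D × Cone Z) : ‖p.1‖ ≤ size p :=
  Real.le_sqrt_of_sq_le (by nlinarith [sq_nonneg p.2.radius])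

theorem radius_le_size (p : E D × Cone Z) : p.2.radius ≤ size p :=
  Real.le_sqrt_of_sq_le (by nlinarith [sq_nonneg ‖p.1‖])

theorem size_le (p : E D × Cone Z) : size p ≤ ‖p.1‖ + p.2.radius := by
  have := Cone.radius_nonneg p.2
  refine Real.sqrt_le_iff.2 ⟨by positivity, ?_⟩
  nlinarith [norm_nonneg p.1]

theorem eq_of_size_eq_zero {p : E D × Cone Z} (h : size p = 0) : p = (0, Cone.vertex) := by
  have h1 := norm_le_size p
  have h2 := radius_le_size p
  rw [h] at h1 h2
  exact Prod.ext (norm_le_zero_iff.1 h1)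
    (Cone.eq_vertex_of_radius (le_antisymm h2 (Cone.radius_nonneg _)))

/-- The projection to the tangent sphere. -/
def proj (p : E D × Cone Z) (hp : 0 < size p) : Sus D Z :=
  ⟨((size p)⁻¹ • p.1, Cone.dil (size p)⁻¹ p.2), by
    change ‖(size p)⁻¹ • p.1‖ ^ 2 + _ ^ 2 = 1
    rw [Cone.radius_dil (inv_nonneg.2 hp.le), norm_smul, norm_inv, Real.norm_of_nonneg hp.le,
      mul_pow, mul_pow, ← mul_add, ← size_sq, inv_pow, inv_mul_cancel₀ (pow_ne_zero 2 hp.ne')]⟩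

/-- The product of `t` and a point of the unit sphere. -/
def scale (t : ℝ) (s : Sus D Z) : E D × Cone Z := (t • s.v, Cone.dil t s.1.2)

theorem size_scale {t : ℝ} (ht : 0 ≤ t) (s : Sus D Z) : size (scale t s) = t := by
  have h : size (scale t s) ^ 2 = t ^ 2 := by
    rw [size_sq]
    change ‖t • s.v‖ ^ 2 + _ ^ 2 = _
    have h1 := s.v_r
    have h2 : (scale t s).2.radius = t * s.r := Cone.radius_dil ht _
    rw [h2, norm_smul, Real.norm_of_nonneg ht]
    linear_combination t ^ 2 * h1
  exact (pow_left_inj₀ (size_nonneg _) ht two_ne_zero).1 h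

theorem scale_proj (p : E D × Cone Z) (hp : 0 < size p) : scale (size p) (proj p hp) = p := by
  refine Prod.ext (smul_inv_smul₀ hp.ne' _) ?_
  change Cone.dil _ (Cone.dil _ _) = _
  rw [Cone.dil_dil hp.le, mul_inv_cancel₀ hp.ne', Cone.dil_one]

theorem proj_scale {t : ℝ} (ht : 0 < t) (s : Sus D Z) (h : 0 < size (scale t s)) :
    proj (scale t s) h = s := by
  have h1 := size_scale ht.le s
  refine Subtype.ext (Prod.ext ?_ ?_)
  · change (size (scale t s))⁻¹ • (t • s.v) = _
    rw [h1, inv_smul_smul₀ ht.ne']; rfl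
  · change Cone.dil (size (scale t s))⁻¹ (Cone.dil t s.1.2) = _
    rw [h1, Cone.dil_dil (inv_nonneg.2 ht.le), inv_mul_cancel₀ ht.ne', Cone.dil_one]

variable [TopologicalSpace Z]

theorem continuous_v : Continuous (v : Sus D Z → E D) := continuous_fst.comp continuous_subtype_val

theorem continuous_r : Continuous (r : Sus D Z → ℝ) :=
  Cone.continuous_radius.comp (continuous_snd.comp continuous_subtype_val)

theorem continuous_emb : Continuous (emb : E D × Z → Sus D Z) := by
  have h : Continuous fun p : E D × Z => (√(1 + ‖p.1‖ ^ 2))⁻¹ :=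
    (by fun_prop : Continuous fun p : E D × Z => √(1 + ‖p.1‖ ^ 2)).inv₀ fun p => (sqrt_pos p.1).ne'
  refine Continuous.subtype_mk ((h.smul continuous_fst).prodMk ?_) _
  exact Cone.continuous_pt.comp (h.prodMk continuous_snd)

theorem isOpenEmbedding_emb : IsOpenEmbedding (emb : E D × Z → Sus D Z) := by
  refine IsOpenEmbedding.of_continuous_injective_isOpenMap continuous_emb emb_injective
    (IsOpenMap.of_nhds_le fun p T hT => ?_)
  obtain ⟨A, hA, B, hB, hAB⟩ := mem_nhds_prod_iff.1 hT
  have hp := emb_r_pos p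
  obtain ⟨z₀, hz₀, he⟩ := emb_surj hp
  have hpz := emb_injective he
  have h1 : ContinuousAt (fun s : Sus D Z => s.r⁻¹ • s.v) (emb p) :=
    (continuous_r.continuousAt.inv₀ hp.ne').smul continuous_v.continuousAt
  have h2 : ContinuousAt (fun s : Sus D Z => s.1.2) (emb p) :=
    (continuous_snd.comp continuous_subtype_val).continuousAt
  have hA' : A ∈ 𝓝 ((emb p).r⁻¹ • (emb p).v) := by rw [← hpz] at hA; exact hA
  have hB' : Cone.off '' (univ ×ˢ B) ∈ 𝓝 (emb p).1.2 := by
    rw [hz₀, Cone.pt_of_pos hp, Cone.nhds_off]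
    refine image_mem_map (prod_mem_nhds univ_mem ?_)
    rw [← hpz] at hB; exact hB
  filter_upwards [h1 hA', h2 hB', continuous_r.continuousAt.eventually (lt_mem_nhds hp)]
    with s ha hb hr
  obtain ⟨z, hz, hs⟩ := emb_surj hr
  obtain ⟨q, hq, hqs⟩ := hb
  have hqs : Cone.off q = s.1.2 := hqs
  rw [hz, Cone.pt_of_pos hr] at hqs
  have hqz := Cone.off_injective hqs
  rw [← hs]
  refine hAB ⟨ha, ?_⟩
  have := hq.2
  rwa [hqz] at this

theorem continuous_size : Continuous (size : E D × Cone Z → ℝ) := by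
  have := Cone.continuous_radius (Z := Z)
  unfold size
  fun_prop

theorem continuous_scale : Continuous fun p : ℝ × Sus D Z => scale p.1 p.2 := by
  refine Continuous.prodMk (continuous_fst.smul (continuous_v.comp continuous_snd)) ?_
  exact Cone.continuous_dil.comp (continuous_fst.prodMk
    ((continuous_snd.comp continuous_subtype_val).comp continuous_snd))

/-- Polar coordinates: `ℝᵈ × C(Z)` is the cone over its unit sphere. -/
def polar (D : ℕ) (Z : Type u) [TopologicalSpace Z] : E D × Cone Z ≃ₜ Cone (Sus D Z) where
  toFun p := if h : 0 < size p then Cone.off (⟨size p, h⟩, proj p h) else Cone.vertex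
  invFun c := match c with
    | none => (0, Cone.vertex)
    | some p => scale p.1 p.2
  left_inv p := by
    by_cases h : 0 < size p
    · simp only [dif_pos h]; exact scale_proj p h
    · simp only [dif_neg h]
      exact (eq_of_size_eq_zero (le_antisymm (not_lt.1 h) (size_nonneg p))).symm
  right_inv c := by
    rcases c with _ | ⟨⟨t, ht⟩, s⟩
    · have : ¬ 0 < size ((0, Cone.vertex) : E D × Cone Z) := by
        simp [size, Cone.radius_vertex]
      simp only [dif_neg this]; rfl
    · have ht' : 0 < t := ht
      have h1 := size_scale ht'.le s
      have h2 : 0 < size (scale t s) := by rwa [h1]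
      simp only [dif_pos h2, proj_scale ht' s h2]
      simp only [h1]
      rfl
  continuous_toFun := by
    refine continuous_iff_continuousAt.2 fun p => ?_
    by_cases h : 0 < size p
    · have h1 : ContinuousOn (fun p : E D × Cone Z => if h : 0 < size p then
          Cone.off (⟨size p, h⟩, proj p h) else Cone.vertex) {p | 0 < size p} := by
        rw [continuousOn_iff_continuous_domRestrict]
        have : ({p : E D × Cone Z | 0 < size p}.domRestrict fun p : E D × Cone Z =>
            if h : 0 < size p then
            Cone.off (⟨size p, h⟩, proj p h) else Cone.vertex) =
            fun q => Cone.off (⟨size q.1, q.2⟩, proj q.1 q.2) := by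
          funext q
          exact dif_pos q.2
        rw [this]
        refine Cone.isOpenEmbedding_off.continuous.comp (Continuous.prodMk
          (Continuous.subtype_mk (continuous_size.comp continuous_subtype_val) _)
          (Continuous.subtype_mk ?_ _))
        have hi : Continuous fun q : {p : E D × Cone Z | 0 < size p} => (size q.1)⁻¹ :=
          (continuous_size.comp continuous_subtype_val).inv₀ fun q => (ne_of_gt q.2)
        exact (hi.smul (continuous_fst.comp continuous_subtype_val)).prodMk
          (Cone.continuous_dil.comp (hi.prodMk (continuous_snd.comp continuous_subtype_val)))
      exact h1.continuousAt ((isOpen_lt continuous_const continuous_size).mem_nhds h)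
    · change Tendsto _ _ (𝓝 (if h : 0 < size p then _ else _))
      rw [dif_neg h, Cone.nhds_vertex, tendsto_comap_iff]
      have h0 : size p = 0 := le_antisymm (not_lt.1 h) (size_nonneg p)
      have := (continuous_size (D := D) (Z := Z)).tendsto p
      rw [h0] at this
      refine this.congr fun q => ?_
      by_cases h : 0 < size q
      · simp only [Function.comp, dif_pos h]; rfl
      · simp only [Function.comp, dif_neg h]
        exact le_antisymm (not_lt.1 h) (size_nonneg q)
  continuous_invFun := by
    refine continuous_iff_continuousAt.2 fun c => ?_
    rcases c with _ | p
    · change Tendsto _ (𝓝 Cone.vertex) (𝓝 (0, Cone.vertex))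
      rw [Cone.nhds_vertex, nhds_prod_eq, tendsto_prod_iff', Cone.nhds_vertex, tendsto_comap_iff]
      have hlim : Tendsto (Cone.radius : Cone (Sus D Z) → ℝ) (comap Cone.radius (𝓝 0)) (𝓝 0) :=
        tendsto_comap
      constructor
      · refine squeeze_zero_norm (fun c => ?_) hlim
        rcases c with _ | ⟨⟨t, ht⟩, s⟩
        · simp [Cone.radius]
        · have := norm_le_size (scale t s)
          rwa [size_scale (le_of_lt ht)] at this
      · refine squeeze_zero (fun c => Cone.radius_nonneg _) (fun c => ?_) hlim
        rcases c with _ | ⟨⟨t, ht⟩, s⟩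
        · exact le_rfl
        · have := radius_le_size (scale t s)
          rwa [size_scale (le_of_lt ht)] at this
    · change Tendsto _ (𝓝 (Cone.off p)) (𝓝 (scale p.1 p.2))
      rw [Cone.nhds_off, tendsto_map'_iff]
      exact (continuous_scale.comp ((continuous_subtype_val.comp continuous_fst).prodMk
        continuous_snd)).tendsto p

theorem polar_symm_pt {t : ℝ} (ht : 0 < t) (s : Sus D Z) :
    (polar D Z).symm (Cone.pt t s) = scale t s := by
  rw [Cone.pt_of_pos ht]; rfl

theorem radius_polar (p : E D × Cone Z) : (polar D Z p).radius = size p := by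
  change Cone.radius (if h : 0 < size p then _ else _) = _
  by_cases h : 0 < size p
  · rw [dif_pos h]; rfl
  · rw [dif_neg h]
    exact (le_antisymm (not_lt.1 h) (size_nonneg p)).symm

instance [CompactSpace Z] : CompactSpace (Sus D Z) := by
  refine isCompact_iff_compactSpace.1 ?_
  have h1 : IsCompact ((fun p : E D × Z => ((p.1, Cone.pt √(1 - ‖p.1‖ ^ 2) p.2) : E D × Cone Z)) ''
      (Metric.closedBall 0 1 ×ˢ univ)) := by
    refine ((isCompact_closedBall 0 1).prod isCompact_univ).image ?_
    refine continuous_fst.prodMk (Cone.continuous_pt.comp (f := fun p : E D × Z =>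
      (√(1 - ‖p.1‖ ^ 2), p.2)) ?_)
    fun_prop
  have h2 : IsCompact ((fun e : E D => ((e, Cone.vertex) : E D × Cone Z)) ''
      Metric.sphere 0 1) := (isCompact_sphere 0 1).image (by fun_prop)
  convert h1.union h2 using 1
  ext ⟨v, c⟩
  constructor
  · intro h
    have h' : ‖v‖ ^ 2 + c.radius ^ 2 = 1 := h
    have hv : ‖v‖ ≤ 1 := by nlinarith [sq_nonneg c.radius, norm_nonneg v]
    rcases c with _ | ⟨⟨r, hr⟩, z⟩
    · obtain ⟨h1, -⟩ := eq_of_r_zero (s := (⟨(v, Cone.vertex), h⟩ : Sus D Z)) rfl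
      have h1' : ‖v‖ = 1 := h1
      exact Or.inr ⟨v, by simpa using h1', rfl⟩
    · have hr' : 0 < r := hr
      refine Or.inl ⟨(v, z), ⟨by simpa using hv, mem_univ _⟩, ?_⟩
      have h3 : r ^ 2 = 1 - ‖v‖ ^ 2 := by
        have : ‖v‖ ^ 2 + r ^ 2 = 1 := h'
        linarith
      simp only [← h3, Real.sqrt_sq hr'.le, Cone.pt_of_pos hr']
      rfl
  · rintro (⟨⟨w, z⟩, ⟨hw, -⟩, h⟩ | ⟨e, he, h⟩)
    · obtain ⟨rfl, rfl⟩ := Prod.ext_iff.1 h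
      have hw' : ‖w‖ ≤ 1 := by simpa using hw
      change ‖w‖ ^ 2 + (Cone.pt _ z).radius ^ 2 = 1
      rw [Cone.radius_pt (Real.sqrt_nonneg _), Real.sq_sqrt (by nlinarith [norm_nonneg w])]
      ring
    · obtain ⟨rfl, rfl⟩ := Prod.ext_iff.1 h
      have : ‖e‖ = 1 := by simpa using he
      change ‖e‖ ^ 2 + (0 : ℝ) ^ 2 = 1
      rw [this]; norm_num

theorem isConnected_of_nonempty [Nonempty Z] (hD : D ≠ 0) : IsConnected (tangentSphere D Z) := by
  have : Nonempty (Fin D) := ⟨⟨0, Nat.pos_of_ne_zero hD⟩⟩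
  obtain ⟨e, he⟩ : ∃ e : E D, ‖e‖ = 1 := exists_norm_eq (E D) zero_le_one
  set F : Z → E D → E D × Cone Z := fun z w => (w, Cone.pt √(1 - ‖w‖ ^ 2) z) with hF
  have hc : ∀ z, IsPreconnected (F z '' Metric.closedBall 0 1) := fun z => by
    refine (convex_closedBall (0 : E D) 1).isPreconnected.image _ (Continuous.continuousOn ?_)
    refine continuous_id.prodMk (Cone.continuous_pt.comp (f := fun w : E D =>
      (√(1 - ‖w‖ ^ 2), z)) ?_)
    fun_prop
  have hx : ∀ z, ((e, Cone.vertex) : E D × Cone Z) ∈ F z '' Metric.closedBall 0 1 := fun z =>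
    ⟨e, by simp [he], by simp [hF, he, Cone.pt_of_nonpos le_rfl]⟩
  have hu : tangentSphere D Z = ⋃ z, F z '' Metric.closedBall 0 1 := by
    ext ⟨v, c⟩
    rw [mem_iUnion]
    constructor
    · intro h
      have h' : ‖v‖ ^ 2 + c.radius ^ 2 = 1 := h
      have hv : ‖v‖ ≤ 1 := by nlinarith [sq_nonneg c.radius, norm_nonneg v]
      have hs : √(1 - ‖v‖ ^ 2) = c.radius := by
        rw [← h', add_sub_cancel_left, Real.sqrt_sq (Cone.radius_nonneg c)]
      rcases c with _ | ⟨⟨r, hr⟩, z⟩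
      · refine ⟨Classical.arbitrary Z, v, by simpa using hv, ?_⟩
        simp only [hF, hs, Cone.radius]
        rw [Cone.pt_of_nonpos le_rfl]; rfl
      · refine ⟨z, v, by simpa using hv, ?_⟩
        simp only [hF, hs, Cone.radius]
        rw [Cone.pt_of_pos hr]; rfl
    · rintro ⟨z, w, hw, h⟩
      obtain ⟨rfl, rfl⟩ := Prod.ext_iff.1 h
      have hw' : ‖w‖ ≤ 1 := by simpa using hw
      change ‖w‖ ^ 2 + (Cone.pt _ z).radius ^ 2 = 1
      rw [Cone.radius_pt (Real.sqrt_nonneg _), Real.sq_sqrt (by nlinarith [norm_nonneg w])]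
      ring
  rw [hu]
  exact ⟨⟨_, mem_iUnion.2 ⟨Classical.arbitrary Z, hx _⟩⟩,
    isPreconnected_iUnion ⟨_, mem_iInter.2 hx⟩ hc⟩

theorem isConnected_of_isEmpty [IsEmpty Z] (hD : 2 ≤ D) : IsConnected (tangentSphere D Z) := by
  have h1 : 1 < Module.rank ℝ (E D) := by
    rw [← Module.finrank_eq_rank, finrank_euclideanSpace_fin]
    exact_mod_cast hD
  have h2 := (isConnected_sphere h1 (0 : E D) zero_le_one).image
    (fun e : E D => ((e, Cone.vertex) : E D × Cone Z)) (by fun_prop)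
  convert h2 using 1
  ext ⟨v, c⟩
  rcases c with _ | ⟨_, z⟩
  · constructor
    · intro h
      obtain ⟨h1, -⟩ := eq_of_r_zero (s := (⟨(v, Cone.vertex), h⟩ : Sus D Z)) rfl
      have h1' : ‖v‖ = 1 := h1
      exact ⟨v, by simpa using h1', rfl⟩
    · rintro ⟨e, he, h⟩
      obtain ⟨rfl, -⟩ := Prod.ext_iff.1 h
      have : ‖e‖ = 1 := by simpa using he
      change ‖e‖ ^ 2 + (0 : ℝ) ^ 2 = 1
      rw [this]; norm_num
  · exact isEmptyElim z

end Sus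

/-! ### Transport of manifold structures -/

section transport

variable {N S F F' : Type*} [TopologicalSpace N] [TopologicalSpace S] [NormedAddCommGroup F]
  [NormedSpace ℝ F] [NormedAddCommGroup F'] [NormedSpace ℝ F'] [ChartedSpace F N]

theorem exists_transport (e : S ≃ₜ N) (L : F ≃L[ℝ] F') :
    ∃ _ : ChartedSpace F' S, ContMDiff 𝓘(ℝ, F') 𝓘(ℝ, F) ∞ e ∧
      ContMDiff 𝓘(ℝ, F) 𝓘(ℝ, F') ∞ e.symm ∧
      (IsManifold 𝓘(ℝ, F) ∞ N → IsManifold 𝓘(ℝ, F') ∞ S) := by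
  let T : OpenPartialHomeomorph N F → OpenPartialHomeomorph S F' := fun φ =>
    (e.transOpenPartialHomeomorph φ).transHomeomorph L.toHomeomorph
  let inst : ChartedSpace F' S :=
    { atlas := T '' atlas F N, chartAt := fun s => T (chartAt F (e s)),
      mem_chart_source := fun s => mem_chart_source F (e s),
      chart_mem_atlas := fun s => ⟨_, chart_mem_atlas F (e s), rfl⟩ }
  refine ⟨inst, ?_, ?_, ?_⟩
  · intro s
    rw [contMDiffAt_iff]
    refine ⟨e.continuous.continuousAt, ?_⟩
    refine ContDiffWithinAt.congr_of_eventuallyEq (f := L.symm)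
      L.symm.contDiff.contDiffWithinAt ?_ ?_
    · simp only [extChartAt, mfld_simps, nhdsWithin_univ]
      have h1 : (chartAt F (e s)).target ∈ 𝓝 (L.symm (L (chartAt F (e s) (e s)))) := by
        rw [L.symm_apply_apply]
        exact chart_target_mem_nhds F (e s)
      filter_upwards [L.symm.continuous.continuousAt h1] with x hx
      change chartAt F (e s) (e (e.symm ((chartAt F (e s)).symm (L.symm x)))) = _
      rw [e.apply_symm_apply, (chartAt F (e s)).right_inv hx]
    · simp only [extChartAt, mfld_simps]
      change _ = L.symm (L (chartAt F (e s) (e s)))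
      rw [L.symm_apply_apply]
  · intro x
    rw [contMDiffAt_iff]
    refine ⟨e.symm.continuous.continuousAt, ?_⟩
    refine ContDiffWithinAt.congr_of_eventuallyEq (f := L)
      L.contDiff.contDiffWithinAt ?_ ?_
    · simp only [extChartAt, mfld_simps, nhdsWithin_univ]
      filter_upwards [chart_target_mem_nhds F x] with y hy
      change L (chartAt F (e (e.symm x)) (e (e.symm ((chartAt F x).symm y)))) = _
      rw [e.apply_symm_apply, e.apply_symm_apply, (chartAt F x).right_inv hy]
    · simp only [extChartAt, mfld_simps]
      change L (chartAt F (e (e.symm x)) (e (e.symm x))) = _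
      rw [e.apply_symm_apply]
  · intro hN
    refine isManifold_of_contDiffOn _ _ _ ?_
    rintro _ _ ⟨φ, hφ, rfl⟩ ⟨ψ, hψ, rfl⟩
    have h1 := (mem_groupoid_of_pregroupoid.1
      (HasGroupoid.compatible (G := contDiffGroupoid ∞ 𝓘(ℝ, F)) hφ hψ)).1
    have h2 : ContDiffOn ℝ ∞ (ψ ∘ φ.symm) (φ.symm ≫ₕ ψ).source := by
      have h1' := h1
      simp only [contDiffPregroupoid, mfld_simps] at h1'
      convert h1' using 1
      ext; simp [mfld_simps]
    have h3 : ContDiffOn ℝ ∞ (L ∘ (ψ ∘ φ.symm) ∘ L.symm) (L.symm ⁻¹' (φ.symm ≫ₕ ψ).source) :=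
      L.contDiff.comp_contDiffOn (h2.comp L.symm.contDiff.contDiffOn fun x hx => hx)
    refine (h3.mono ?_).congr ?_
    · rintro x hx
      simp [T, mfld_simps] at hx ⊢
      exact hx
    · rintro x hx
      simp [T, mfld_simps]

end transport

/-- A map with a smooth inverse between open sets is a local diffeomorphism. -/
theorem isLocalDiffeomorphOn_of_inverse {𝕜 E₁ H₁ M₁ E₂ H₂ M₂ : Type*} [NontriviallyNormedField 𝕜]
    [NormedAddCommGroup E₁] [NormedSpace 𝕜 E₁] [TopologicalSpace H₁] {I : ModelWithCorners 𝕜 E₁ H₁}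
    [TopologicalSpace M₁] [ChartedSpace H₁ M₁]
    [NormedAddCommGroup E₂] [NormedSpace 𝕜 E₂] [TopologicalSpace H₂] {J : ModelWithCorners 𝕜 E₂ H₂}
    [TopologicalSpace M₂] [ChartedSpace H₂ M₂] {n : WithTop ℕ∞}
    {f : M₁ → M₂} {g : M₂ → M₁} {s : Set M₁} {t : Set M₂} (hs : IsOpen s) (ht : IsOpen t)
    (hf : MapsTo f s t) (hg : MapsTo g t s) (hgf : LeftInvOn g f s) (hfg : RightInvOn g f t)
    (hfs : ContMDiffOn I J n f s) (hgs : ContMDiffOn J I n g t) :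
    IsLocalDiffeomorphOn I J n f s := fun x =>
  ⟨{ toFun := f, invFun := g, source := s, target := t, map_source' := hf, map_target' := hg,
     left_inv' := hgf, right_inv' := hfg, open_source := hs, open_target := ht,
     contMDiffOn_toFun := hfs, contMDiffOn_invFun := hgs }, x.2, fun _ _ => rfl⟩

/-! ### The tangent sphere as a stratified space -/

namespace Sus

variable {D : ℕ} {Z : StratSpace.{u}}

/-- The dimension of the stratum of a point of the tangent sphere. -/
def dim (s : Sus D Z.carrier) : ℕ :=
  match s.1.2 with
  | none => D - 1
  | some p => D + Z.dim p.2

theorem dim_emb (p : E D × Z.carrier) : dim (emb p) = D + Z.dim p.2 := by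
  have h : (emb p).1.2 = some (⟨(√(1 + ‖p.1‖ ^ 2))⁻¹, inv_pos.2 (sqrt_pos _)⟩, p.2) :=
    Cone.pt_of_pos (inv_pos.2 (sqrt_pos _)) _
  unfold dim
  rw [h]

theorem dim_tipPt (e : E D) (he : ‖e‖ = 1) : dim (tipPt e he : Sus D Z.carrier) = D - 1 := rfl

theorem pos_of_norm_eq_one {e : E D} (he : ‖e‖ = 1) : 0 < D := by
  rcases Nat.eq_zero_or_pos D with h | h
  · subst h
    rw [Subsingleton.elim e 0, norm_zero] at he
    exact absurd he zero_ne_one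
  · exact h

theorem r_pos_of_dim {s : Sus D Z.carrier} (h : D ≤ dim s) : 0 < s.r := by
  refine lt_of_le_of_ne s.r_nonneg fun h0 => ?_
  obtain ⟨h1, h2⟩ := eq_of_r_zero h0.symm
  rw [h2, dim_tipPt] at h
  have := pos_of_norm_eq_one h1
  omega

theorem r_eq_zero_of_dim {s : Sus D Z.carrier} (h : dim s < D) : s.r = 0 := by
  by_contra h0
  obtain ⟨z, -, hz⟩ := emb_surj (lt_of_le_of_ne s.r_nonneg (Ne.symm h0))
  rw [← hz, dim_emb] at h
  omega

/-- The parametrization `(w, z) ↦ [w : 1 : z]` of a stratum. -/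
def embS {j i : ℕ} (h : D + j = i) (p : E D × Z.Stratum j) : {s : Sus D Z.carrier // dim s = i} :=
  ⟨emb (p.1, p.2.1), by rw [dim_emb, p.2.2, h]⟩

theorem isEmbedding_embS {j i : ℕ} (h : D + j = i) :
    IsEmbedding (embS h : E D × Z.Stratum j → {s : Sus D Z.carrier // dim s = i}) := by
  refine IsEmbedding.of_comp (f := embS h) (g := Subtype.val) ?_ continuous_subtype_val ?_
  · refine Continuous.subtype_mk (continuous_emb.comp ?_) _
    fun_prop
  · exact isOpenEmbedding_emb.isEmbedding.comp
      (IsEmbedding.id.prodMap IsEmbedding.subtypeVal)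

theorem surjective_embS {j i : ℕ} (h : D + j = i) :
    Function.Surjective (embS h : E D × Z.Stratum j → {s : Sus D Z.carrier // dim s = i}) := by
  rintro ⟨s, hs⟩
  obtain ⟨z, -, hz⟩ := emb_surj (r_pos_of_dim (s := s) (by omega))
  refine ⟨(s.r⁻¹ • s.v, ⟨z, ?_⟩), Subtype.ext hz⟩
  have := dim_emb (s.r⁻¹ • s.v, z)
  rw [hz, hs] at this
  simp only at this
  omega

/-- The coordinates `(w, z)` on a stratum. -/
def offHomeo {j i : ℕ} (h : D + j = i) :
    {s : Sus D Z.carrier // dim s = i} ≃ₜ E D × Z.Stratum j :=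
  ((isEmbedding_embS h).toHomeomorphOfSurjective (surjective_embS h)).symm

/-- The sphere of unit vectors as a stratum. -/
def sphereHomeo {i : ℕ} (h : i + 1 = D) :
    {s : Sus D Z.carrier // dim s = i} ≃ₜ Metric.sphere (0 : E D) 1 where
  toFun s := ⟨s.1.v, by
    have := (eq_of_r_zero (r_eq_zero_of_dim (s := s.1) (by have := s.2; omega))).1
    simpa using this⟩
  invFun e := ⟨tipPt e.1 (by simp), by rw [dim_tipPt]; omega⟩
  left_inv s := Subtype.ext
    (eq_of_r_zero (r_eq_zero_of_dim (s := s.1) (by have := s.2; omega))).2.symm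
  right_inv _ := rfl
  continuous_toFun := by
    refine Continuous.subtype_mk (continuous_v.comp continuous_subtype_val) _
  continuous_invFun := by
    refine Continuous.subtype_mk (Continuous.subtype_mk ?_ _) _
    fun_prop

theorem exists_unit {i : ℕ} (h : i + 1 = D) : ∃ e : E D, ‖e‖ = 1 := by
  have : Nonempty (Fin D) := ⟨⟨0, by omega⟩⟩
  exact exists_norm_eq (E D) zero_le_one

/-- The point of the tangent sphere in the direction of a non-zero vector `u`. -/
def dir {i : ℕ} (h : i + 1 = D) (u : E D) : {s : Sus D Z.carrier // dim s = i} :=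
  if hu : u = 0 then ⟨tipPt (exists_unit h).choose (exists_unit h).choose_spec, by
      rw [dim_tipPt]; omega⟩
  else ⟨tipPt (‖u‖⁻¹ • u) (norm_smul_inv_norm (𝕜 := ℝ) hu), by rw [dim_tipPt]; omega⟩

theorem dir_val {i : ℕ} (h : i + 1 = D) {u : E D} (hu : u ≠ 0) :
    (dir (Z := Z) h u).1 = tipPt (‖u‖⁻¹ • u) (norm_smul_inv_norm (𝕜 := ℝ) hu) := by
  unfold dir
  rw [dif_neg hu]

theorem exists_charted (D : ℕ) (Z : StratSpace.{u}) (i : ℕ) :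
    ∃ _ : ChartedSpace (E i) {s : Sus D Z.carrier // dim s = i},
      (∀ {j : ℕ} (h : D + j = i),
        ContMDiff 𝓘(ℝ, E i) (𝓘(ℝ, E D).prod 𝓘(ℝ, E j)) ∞ (offHomeo (Z := Z) h) ∧
        ContMDiff (𝓘(ℝ, E D).prod 𝓘(ℝ, E j)) 𝓘(ℝ, E i) ∞ (embS (Z := Z) h)) ∧
      (∀ h : i + 1 = D,
        ContMDiff 𝓘(ℝ, E i) 𝓘(ℝ, E D) ∞
          (fun s : {s : Sus D Z.carrier // dim s = i} => s.1.v) ∧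
        ContMDiffOn 𝓘(ℝ, E D) 𝓘(ℝ, E i) ∞ (dir (Z := Z) h) {0}ᶜ) ∧
      ((∀ j, IsManifold 𝓘(ℝ, E j) ∞ (Z.Stratum j)) →
        IsManifold 𝓘(ℝ, E i) ∞ {s : Sus D Z.carrier // dim s = i}) := by
  rcases lt_trichotomy (i + 1) D with hi | rfl | hi
  · have : IsEmpty {s : Sus D Z.carrier // dim s = i} := ⟨fun s => by
      have h1 := s.2
      have h2 := (eq_of_r_zero (r_eq_zero_of_dim (s := s.1) (by omega))).2
      rw [h2, dim_tipPt] at h1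
      omega⟩
    let I : ChartedSpace (E i) {s : Sus D Z.carrier // dim s = i} := ChartedSpace.empty _ _
    exact ⟨I, fun h => by omega, fun h => by omega, fun _ => inferInstance⟩
  · have h0 : i + 1 = i + 1 := rfl
    have : Fact (Module.finrank ℝ (E (i + 1)) = i + 1) := ⟨by simp⟩
    obtain ⟨I, h1, h2, h3⟩ := exists_transport (sphereHomeo (Z := Z) h0)
      (ContinuousLinearEquiv.refl ℝ (E i))
    refine ⟨I, fun h => by omega, fun h => ⟨?_, ?_⟩, fun _ => h3 inferInstance⟩
    · exact contMDiff_coe_sphere.comp h1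
    · intro u hu
      refine ContMDiffAt.contMDiffWithinAt ?_
      let U : TopologicalSpace.Opens (E (i + 1)) := ⟨{0}ᶜ, isOpen_compl_singleton⟩
      suffices hU : ContMDiff 𝓘(ℝ, E (i + 1)) 𝓘(ℝ, E i) ∞ fun x : U => dir (Z := Z) h x from
        contMDiffAt_subtype_iff.1 (hU ⟨u, hu⟩)
      have hf : ContMDiff 𝓘(ℝ, E (i + 1)) 𝓘(ℝ, E (i + 1)) ∞
          fun x : U => ‖(x : E (i + 1))‖⁻¹ • (x : E (i + 1)) := by
        intro x
        refine (contMDiffAt_subtype_iff (f := fun x : E (i + 1) => ‖x‖⁻¹ • x)).2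
          (ContDiffAt.contMDiffAt ?_)
        have hx : (x : E (i + 1)) ≠ 0 := x.2
        exact ((contDiffAt_norm ℝ hx).inv (norm_ne_zero_iff.2 hx)).smul contDiffAt_id
      have hs : ∀ x : U, ‖(x : E (i + 1))‖⁻¹ • (x : E (i + 1)) ∈ Metric.sphere (0 : E (i + 1)) 1 :=
        fun x => by
          have hx : (x : E (i + 1)) ≠ 0 := x.2
          simpa using norm_smul_inv_norm (𝕜 := ℝ) hx
      have := h2.comp (hf.codRestrict_sphere hs)
      refine this.congr fun x => ?_
      have hx : (x : E (i + 1)) ≠ 0 := x.2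
      refine Subtype.ext ?_
      rw [dir_val h hx]; rfl
  · obtain ⟨j, hj⟩ : ∃ j, D + j = i := ⟨i - D, by omega⟩
    have hr : Module.finrank ℝ (E D × E j) = Module.finrank ℝ (E i) := by simp [hj]
    let : ChartedSpace (E D × E j) (E D × Z.Stratum j) :=
      inferInstanceAs (ChartedSpace (ModelProd (E D) (E j)) (E D × Z.Stratum j))
    obtain ⟨I, h1, h2, h3⟩ := exists_transport (offHomeo (Z := Z) hj)
      (ContinuousLinearEquiv.ofFinrankEq hr)
    rw [modelWithCornersSelf_prod] at h1 h2 h3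
    refine ⟨I, fun {j'} h => ?_, fun h => by omega, fun hZ => ?_⟩
    · obtain rfl : j' = j := by omega
      exact ⟨h1, h2⟩
    · have := hZ j
      exact h3 (inferInstanceAs (IsManifold (𝓘(ℝ, E D).prod 𝓘(ℝ, E j)) ∞ (E D × Z.Stratum j)))

end Sus

/-- The tangent sphere `{|v|² + r² = 1} ⊆ ℝᵈ × C(Z)` as a stratified space; `n` is the dimension
that it is given (see `IsSuspDim`). -/
def Susp (D : ℕ) (Z : StratSpace.{u}) (n : ℕ) : StratSpace.{u} where
  carrier := Sus D Z.carrier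
  n := n
  dim := Sus.dim
  charted i := (Sus.exists_charted D Z i).choose

namespace Susp

variable {D : ℕ} {Z : StratSpace.{u}} {n : ℕ}

/-- The linear component, on a stratum. -/
def v {i : ℕ} (s : (Susp D Z n).Stratum i) : E D := Sus.v (Z := Z.carrier) s.1

/-- The radial component, on a stratum. -/
def r {i : ℕ} (s : (Susp D Z n).Stratum i) : ℝ := Sus.r (Z := Z.carrier) s.1

/-- The component in `Z`, on a stratum. -/
def z {j i : ℕ} (h : D + j = i) (s : (Susp D Z n).Stratum i) : Z.Stratum j :=
  (Sus.offHomeo h s).2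

/-- The parametrization `(w, z) ↦ [w : 1 : z]` of a stratum. -/
def mk {j i : ℕ} (h : D + j = i) (p : E D × Z.Stratum j) : (Susp D Z n).Stratum i :=
  Sus.embS h p

/-- The point in the direction of a non-zero vector. -/
def dir {i : ℕ} (h : i + 1 = D) (u : E D) : (Susp D Z n).Stratum i := Sus.dir h u

theorem v_r {i : ℕ} (s : (Susp D Z n).Stratum i) : ‖v s‖ ^ 2 + r s ^ 2 = 1 := Sus.v_r _

theorem v_mk {j i : ℕ} (h : D + j = i) (p : E D × Z.Stratum j) :
    v (mk (n := n) h p) = (√(1 + ‖p.1‖ ^ 2))⁻¹ • p.1 := rfl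

theorem r_mk {j i : ℕ} (h : D + j = i) (p : E D × Z.Stratum j) :
    r (mk (n := n) h p) = (√(1 + ‖p.1‖ ^ 2))⁻¹ := Sus.emb_r _

theorem z_mk {j i : ℕ} (h : D + j = i) (p : E D × Z.Stratum j) : z h (mk (n := n) h p) = p.2 :=
  congrArg Prod.snd ((Sus.offHomeo h).apply_symm_apply p)

theorem r_pos {j i : ℕ} (h : D + j = i) (s : (Susp D Z n).Stratum i) : 0 < r s :=
  Sus.r_pos_of_dim (by have : Sus.dim s.1 = i := s.2; omega)

theorem mk_offHomeo {j i : ℕ} (h : D + j = i) (s : (Susp D Z n).Stratum i) :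
    mk h (Sus.offHomeo h s) = s := (Sus.offHomeo h).symm_apply_apply s

theorem mk_v_r_z {j i : ℕ} (h : D + j = i) (s : (Susp D Z n).Stratum i) :
    mk h ((r s)⁻¹ • v s, z h s) = s := by
  have h1 := mk_offHomeo h s
  conv_rhs => rw [← h1]
  refine congrArg (mk h) (Prod.ext ?_ rfl)
  rw [← h1, v_mk, r_mk, inv_inv, smul_inv_smul₀ (Sus.sqrt_pos _).ne', h1]

theorem val_eq {j i : ℕ} (h : D + j = i) (s : (Susp D Z n).Stratum i) :
    (s.1 : Sus D Z.carrier).1 = (v s, Cone.pt (r s) (z h s).1) := by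
  have h1 := mk_v_r_z h s
  refine Prod.ext rfl ?_
  obtain ⟨z', h2, h3⟩ := Sus.emb_surj (s := s.1) (r_pos h s)
  have h4 : (mk (n := n) h ((r s)⁻¹ • v s, z h s)).1 = s.1 := congrArg Subtype.val h1
  have h5 := Sus.emb_injective (h3.trans h4.symm)
  have h6 : z' = (z h s).1 := congrArg Prod.snd h5
  rw [← h6]; exact h2

theorem r_zero {i : ℕ} (h : i + 1 = D) (s : (Susp D Z n).Stratum i) : r s = 0 :=
  Sus.r_eq_zero_of_dim (by have : Sus.dim s.1 = i := s.2; omega)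

theorem norm_v {i : ℕ} (h : i + 1 = D) (s : (Susp D Z n).Stratum i) : ‖v s‖ = 1 :=
  (Sus.eq_of_r_zero (r_zero h s)).1

theorem val_eq_vertex {i : ℕ} (h : i + 1 = D) (s : (Susp D Z n).Stratum i) :
    (s.1 : Sus D Z.carrier).1 = (v s, Cone.vertex) :=
  congrArg Subtype.val (Sus.eq_of_r_zero (r_zero h s)).2

theorem v_dir {i : ℕ} (h : i + 1 = D) {u : E D} (hu : u ≠ 0) :
    v (dir (Z := Z) (n := n) h u) = ‖u‖⁻¹ • u := by
  unfold v dir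
  rw [Sus.dir_val h hu]; rfl

theorem dir_v {i : ℕ} (h : i + 1 = D) (s : (Susp D Z n).Stratum i) {t : ℝ} (ht : 0 < t) :
    dir h (t • v s) = s := by
  have h1 := norm_v h s
  have h0 : v s ≠ 0 := fun h0 => by rw [h0, norm_zero] at h1; exact zero_ne_one h1
  refine Subtype.ext (Subtype.ext ?_)
  rw [val_eq_vertex h, val_eq_vertex h, v_dir h (smul_ne_zero ht.ne' h0), norm_smul, h1, mul_one,
    Real.norm_of_nonneg ht.le, inv_smul_smul₀ ht.ne']

theorem dim_cases {i : ℕ} (s : (Susp D Z n).Stratum i) : i + 1 = D ∨ ∃ j, D + j = i := by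
  rcases Nat.lt_or_ge i D with h | h
  · have hs : Sus.dim s.1 = i := s.2
    have h2 := (Sus.eq_of_r_zero (Sus.r_eq_zero_of_dim (s := s.1) (by omega))).2
    have hp := Sus.pos_of_norm_eq_one
      (Sus.eq_of_r_zero (Sus.r_eq_zero_of_dim (s := s.1) (by omega))).1
    rw [h2, Sus.dim_tipPt] at hs
    exact Or.inl (by omega)
  · exact Or.inr ⟨i - D, by omega⟩

theorem contMDiff_mk {j i : ℕ} (h : D + j = i) :
    ContMDiff (𝓘(ℝ, E D).prod 𝓘(ℝ, E j)) 𝓘(ℝ, E i) ∞ (mk (Z := Z) (n := n) h) :=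
  ((Sus.exists_charted D Z i).choose_spec.1 h).2

theorem contMDiff_offHomeo {j i : ℕ} (h : D + j = i) :
    ContMDiff 𝓘(ℝ, E i) (𝓘(ℝ, E D).prod 𝓘(ℝ, E j)) ∞
      (fun s : (Susp D Z n).Stratum i => Sus.offHomeo h s) :=
  ((Sus.exists_charted D Z i).choose_spec.1 h).1

theorem contMDiff_z {j i : ℕ} (h : D + j = i) :
    ContMDiff 𝓘(ℝ, E i) 𝓘(ℝ, E j) ∞ (z (Z := Z) (n := n) h) :=
  contMDiff_snd.comp (contMDiff_offHomeo h)

theorem contMDiffOn_dir {i : ℕ} (h : i + 1 = D) :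
    ContMDiffOn 𝓘(ℝ, E D) 𝓘(ℝ, E i) ∞ (dir (Z := Z) (n := n) h) {0}ᶜ :=
  ((Sus.exists_charted D Z i).choose_spec.2.1 h).2

theorem contDiff_inv_sqrt {F : Type*} [NormedAddCommGroup F] [InnerProductSpace ℝ F] :
    ContDiff ℝ ∞ fun w : F => (√(1 + ‖w‖ ^ 2))⁻¹ :=
  ((contDiff_const.add (contDiff_norm_sq ℝ)).sqrt fun w => (by positivity)).inv fun w =>
    (Real.sqrt_pos.2 (by positivity)).ne'

theorem contMDiff_v {i : ℕ} : ContMDiff 𝓘(ℝ, E i) 𝓘(ℝ, E D) ∞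
    (v : (Susp D Z n).Stratum i → E D) := by
  intro s
  rcases dim_cases s with h | ⟨j, h⟩
  · exact ((Sus.exists_charted D Z i).choose_spec.2.1 h).1 s
  · have h1 : ContMDiff 𝓘(ℝ, E i) 𝓘(ℝ, E D) ∞
        (fun s : (Susp D Z n).Stratum i => (Sus.offHomeo h s).1) :=
      contMDiff_fst.comp (contMDiff_offHomeo h)
    have h2 : ContDiff ℝ ∞ fun w : E D => (√(1 + ‖w‖ ^ 2))⁻¹ • w :=
      contDiff_inv_sqrt.smul contDiff_id
    refine (h2.contMDiff.comp h1).congr (fun s => ?_) s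
    conv_lhs => rw [← mk_offHomeo h s]
    rfl

theorem contMDiff_r {i : ℕ} : ContMDiff 𝓘(ℝ, E i) 𝓘(ℝ, ℝ) ∞
    (r : (Susp D Z n).Stratum i → ℝ) := by
  intro s
  rcases dim_cases s with h | ⟨j, h⟩
  · exact (contMDiff_const (c := (0 : ℝ))).congr (fun s => r_zero h s) s
  · have h1 : ContMDiff 𝓘(ℝ, E i) 𝓘(ℝ, E D) ∞
        (fun s : (Susp D Z n).Stratum i => (Sus.offHomeo h s).1) :=
      contMDiff_fst.comp (contMDiff_offHomeo h)
    refine (contDiff_inv_sqrt.contMDiff.comp h1).congr (fun s => ?_) s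
    conv_lhs => rw [← mk_offHomeo h s]
    exact r_mk h _

theorem isManifold (hZ : ∀ j, IsManifold 𝓘(ℝ, E j) ∞ (Z.Stratum j)) (i : ℕ) :
    IsManifold 𝓘(ℝ, E i) ∞ ((Susp D Z n).Stratum i) :=
  (Sus.exists_charted D Z i).choose_spec.2.2 hZ

end Susp

/-! ### Product charts -/

theorem isLocalDiffeomorphAt_id_prodMap {𝕜 E₀ H₀ M₀ E₁ H₁ M₁ E₂ H₂ M₂ : Type*}
    [NontriviallyNormedField 𝕜]
    [NormedAddCommGroup E₀] [NormedSpace 𝕜 E₀] [TopologicalSpace H₀] {I₀ : ModelWithCorners 𝕜 E₀ H₀}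
    [TopologicalSpace M₀] [ChartedSpace H₀ M₀]
    [NormedAddCommGroup E₁] [NormedSpace 𝕜 E₁] [TopologicalSpace H₁] {I : ModelWithCorners 𝕜 E₁ H₁}
    [TopologicalSpace M₁] [ChartedSpace H₁ M₁]
    [NormedAddCommGroup E₂] [NormedSpace 𝕜 E₂] [TopologicalSpace H₂] {J : ModelWithCorners 𝕜 E₂ H₂}
    [TopologicalSpace M₂] [ChartedSpace H₂ M₂] {n : WithTop ℕ∞}
    {f : M₁ → M₂} {x : M₁} (hf : IsLocalDiffeomorphAt I J n f x) (b : M₀) :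
    IsLocalDiffeomorphAt (I₀.prod I) (I₀.prod J) n (Prod.map id f) (b, x) := by
  obtain ⟨φ, hx, h⟩ := hf
  refine ⟨{ (PartialEquiv.refl M₀).prod φ.toPartialEquiv with
    open_source := isOpen_univ.prod φ.open_source
    open_target := isOpen_univ.prod φ.open_target
    contMDiffOn_toFun := contMDiffOn_id.prodMap φ.contMDiffOn_toFun
    contMDiffOn_invFun := contMDiffOn_id.prodMap φ.contMDiffOn_invFun }, ⟨mem_univ _, hx⟩, ?_⟩
  rintro ⟨a, y⟩ ⟨-, hy⟩
  exact Prod.ext rfl (h hy)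

/-- An open embedding `P × X → M`, with `P ⊆ V` open, that maps strata diffeomorphically to
strata. -/
structure ProdChart (M X : StratSpace.{u}) (V : Type) [NormedAddCommGroup V] [NormedSpace ℝ V] where
  P : Set V
  isOpen_P : IsOpen P
  e : OpenPartialHomeomorph (V × X.carrier) M.carrier
  source_eq : e.source = P ×ˢ univ
  param : ∀ {j i : ℕ}, Module.finrank ℝ V + j = i → V × X.Stratum j → M.Stratum i
  param_eq : ∀ {j i : ℕ} (h : Module.finrank ℝ V + j = i), ∀ b ∈ P, ∀ x : X.Stratum j,
    (param h (b, x)).1 = e (b, x.1)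
  param_diffeo : ∀ {j i : ℕ} (h : Module.finrank ℝ V + j = i),
    IsLocalDiffeomorphOn (𝓘(ℝ, V).prod 𝓘(ℝ, E j)) 𝓘(ℝ, E i) ∞ (param h) {p | p.1 ∈ P}

section

variable {M X Z : StratSpace.{u}} {V : Type} [NormedAddCommGroup V] [NormedSpace ℝ V]

/-- The dilation by a positive factor, as a homeomorphism. -/
def Cone.dilHomeo {Y : Type u} [TopologicalSpace Y] (μ : ℝ) (hμ : 0 < μ) : Cone Y ≃ₜ Cone Y where
  toFun := Cone.dil μ
  invFun := Cone.dil μ⁻¹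
  left_inv c := by rw [Cone.dil_dil (inv_nonneg.2 hμ.le), inv_mul_cancel₀ hμ.ne', Cone.dil_one]
  right_inv c := by rw [Cone.dil_dil hμ.le, mul_inv_cancel₀ hμ.ne', Cone.dil_one]
  continuous_toFun := Cone.continuous_dil.comp (continuous_const.prodMk continuous_id)
  continuous_invFun := Cone.continuous_dil.comp (continuous_const.prodMk continuous_id)

/-- The affine coordinates of a composed chart. -/
def affHomeo {d D : ℕ} (Y : Type u) [TopologicalSpace Y] (T : E D ≃L[ℝ] V × E d) (o : V × E d)
    (μ : ℝ) (hμ : 0 < μ) : E D × Cone Y ≃ₜ V × (E d × Cone Y) :=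
  ((T.toHomeomorph.trans (Homeomorph.addLeft o)).prodCongr (Cone.dilHomeo μ hμ)).trans
    (Homeomorph.prodAssoc _ _ _)

/-- The affine coordinates of a composed chart, on a stratum. -/
def affMap {d D : ℕ} {S : Type u} (T : E D ≃L[ℝ] V × E d) (o : V × E d) (μ : ℝ)
    (p : E D × (ℝ × S)) : V × (E d × (ℝ × S)) :=
  ((o + T p.1).1, ((o + T p.1).2, (μ * p.2.1, p.2.2)))

theorem affMap_diffeo {d D j : ℕ} {S : Type u} [TopologicalSpace S] [ChartedSpace (E j) S]
    (T : E D ≃L[ℝ] V × E d) (o : V × E d) {μ : ℝ} (hμ : 0 < μ) :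
    IsLocalDiffeomorphOn (𝓘(ℝ, E D).prod (𝓘(ℝ, ℝ).prod 𝓘(ℝ, E j)))
      (𝓘(ℝ, V).prod (𝓘(ℝ, E d).prod (𝓘(ℝ, ℝ).prod 𝓘(ℝ, E j)))) ∞
      (affMap (S := S) T o μ) univ := by
  refine isLocalDiffeomorphOn_of_inverse (t := univ)
    (g := fun p => (T.symm ((p.1, p.2.1) - o), (μ⁻¹ * p.2.2.1, p.2.2.2)))
    isOpen_univ isOpen_univ (mapsTo_univ _ _) (mapsTo_univ _ _) ?_ ?_ ?_ ?_
  · rintro ⟨e, r, z⟩ -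
    simp only [affMap, Prod.mk.eta, add_sub_cancel_left, T.symm_apply_apply,
      inv_mul_cancel_left₀ hμ.ne']
  · rintro ⟨b, y, r, z⟩ -
    simp only [affMap, T.apply_symm_apply, add_sub_cancel, mul_inv_cancel_left₀ hμ.ne']
  · have h1 : ContDiff ℝ ∞ fun e : E D => (o + T e).1 :=
      contDiff_fst.comp (contDiff_const.add T.contDiff)
    have h2 : ContDiff ℝ ∞ fun e : E D => (o + T e).2 :=
      contDiff_snd.comp (contDiff_const.add T.contDiff)
    have h3 : ContDiff ℝ ∞ fun r : ℝ => μ * r := contDiff_const.mul contDiff_id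
    exact ((h1.contMDiff.comp contMDiff_fst).prodMk ((h2.contMDiff.comp contMDiff_fst).prodMk
      ((h3.contMDiff.comp (contMDiff_fst.comp contMDiff_snd)).prodMk
        (contMDiff_snd.comp contMDiff_snd)))).contMDiffOn
  · have h1 : ContDiff ℝ ∞ fun e : V × E d => T.symm (e - o) :=
      T.symm.contDiff.comp (contDiff_id.sub contDiff_const)
    have h3 : ContDiff ℝ ∞ fun r : ℝ => μ⁻¹ * r := contDiff_const.mul contDiff_id
    have h4 : ContMDiff (𝓘(ℝ, V).prod (𝓘(ℝ, E d).prod (𝓘(ℝ, ℝ).prod 𝓘(ℝ, E j)))) 𝓘(ℝ, V × E d) ∞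
        (fun p : V × (E d × (ℝ × S)) => (p.1, p.2.1)) :=
      contMDiff_fst.prodMk_space (contMDiff_fst.comp contMDiff_snd)
    exact ((h1.contMDiff.comp h4).prodMk
      ((h3.contMDiff.comp (contMDiff_fst.comp (contMDiff_snd.comp contMDiff_snd))).prodMk
        (contMDiff_snd.comp (contMDiff_snd.comp contMDiff_snd)))).contMDiffOn

theorem affTip_diffeo {d D : ℕ} (T : E D ≃L[ℝ] V × E d) (o : V × E d) :
    IsLocalDiffeomorphOn 𝓘(ℝ, E D) (𝓘(ℝ, V).prod 𝓘(ℝ, E d)) ∞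
      (fun e => ((o + T e).1, (o + T e).2)) univ := by
  refine isLocalDiffeomorphOn_of_inverse (t := univ) (g := fun p => T.symm (p - o))
    isOpen_univ isOpen_univ (mapsTo_univ _ _) (mapsTo_univ _ _) ?_ ?_ ?_ ?_
  · intro e _
    simp only [Prod.mk.eta, add_sub_cancel_left, T.symm_apply_apply]
  · intro p _
    simp
  · have h1 : ContDiff ℝ ∞ fun e : E D => (o + T e).1 :=
      contDiff_fst.comp (contDiff_const.add T.contDiff)
    have h2 : ContDiff ℝ ∞ fun e : E D => (o + T e).2 :=
      contDiff_snd.comp (contDiff_const.add T.contDiff)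
    exact (h1.contMDiff.prodMk h2.contMDiff).contMDiffOn
  · have h1 : ContDiff ℝ ∞ fun e : V × E d => T.symm (e - o) :=
      T.symm.contDiff.comp (contDiff_id.sub contDiff_const)
    have h4 : ContMDiff (𝓘(ℝ, V).prod 𝓘(ℝ, E d)) 𝓘(ℝ, V × E d) ∞
        (fun p : V × E d => (p.1, p.2)) :=
      contMDiff_fst.prodMk_space contMDiff_snd
    exact (h1.contMDiff.comp h4).contMDiffOn

/-- The data of a chart of `M` composed of a product chart `P × X → M` and a chart of `X`. -/
structure ComposeData (Ψ : ProdChart M X V) (c : EdgeChart X Z) where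
  D : ℕ
  T : E D ≃L[ℝ] V × E c.d
  o : V × E c.d
  μ : ℝ
  μ_pos : 0 < μ
  B : Set (E D)
  isOpen_B : IsOpen B
  nonempty_B : B.Nonempty
  bounded_B : Bornology.IsBounded B
  mem_B : ∀ e ∈ B, (o + T e).1 ∈ Ψ.P ∧ (o + T e).2 ∈ c.U
  R : ℝ
  R_pos : 0 < R
  R_le : μ * R ≤ c.R

namespace ComposeData

variable {Ψ : ProdChart M X V} {c : EdgeChart X Z} (δ : ComposeData Ψ c)

theorem D_eq : δ.D = Module.finrank ℝ V + c.d := by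
  have h2 : FiniteDimensional ℝ (V × E c.d) := δ.T.toLinearEquiv.finiteDimensional
  have h3 : FiniteDimensional ℝ V := FiniteDimensional.of_surjective
    (LinearMap.fst ℝ V (E c.d)) LinearMap.fst_surjective
  have := δ.T.toLinearEquiv.finrank_eq
  simpa using this

/-- The inverse of the composed chart. -/
def inv : OpenPartialHomeomorph (E δ.D × Cone Z.carrier) M.carrier :=
  ((affHomeo Z.carrier δ.T δ.o δ.μ δ.μ_pos).toOpenPartialHomeomorph ≫ₕ
    (((OpenPartialHomeomorph.refl V).prod c.φ.symm) ≫ₕ Ψ.e)).restrOpen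
    (δ.B ×ˢ {c | c.radius < δ.R}) (δ.isOpen_B.prod (Cone.isOpen_radius_lt _))

theorem inv_apply (p : E δ.D × Cone Z.carrier) : δ.inv p =
    Ψ.e ((δ.o + δ.T p.1).1, c.φ.symm ((δ.o + δ.T p.1).2, Cone.dil δ.μ p.2)) := rfl

theorem mem_target {p : E δ.D × Cone Z.carrier} (h1 : p.1 ∈ δ.B) (h2 : p.2.radius < δ.R) :
    ((δ.o + δ.T p.1).2, Cone.dil δ.μ p.2) ∈ c.φ.target := by
  refine c.mem_target.2 ⟨(δ.mem_B _ h1).2, ?_⟩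
  rw [Cone.radius_dil δ.μ_pos.le]
  exact (mul_lt_mul_of_pos_left h2 δ.μ_pos).trans_le δ.R_le

theorem inv_source : δ.inv.source = {p | p.1 ∈ δ.B ∧ p.2.radius < δ.R} := by
  ext p
  constructor
  · exact fun h => h.2
  · rintro ⟨h1, h2⟩
    refine ⟨⟨mem_univ _, ⟨mem_univ _, δ.mem_target h1 h2⟩, ?_⟩, h1, h2⟩
    rw [mem_preimage, Ψ.source_eq]
    exact ⟨(δ.mem_B _ h1).1, mem_univ _⟩

theorem mem_Ioo {r : ℝ} (hr : r ∈ Ioo 0 δ.R) : δ.μ * r ∈ Ioo 0 c.R :=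
  ⟨mul_pos δ.μ_pos hr.1, (mul_lt_mul_of_pos_left hr.2 δ.μ_pos).trans_le δ.R_le⟩

/-- The composed chart of `M`. -/
abbrev chart : EdgeChart M Z where
  d := δ.D
  U := δ.B
  isOpen_U := δ.isOpen_B
  nonempty_U := δ.nonempty_B
  bounded_U := δ.bounded_B
  R := δ.R
  R_pos := δ.R_pos
  φ := δ.inv.symm
  target_eq := δ.inv_source
  param {j i} h p := Ψ.param (j := c.d + 1 + j) (by have := δ.D_eq; omega)
    (Prod.map id (c.param rfl) (affMap δ.T δ.o δ.μ p))
  param_eq {j i} h y hy r hr z := by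
    have h1 := δ.mem_B y hy
    simp only [affMap, Prod.map, id]
    rw [Ψ.param_eq _ _ h1.1, c.param_eq rfl _ h1.2 _ (δ.mem_Ioo hr)]
    change _ = δ.inv _
    rw [δ.inv_apply, Cone.dil_pt δ.μ_pos.le]
  param_diffeo {j i} h := fun ⟨⟨y, r, z⟩, hy, hr⟩ => by
    have h1 := δ.mem_B y hy
    have h2 := isLocalDiffeomorphAt_id_prodMap (I₀ := 𝓘(ℝ, V)) (c.param_diffeo (j := j) rfl
      ⟨((δ.o + δ.T y).2, (δ.μ * r, z)), h1.2, δ.mem_Ioo hr⟩) (δ.o + δ.T y).1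
    have h3 := (affMap_diffeo (S := Z.Stratum j) (j := j) δ.T δ.o δ.μ_pos) ⟨(y, (r, z)), mem_univ _⟩
    exact (h3.comp _ _ h2).comp _ _ (Ψ.param_diffeo _ ⟨(_, _), h1.1⟩)
  tip {i} h e := Ψ.param (j := c.d) (by have := δ.D_eq; omega)
    (Prod.map id (c.tip rfl) ((δ.o + δ.T e).1, (δ.o + δ.T e).2))
  tip_eq {i} h y hy := by
    have h1 := δ.mem_B y hy
    simp only [Prod.map, id]
    rw [Ψ.param_eq _ _ h1.1, c.tip_eq rfl _ h1.2]
    rfl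
  tip_diffeo {i} h := fun ⟨y, hy⟩ => by
    have h1 := δ.mem_B y hy
    have h2 := isLocalDiffeomorphAt_id_prodMap (I₀ := 𝓘(ℝ, V)) (c.tip_diffeo rfl
      ⟨(δ.o + δ.T y).2, h1.2⟩) (δ.o + δ.T y).1
    have h3 := (affTip_diffeo δ.T δ.o) ⟨y, mem_univ _⟩
    exact (h3.comp _ _ h2).comp _ _ (Ψ.param_diffeo _ ⟨(_, _), h1.1⟩)

end ComposeData

/-- Polar coordinates on the cone without its vertex. -/
def Cone.ptHomeo (Y : Type u) [TopologicalSpace Y] [Nonempty Y] :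
    OpenPartialHomeomorph (ℝ × Y) (Cone Y) :=
  have : Nonempty (Ioi (0 : ℝ)) := ⟨⟨1, mem_Ioi.2 one_pos⟩⟩
  ((isOpen_Ioi.isOpenEmbedding_subtypeVal.toOpenPartialHomeomorph
    (Subtype.val : Ioi (0 : ℝ) → ℝ)).prod (OpenPartialHomeomorph.refl Y)).symm ≫ₕ
    (Cone.isOpenEmbedding_off.toOpenPartialHomeomorph _)

theorem Cone.ptHomeo_source (Y : Type u) [TopologicalSpace Y] [Nonempty Y] :
    (Cone.ptHomeo Y).source = {p | 0 < p.1} := by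
  ext ⟨r, y⟩
  simp [Cone.ptHomeo]

theorem Cone.ptHomeo_apply (Y : Type u) [TopologicalSpace Y] [Nonempty Y] {r : ℝ} (hr : 0 < r)
    (y : Y) : Cone.ptHomeo Y (r, y) = Cone.pt r y := by
  have : Nonempty (Ioi (0 : ℝ)) := ⟨⟨1, mem_Ioi.2 one_pos⟩⟩
  rw [Cone.pt_of_pos hr]
  change Cone.off (_, y) = _
  have := (isOpen_Ioi.isOpenEmbedding_subtypeVal.toOpenPartialHomeomorph
    (Subtype.val : Ioi (0 : ℝ) → ℝ)).left_inv (x := ⟨r, hr⟩) (mem_univ _)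
  exact congrArg (fun t => Cone.off (t, y)) this

/-- The dilated coordinates about a point. -/
def boxHomeo {d : ℕ} (Y : Type u) [TopologicalSpace Y] (b : V) (y : E d) (r : ℝ) (hr : 0 < r) :
    (V × (E d × ℝ)) × Y ≃ₜ V × (E d × (ℝ × Y)) where
  toFun p := (b + r • p.1.1, (y + r • p.1.2.1, (r * (1 + p.1.2.2), p.2)))
  invFun q := ((r⁻¹ • (q.1 - b), (r⁻¹ • (q.2.1 - y), r⁻¹ * q.2.2.1 - 1)), q.2.2.2)
  left_inv p := by
    simp [inv_smul_smul₀ hr.ne', inv_mul_cancel_left₀ hr.ne']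
  right_inv q := by
    simp [smul_inv_smul₀ hr.ne', mul_inv_cancel_left₀ hr.ne']
  continuous_toFun := by fun_prop
  continuous_invFun := by fun_prop

theorem boxHomeo_diffeo {d j : ℕ} {S : Type u} [TopologicalSpace S] [ChartedSpace (E j) S]
    (b : V) (y : E d) {r : ℝ} (hr : 0 < r) :
    IsLocalDiffeomorphOn (𝓘(ℝ, V × (E d × ℝ)).prod 𝓘(ℝ, E j))
      (𝓘(ℝ, V).prod (𝓘(ℝ, E d).prod (𝓘(ℝ, ℝ).prod 𝓘(ℝ, E j)))) ∞
      (boxHomeo S b y r hr) univ := by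
  refine isLocalDiffeomorphOn_of_inverse (t := univ)
    (g := (boxHomeo S b y r hr).symm)
    isOpen_univ isOpen_univ (mapsTo_univ _ _) (mapsTo_univ _ _)
    (fun p _ => (boxHomeo S b y r hr).symm_apply_apply p)
    (fun p _ => (boxHomeo S b y r hr).apply_symm_apply p) ?_ ?_
  · have h1 : ContDiff ℝ ∞ fun p : V × (E d × ℝ) => b + r • p.1 := by fun_prop
    have h2 : ContDiff ℝ ∞ fun p : V × (E d × ℝ) => y + r • p.2.1 := by fun_prop
    have h3 : ContDiff ℝ ∞ fun p : V × (E d × ℝ) => r * (1 + p.2.2) := by fun_prop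
    exact ((h1.contMDiff.comp contMDiff_fst).prodMk ((h2.contMDiff.comp contMDiff_fst).prodMk
      ((h3.contMDiff.comp contMDiff_fst).prodMk contMDiff_snd))).contMDiffOn
  · have h1 : ContDiff ℝ ∞ fun p : V => r⁻¹ • (p - b) := by fun_prop
    have h2 : ContDiff ℝ ∞ fun p : E d => r⁻¹ • (p - y) := by fun_prop
    have h3 : ContDiff ℝ ∞ fun p : ℝ => r⁻¹ * p - 1 := by fun_prop
    exact (((h1.contMDiff.comp contMDiff_fst).prodMk_space
      ((h2.contMDiff.comp (contMDiff_fst.comp contMDiff_snd)).prodMk_space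
      (h3.contMDiff.comp (contMDiff_fst.comp (contMDiff_snd.comp contMDiff_snd))))).prodMk
      (contMDiff_snd.comp (contMDiff_snd.comp contMDiff_snd))).contMDiffOn

theorem ConeChart.box_radius (c : ConeChart X Z) {Q : Set V} {b : V} {y : E c.d} {r : ℝ}
    (hr : 0 < r) {u : V × (E c.d × ℝ)} (hu : u ∈ c.box Q b y r) : r * (1 + u.2.2) ∈ Ioo 0 c.R := by
  refine ⟨mul_pos hr ?_, hu.2.2.2⟩
  have h1 : |u.2.2| < 1 / 2 := ((norm_snd_le u.2).trans (norm_snd_le u)).trans_lt hu.1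
  have := abs_lt.1 h1
  linarith

theorem ConeChart.isOpen_box (c : ConeChart X Z) {Q : Set V} (hQ : IsOpen Q) (b : V) (y : E c.d)
    (r : ℝ) : IsOpen (c.box Q b y r) := by
  have h1 : IsOpen {u : V × (E c.d × ℝ) | ‖u‖ < 1 / 2} := isOpen_lt continuous_norm continuous_const
  have h2 : IsOpen {u : V × (E c.d × ℝ) | b + r • u.1 ∈ Q} :=
    hQ.preimage (by fun_prop : Continuous fun u : V × (E c.d × ℝ) => b + r • u.1)
  have h3 : IsOpen {u : V × (E c.d × ℝ) | y + r • u.2.1 ∈ c.U} :=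
    c.isOpen_U.preimage (by fun_prop : Continuous fun u : V × (E c.d × ℝ) => y + r • u.2.1)
  have h4 : IsOpen {u : V × (E c.d × ℝ) | r * (1 + u.2.2) < c.R} :=
    isOpen_lt (by fun_prop) continuous_const
  exact h1.inter (h2.inter (h3.inter h4))

/-- The product chart over the box around a point, in dilated coordinates. -/
def ProdChart.step [FiniteDimensional ℝ V] (Ψ : ProdChart M X V) (c : ConeChart X Z)
    [Nonempty Z.carrier] (b : V) (y : E c.d) (r : ℝ) (hr : 0 < r) :
    ProdChart M Z (V × (E c.d × ℝ)) where
  P := c.box Ψ.P b y r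
  isOpen_P := c.isOpen_box Ψ.isOpen_P b y r
  e := (((boxHomeo Z.carrier b y r hr).toOpenPartialHomeomorph ≫ₕ
    ((OpenPartialHomeomorph.refl V).prod (((OpenPartialHomeomorph.refl (E c.d)).prod
      (Cone.ptHomeo Z.carrier)) ≫ₕ c.φ.symm)) ≫ₕ Ψ.e).restr (c.box Ψ.P b y r ×ˢ univ))
  source_eq := by
    rw [OpenPartialHomeomorph.restr_source' _ _ ((c.isOpen_box Ψ.isOpen_P b y r).prod isOpen_univ)]
    refine inter_eq_right.2 ?_
    rintro ⟨u, z⟩ ⟨hu, -⟩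
    have h1 := c.box_radius hr hu
    refine ⟨mem_univ _, ⟨mem_univ _, ⟨mem_univ _, ?_⟩, ?_⟩, ?_⟩
    · rw [Cone.ptHomeo_source]; exact h1.1
    · change (y + r • u.2.1, Cone.ptHomeo Z.carrier (r * (1 + u.2.2), z)) ∈ c.φ.target
      rw [Cone.ptHomeo_apply _ h1.1]
      exact c.mem_target.2 ⟨hu.2.2.1, by rw [Cone.radius_pt h1.1.le]; exact h1.2⟩
    · rw [mem_preimage, Ψ.source_eq]
      exact ⟨hu.2.1, mem_univ _⟩
  param {j i} h p := Ψ.param (j := c.d + 1 + j) (by simp at h; omega)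
    (Prod.map id (c.param rfl) (boxHomeo (Z.Stratum j) b y r hr p))
  param_eq {j i} h u hu x := by
    have h1 := c.box_radius hr hu
    have h2 : (Ψ.param (j := c.d + 1 + j) (i := i) (by simp at h; omega) (b + r • u.1,
        c.param rfl (y + r • u.2.1, (r * (1 + u.2.2), x)))).1 = Ψ.e (b + r • u.1,
        c.φ.symm (y + r • u.2.1, Cone.pt (r * (1 + u.2.2)) x.1)) := by
      rw [Ψ.param_eq _ _ hu.2.1, c.param_eq rfl _ hu.2.2.1 _ h1]
    refine h2.trans ?_
    rw [← Cone.ptHomeo_apply _ h1.1]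
    rfl
  param_diffeo {j i} h := fun ⟨⟨u, z⟩, hu⟩ => by
    have h1 := c.box_radius hr hu
    have h2 := isLocalDiffeomorphAt_id_prodMap (I₀ := 𝓘(ℝ, V)) (c.param_diffeo (j := j) rfl
      ⟨(y + r • u.2.1, (r * (1 + u.2.2), z)), hu.2.2.1, h1⟩) (b + r • u.1)
    have h3 := (boxHomeo_diffeo (S := Z.Stratum j) (j := j) b y hr) ⟨(u, z), mem_univ _⟩
    exact (h3.comp _ _ h2).comp _ _ (Ψ.param_diffeo _ ⟨(_, _), hu.2.1⟩)

end

/-! ### Pull-backs by product charts -/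

theorem mfderiv_comp_prodMap {E₀ H₀ M₀ E₁ H₁ M₁ E₂ H₂ M₂ E₃ H₃ M₃ E₄ H₄ M₄ : Type*}
    [NormedAddCommGroup E₀] [NormedSpace ℝ E₀] [TopologicalSpace H₀] {I₀ : ModelWithCorners ℝ E₀ H₀}
    [TopologicalSpace M₀] [ChartedSpace H₀ M₀]
    [NormedAddCommGroup E₁] [NormedSpace ℝ E₁] [TopologicalSpace H₁] {I₁ : ModelWithCorners ℝ E₁ H₁}
    [TopologicalSpace M₁] [ChartedSpace H₁ M₁]
    [NormedAddCommGroup E₂] [NormedSpace ℝ E₂] [TopologicalSpace H₂] {I₂ : ModelWithCorners ℝ E₂ H₂}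
    [TopologicalSpace M₂] [ChartedSpace H₂ M₂]
    [NormedAddCommGroup E₃] [NormedSpace ℝ E₃] [TopologicalSpace H₃] {I₃ : ModelWithCorners ℝ E₃ H₃}
    [TopologicalSpace M₃] [ChartedSpace H₃ M₃]
    [NormedAddCommGroup E₄] [NormedSpace ℝ E₄] [TopologicalSpace H₄] {I₄ : ModelWithCorners ℝ E₄ H₄}
    [TopologicalSpace M₄] [ChartedSpace H₄ M₄]
    {F : M₀ × M₂ → M₃} {f : M₁ → M₂} {A : M₄ → M₀ × M₁} {p : M₄} {A' : E₄ →L[ℝ] E₀ × E₁}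
    (hA : HasMFDerivAt I₄ (I₀.prod I₁) A p A') (hf : MDifferentiableAt I₁ I₂ f (A p).2)
    (hF : MDifferentiableAt (I₀.prod I₂) I₃ F ((A p).1, f (A p).2)) (w : E₄) :
    (mfderiv I₄ I₃ (fun p => F (Prod.map id f (A p))) p : E₄ →L[ℝ] E₃) w =
      (mfderiv (I₀.prod I₂) I₃ F ((A p).1, f (A p).2) : E₀ × E₂ →L[ℝ] E₃)
        ((A' w).1, (mfderiv I₁ I₂ f (A p).2 : E₁ →L[ℝ] E₂) (A' w).2) := by
  have h0 : HasMFDerivAt I₄ I₀ (fun p => (A p).1) p ((ContinuousLinearMap.fst ℝ E₀ E₁).comp A') :=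
    (hasMFDerivAt_fst (I := I₀) (I' := I₁) (A p)).comp p hA
  have h1 : HasMFDerivAt I₄ I₁ (fun p => (A p).2) p ((ContinuousLinearMap.snd ℝ E₀ E₁).comp A') :=
    (hasMFDerivAt_snd (I := I₀) (I' := I₁) (A p)).comp p hA
  have h2 : HasMFDerivAt I₄ I₂ (fun p => f (A p).2) p _ := hf.hasMFDerivAt.comp p h1
  have h3 := hF.hasMFDerivAt.comp p (h0.prodMk h2)
  exact congrArg (fun L : E₄ →L[ℝ] E₃ => L w) h3.mfderiv

section

variable {M X Z : StratSpace.{u}} {V : Type} [NormedAddCommGroup V] [NormedSpace ℝ V]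

theorem affMap_hasMFDerivAt {d D j : ℕ} {S : Type u} [TopologicalSpace S] [ChartedSpace (E j) S]
    (T : E D ≃L[ℝ] V × E d) (o : V × E d) (μ : ℝ) (p : E D × (ℝ × S)) :
    HasMFDerivAt (𝓘(ℝ, E D).prod (𝓘(ℝ, ℝ).prod 𝓘(ℝ, E j)))
      (𝓘(ℝ, V).prod (𝓘(ℝ, E d).prod (𝓘(ℝ, ℝ).prod 𝓘(ℝ, E j)))) (affMap (S := S) T o μ) p
      ((((ContinuousLinearMap.fst ℝ V (E d)).comp T.toContinuousLinearMap).comp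
        (ContinuousLinearMap.fst ℝ (E D) (ℝ × E j))).prod
        ((((ContinuousLinearMap.snd ℝ V (E d)).comp T.toContinuousLinearMap).comp
        (ContinuousLinearMap.fst ℝ (E D) (ℝ × E j))).prod
        (((μ • ContinuousLinearMap.id ℝ ℝ).prodMap (ContinuousLinearMap.id ℝ (E j))).comp
        (ContinuousLinearMap.snd ℝ (E D) (ℝ × E j)))) :
        E D × (ℝ × E j) →L[ℝ] V × (E d × (ℝ × E j))) := by
  have h0 : HasFDerivAt (fun e : E D => o + T e) T.toContinuousLinearMap p.1 :=
    T.hasFDerivAt.const_add o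
  have h1 : HasFDerivAt (fun e : E D => (o + T e).1)
      ((ContinuousLinearMap.fst ℝ V (E d)).comp T.toContinuousLinearMap) p.1 := h0.fst
  have h2 : HasFDerivAt (fun e : E D => (o + T e).2)
      ((ContinuousLinearMap.snd ℝ V (E d)).comp T.toContinuousLinearMap) p.1 := h0.snd
  have h3 : HasFDerivAt (fun r : ℝ => μ * r) (μ • ContinuousLinearMap.id ℝ ℝ) p.2.1 :=
    (hasFDerivAt_id p.2.1).const_mul μ
  have hfst := hasMFDerivAt_fst (I := 𝓘(ℝ, E D)) (I' := 𝓘(ℝ, ℝ).prod 𝓘(ℝ, E j)) p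
  have hsnd := hasMFDerivAt_snd (I := 𝓘(ℝ, E D)) (I' := 𝓘(ℝ, ℝ).prod 𝓘(ℝ, E j)) p
  have hs1 := (hasMFDerivAt_fst (I := 𝓘(ℝ, ℝ)) (I' := 𝓘(ℝ, E j)) p.2).comp p hsnd
  have hs2 := (hasMFDerivAt_snd (I := 𝓘(ℝ, ℝ)) (I' := 𝓘(ℝ, E j)) p.2).comp p hsnd
  exact (h1.hasMFDerivAt.comp p hfst).prodMk ((h2.hasMFDerivAt.comp p hfst).prodMk
    ((h3.hasMFDerivAt.comp p hs1).prodMk hs2))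

theorem affTip_hasMFDerivAt {d D : ℕ} (T : E D ≃L[ℝ] V × E d) (o : V × E d) (e : E D) :
    HasMFDerivAt 𝓘(ℝ, E D) (𝓘(ℝ, V).prod 𝓘(ℝ, E d)) (fun e => ((o + T e).1, (o + T e).2)) e
      (T.toContinuousLinearMap : E D →L[ℝ] V × E d) := by
  have h0 : HasFDerivAt (fun e : E D => o + T e) T.toContinuousLinearMap e :=
    T.hasFDerivAt.const_add o
  exact h0.fst.hasMFDerivAt.prodMk h0.snd.hasMFDerivAt

theorem boxHomeo_hasMFDerivAt {d j : ℕ} {S : Type u} [TopologicalSpace S] [ChartedSpace (E j) S]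
    (b : V) (y : E d) {r : ℝ} (hr : 0 < r) (p : (V × (E d × ℝ)) × S) :
    HasMFDerivAt (𝓘(ℝ, V × (E d × ℝ)).prod 𝓘(ℝ, E j))
      (𝓘(ℝ, V).prod (𝓘(ℝ, E d).prod (𝓘(ℝ, ℝ).prod 𝓘(ℝ, E j)))) (boxHomeo S b y r hr) p
      (((r • ContinuousLinearMap.fst ℝ V (E d × ℝ)).comp
          (ContinuousLinearMap.fst ℝ (V × (E d × ℝ)) (E j))).prod
        (((r • (ContinuousLinearMap.fst ℝ (E d) ℝ).comp
          (ContinuousLinearMap.snd ℝ V (E d × ℝ))).comp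
          (ContinuousLinearMap.fst ℝ (V × (E d × ℝ)) (E j))).prod
        (((r • (ContinuousLinearMap.snd ℝ (E d) ℝ).comp
          (ContinuousLinearMap.snd ℝ V (E d × ℝ))).comp
          (ContinuousLinearMap.fst ℝ (V × (E d × ℝ)) (E j))).prod
          (ContinuousLinearMap.snd ℝ (V × (E d × ℝ)) (E j)))) :
        (V × (E d × ℝ)) × E j →L[ℝ] V × (E d × (ℝ × E j))) := by
  have h1 : HasFDerivAt (fun u : V × (E d × ℝ) => b + r • u.1)
      (r • ContinuousLinearMap.fst ℝ V (E d × ℝ)) p.1 :=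
    ((hasFDerivAt_fst (p := p.1)).const_smul r).const_add b
  have h2 : HasFDerivAt (fun u : V × (E d × ℝ) => y + r • u.2.1)
      (r • (ContinuousLinearMap.fst ℝ (E d) ℝ).comp (ContinuousLinearMap.snd ℝ V (E d × ℝ))) p.1 :=
    ((hasFDerivAt_snd (p := p.1)).fst.const_smul r).const_add y
  have h3 : HasFDerivAt (fun u : V × (E d × ℝ) => r * (1 + u.2.2))
      (r • (ContinuousLinearMap.snd ℝ (E d) ℝ).comp (ContinuousLinearMap.snd ℝ V (E d × ℝ))) p.1 :=
    ((hasFDerivAt_snd (p := p.1)).snd.const_add 1).const_smul r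
  have hfst := hasMFDerivAt_fst (I := 𝓘(ℝ, V × (E d × ℝ))) (I' := 𝓘(ℝ, E j)) p
  have hsnd := hasMFDerivAt_snd (I := 𝓘(ℝ, V × (E d × ℝ))) (I' := 𝓘(ℝ, E j)) p
  exact (h1.hasMFDerivAt.comp p hfst).prodMk ((h2.hasMFDerivAt.comp p hfst).prodMk
    ((h3.hasMFDerivAt.comp p hfst).prodMk hsnd))

/-- The pull-back of a metric by a product chart. -/
def ProdChart.pull (Ψ : ProdChart M X V) (h : Module.finrank ℝ V + X.n = M.n) (g : Metric M) :
    Tensor V X := fun b x =>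
  let L : V × E X.n →L[ℝ] E M.n :=
    mfderiv (𝓘(ℝ, V).prod 𝓘(ℝ, E X.n)) 𝓘(ℝ, E M.n) (Ψ.param h) (b, x)
  (g (Ψ.param h (b, x))).comp L.toLinearMap

theorem ProdChart.pull_apply (Ψ : ProdChart M X V) (h : Module.finrank ℝ V + X.n = M.n)
    (g : Metric M) (b : V) (x : X.Reg) (v : V × E X.n) : Ψ.pull h g b x v =
      g (Ψ.param h (b, x)) ((mfderiv (𝓘(ℝ, V).prod 𝓘(ℝ, E X.n)) 𝓘(ℝ, E M.n) (Ψ.param h) (b, x) :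
        V × E X.n →L[ℝ] E M.n) v) := rfl

namespace ComposeData

variable {Ψ : ProdChart M X V} {c : EdgeChart X Z} (δ : ComposeData Ψ c)

theorem param_eq_comp {j k i : ℕ} (hk : c.d + 1 + j = k) (hV : Module.finrank ℝ V + k = i)
    (h : δ.D + 1 + j = i) : δ.chart.param h =
      fun p => Ψ.param hV (Prod.map id (c.param hk) (affMap δ.T δ.o δ.μ p)) := by
  subst hk; rfl

theorem tip_eq_comp {k i : ℕ} (hk : c.d = k) (hV : Module.finrank ℝ V + k = i)
    (h : δ.D = i) : δ.chart.tip h =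
      fun p => Ψ.param hV (Prod.map id (c.tip hk) ((δ.o + δ.T p).1, (δ.o + δ.T p).2)) := by
  subst hk; rfl

theorem pull_eq (hX : c.d + 1 + Z.n = X.n) (hV : Module.finrank ℝ V + X.n = M.n)
    (h : δ.D + 1 + Z.n = M.n) (g : Metric M) {e : E δ.D} (he : e ∈ δ.B) {r : ℝ}
    (hr : r ∈ Ioo 0 δ.R) (z : Z.Reg) (b v₀ : E 0) (v : E δ.D) (t : ℝ) (ζ : E Z.n) :
    δ.chart.pull h g.lift b e r z (v₀, (v, (t, ζ))) =
      c.pull hX (Ψ.pull hV g) (δ.o + δ.T e).1 (δ.o + δ.T e).2 (δ.μ * r) z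
        ((δ.T v).1, ((δ.T v).2, (δ.μ * t, ζ))) := by
  have h1 := δ.mem_B e he
  have hf := (c.param_diffeo hX ⟨((δ.o + δ.T e).2, (δ.μ * r, z)), h1.2,
    δ.mem_Ioo hr⟩).mdifferentiableAt (by simp)
  have hF := (Ψ.param_diffeo hV ⟨((δ.o + δ.T e).1, c.param hX ((δ.o + δ.T e).2, (δ.μ * r, z))),
    h1.1⟩).mdifferentiableAt (by simp)
  have key := mfderiv_comp_prodMap (affMap_hasMFDerivAt (S := Z.Reg) (j := Z.n) δ.T δ.o δ.μ
    (e, (r, z))) hf hF (v, (t, ζ))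
  rw [ConeChart.pull_apply, ConeChart.pull_apply, ProdChart.pull_apply, Metric.lift]
  rw [δ.param_eq_comp hX hV h]
  exact congrArg (g _) key

theorem pullTip_eq (hX : c.d = X.n) (hV : Module.finrank ℝ V + X.n = M.n)
    (h : δ.D = M.n) (g : Metric M) {e : E δ.D} (he : e ∈ δ.B) (b v₀ : E 0) (v : E δ.D) :
    δ.chart.pullTip h g.lift b e (v₀, v) =
      c.pullTip hX (Ψ.pull hV g) (δ.o + δ.T e).1 (δ.o + δ.T e).2 (δ.T v) := by
  have h1 := δ.mem_B e he
  have hf := (c.tip_diffeo hX ⟨(δ.o + δ.T e).2, h1.2⟩).mdifferentiableAt (by simp)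
  have hF := (Ψ.param_diffeo hV ⟨((δ.o + δ.T e).1, c.tip hX (δ.o + δ.T e).2),
    h1.1⟩).mdifferentiableAt (by simp)
  have key := mfderiv_comp_prodMap (affTip_hasMFDerivAt δ.T δ.o e) hf hF v
  rw [EdgeChart.pullTip_apply, EdgeChart.pullTip_apply, ProdChart.pull_apply, Metric.lift]
  rw [δ.tip_eq_comp hX hV h]
  exact congrArg (g _) key

end ComposeData

theorem ProdChart.step_pull [FiniteDimensional ℝ V] (Ψ : ProdChart M X V) (c : ConeChart X Z)
    [Nonempty Z.carrier] (b : V) (y : E c.d) (r : ℝ) (hr : 0 < r)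
    (hX : c.d + 1 + Z.n = X.n) (hV : Module.finrank ℝ V + X.n = M.n)
    (h : Module.finrank ℝ (V × (E c.d × ℝ)) + Z.n = M.n) (g : Metric M) {u : V × (E c.d × ℝ)}
    (hu : u ∈ c.box Ψ.P b y r) (z : Z.Reg) :
    (Ψ.step c b y r hr).pull h g u z = r ^ 2 • c.rescale hX (Ψ.pull hV g) b y r u z := by
  have h1 := c.box_radius hr hu
  have hf := (c.param_diffeo hX ⟨(y + r • u.2.1, (r * (1 + u.2.2), z)), hu.2.2.1,
    h1⟩).mdifferentiableAt (by simp)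
  have hF := (Ψ.param_diffeo hV ⟨(b + r • u.1, c.param hX (y + r • u.2.1, (r * (1 + u.2.2), z))),
    hu.2.1⟩).mdifferentiableAt (by simp)
  ext ⟨v, ζ⟩
  have key := mfderiv_comp_prodMap (boxHomeo_hasMFDerivAt (S := Z.Reg) (j := Z.n) b y hr
    (u, z)) hf hF (v, ζ)
  have hp : (Ψ.step c b y r hr).param h = fun p => Ψ.param hV (Prod.map id (c.param hX)
      (boxHomeo (Z.Reg) b y r hr p)) := by
    have : ∀ {k : ℕ} (hk : c.d + 1 + Z.n = k) (hV : Module.finrank ℝ V + k = M.n),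
        (Ψ.step c b y r hr).param h = fun p => Ψ.param hV (Prod.map id (c.param hk)
      (boxHomeo (Z.Reg) b y r hr p)) := by
      intro k hk hV
      subst hk; rfl
    exact this hX hV
  rw [smul_apply, ConeChart.rescale_apply, smul_eq_mul,
    mul_inv_cancel_left₀ (pow_ne_zero 2 hr.ne')]
  rw [ConeChart.pull_apply, ProdChart.pull_apply, ProdChart.pull_apply, hp]
  exact congrArg (g _) key

/-- The trivial product chart. -/
def ProdChart.refl (M : StratSpace.{u}) : ProdChart M M (E 0) where
  P := univ
  isOpen_P := isOpen_univ
  e := (Homeomorph.uniqueProd (E 0) M.carrier).toOpenPartialHomeomorph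
  source_eq := by simp
  param {j i} h p := ⟨p.2.1, by rw [p.2.2]; simpa using h⟩
  param_eq h b hb x := rfl
  param_diffeo {j i} h := by
    obtain rfl : j = i := by simpa using h
    refine isLocalDiffeomorphOn_of_inverse (t := univ) (g := fun x => (0, x)) isOpen_univ
      isOpen_univ (mapsTo_univ _ _) (mapsTo_univ _ _)
      (fun p _ => Prod.ext (Subsingleton.elim _ _) rfl) (fun _ _ => rfl)
      contMDiff_snd.contMDiffOn (contMDiff_const.prodMk contMDiff_id).contMDiffOn

theorem ProdChart.refl_pull (h : Module.finrank ℝ (E 0) + M.n = M.n) (g : Metric M) :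
    (ProdChart.refl M).pull h g = g.lift := by
  funext b x
  ext v
  rw [ProdChart.pull_apply]
  have h1 : (ProdChart.refl M).param h = Prod.snd := rfl
  rw [h1, mfderiv_snd]
  rfl

end

/-! ### Charts of the tangent sphere -/

/-- An orthogonal splitting `ℝᵏ⁺¹ = ℝ e ⊕ ℝᵏ`. -/
structure Split (K D : ℕ) where
  e : E D
  norm_e : ‖e‖ = 1
  ι : E K →ₗᵢ[ℝ] E D
  π : E D →L[ℝ] E K
  π_ι : ∀ y, π (ι y) = y
  π_e : π e = 0
  inner_ι : ∀ y, inner ℝ e (ι y) = 0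
  eq : ∀ u, u = inner ℝ e u • e + ι (π u)

theorem exists_split {K D : ℕ} (h : K + 1 = D) {e : E D} (he : ‖e‖ = 1) :
    ∃ σ : Split K D, σ.e = e := by
  have hF : Fact (Module.finrank ℝ (E D) = K + 1) := ⟨by simp [h]⟩
  have he0 : e ≠ 0 := fun h0 => by rw [h0, norm_zero] at he; exact zero_ne_one he
  let b := (OrthonormalBasis.fromOrthogonalSpanSingleton (𝕜 := ℝ) K he0).repr
  have hι : ∀ y, inner ℝ e (((ℝ ∙ e)ᗮ.subtypeₗᵢ.comp b.symm.toLinearIsometry) y) = 0 := fun y =>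
    Submodule.mem_orthogonal_singleton_iff_inner_right.1 (b.symm y).2
  refine ⟨⟨e, he, (ℝ ∙ e)ᗮ.subtypeₗᵢ.comp b.symm.toLinearIsometry,
    b.toContinuousLinearEquiv.toContinuousLinearMap.comp ((ℝ ∙ e)ᗮ).orthogonalProjectionOnto,
    fun y => ?_, ?_, hι, fun u => ?_⟩, rfl⟩
  · simp
  · have : ((ℝ ∙ e)ᗮ).orthogonalProjectionOnto e = 0 :=
      Submodule.orthogonalProjectionOnto_orthogonal_apply_eq_zero (Submodule.mem_span_singleton_self e)
    simp [this]
  · have h1 := (ℝ ∙ e).starProjection_add_starProjection_orthogonal u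
    have h2 := Submodule.starProjection_unit_singleton ℝ he u
    rw [h2] at h1
    conv_lhs => rw [← h1]
    simp

namespace Split

variable {K D : ℕ} (σ : Split K D)

theorem inner_e (y : E K) : inner ℝ σ.e (σ.e + σ.ι y) = (1 : ℝ) := by
  rw [inner_add_right, σ.inner_ι, real_inner_self_eq_norm_sq, σ.norm_e]; norm_num

theorem norm_sq (y : E K) : ‖σ.e + σ.ι y‖ ^ 2 = 1 + ‖y‖ ^ 2 := by
  rw [norm_add_sq_real, σ.inner_ι, σ.norm_e, σ.ι.norm_map]; norm_num

theorem inner_map (y y' : E K) : inner ℝ (σ.e + σ.ι y) (σ.ι y') = inner ℝ y y' := by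
  rw [inner_add_left, σ.inner_ι, zero_add, σ.ι.inner_map_map]

theorem ne_zero (y : E K) : σ.e + σ.ι y ≠ 0 := fun h => by
  have := σ.norm_sq y
  rw [h, norm_zero] at this
  nlinarith [sq_nonneg ‖y‖]

theorem size_pos {Z : Type u} (p : E K × Cone Z) : 0 < Sus.size (σ.e + σ.ι p.1, p.2) := by
  have h := Sus.size_sq (σ.e + σ.ι p.1, p.2)
  simp only at h
  rw [σ.norm_sq] at h
  have h1 := Sus.size_nonneg (σ.e + σ.ι p.1, p.2)
  refine lt_of_le_of_ne h1 fun h0 => ?_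
  rw [← h0] at h
  nlinarith [sq_nonneg ‖p.1‖, sq_nonneg p.2.radius]

/-- The point `[e + y : κ]`. -/
def gn {Z : Type u} (p : E K × Cone Z) : Sus D Z := Sus.proj (σ.e + σ.ι p.1, p.2) (σ.size_pos p)

/-- The affine coordinates `y`, `κ` of the point `[e + y : κ]`. -/
def gnInv {Z : Type u} (s : Sus D Z) : E K × Cone Z :=
  ((inner ℝ σ.e s.v)⁻¹ • σ.π s.v, Cone.dil (inner ℝ σ.e s.v)⁻¹ s.1.2)

theorem inner_gn {Z : Type u} (p : E K × Cone Z) :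
    inner ℝ σ.e (σ.gn p).v = (Sus.size (σ.e + σ.ι p.1, p.2))⁻¹ := by
  change inner ℝ σ.e ((Sus.size (σ.e + σ.ι p.1, p.2))⁻¹ • (σ.e + σ.ι p.1)) = _
  rw [inner_smul_right, σ.inner_e, mul_one]

theorem gnInv_gn {Z : Type u} (p : E K × Cone Z) : σ.gnInv (σ.gn p) = p := by
  have h := σ.size_pos p
  unfold gnInv
  rw [σ.inner_gn, inv_inv]
  refine Prod.ext ?_ ?_
  · change Sus.size (σ.e + σ.ι p.1, p.2) • σ.π ((Sus.size (σ.e + σ.ι p.1, p.2))⁻¹ •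
      (σ.e + σ.ι p.1)) = _
    rw [map_smul, smul_inv_smul₀ h.ne', map_add, σ.π_e, zero_add, σ.π_ι]
  · change Cone.dil _ (Cone.dil _ _) = _
    rw [Cone.dil_dil h.le, mul_inv_cancel₀ h.ne', Cone.dil_one]

theorem affine {u : E D} (hu : 0 < inner ℝ σ.e u) :
    σ.e + σ.ι ((inner ℝ σ.e u)⁻¹ • σ.π u) = (inner ℝ σ.e u)⁻¹ • u := by
  have h : (inner ℝ σ.e u : ℝ)⁻¹ • u = (inner ℝ σ.e u : ℝ)⁻¹ •
    (inner ℝ σ.e u • σ.e + σ.ι (σ.π u)) := congrArg _ (σ.eq u)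
  rw [h, smul_add, inv_smul_smul₀ hu.ne', map_smul]

theorem gn_gnInv {Z : Type u} {s : Sus D Z} (hs : 0 < inner ℝ σ.e s.v) : σ.gn (σ.gnInv s) = s := by
  have h : (σ.e + σ.ι (σ.gnInv s).1, (σ.gnInv s).2) = Sus.scale (inner ℝ σ.e s.v)⁻¹ s :=
    Prod.ext (σ.affine hs) rfl
  unfold gn
  simp only [h]
  exact Sus.proj_scale (inv_pos.2 hs) s _

variable {Z : Type u} [TopologicalSpace Z]

theorem continuous_gn : Continuous (σ.gn (Z := Z)) := by
  have h1 : Continuous fun p : E K × Cone Z => (Sus.size (σ.e + σ.ι p.1, p.2))⁻¹ := by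
    refine Continuous.inv₀ (Sus.continuous_size.comp ?_) fun p => (σ.size_pos p).ne'
    have := σ.ι.continuous
    fun_prop
  have h2 : Continuous fun p : E K × Cone Z => σ.e + σ.ι p.1 := by
    have := σ.ι.continuous
    fun_prop
  exact Continuous.subtype_mk ((h1.smul h2).prodMk
    (Cone.continuous_dil.comp (h1.prodMk continuous_snd))) _

theorem continuous_inner : Continuous fun s : Sus D Z => (inner ℝ σ.e s.v : ℝ) :=
  continuous_const.inner Sus.continuous_v

theorem continuousOn_gnInv : ContinuousOn (σ.gnInv (Z := Z)) {s | 0 < inner ℝ σ.e s.v} := by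
  have h1 : ContinuousOn (fun s : Sus D Z => (inner ℝ σ.e s.v : ℝ)⁻¹) {s | 0 < inner ℝ σ.e s.v} :=
    σ.continuous_inner.continuousOn.inv₀ fun s hs => (ne_of_gt hs)
  exact (h1.smul (σ.π.continuous.comp Sus.continuous_v).continuousOn).prodMk
    (Cone.continuous_dil.comp_continuousOn
      (h1.prodMk (continuous_snd.comp continuous_subtype_val).continuousOn))

/-- The homeomorphism of a gnomonic chart. -/
def homeo (Z : Type u) [TopologicalSpace Z] : OpenPartialHomeomorph (Sus D Z) (E K × Cone Z) where
  toFun := σ.gnInv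
  invFun := σ.gn
  source := {s | 0 < inner ℝ σ.e s.v} ∩
    σ.gnInv ⁻¹' {p | p.1 ∈ Metric.ball 0 1 ∧ p.2.radius < 1}
  target := {p | p.1 ∈ Metric.ball 0 1 ∧ p.2.radius < 1}
  map_source' s hs := hs.2
  map_target' p hp := ⟨by
    rw [mem_ofPred_eq, σ.inner_gn]; exact inv_pos.2 (σ.size_pos p), by
    rw [mem_preimage, σ.gnInv_gn]; exact hp⟩
  left_inv' s hs := σ.gn_gnInv hs.1
  right_inv' p _ := σ.gnInv_gn p
  open_source := σ.continuousOn_gnInv.isOpen_inter_preimage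
    (isOpen_lt continuous_const σ.continuous_inner)
    (Metric.isOpen_ball.prod (Cone.isOpen_radius_lt 1))
  open_target := Metric.isOpen_ball.prod (Cone.isOpen_radius_lt 1)
  continuousOn_toFun := σ.continuousOn_gnInv.mono inter_subset_left
  continuousOn_invFun := σ.continuous_gn.continuousOn

end Split

theorem Sus.emb_eq_proj {D : ℕ} {Z : Type u} (u : E D) {ρ : ℝ} (hρ : 0 < ρ) (z : Z)
    (hp : 0 < size (u, Cone.pt ρ z)) : emb (ρ⁻¹ • u, z) = proj (u, Cone.pt ρ z) hp := by
  have h1 := size_sq (u, Cone.pt ρ z)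
  simp only [Cone.radius_pt hρ.le] at h1
  have h2 : √(1 + ‖ρ⁻¹ • u‖ ^ 2) = ρ⁻¹ * size (u, Cone.pt ρ z) := by
    rw [Real.sqrt_eq_iff_mul_self_eq_of_pos (mul_pos (inv_pos.2 hρ) hp), norm_smul, norm_inv,
      Real.norm_of_nonneg hρ.le]
    have : ρ⁻¹ * size (u, Cone.pt ρ z) * (ρ⁻¹ * size (u, Cone.pt ρ z)) =
      ρ⁻¹ ^ 2 * size (u, Cone.pt ρ z) ^ 2 := by ring
    rw [this, h1]
    field_simp
    ring
  refine Subtype.ext (Prod.ext ?_ ?_)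
  · change (√(1 + ‖ρ⁻¹ • u‖ ^ 2))⁻¹ • ρ⁻¹ • u = (size (u, Cone.pt ρ z))⁻¹ • u
    rw [h2, smul_smul, mul_inv, inv_inv, mul_right_comm, mul_inv_cancel₀ hρ.ne', one_mul]
  · change Cone.pt (√(1 + ‖ρ⁻¹ • u‖ ^ 2))⁻¹ z = Cone.dil (size (u, Cone.pt ρ z))⁻¹ (Cone.pt ρ z)
    rw [h2, Cone.dil_pt (inv_nonneg.2 hp.le), mul_inv, inv_inv, mul_comm]

theorem Sus.dir_eq_proj {D i : ℕ} {Z : StratSpace.{u}} (h : i + 1 = D) {u : E D} (hu : u ≠ 0)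
    (hp : 0 < size (u, (Cone.vertex : Cone Z.carrier))) :
    (dir (Z := Z) h u).1 = proj (u, Cone.vertex) hp := by
  rw [dir_val h hu]
  have h1 : size (u, (Cone.vertex : Cone Z.carrier)) = ‖u‖ := by
    simp [size, Cone.radius_vertex]
  refine Subtype.ext (Prod.ext ?_ rfl)
  change ‖u‖⁻¹ • u = (size (u, Cone.vertex))⁻¹ • u
  rw [h1]

section

variable {K D : ℕ} (σ : Split K D) (Z : StratSpace.{u}) (n : ℕ)

theorem Split.contMDiffOn_inner (i : ℕ) : ContMDiffOn 𝓘(ℝ, E i) 𝓘(ℝ, ℝ) ∞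
    (fun s : (Susp D Z n).Stratum i => (inner ℝ σ.e (Susp.v s) : ℝ)⁻¹)
    {s | 0 < inner ℝ σ.e (Susp.v s)} := by
  have h1 : ContDiffOn ℝ ∞ (fun u : E D => (inner ℝ σ.e u : ℝ)⁻¹) {u | 0 < inner ℝ σ.e u} :=
    ContDiffOn.inv (contDiff_const.inner ℝ contDiff_id).contDiffOn fun u hu => (ne_of_gt hu)
  exact h1.contMDiffOn.comp Susp.contMDiff_v.contMDiffOn fun s hs => hs

theorem Split.contMDiffOn_affine (i : ℕ) : ContMDiffOn 𝓘(ℝ, E i) 𝓘(ℝ, E K) ∞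
    (fun s : (Susp D Z n).Stratum i => (inner ℝ σ.e (Susp.v s) : ℝ)⁻¹ • σ.π (Susp.v s))
    {s | 0 < inner ℝ σ.e (Susp.v s)} :=
  (σ.contMDiffOn_inner Z n i).smul (σ.π.contMDiff.comp Susp.contMDiff_v).contMDiffOn

theorem Split.isOpen_pos (i : ℕ) :
    IsOpen {s : (Susp D Z n).Stratum i | 0 < (inner ℝ σ.e (Susp.v s) : ℝ)} :=
  isOpen_lt continuous_const (continuous_const.inner Susp.contMDiff_v.continuous)

/-- The gnomonic chart `[e + y : κ] ↦ (y, κ)` of the tangent sphere. -/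
abbrev Split.chart (hK : K + 1 = D) : EdgeChart (Susp D Z n) Z where
  d := K
  U := Metric.ball 0 1
  isOpen_U := Metric.isOpen_ball
  nonempty_U := ⟨0, Metric.mem_ball_self one_pos⟩
  bounded_U := Metric.isBounded_ball
  R := 1
  R_pos := one_pos
  φ := σ.homeo Z.carrier
  target_eq := rfl
  param {j i} h p := Susp.mk (by omega : D + j = i) (p.2.1⁻¹ • (σ.e + σ.ι p.1), p.2.2)
  param_eq {j i} h y hy r hr z := Sus.emb_eq_proj (σ.e + σ.ι y) hr.1 z.1 (σ.size_pos (y, Cone.pt r z.1))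
  param_diffeo {j i} h := by
    have hD : D + j = i := by omega
    have hsub : {s : (Susp D Z n).Stratum i | 0 < (inner ℝ σ.e (Susp.v s) : ℝ) ∧
        (inner ℝ σ.e (Susp.v s) : ℝ)⁻¹ • σ.π (Susp.v s) ∈ Metric.ball 0 1 ∧
        (inner ℝ σ.e (Susp.v s) : ℝ)⁻¹ * Susp.r s ∈ Ioo 0 1} ⊆
        {s | 0 < inner ℝ σ.e (Susp.v s)} := fun s hs => hs.1
    have hval : ∀ (y : E K) (r : ℝ) (z : Z.Stratum j), 0 < r →
        ∃ N > 0, Susp.v (Susp.mk (n := n) hD (r⁻¹ • (σ.e + σ.ι y), z)) = N • (σ.e + σ.ι y) ∧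
          Susp.r (Susp.mk (n := n) hD (r⁻¹ • (σ.e + σ.ι y), z)) = N * r ∧
          inner ℝ σ.e (N • (σ.e + σ.ι y)) = N := by
      intro y r z hr
      have hN : 0 < (√(1 + ‖r⁻¹ • (σ.e + σ.ι y)‖ ^ 2))⁻¹ * r⁻¹ :=
        mul_pos (inv_pos.2 (Sus.sqrt_pos _)) (inv_pos.2 hr)
      refine ⟨_, hN, ?_, ?_, ?_⟩
      · rw [Susp.v_mk, smul_smul]
      · rw [Susp.r_mk, inv_mul_cancel_right₀ hr.ne']
      · rw [inner_smul_right, σ.inner_e, mul_one]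
    refine isLocalDiffeomorphOn_of_inverse
      (g := fun s => ((inner ℝ σ.e (Susp.v s))⁻¹ • σ.π (Susp.v s),
        ((inner ℝ σ.e (Susp.v s))⁻¹ * Susp.r s, Susp.z hD s)))
      (t := {s : (Susp D Z n).Stratum i | 0 < (inner ℝ σ.e (Susp.v s) : ℝ) ∧
        (inner ℝ σ.e (Susp.v s) : ℝ)⁻¹ • σ.π (Susp.v s) ∈ Metric.ball 0 1 ∧
        (inner ℝ σ.e (Susp.v s) : ℝ)⁻¹ * Susp.r s ∈ Ioo 0 1}) ?_ ?_ ?_ ?_ ?_ ?_ ?_ ?_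
    · exact Metric.isOpen_ball.preimage continuous_fst |>.inter
        (isOpen_Ioo.preimage (continuous_fst.comp continuous_snd))
    · exact (((σ.contMDiffOn_affine Z n i).continuousOn.prodMk
        ((σ.contMDiffOn_inner Z n i).continuousOn.mul
          Susp.contMDiff_r.continuous.continuousOn)).isOpen_inter_preimage
        (σ.isOpen_pos Z n i) (Metric.isOpen_ball.prod isOpen_Ioo))
    · rintro ⟨y, r, z⟩ ⟨hy, hr⟩
      obtain ⟨N, hN, h1, h2, h3⟩ := hval y r z hr.1
      simp only [mem_ofPred_eq, h2, h1, h3]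
      refine ⟨hN, ?_, ?_⟩
      · rwa [map_smul, inv_smul_smul₀ hN.ne', map_add, σ.π_e, zero_add, σ.π_ι]
      · rwa [inv_mul_cancel_left₀ hN.ne']
    · rintro s ⟨h1, h2, h3⟩
      exact ⟨h2, h3⟩
    · rintro ⟨y, r, z⟩ ⟨hy, hr⟩
      obtain ⟨N, hN, h1, h2, h3⟩ := hval y r z hr.1
      simp only [h3, h2, h1, Susp.z_mk]
      rw [map_smul, inv_smul_smul₀ hN.ne', map_add, σ.π_e, zero_add, σ.π_ι,
        inv_mul_cancel_left₀ hN.ne']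
    · rintro s ⟨h1, h2, h3⟩
      simp only
      rw [σ.affine h1, smul_smul, mul_inv, inv_inv, mul_right_comm, mul_inv_cancel₀ h1.ne',
        one_mul]
      exact Susp.mk_v_r_z hD s
    · have h1 : ContDiffOn ℝ ∞ (fun p : E K × ℝ => p.2⁻¹ • (σ.e + σ.ι p.1)) {p | 0 < p.2} := by
        have := σ.ι.contDiff (n := ∞)
        exact (ContDiffOn.inv contDiff_snd.contDiffOn fun p hp => ne_of_gt hp).smul
          (by fun_prop)
      have h2 : ContMDiff (𝓘(ℝ, E K).prod (𝓘(ℝ, ℝ).prod 𝓘(ℝ, E j))) 𝓘(ℝ, E K × ℝ) ∞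
          (fun p : E K × (ℝ × Z.Stratum j) => (p.1, p.2.1)) :=
        contMDiff_fst.prodMk_space (contMDiff_fst.comp contMDiff_snd)
      refine (Susp.contMDiff_mk hD).comp_contMDiffOn
        ((h1.contMDiffOn.comp h2.contMDiffOn fun p hp => hp.2.1).prodMk
          (contMDiff_snd.comp contMDiff_snd).contMDiffOn)
    · exact ((σ.contMDiffOn_affine Z n i).mono hsub).prodMk
        ((((σ.contMDiffOn_inner Z n i).mono hsub).mul Susp.contMDiff_r.contMDiffOn).prodMk
          (Susp.contMDiff_z hD).contMDiffOn)
  tip {i} h y := Susp.dir (by omega : i + 1 = D) (σ.e + σ.ι y)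
  tip_eq {i} h y hy := Sus.dir_eq_proj (by omega) (σ.ne_zero y) (σ.size_pos (y, Cone.vertex))
  tip_diffeo {i} h := by
    have hD : i + 1 = D := by omega
    have hval : ∀ y : E K, ∃ N > 0,
        Susp.v (Susp.dir (Z := Z) (n := n) hD (σ.e + σ.ι y)) = N • (σ.e + σ.ι y) ∧
          inner ℝ σ.e (N • (σ.e + σ.ι y)) = N := fun y =>
      ⟨_, inv_pos.2 (norm_pos_iff.2 (σ.ne_zero y)), Susp.v_dir hD (σ.ne_zero y), by
        rw [inner_smul_right, σ.inner_e, mul_one]⟩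
    refine isLocalDiffeomorphOn_of_inverse
      (g := fun s => (inner ℝ σ.e (Susp.v s))⁻¹ • σ.π (Susp.v s))
      (t := {s : (Susp D Z n).Stratum i | 0 < (inner ℝ σ.e (Susp.v s) : ℝ) ∧
        (inner ℝ σ.e (Susp.v s) : ℝ)⁻¹ • σ.π (Susp.v s) ∈ Metric.ball 0 1})
      Metric.isOpen_ball ?_ ?_ ?_ ?_ ?_ ?_ ?_
    · exact (σ.contMDiffOn_affine Z n i).continuousOn.isOpen_inter_preimage
        (σ.isOpen_pos Z n i) Metric.isOpen_ball
    · intro y hy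
      obtain ⟨N, hN, h1, h3⟩ := hval y
      simp only [mem_ofPred_eq, h1, h3]
      refine ⟨hN, ?_⟩
      rwa [map_smul, inv_smul_smul₀ hN.ne', map_add, σ.π_e, zero_add, σ.π_ι]
    · exact fun s hs => hs.2
    · intro y hy
      obtain ⟨N, hN, h1, h3⟩ := hval y
      simp only [h3, h1]
      rw [map_smul, inv_smul_smul₀ hN.ne', map_add, σ.π_e, zero_add, σ.π_ι]
    · rintro s ⟨h1, h2⟩
      simp only
      rw [σ.affine h1]
      exact Susp.dir_v hD s (inv_pos.2 h1)
    · have h1 : ContDiff ℝ ∞ fun y : E K => σ.e + σ.ι y := contDiff_const.add σ.ι.contDiff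
      exact (Susp.contMDiffOn_dir hD).comp h1.contMDiff.contMDiffOn fun y _ => σ.ne_zero y
    · exact (σ.contMDiffOn_affine Z n i).mono fun s hs => hs.1

/-- The product chart `(w, z) ↦ [w : 1 : z]` of the tangent sphere. -/
def suspProd (D : ℕ) (Z : StratSpace.{u}) (n : ℕ) [Nonempty Z.carrier] :
    ProdChart (Susp D Z n) Z (E D) where
  P := univ
  isOpen_P := isOpen_univ
  e := Sus.isOpenEmbedding_emb.toOpenPartialHomeomorph _
  source_eq := by simp
  param {j i} h p := Susp.mk (by simpa using h) p
  param_eq h b hb x := rfl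
  param_diffeo {j i} h := by
    have hD : D + j = i := by simpa using h
    exact isLocalDiffeomorphOn_of_inverse (t := univ)
      (g := fun s : (Susp D Z n).Stratum i => Sus.offHomeo hD s) isOpen_univ
      isOpen_univ (mapsTo_univ _ _) (mapsTo_univ _ _)
      (fun p _ => (Sus.offHomeo hD).apply_symm_apply p) (fun s _ => Susp.mk_offHomeo hD s)
      (Susp.contMDiff_mk hD).contMDiffOn (Susp.contMDiff_offHomeo hD).contMDiffOn

end

/-! ### The atlas of the tangent sphere -/

theorem exists_iterAtlas {X : StratSpace.{u}} [CompactSpace X.carrier] [T2Space X.carrier]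
    (hman : ∀ j, IsManifold 𝓘(ℝ, E j) ∞ (X.Stratum j)) (hdim : ∀ x, X.dim x ≤ X.n)
    (hdense : Dense {x | X.dim x = X.n}) (hcod : ∀ x, X.dim x + 1 ≠ X.n) {J : Type*}
    (Z : J → StratSpace.{u}) (c : ∀ j, EdgeChart X (Z j)) (A : ∀ j, IterAtlas (Z j))
    (hcover : ∀ x, ∃ j, x ∈ (c j).φ.source)
    (hlink : ∀ j, ((c j).d = X.n ∧ IsEmpty (Z j).carrier) ∨
      ((c j).d + 1 + (Z j).n = X.n ∧ Nonempty (Z j).carrier)) :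
    ∃ B : IterAtlas X, ∀ P : ∀ Z : StratSpace.{u}, EdgeChart X Z → IterAtlas Z → Prop,
      (∀ j, P (Z j) (c j) (A j)) → ∀ i, P (B.link i) (B.chart i) (B.sub i) := by
  obtain ⟨t, ht⟩ := isCompact_univ.elim_finite_subcover (fun j => (c j).φ.source)
    (fun j => (c j).φ.open_source) fun x _ => mem_iUnion.2 (hcover x)
  let f : Fin t.card → J := fun i => (t.equivFin.symm i).1
  have hf : ∀ x, ∃ i, x ∈ (c (f i)).φ.source := fun x => by
    obtain ⟨j, hj, hx⟩ := mem_iUnion₂.1 (ht (mem_univ x))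
    refine ⟨t.equivFin ⟨j, hj⟩, ?_⟩
    have h : f (t.equivFin ⟨j, hj⟩) = j := by simp [f]
    rw [h]
    exact hx
  refine ⟨.mk t.card (fun i => Z (f i)) (fun i => c (f i))
    ⟨inferInstance, inferInstance, hman, hdim, hdense, hcod, hf, fun i => hlink (f i)⟩
    (fun i => A (f i)), fun P hP i => hP (f i)⟩

/-- The condition on the dimensions for the tangent sphere `Susp D Z n`. -/
def SuspDim (D : ℕ) (Z : StratSpace.{u}) (n : ℕ) : Prop :=
  (IsEmpty Z.carrier ∧ n + 1 = D) ∨ (Nonempty Z.carrier ∧ D + Z.n = n ∧ Z.n ≠ 0)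

namespace Susp

variable {D : ℕ} {Z : StratSpace.{u}} {n : ℕ}

theorem point_cases (s : (Susp D Z n).carrier) :
    (∃ (e : E D) (he : ‖e‖ = 1), s = Sus.tipPt e he) ∨
    ∃ (w : E D) (z : Z.carrier), s = Sus.emb (w, z) := by
  rcases eq_or_lt_of_le (Sus.r_nonneg s) with h | h
  · obtain ⟨h1, h2⟩ := Sus.eq_of_r_zero h.symm
    exact Or.inl ⟨_, h1, h2⟩
  · obtain ⟨z, -, hz⟩ := Sus.emb_surj h
    exact Or.inr ⟨_, z, hz.symm⟩

theorem dim_tip {e : E D} (he : ‖e‖ = 1) :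
    (Susp D Z n).dim (Sus.tipPt e he : Sus D Z.carrier) + 1 = D := by
  have := Sus.pos_of_norm_eq_one he
  have h : (Susp D Z n).dim (Sus.tipPt e he : Sus D Z.carrier) = D - 1 :=
    Sus.dim_tipPt (Z := Z) e he
  omega

theorem dim_emb (w : E D) (z : Z.carrier) :
    (Susp D Z n).dim (Sus.emb (w, z) : Sus D Z.carrier) = D + Z.dim z := Sus.dim_emb (w, z)

theorem dim_le (A : IterAtlas Z) (h : SuspDim D Z n) (s : (Susp D Z n).carrier) :
    (Susp D Z n).dim s ≤ n := by
  rcases point_cases s with ⟨e, he, rfl⟩ | ⟨w, z, rfl⟩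
  · have := dim_tip (Z := Z) (n := n) he
    rcases h with ⟨-, h⟩ | ⟨-, h, -⟩ <;> omega
  · rw [dim_emb]
    rcases h with ⟨h, -⟩ | ⟨-, h, -⟩
    · exact isEmptyElim z
    · have := A.isAtlas.dim_le z
      omega

theorem codim (A : IterAtlas Z) (h : SuspDim D Z n) (s : (Susp D Z n).carrier) :
    (Susp D Z n).dim s + 1 ≠ n := by
  rcases point_cases s with ⟨e, he, rfl⟩ | ⟨w, z, rfl⟩
  · rw [dim_tip he]
    rcases h with ⟨-, h⟩ | ⟨-, h, h'⟩ <;> omega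
  · rw [dim_emb]
    rcases h with ⟨h, -⟩ | ⟨-, h, -⟩
    · exact isEmptyElim z
    · have := A.isAtlas.no_codim_one z
      omega

theorem dense_reg (A : IterAtlas Z) (h : SuspDim D Z n) :
    Dense {s | (Susp D Z n).dim s = n} := by
  intro s
  rcases h with ⟨h0, h⟩ | ⟨h0, h, -⟩
  · refine subset_closure ?_
    rcases point_cases s with ⟨e, he, rfl⟩ | ⟨w, z, rfl⟩
    · have := dim_tip (Z := Z) (n := n) he
      change (Susp D Z n).dim (Sus.tipPt e he : Sus D Z.carrier) = n
      omega
    · exact isEmptyElim z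
  · have hreg : ∀ (w : E D) (z : Z.carrier), Z.dim z = Z.n →
        (Sus.emb (w, z) : Sus D Z.carrier) ∈ {s | (Susp D Z n).dim s = n} := fun w z hz => by
      change (Susp D Z n).dim (Sus.emb (w, z) : Sus D Z.carrier) = n
      rw [dim_emb, hz, h]
    rcases point_cases s with ⟨e, he, rfl⟩ | ⟨w, z, rfl⟩
    · obtain ⟨z, hz⟩ := A.isAtlas.dense_reg.nonempty
      have hD := Sus.pos_of_norm_eq_one he
      obtain ⟨σ, hσ⟩ := exists_split (K := D - 1) (by omega) he
      have h1 : Continuous fun a : ℝ => σ.gn ((0 : E (D - 1)), Cone.pt a z) :=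
        σ.continuous_gn.comp (continuous_const.prodMk
          (Cone.continuous_pt.comp (continuous_id.prodMk continuous_const)))
      have h2 : σ.gn ((0 : E (D - 1)), Cone.pt 0 z) = Sus.tipPt e he := by
        have hsz : Sus.size (σ.e + σ.ι 0, Cone.pt (0 : ℝ) z) = 1 := by
          simp [Sus.size, Cone.radius_pt le_rfl, σ.norm_e]
        refine Subtype.ext (Prod.ext ?_ ?_)
        · change (Sus.size (σ.e + σ.ι 0, Cone.pt (0 : ℝ) z))⁻¹ • (σ.e + σ.ι 0) = e
          rw [hsz, hσ]; simp
        · change Cone.dil (Sus.size (σ.e + σ.ι 0, Cone.pt (0 : ℝ) z))⁻¹ (Cone.pt (0 : ℝ) z) =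
            Cone.vertex
          rw [hsz, inv_one, Cone.dil_one, Cone.pt_of_nonpos le_rfl]
      have h3 := (h1.tendsto 0).mono_left (nhdsWithin_le_nhds (s := Ioi 0))
      simp only [h2] at h3
      refine mem_closure_of_tendsto h3 ?_
      filter_upwards [self_mem_nhdsWithin] with a ha
      have : σ.gn ((0 : E (D - 1)), Cone.pt a z) = Sus.emb (a⁻¹ • (σ.e + σ.ι 0), z) :=
        (Sus.emb_eq_proj _ ha z _).symm
      rw [this]
      exact hreg _ z hz
    · have hz := A.isAtlas.dense_reg z
      have h1 : Continuous fun z : Z.carrier => (Sus.emb (w, z) : Sus D Z.carrier) :=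
        Sus.continuous_emb.comp (continuous_const.prodMk continuous_id)
      exact map_mem_closure (f := fun z : Z.carrier => (Sus.emb (w, z) : Sus D Z.carrier)) h1 hz
        fun z hz => hreg w z hz

end Susp

theorem exists_contraction {V : Type} [NormedAddCommGroup V] [NormedSpace ℝ V]
    [FiniteDimensional ℝ V] {D : ℕ} (h : D = Module.finrank ℝ V) :
    ∃ T : E D ≃L[ℝ] V, ∀ v, ‖T v‖ ≤ ‖v‖ := by
  have h1 : Module.finrank ℝ (E D) = Module.finrank ℝ V := by simp [h]
  let T := ContinuousLinearEquiv.ofFinrankEq h1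
  have hT : 0 < ‖(T : E D →L[ℝ] V)‖ + 1 := by positivity
  refine ⟨T.trans (ContinuousLinearEquiv.smulLeft (Units.mk0 _ (inv_ne_zero hT.ne'))),
    fun v => ?_⟩
  have h2 := (T : E D →L[ℝ] V).le_opNorm v
  have h3 : ‖(‖(T : E D →L[ℝ] V)‖ + 1)⁻¹ • T v‖ ≤ ‖v‖ := by
    rw [norm_smul, norm_inv, Real.norm_of_nonneg hT.le, inv_mul_le_iff₀ hT]
    have h2' : ‖T v‖ ≤ ‖(T : E D →L[ℝ] V)‖ * ‖v‖ := h2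
    nlinarith [norm_nonneg v]
  exact h3

section

variable {Z : StratSpace.{u}} (D n : ℕ)

/-- The data of the chart of the tangent sphere induced from a chart of `Z`, over a ball of
radius `ρ`. -/
def suspCompose {Z' : StratSpace.{u}} [Nonempty Z.carrier] (c : EdgeChart Z Z') {ρ : ℝ}
    (hρ : 0 < ρ) : ComposeData (suspProd D Z n) c :=
  let T := (exists_contraction (V := E D × E c.d) (D := D + c.d) (by simp)).choose
  { D := D + c.d
    T := T
    o := 0
    μ := 1
    μ_pos := one_pos
    B := {e | ‖(T e).1‖ < ρ ∧ (T e).2 ∈ c.U}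
    isOpen_B := by
      have h1 : IsOpen {e : E (D + c.d) | ‖(T e).1‖ < ρ} :=
        isOpen_lt (by fun_prop) continuous_const
      exact h1.inter (c.isOpen_U.preimage (by fun_prop : Continuous fun e => (T e).2))
    nonempty_B := by
      obtain ⟨y, hy⟩ := c.nonempty_U
      exact ⟨T.symm (0, y), by simpa using hρ, by simpa using hy⟩
    bounded_B := by
      have h1 : Bornology.IsBounded (Metric.ball (0 : E D) ρ ×ˢ c.U) :=
        Metric.isBounded_ball.prod c.bounded_U
      refine (T.symm.lipschitz.isBounded_image h1).subset fun e he => ?_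
      exact ⟨T e, ⟨by simpa using he.1, he.2⟩, T.symm_apply_apply e⟩
    mem_B := fun e he => by
      refine ⟨mem_univ _, ?_⟩
      rw [zero_add]; exact he.2
    R := c.R
    R_pos := c.R_pos
    R_le := by rw [one_mul] }

theorem suspCompose_norm_le {Z' : StratSpace.{u}} [Nonempty Z.carrier] (c : EdgeChart Z Z') {ρ : ℝ}
    (hρ : 0 < ρ) (v : E (D + c.d)) : ‖(suspCompose D n c hρ).T v‖ ≤ ‖v‖ :=
  (exists_contraction (V := E D × E c.d) (D := D + c.d) (by simp)).choose_spec v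

theorem IterAtlas.nonempty_of_chart (A : IterAtlas Z) (i : Fin A.size) : Nonempty Z.carrier := by
  obtain ⟨y, hy⟩ := (A.chart i).nonempty_U
  exact ⟨(A.chart i).φ.symm (y, Cone.vertex)⟩

theorem exists_susp_atlas (A : IterAtlas Z) {D n : ℕ} (h : SuspDim D Z n) :
    ∃ B : IterAtlas (Susp D Z n), ∀ P : ∀ Z' : StratSpace.{u}, EdgeChart (Susp D Z n) Z' →
      IterAtlas Z' → Prop,
      (∀ K (hK : K + 1 = D) (σ : Split K D), P Z (σ.chart Z n hK) A) →
      (∀ (_ : Nonempty Z.carrier) i (ρ : ℝ) (hρ : 0 < ρ),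
        P (A.link i) (suspCompose D n (A.chart i) hρ).chart (A.sub i)) →
      ∀ i, P (B.link i) (B.chart i) (B.sub i) := by
  have := A.isAtlas.compact
  have := A.isAtlas.t2
  have : CompactSpace (Susp D Z n).carrier := inferInstanceAs (CompactSpace (Sus D Z.carrier))
  have : T2Space (Susp D Z n).carrier := inferInstanceAs (T2Space (Sus D Z.carrier))
  let J := {p : Σ K, Split K D // p.1 + 1 = D} ⊕ (Fin A.size × {ρ : ℝ // 0 < ρ})
  let Zf : J → StratSpace.{u} := fun j => match j with
    | .inl _ => Z
    | .inr p => A.link p.1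
  let cf : ∀ j : J, EdgeChart (Susp D Z n) (Zf j) := fun j => match j with
    | .inl p => p.1.2.chart Z n p.2
    | .inr p => haveI := A.nonempty_of_chart p.1
      (suspCompose D n (A.chart p.1) p.2.2).chart
  let Af : ∀ j : J, IterAtlas (Zf j) := fun j => match j with
    | .inl _ => A
    | .inr p => A.sub p.1
  have hcover : ∀ s, ∃ j, s ∈ (cf j).φ.source := by
    intro s
    rcases Susp.point_cases s with ⟨e, he, rfl⟩ | ⟨w, z, rfl⟩
    · have hD := Sus.pos_of_norm_eq_one he
      obtain ⟨σ, hσ⟩ := exists_split (K := D - 1) (by omega) he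
      refine ⟨.inl ⟨⟨D - 1, σ⟩, by simp only; omega⟩, ?_, ?_, ?_⟩
      · change 0 < inner ℝ σ.e e
        rw [hσ, real_inner_self_eq_norm_sq, he]; norm_num
      · change (inner ℝ σ.e e : ℝ)⁻¹ • σ.π e ∈ _
        rw [← hσ, σ.π_e, smul_zero]
        exact Metric.mem_ball_self one_pos
      · exact one_pos
    · obtain ⟨i, hi⟩ := A.isAtlas.cover z
      have hne := A.nonempty_of_chart i
      refine ⟨.inr (i, ⟨‖w‖ + 1, by positivity⟩), ?_⟩
      set δ := suspCompose D n (A.chart i) (by positivity : 0 < ‖w‖ + 1) with hδ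
      change _ ∈ δ.inv.target
      have hT := (A.chart i).mem_target.1 ((A.chart i).φ.map_source hi)
      set p := (A.chart i).φ z with hp
      have hq : (δ.T.symm (w, p.1), p.2) ∈ δ.inv.source := by
        rw [δ.inv_source]
        refine ⟨⟨?_, ?_⟩, hT.2⟩
        · change ‖(δ.T (δ.T.symm (w, p.1))).1‖ < ‖w‖ + 1
          rw [δ.T.apply_symm_apply]
          simp
        · change (δ.T (δ.T.symm (w, p.1))).2 ∈ _
          rw [δ.T.apply_symm_apply]
          exact hT.1
      have := δ.inv.map_source hq
      rw [δ.inv_apply] at this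
      have h1 : δ.o + δ.T (δ.T.symm (w, p.1)) = (w, p.1) := by
        rw [δ.T.apply_symm_apply]; exact zero_add _
      have h2 : Cone.dil δ.μ p.2 = p.2 := Cone.dil_one _
      simp only [h1, h2] at this
      rw [Prod.mk.eta, hp, (A.chart i).φ.left_inv hi] at this
      exact this
  have hlink : ∀ j, ((cf j).d = n ∧ IsEmpty (Zf j).carrier) ∨
      ((cf j).d + 1 + (Zf j).n = n ∧ Nonempty (Zf j).carrier) := by
    intro j
    rcases j with ⟨⟨K, σ⟩, hK⟩ | ⟨i, ρ, hρ⟩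
    · rcases h with ⟨h0, h⟩ | ⟨h0, h, -⟩
      · exact Or.inl ⟨by change K = n; simp only at hK; omega, h0⟩
      · exact Or.inr ⟨by change K + 1 + Z.n = n; simp only at hK; omega, h0⟩
    · have hne := A.nonempty_of_chart i
      rcases h with ⟨h0, h⟩ | ⟨-, h, -⟩
      · exact absurd hne (not_nonempty_iff.2 h0)
      · rcases A.isAtlas.link i with ⟨h1, h2⟩ | ⟨h1, h2⟩
        · exact Or.inl ⟨by change D + (A.chart i).d = n; omega, h2⟩
        · exact Or.inr ⟨by change D + (A.chart i).d + 1 + (A.link i).n = n; omega, h2⟩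
  obtain ⟨B, hB⟩ := exists_iterAtlas (X := Susp D Z n) (Susp.isManifold A.isAtlas.manifold)
    (Susp.dim_le A h) (Susp.dense_reg A h) (Susp.codim A h) Zf cf Af hcover hlink
  refine ⟨B, fun P h1 h2 => hB P fun j => ?_⟩
  rcases j with ⟨⟨K, σ⟩, hK⟩ | ⟨i, ρ, hρ⟩
  · exact h1 K hK σ
  · exact h2 _ i ρ hρ

end

/-! ### The metric of the tangent sphere -/

section proj

variable {F : Type*} [NormedAddCommGroup F]

/-- The conformal factor `1 / (1 + |x|²)`. -/
def cf (x : F) : ℝ := (1 + ‖x‖ ^ 2)⁻¹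

theorem cf_pos (x : F) : 0 < cf x := inv_pos.2 (by positivity)

theorem cf_le_one (x : F) : cf x ≤ 1 := inv_le_one_of_one_le₀ (by nlinarith [sq_nonneg ‖x‖])

theorem cf_mul (x : F) : cf x * (1 + ‖x‖ ^ 2) = 1 := inv_mul_cancel₀ (by positivity)

theorem cf_lower {x : F} {ρ : ℝ} (hx : ‖x‖ ≤ ρ) : (1 + ρ ^ 2)⁻¹ ≤ cf x := by
  have := norm_nonneg x
  unfold cf
  gcongr

theorem cf_sub (x y : F) : cf x - cf y = (‖y‖ ^ 2 - ‖x‖ ^ 2) * cf x * cf y := by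
  unfold cf
  field_simp
  ring

theorem norm_sq_sub_le {x y : F} {ρ : ℝ} (hx : ‖x‖ ≤ ρ) (hy : ‖y‖ ≤ ρ) :
    |‖y‖ ^ 2 - ‖x‖ ^ 2| ≤ 2 * ρ * ‖x - y‖ := by
  have h1 : ‖y‖ ^ 2 - ‖x‖ ^ 2 = (‖y‖ + ‖x‖) * (‖y‖ - ‖x‖) := by ring
  have h2 := abs_norm_sub_norm_le y x
  rw [norm_sub_rev] at h2
  have hx0 := norm_nonneg x
  have hy0 := norm_nonneg y
  rw [h1, abs_mul, abs_of_nonneg (by positivity)]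
  have : 0 ≤ ρ := hx0.trans hx
  gcongr
  linarith

theorem abs_cf_sub_le {x y : F} {ρ : ℝ} (hx : ‖x‖ ≤ ρ) (hy : ‖y‖ ≤ ρ) :
    |cf x - cf y| ≤ 2 * ρ * ‖x - y‖ * cf y := by
  have h1 := norm_sq_sub_le hx hy
  have hρ : 0 ≤ ρ := (norm_nonneg x).trans hx
  rw [cf_sub, abs_mul, abs_mul, abs_of_pos (cf_pos x), abs_of_pos (cf_pos y)]
  have h3 := (cf_pos y).le
  refine mul_le_mul_of_nonneg_right ?_ h3
  calc |‖y‖ ^ 2 - ‖x‖ ^ 2| * cf x ≤ |‖y‖ ^ 2 - ‖x‖ ^ 2| * 1 :=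
        mul_le_mul_of_nonneg_left (cf_le_one x) (abs_nonneg _)
    _ ≤ _ := by rwa [mul_one]

variable [InnerProductSpace ℝ F]

/-- The round metric in affine coordinates: `|v|² / (1 + |x|²) - ⟨x, v⟩² / (1 + |x|²)²`. -/
def roundForm (x : F) : QuadraticForm ℝ F :=
  cf x • LinearMap.BilinMap.toQuadraticMap (innerₗ F) -
    cf x ^ 2 • QuadraticMap.sq.comp (innerₗ F x)

theorem roundForm_apply (x v : F) :
    roundForm x v = cf x * ‖v‖ ^ 2 - cf x ^ 2 * inner ℝ x v ^ 2 := by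
  have h : inner ℝ v v = ‖v‖ ^ 2 := real_inner_self_eq_norm_sq v
  simp only [roundForm, sub_apply, smul_apply, smul_eq_mul,
    LinearMap.BilinMap.toQuadraticMap_apply, innerₗ_apply_apply, QuadraticMap.comp_apply,
    QuadraticMap.sq_apply, h]
  ring

theorem roundForm_lower (x v : F) : cf x ^ 2 * ‖v‖ ^ 2 ≤ roundForm x v := by
  rw [roundForm_apply]
  have h1 := abs_real_inner_le_norm x v
  have h2 : inner ℝ x v ^ 2 ≤ ‖x‖ ^ 2 * ‖v‖ ^ 2 := by
    rw [← mul_pow, ← sq_abs]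
    gcongr
  have h3 : cf x * ‖v‖ ^ 2 = cf x ^ 2 * ‖v‖ ^ 2 + cf x ^ 2 * (‖x‖ ^ 2 * ‖v‖ ^ 2) := by
    linear_combination (-cf x * ‖v‖ ^ 2) * cf_mul x
  have h4 : cf x ^ 2 * inner ℝ x v ^ 2 ≤ cf x ^ 2 * (‖x‖ ^ 2 * ‖v‖ ^ 2) := by gcongr
  linarith

theorem roundForm_nonneg (x v : F) : 0 ≤ roundForm x v :=
  le_trans (by positivity) (roundForm_lower x v)

theorem roundForm_upper (x v : F) : roundForm x v ≤ ‖v‖ ^ 2 := by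
  rw [roundForm_apply]
  have h1 : cf x * ‖v‖ ^ 2 ≤ 1 * ‖v‖ ^ 2 := by gcongr; exact cf_le_one x
  have h2 : 0 ≤ cf x ^ 2 * inner ℝ x v ^ 2 := by positivity
  linarith

theorem roundForm_sub_le {x y : F} {ρ : ℝ} (hx : ‖x‖ ≤ ρ) (hy : ‖y‖ ≤ ρ) (v : F) :
    |roundForm x v - roundForm y v| ≤ (4 * ρ + 4 * ρ ^ 3) * ‖x - y‖ * ‖v‖ ^ 2 := by
  have hρ : 0 ≤ ρ := (norm_nonneg x).trans hx
  set d := ‖x - y‖ with hd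
  have hd0 : 0 ≤ d := norm_nonneg _
  have hα : |cf x - cf y| ≤ 2 * ρ * d := by
    refine (abs_cf_sub_le hx hy).trans ?_
    have := cf_le_one y
    have h0 : 0 ≤ 2 * ρ * d := by positivity
    nlinarith
  have h1 : |inner ℝ x v| ≤ ρ * ‖v‖ := (abs_real_inner_le_norm x v).trans (by gcongr)
  have h2 : |inner ℝ y v| ≤ ρ * ‖v‖ := (abs_real_inner_le_norm y v).trans (by gcongr)
  have h3 : |inner ℝ x v - inner ℝ y v| ≤ d * ‖v‖ := by
    rw [← inner_sub_left]; exact abs_real_inner_le_norm _ _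
  set p : ℝ := inner ℝ x v
  set q : ℝ := inner ℝ y v
  have e : roundForm x v - roundForm y v = (cf x - cf y) * ‖v‖ ^ 2 -
      (cf x - cf y) * (cf x + cf y) * p ^ 2 - cf y ^ 2 * ((p - q) * (p + q)) := by
    rw [roundForm_apply, roundForm_apply]; ring
  have hc : |cf x + cf y| ≤ 2 := by
    rw [abs_of_pos (add_pos (cf_pos x) (cf_pos y))]
    linarith [cf_le_one x, cf_le_one y]
  have hy2 : |cf y ^ 2| ≤ 1 := by
    rw [abs_of_nonneg (by positivity)]
    exact pow_le_one₀ (cf_pos y).le (cf_le_one y)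
  have t1 : |(cf x - cf y) * ‖v‖ ^ 2| ≤ 2 * ρ * d * ‖v‖ ^ 2 := by
    rw [abs_mul, abs_of_nonneg (sq_nonneg ‖v‖)]; gcongr
  have t2 : |(cf x - cf y) * (cf x + cf y) * p ^ 2| ≤ 2 * ρ * d * 2 * (ρ * ‖v‖) ^ 2 := by
    rw [abs_mul, abs_mul, abs_pow]; gcongr
  have t3 : |cf y ^ 2 * ((p - q) * (p + q))| ≤ 1 * ((d * ‖v‖) * (2 * (ρ * ‖v‖))) := by
    rw [abs_mul, abs_mul]
    gcongr
    exact (abs_add_le p q).trans (by linarith)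
  rw [e]
  refine (abs_sub _ _).trans (le_trans (add_le_add ((abs_sub _ _).trans (add_le_add t1 t2)) t3) ?_)
  apply le_of_eq
  ring

/-- The derivative of a normalized vector: if `q = 1 / |(a, t)|`, then the differential of
`(q a, q t)` has norm squared `q² |(a', t')|² - q⁴ ⟨(a, t), (a', t')⟩²`. -/
theorem normalized_norm_sq (a a' : F) (t t' q q' : ℝ) (hq : q ^ 2 * (‖a‖ ^ 2 + t ^ 2) = 1)
    (hq' : q' = -(q ^ 3 * (inner ℝ a a' + t * t'))) :
    ‖q • a' + q' • a‖ ^ 2 + (q * t' + q' * t) ^ 2 =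
      q ^ 2 * (‖a'‖ ^ 2 + t' ^ 2) - q ^ 4 * (inner ℝ a a' + t * t') ^ 2 := by
  rw [norm_add_sq_real, norm_smul, norm_smul, inner_smul_left, inner_smul_right, mul_pow, mul_pow,
    Real.norm_eq_abs, Real.norm_eq_abs, sq_abs, sq_abs, real_inner_comm a a']
  simp only [conj_trivial]
  set s : ℝ := inner ℝ a a'
  rw [hq']
  linear_combination (q ^ 4 * (s + t * t') ^ 2) * hq

end proj

/-- The function `1 / √x` composed with a positive function. -/
theorem hasFDerivAt_inv_sqrt {W : Type*} [NormedAddCommGroup W] [NormedSpace ℝ W] {N : W → ℝ}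
    {N' : W →L[ℝ] ℝ} {w : W} (hN : HasFDerivAt N N' w) (h0 : 0 < N w) :
    HasFDerivAt (fun w => (√(N w))⁻¹) (-((√(N w))⁻¹ ^ 3 / 2) • N') w := by
  have h2 := (Real.sqrt_pos.2 h0).ne'
  have h1 := (hasDerivAt_inv h2).comp_hasFDerivAt w (hN.sqrt h0.ne')
  refine h1.congr_fderiv ?_
  rw [smul_smul]
  congr 1
  field_simp

section

variable {D : ℕ} {Z : StratSpace.{u}} {n : ℕ}

/-- The differential of the linear component, on the regular stratum. -/
def Susp.dv (s : (Susp D Z n).Stratum n) : E n →L[ℝ] E D :=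
  mfderiv 𝓘(ℝ, E n) 𝓘(ℝ, E D) (Susp.v : (Susp D Z n).Stratum n → E D) s

/-- The differential of the radial component, on the regular stratum. -/
def Susp.dr (s : (Susp D Z n).Stratum n) : E n →L[ℝ] ℝ :=
  mfderiv 𝓘(ℝ, E n) 𝓘(ℝ, ℝ) (Susp.r : (Susp D Z n).Stratum n → ℝ) s

/-- The differential of the component in `Z`, on the regular stratum. -/
def Susp.dz (h : D + Z.n = n) (s : (Susp D Z n).Stratum n) : E n →L[ℝ] E Z.n :=
  mfderiv 𝓘(ℝ, E n) 𝓘(ℝ, E Z.n) (Susp.z h : (Susp D Z n).Stratum n → Z.Reg) s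

/-- The metric `|dv|² + dr² + r² k` on the tangent sphere `{|v|² + r² = 1}`. -/
def suspMetric (D : ℕ) {Z : StratSpace.{u}} (n : ℕ) (k : Metric Z) : Metric (Susp D Z n) :=
  fun s : (Susp D Z n).Stratum n =>
  let q : QuadraticForm ℝ (E n) :=
    (LinearMap.BilinMap.toQuadraticMap (innerₗ (E D))).comp (Susp.dv s).toLinearMap +
      QuadraticMap.sq.comp (Susp.dr s).toLinearMap +
    if h : D + Z.n = n then
      Susp.r s ^ 2 • (k (Susp.z h s)).comp (Susp.dz h s).toLinearMap
    else 0
  q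

/-- The value of the `k`-part of the metric. -/
def linkPart (k : Metric Z) (s : (Susp D Z n).Stratum n) (ζ : D + Z.n = n → E Z.n) : ℝ :=
  if h : D + Z.n = n then Susp.r s ^ 2 * k (Susp.z h s) (ζ h) else 0

theorem suspMetric_apply (k : Metric Z) (s : (Susp D Z n).Stratum n) (ξ : E n) :
    suspMetric D n k s ξ = ‖Susp.dv s ξ‖ ^ 2 + Susp.dr s ξ ^ 2 +
      linkPart k s fun h => Susp.dz h s ξ := by
  rw [← real_inner_self_eq_norm_sq, pow_two]
  unfold linkPart suspMetric
  by_cases h : D + Z.n = n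
  · simp only [dif_pos h]
    rfl
  · simp only [dif_neg h]
    rfl

/-- The pull-back of the metric by a map into the regular stratum. -/
theorem suspMetric_comp {E₁ H₁ M₁ : Type*} [NormedAddCommGroup E₁] [NormedSpace ℝ E₁]
    [TopologicalSpace H₁] {I : ModelWithCorners ℝ E₁ H₁} [TopologicalSpace M₁] [ChartedSpace H₁ M₁]
    (k : Metric Z) {F : M₁ → (Susp D Z n).Stratum n} {p : M₁}
    (hF : MDifferentiableAt I 𝓘(ℝ, E n) F p) {v' : E₁ →L[ℝ] E D} {r' : E₁ →L[ℝ] ℝ}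
    {z' : ∀ _ : D + Z.n = n, E₁ →L[ℝ] E Z.n}
    (hv : HasMFDerivAt I 𝓘(ℝ, E D) (fun p => Susp.v (F p)) p v')
    (hr : HasMFDerivAt I 𝓘(ℝ, ℝ) (fun p => Susp.r (F p)) p r')
    (hz : ∀ h, HasMFDerivAt I 𝓘(ℝ, E Z.n) (fun p => Susp.z h (F p)) p (z' h)) (w : E₁) :
    suspMetric D n k (F p) ((mfderiv I 𝓘(ℝ, E n) F p : E₁ →L[ℝ] E n) w) =
      ‖v' w‖ ^ 2 + r' w ^ 2 + linkPart k (F p) fun h => z' h w := by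
  have ev : Susp.dv (F p) ((mfderiv I 𝓘(ℝ, E n) F p : E₁ →L[ℝ] E n) w) = v' w := by
    have h1 := ((Susp.contMDiff_v (F p)).mdifferentiableAt (by simp)).hasMFDerivAt.comp p
      hF.hasMFDerivAt
    exact congrArg (fun L : E₁ →L[ℝ] E D => L w) (hasMFDerivAt_unique h1 hv)
  have er : Susp.dr (F p) ((mfderiv I 𝓘(ℝ, E n) F p : E₁ →L[ℝ] E n) w) = r' w := by
    have h1 := ((Susp.contMDiff_r (F p)).mdifferentiableAt (by simp)).hasMFDerivAt.comp p
      hF.hasMFDerivAt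
    exact congrArg (fun L : E₁ →L[ℝ] ℝ => L w) (hasMFDerivAt_unique h1 hr)
  have ez : ∀ h, Susp.dz h (F p) ((mfderiv I 𝓘(ℝ, E n) F p : E₁ →L[ℝ] E n) w) = z' h w :=
    fun h => by
    have h1 := ((Susp.contMDiff_z h (F p)).mdifferentiableAt (by simp)).hasMFDerivAt.comp p
      hF.hasMFDerivAt
    exact congrArg (fun L : E₁ →L[ℝ] E Z.n => L w) (hasMFDerivAt_unique h1 (hz h))
  refine (suspMetric_apply k (F p) _).trans ?_
  rw [ev, er]
  simp only [ez]

theorem suspMetric_normalized {E₁ H₁ M₁ W : Type*} [NormedAddCommGroup E₁] [NormedSpace ℝ E₁]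
    [TopologicalSpace H₁] {I : ModelWithCorners ℝ E₁ H₁} [TopologicalSpace M₁] [ChartedSpace H₁ M₁]
    [NormedAddCommGroup W] [NormedSpace ℝ W]
    (k : Metric Z) {F : M₁ → (Susp D Z n).Stratum n} {p : M₁}
    (hF : MDifferentiableAt I 𝓘(ℝ, E n) F p) {π : M₁ → W} {π' : E₁ →L[ℝ] W}
    (hπ : HasMFDerivAt I 𝓘(ℝ, W) π p π') {f : W → E D} {t : W → ℝ} {f' : W →L[ℝ] E D}
    {t' : W →L[ℝ] ℝ} (hf : HasFDerivAt f f' (π p)) (ht : HasFDerivAt t t' (π p))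
    (hN : 0 < ‖f (π p)‖ ^ 2 + t (π p) ^ 2)
    (hv : ∀ᶠ p' in 𝓝 p, Susp.v (F p') = (√(‖f (π p')‖ ^ 2 + t (π p') ^ 2))⁻¹ • f (π p'))
    (hr : ∀ᶠ p' in 𝓝 p, Susp.r (F p') = (√(‖f (π p')‖ ^ 2 + t (π p') ^ 2))⁻¹ * t (π p'))
    {z' : ∀ _ : D + Z.n = n, E₁ →L[ℝ] E Z.n}
    (hz : ∀ h, HasMFDerivAt I 𝓘(ℝ, E Z.n) (fun p => Susp.z h (F p)) p (z' h)) (w : E₁) :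
    suspMetric D n k (F p) ((mfderiv I 𝓘(ℝ, E n) F p : E₁ →L[ℝ] E n) w) =
      (‖f (π p)‖ ^ 2 + t (π p) ^ 2)⁻¹ * (‖f' (π' w)‖ ^ 2 + t' (π' w) ^ 2) -
      (‖f (π p)‖ ^ 2 + t (π p) ^ 2)⁻¹ ^ 2 *
        (inner ℝ (f (π p)) (f' (π' w)) + t (π p) * t' (π' w)) ^ 2 +
      linkPart k (F p) fun h => z' h w := by
  set N : W → ℝ := fun x => ‖f x‖ ^ 2 + t x ^ 2 with hNdef
  have hN' : HasFDerivAt N (2 • (innerSL ℝ (f (π p))).comp f' + (2 * t (π p)) • t') (π p) := by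
    have h2 : HasFDerivAt (fun x => t x ^ 2) ((2 * t (π p)) • t') (π p) := by
      simpa using ht.pow 2
    exact hf.norm_sq.add h2
  have hq := hasFDerivAt_inv_sqrt hN' hN
  have hv' := ((hq.smul hf).hasMFDerivAt.comp p hπ).congr_of_eventuallyEq hv
  have hr' := ((hq.mul ht).hasMFDerivAt.comp p hπ).congr_of_eventuallyEq hr
  have hq2 : (√(N (π p)))⁻¹ ^ 2 = (N (π p))⁻¹ := by rw [inv_pow, Real.sq_sqrt hN.le]
  have key := normalized_norm_sq (f (π p)) (f' (π' w)) (t (π p)) (t' (π' w)) (√(N (π p)))⁻¹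
    (-((√(N (π p)))⁻¹ ^ 3 * (inner ℝ (f (π p)) (f' (π' w)) + t (π p) * t' (π' w))))
    (by rw [hq2]; exact inv_mul_cancel₀ hN.ne') rfl
  have e4 : (√(N (π p)))⁻¹ ^ 4 = (N (π p))⁻¹ ^ 2 := by rw [← hq2]; ring
  rw [hq2, e4] at key
  refine (suspMetric_comp k hF hv' hr' hz w).trans ?_
  rw [← key]
  have e1 : (-((√(N (π p)))⁻¹ ^ 3 / 2) • (2 • (innerSL ℝ (f (π p))).comp f' +
      (2 * t (π p)) • t')) (π' w) =
      -((√(N (π p)))⁻¹ ^ 3 * (inner ℝ (f (π p)) (f' (π' w)) + t (π p) * t' (π' w))) := by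
    simp only [smul_apply, add_apply, ContinuousLinearMap.comp_apply, innerSL_apply_apply,
      smul_eq_mul, nsmul_eq_mul]
    push_cast
    ring
  rw [← e1]
  congr 2
  exact congrArg (· ^ 2) (congrArg₂ (· + ·) rfl (mul_comm (t (π p)) _))

end

section

variable {D : ℕ} {Z : StratSpace.{u}} {n : ℕ}

theorem linkPart_of_eq (k : Metric Z) (s : (Susp D Z n).Stratum n) (ζ : D + Z.n = n → E Z.n)
    (h : D + Z.n = n) : linkPart k s ζ = Susp.r s ^ 2 * k (Susp.z h s) (ζ h) := dif_pos h

theorem linkPart_of_ne (k : Metric Z) (s : (Susp D Z n).Stratum n) (ζ : D + Z.n = n → E Z.n)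
    (h : D + Z.n ≠ n) : linkPart k s ζ = 0 := dif_neg h

/-- The metric of the tangent sphere in the coordinates `[w : 1 : z]`. -/
theorem suspProd_pull [Nonempty Z.carrier] (k : Metric Z) (h : D + Z.n = n)
    (hV : Module.finrank ℝ (E D) + Z.n = (Susp D Z n).n) :
    (suspProd D Z n).pull hV (suspMetric D n k) =
      warp (0 : E D →L[ℝ] E 0) roundForm cf k.lift := by
  funext w x
  ext ⟨w', ζ⟩
  have hF := (Susp.contMDiff_mk (Z := Z) (n := n) h (w, x)).mdifferentiableAt (by simp)
  have hf : HasFDerivAt (fun w : E D => w) (ContinuousLinearMap.id ℝ (E D)) w := hasFDerivAt_id w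
  have ht : HasFDerivAt (fun _ : E D => (1 : ℝ)) (0 : E D →L[ℝ] ℝ) w := hasFDerivAt_const 1 w
  have hs : ∀ p' : E D × Z.Reg, √(‖p'.1‖ ^ 2 + 1 ^ 2) = √(1 + ‖p'.1‖ ^ 2) := fun p' => by
    rw [one_pow, add_comm]
  have key := suspMetric_normalized (D := D) (n := n) k hF
    (hasMFDerivAt_fst (I := 𝓘(ℝ, E D)) (I' := 𝓘(ℝ, E Z.n)) (w, x)) hf ht (by positivity)
    (Eventually.of_forall fun p' => by rw [hs, Susp.v_mk])
    (Eventually.of_forall fun p' => by rw [hs, Susp.r_mk, mul_one])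
    (z' := fun _ => ContinuousLinearMap.snd ℝ (E D) (E Z.n))
    (fun h' => (hasMFDerivAt_snd (I := 𝓘(ℝ, E D)) (I' := 𝓘(ℝ, E Z.n)) (w, x)).congr_of_eventuallyEq
      (Eventually.of_forall fun p' => Susp.z_mk h' p')) (w', ζ)
  rw [linkPart_of_eq _ _ _ h, Susp.z_mk, Susp.r_mk] at key
  refine Eq.trans key ?_
  rw [warp_apply, roundForm_apply]
  have e1 : (‖w‖ ^ 2 + (1 : ℝ) ^ 2)⁻¹ = cf w := by rw [cf, one_pow, add_comm]
  have e2 : ((√(1 + ‖w‖ ^ 2))⁻¹ : ℝ) ^ 2 = cf w := by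
    rw [inv_pow, Real.sq_sqrt (by positivity), cf]
  have e3 : k.lift ((0 : E D →L[ℝ] E 0) w) x ((0 : E D →L[ℝ] E 0) w', ζ) = k x ζ := rfl
  simp only [e1, e2, e3]
  change cf w * (‖w'‖ ^ 2 + 0 ^ 2) - cf w ^ 2 * (inner ℝ w w' + 1 * 0) ^ 2 + cf w * k x ζ = _
  ring

variable {K : ℕ}

/-- The pair `(y, t)`, in the Euclidean product. -/
def euc (y : E K) (t : ℝ) : WithLp 2 (E K × ℝ) := WithLp.toLp 2 (y, t)

theorem norm_euc_sq (y : E K) (t : ℝ) : ‖euc y t‖ ^ 2 = ‖y‖ ^ 2 + t ^ 2 := by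
  rw [euc, WithLp.prod_norm_sq_eq_of_L2]
  simp

theorem inner_euc (y y' : E K) (t t' : ℝ) :
    inner ℝ (euc y t) (euc y' t') = inner ℝ y y' + t * t' := by
  simp [euc, WithLp.prod_inner_apply, mul_comm]

theorem euc_sub (y y' : E K) (t t' : ℝ) : euc y t - euc y' t' = euc (y - y') (t - t') := rfl

theorem euc_smul (s : ℝ) (y : E K) (t : ℝ) : s • euc y t = euc (s • y) (s * t) := rfl

theorem norm_euc_le (y : E K) (t : ℝ) : ‖euc y t‖ ≤ 2 * ‖(y, t)‖ := by
  have h := norm_euc_sq y t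
  have h1 := norm_fst_le (y, t)
  have h2 := norm_snd_le (y, t)
  simp only at h1 h2
  rw [Real.norm_eq_abs] at h2
  have h3 := sq_abs t
  refine abs_le_of_sq_le_sq' ?_ (by positivity) |>.2
  rw [h]
  nlinarith [norm_nonneg y, abs_nonneg t, norm_nonneg (y, t)]

theorem le_norm_euc (y : E K) (t : ℝ) : ‖(y, t)‖ ≤ ‖euc y t‖ := by
  have h := norm_euc_sq y t
  rw [Prod.norm_def]
  refine max_le ?_ ?_
  · refine abs_le_of_sq_le_sq' ?_ (norm_nonneg _) |>.2
    simp only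
    nlinarith [sq_nonneg t]
  · refine abs_le_of_sq_le_sq' ?_ (norm_nonneg _) |>.2
    simp only
    rw [Real.norm_eq_abs, sq_abs]
    nlinarith [sq_nonneg ‖y‖]

theorem roundForm_euc (y y' : E K) (t t' : ℝ) : roundForm (euc y t) (euc y' t') =
    cf (euc y t) * (‖y'‖ ^ 2 + t' ^ 2) - cf (euc y t) ^ 2 * (inner ℝ y y' + t * t') ^ 2 := by
  rw [roundForm_apply, norm_euc_sq, inner_euc]

/-- The metric of the tangent sphere in a gnomonic chart. -/
theorem gnomonic_pull (σ : Split K D) (hK : K + 1 = D) (k : Metric Z)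
    (h : K + 1 + Z.n = n) (b v₀ : E 0) (y : E K) {r : ℝ} (hr : 0 < r) (hr1 : r < 1)
    (hy : y ∈ Metric.ball (0 : E K) 1) (z : Z.Reg)
    (y' : E K) (t : ℝ) (ζ : E Z.n) :
    (σ.chart Z n hK).pull h (suspMetric D n k).lift b y r z (v₀, (y', (t, ζ))) =
      roundForm (euc y r) (euc y' t) + cf (euc y r) * r ^ 2 * k z ζ := by
  have hD : D + Z.n = n := by omega
  have hF := ((σ.chart Z n hK).param_diffeo h ⟨(y, (r, z)), hy, hr, hr1⟩).mdifferentiableAt (by simp)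
  let W := E K × ℝ
  have hπ : HasMFDerivAt (𝓘(ℝ, E K).prod (𝓘(ℝ, ℝ).prod 𝓘(ℝ, E Z.n))) 𝓘(ℝ, W)
      (fun p : E K × (ℝ × Z.Reg) => (p.1, p.2.1)) (y, (r, z))
      ((ContinuousLinearMap.fst ℝ (E K) (ℝ × E Z.n)).prod
        ((ContinuousLinearMap.fst ℝ ℝ (E Z.n)).comp
          (ContinuousLinearMap.snd ℝ (E K) (ℝ × E Z.n)))) := by
    have h1 := hasMFDerivAt_fst (I := 𝓘(ℝ, E K)) (I' := 𝓘(ℝ, ℝ).prod 𝓘(ℝ, E Z.n))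
      ((y, (r, z)) : E K × (ℝ × Z.Reg))
    have h2 := hasMFDerivAt_snd (I := 𝓘(ℝ, E K)) (I' := 𝓘(ℝ, ℝ).prod 𝓘(ℝ, E Z.n))
      ((y, (r, z)) : E K × (ℝ × Z.Reg))
    have h3 := (hasMFDerivAt_fst (I := 𝓘(ℝ, ℝ)) (I' := 𝓘(ℝ, E Z.n))
      ((r, z) : ℝ × Z.Reg)).comp ((y, (r, z)) : E K × (ℝ × Z.Reg)) h2
    have h4 := h1.prodMk h3
    rw [modelWithCornersSelf_prod, ← chartedSpaceSelf_prod]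
    exact h4
  have hf : HasFDerivAt (fun x : W => σ.e + σ.ι x.1)
      (σ.ι.toContinuousLinearMap.comp (ContinuousLinearMap.fst ℝ (E K) ℝ)) (y, r) :=
    (σ.ι.toContinuousLinearMap.hasFDerivAt.comp (y, r) hasFDerivAt_fst).const_add σ.e
  have ht : HasFDerivAt (fun x : W => x.2) (ContinuousLinearMap.snd ℝ (E K) ℝ) (y, r) :=
    hasFDerivAt_snd
  have hz : HasMFDerivAt (𝓘(ℝ, E K).prod (𝓘(ℝ, ℝ).prod 𝓘(ℝ, E Z.n))) 𝓘(ℝ, E Z.n)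
      (fun p : E K × (ℝ × Z.Reg) => p.2.2) (y, (r, z))
      ((ContinuousLinearMap.snd ℝ ℝ (E Z.n)).comp
          (ContinuousLinearMap.snd ℝ (E K) (ℝ × E Z.n))) :=
    (hasMFDerivAt_snd (I := 𝓘(ℝ, ℝ)) (I' := 𝓘(ℝ, E Z.n)) ((r, z) : ℝ × Z.Reg)).comp
      ((y, (r, z)) : E K × (ℝ × Z.Reg))
      (hasMFDerivAt_snd (I := 𝓘(ℝ, E K)) (I' := 𝓘(ℝ, ℝ).prod 𝓘(ℝ, E Z.n))
      ((y, (r, z)) : E K × (ℝ × Z.Reg)))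
  have hN : ∀ (y : E K) (r : ℝ), ‖σ.e + σ.ι y‖ ^ 2 + r ^ 2 = 1 + ‖euc y r‖ ^ 2 := fun y r => by
    rw [σ.norm_sq, norm_euc_sq]; ring
  have hsq : ∀ (y : E K) (r : ℝ), 0 < r → (√(1 + ‖r⁻¹ • (σ.e + σ.ι y)‖ ^ 2))⁻¹ =
      (√(‖σ.e + σ.ι y‖ ^ 2 + r ^ 2))⁻¹ * r := fun y r hr => by
    have : ‖σ.e + σ.ι y‖ ^ 2 + r ^ 2 = r ^ 2 * (1 + ‖r⁻¹ • (σ.e + σ.ι y)‖ ^ 2) := by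
      rw [norm_smul, norm_inv, Real.norm_of_nonneg hr.le]
      field_simp
      ring
    rw [this, Real.sqrt_mul (by positivity), Real.sqrt_sq hr.le, mul_inv, mul_right_comm,
      inv_mul_cancel₀ hr.ne', one_mul]
  have hpos : ∀ᶠ p' : E K × (ℝ × Z.Reg) in 𝓝 (y, (r, z)), 0 < p'.2.1 :=
    (continuous_fst.comp continuous_snd).continuousAt.eventually (lt_mem_nhds hr)
  have key := suspMetric_normalized (D := D) (n := n) k hF hπ hf ht
    (by rw [hN]; positivity)
    (hpos.mono fun p' hp => by
      change Susp.v (Susp.mk hD _) = _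
      rw [Susp.v_mk, hsq _ _ hp, smul_smul, mul_assoc, mul_inv_cancel₀ hp.ne', mul_one])
    (hpos.mono fun p' hp => by
      change Susp.r (Susp.mk hD _) = _
      rw [Susp.r_mk, hsq _ _ hp])
    (fun h' => hz.congr_of_eventuallyEq
      (Eventually.of_forall fun p' => Susp.z_mk h' _)) (y', (t, ζ))
  refine Eq.trans key ?_
  rw [linkPart_of_eq _ _ _ hD]
  have e1 : Susp.r ((σ.chart Z n hK).param h (y, (r, z))) ^ 2 = cf (euc y r) * r ^ 2 := by
    change Susp.r (Susp.mk hD _) ^ 2 = _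
    rw [Susp.r_mk, hsq _ _ hr, mul_pow, inv_pow, hN, Real.sq_sqrt (by positivity), cf]
  have e2 : Susp.z hD ((σ.chart Z n hK).param h (y, (r, z))) = z := Susp.z_mk hD _
  rw [e1, e2, roundForm_euc]
  have e3 : (‖σ.e + σ.ι y‖ ^ 2 + r ^ 2)⁻¹ = cf (euc y r) := by rw [hN, cf]
  simp only [e3]
  congr 1
  change cf (euc y r) * (‖σ.ι y'‖ ^ 2 + t ^ 2) - cf (euc y r) ^ 2 *
    (inner ℝ (σ.e + σ.ι y) (σ.ι y') + r * t) ^ 2 = _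
  rw [σ.ι.norm_map, σ.inner_map]

/-- The round metric in a gnomonic chart. -/
theorem gnomonic_pullTip (σ : Split K D) (hK : K + 1 = D) (k : Metric Z)
    (h : K = n) (b v₀ : E 0) (y : E K) (hy : y ∈ Metric.ball (0 : E K) 1) (y' : E K) :
    (σ.chart Z n hK).pullTip h (suspMetric D n k).lift b y (v₀, y') = roundForm y y' := by
  have hD : n + 1 = D := by omega
  have hF := ((σ.chart Z n hK).tip_diffeo h ⟨y, hy⟩).mdifferentiableAt (by simp)
  have hf : HasFDerivAt (fun x : E K => σ.e + σ.ι x) σ.ι.toContinuousLinearMap y :=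
    σ.ι.toContinuousLinearMap.hasFDerivAt.const_add σ.e
  have ht : HasFDerivAt (fun _ : E K => (0 : ℝ)) (0 : E K →L[ℝ] ℝ) y := hasFDerivAt_const 0 y
  have hn : ∀ x : E K, √(‖σ.e + σ.ι x‖ ^ 2 + 0 ^ 2) = ‖σ.e + σ.ι x‖ := fun x => by
    rw [zero_pow two_ne_zero, add_zero, Real.sqrt_sq (norm_nonneg _)]
  have key := suspMetric_normalized (D := D) (n := n) k hF
    (hasMFDerivAt_id y) hf ht (by rw [zero_pow two_ne_zero, add_zero, id, σ.norm_sq]; positivity)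
    (Eventually.of_forall fun p' => by
      change Susp.v (Susp.dir hD _) = _
      rw [Susp.v_dir hD (σ.ne_zero p'), id, hn])
    (Eventually.of_forall fun p' => by
      rw [mul_zero]; exact Susp.r_zero hD _)
    (z' := fun _ => 0) (fun h' => by omega) y'
  refine Eq.trans key ?_
  rw [linkPart_of_ne _ _ _ (by omega), roundForm_apply]
  have e : (‖σ.e + σ.ι y‖ ^ 2 + 0 ^ 2)⁻¹ = cf y := by
    rw [zero_pow two_ne_zero, add_zero, σ.norm_sq, cf]
  simp only [id, e]
  change cf y * (‖σ.ι y'‖ ^ 2 + 0 ^ 2) - cf y ^ 2 *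
    (inner ℝ (σ.e + σ.ι y) (σ.ι y') + 0 * 0) ^ 2 + 0 = _
  rw [σ.ι.norm_map, σ.inner_map]
  ring

end

section

variable {X : StratSpace.{u}}

theorem IsEdgeOn.congr {γ C : ℝ} (A : IterAtlas X) : ∀ {V : Type} [NormedAddCommGroup V]
    [NormedSpace ℝ V] {Q : Set V} {G G' : Tensor V X}, (∀ b ∈ Q, G b = G' b) →
    IsEdgeOn γ C A V Q G → IsEdgeOn γ C A V Q G' := by
  refine IterAtlas.ind (P := fun X A => ∀ {V : Type} [NormedAddCommGroup V]
    [NormedSpace ℝ V] {Q : Set V} {G G' : Tensor V X}, (∀ b ∈ Q, G b = G' b) →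
    IsEdgeOn γ C A V Q G → IsEdgeOn γ C A V Q G') ?_ A
  intro X A ih V _ _ Q G G' hG h
  rw [isEdgeOn_iff] at h ⊢
  refine ⟨fun b hb x => hG b hb ▸ h.1 b hb x, fun i => ?_⟩
  obtain ⟨H, a, k, h1, h2, h3, h4⟩ := h.2 i
  refine ⟨H, a, k, h1, h2, fun hd b hb y hy => ?_, fun hd b hb y hy r hr => ⟨fun z v => ?_, ?_⟩⟩
  · rw [← h3 hd b hb y hy]
    simp only [EdgeChart.pullTip, hG b hb]
  · have := (h4 hd b hb y hy r hr).1 z v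
    simp only [ConeChart.pull, hG b hb] at this ⊢
    exact this
  · refine ih i (fun u hu => ?_) (h4 hd b hb y hy r hr).2
    funext z
    simp only [ConeChart.rescale, ConeChart.pull, hG _ hu.2.1]

/-- Positivity of an edge metric follows from the conditions in the charts. -/
theorem isEdgeOn_of_charts {γ C : ℝ} (hC : 0 < C) (A : IterAtlas X) {V : Type}
    [NormedAddCommGroup V] [NormedSpace ℝ V] {Q : Set V} {G : Tensor V X}
    (h : ∀ i, ChartEdge γ C (A.chart i) (A.sub i) V Q G) : IsEdgeOn γ C A V Q G := by
  refine (isEdgeOn_iff A).2 ⟨fun b hb x => ?_, h⟩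
  obtain ⟨i, hi⟩ := A.reg_cases x
  obtain ⟨H, a, k, h1, h2, h3, h4⟩ := h i
  rcases hi with ⟨hd, -, y, hy, rfl⟩ | ⟨hd, y, hy, r, hr, z, rfl⟩
  · rintro ⟨v, ξ⟩ hv
    obtain ⟨w, rfl⟩ := (A.chart i).tip_mfderiv_surj hd hy ξ
    have e : G b ((A.chart i).tip hd y) (v, _) = H (b, y) (v, w) :=
      congrArg (fun q : QuadraticForm ℝ _ => q (v, w)) (h3 hd b hb y hy)
    refine lt_of_lt_of_eq ?_ e.symm
    have hne : (v, w) ≠ 0 := fun h0 => hv (by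
      obtain ⟨rfl, rfl⟩ := Prod.mk_eq_zero.1 h0
      exact Prod.ext rfl (map_zero (mfderiv 𝓘(ℝ, E (A.chart i).d) 𝓘(ℝ, E X.n)
        ((A.chart i).tip hd) y : E (A.chart i).d →L[ℝ] E X.n)))
    exact (by positivity : 0 < C⁻¹ * ‖(v, w)‖ ^ 2).trans_le ((h1 _ ⟨hb, hy⟩).1 (v, w)).1
  · rintro ⟨v, ξ⟩ hv
    obtain ⟨w, rfl⟩ := (A.chart i).param_mfderiv_surj hd hy hr z ξ
    have e := (A.chart i).pull_eq_rescale hd G b y hr.1 z v w.1 w.2.1 w.2.2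
    rw [ConeChart.pull_apply] at e
    refine lt_of_lt_of_eq ?_ e.symm
    refine mul_pos (pow_pos hr.1 2) (((isEdgeOn_iff _).1 (h4 hd b hb y hy r hr).2).1 0
      ((A.chart i).zero_mem_box hb hy hr) z _ fun h0 => hv ?_)
    have h5 : v = 0 ∧ w.1 = 0 ∧ w.2.1 = 0 ∧ w.2.2 = 0 := by
      simpa [Prod.mk_eq_zero, hr.1.ne', and_assoc] using h0
    have hw : w = 0 := Prod.ext h5.2.1 (Prod.ext h5.2.2.1 h5.2.2.2)
    obtain rfl := h5.1
    subst hw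
    exact Prod.ext rfl (map_zero (mfderiv (𝓘(ℝ, E (A.chart i).d).prod (𝓘(ℝ, ℝ).prod
      𝓘(ℝ, E (A.link i).n))) 𝓘(ℝ, E X.n) ((A.chart i).param hd) (y, (r, z)) :
        E (A.chart i).d × (ℝ × E (A.link i).n) →L[ℝ] E X.n))

theorem norm_pair_zero {W : Type*} [NormedAddCommGroup W] (v : E 0 × W) : ‖v‖ = ‖v.2‖ := by
  rw [Prod.norm_def, Subsingleton.elim v.1 0, norm_zero, max_eq_right (norm_nonneg _)]

/-- A composed chart of `M` satisfies the conditions on an edge metric, if the pull-back to the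
product does. -/
theorem ComposeData.chartEdge {M X Z : StratSpace.{u}} {V : Type} [NormedAddCommGroup V]
    [NormedSpace ℝ V] {Ψ : ProdChart M X V} {c : EdgeChart X Z} (δ : ComposeData Ψ c) {γ C : ℝ}
    (hγ : 0 < γ) (hγ1 : γ ≤ 1) (hC : 1 ≤ C) (hμ : δ.μ = 1) (ho : δ.o = 0)
    (hT : ∀ v, ‖δ.T v‖ ≤ ‖v‖) (A : IterAtlas Z) {Q : Set V} (hQ : ∀ e ∈ δ.B, (δ.T e).1 ∈ Q)
    (hV : Module.finrank ℝ V + X.n = M.n) {g : Metric M}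
    (hG : ChartEdge γ C c A V Q (Ψ.pull hV g)) :
    ∃ C' ≥ 1, ChartEdge γ C' δ.chart A (E 0) univ g.lift := by
  obtain ⟨c0, hc0, hTs⟩ : ∃ c0 ≥ (1 : ℝ), ∀ v, ‖v‖ ≤ c0 * ‖δ.T v‖ := by
    refine ⟨‖(δ.T.symm : (V × E c.d) →L[ℝ] E δ.D)‖ + 1, by simp, fun v => ?_⟩
    have h1 : ‖δ.T.symm (δ.T v)‖ ≤ ‖(δ.T.symm : (V × E c.d) →L[ℝ] E δ.D)‖ * ‖δ.T v‖ :=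
      (δ.T.symm : (V × E c.d) →L[ℝ] E δ.D).le_opNorm (δ.T v)
    rw [δ.T.symm_apply_apply] at h1
    nlinarith [norm_nonneg (δ.T v)]
  have hc02 : 1 ≤ c0 ^ 2 := one_le_pow₀ hc0
  obtain ⟨C₁, hC₁, hwarp⟩ := warp_edge hγ hγ1 A C (c0 ^ 2) hC hc02
  obtain ⟨H, a, k, h1, h2, h3, h4⟩ := hG
  have hmem : ∀ e ∈ δ.B, (δ.T e).1 ∈ Q ∧ (δ.T e).2 ∈ c.U := fun e he =>
    ⟨hQ e he, by have := (δ.mem_B e he).2; rwa [ho, zero_add] at this⟩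
  have hmem' : ∀ p ∈ (univ : Set (E 0)) ×ˢ δ.B, δ.T p.2 ∈ Q ×ˢ c.U := fun p hp => hmem _ hp.2
  set C' := C₁ + C * c0 ^ 2 with hC'
  have hCC : C ≤ C' := by nlinarith
  have hCC2 : C * c0 ^ 2 ≤ C' := by linarith
  have hC0 : 0 < C := by linarith
  have hinv : C'⁻¹ ≤ C⁻¹ := inv_anti₀ hC0 hCC
  have hdist : ∀ p p' : E 0 × E δ.D, ‖δ.T p.2 - δ.T p'.2‖ ≤ ‖p - p'‖ := fun p p' => by
    rw [← map_sub, norm_pair_zero (p - p')]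
    exact hT _
  refine ⟨C', by nlinarith, fun p => (H (δ.T p.2)).comp
    (δ.T.toLinearEquiv.toLinearMap ∘ₗ LinearMap.snd ℝ (E 0) (E δ.D)), fun p => a (δ.T p.2),
    fun p => k (δ.T p.2), fun p hp => ⟨fun v => ?_, ?_, ?_, ?_⟩, fun p hp p' hp' => ⟨fun v => ?_, ?_,
      fun z v => ?_⟩, fun h b _ y hy => ?_, fun h b _ y hy r hr => ⟨fun z => ?_, ?_⟩⟩
  · have h5 := (h1 _ (hmem' p hp)).1 (δ.T v.2)
    change C'⁻¹ * ‖v‖ ^ 2 ≤ H (δ.T p.2) (δ.T v.2) ∧ H (δ.T p.2) (δ.T v.2) ≤ C' * ‖v‖ ^ 2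
    rw [norm_pair_zero v]
    refine ⟨le_trans ?_ h5.1, h5.2.trans ?_⟩
    · rw [inv_mul_le_iff₀ (by linarith), ← mul_assoc, mul_comm C', ← div_eq_inv_mul]
      rw [div_mul_eq_mul_div, le_div_iff₀ hC0]
      calc ‖v.2‖ ^ 2 * C ≤ (c0 * ‖δ.T v.2‖) ^ 2 * C := by gcongr; exact hTs _
        _ = C * c0 ^ 2 * ‖δ.T v.2‖ ^ 2 := by ring
        _ ≤ _ := by gcongr
    · gcongr
      exact hT _
  · exact hinv.trans (h1 _ (hmem' p hp)).2.1
  · exact (h1 _ (hmem' p hp)).2.2.1.trans hCC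
  · exact IsEdgeOn.mono hC0 hCC _ (h1 _ (hmem' p hp)).2.2.2
  · refine ((h2 _ (hmem' p hp) _ (hmem' p' hp')).1 (δ.T v.2)).trans ?_
    rw [norm_pair_zero v]
    gcongr
    · exact hdist p p'
    · exact hT _
  · refine (h2 _ (hmem' p hp) _ (hmem' p' hp')).2.1.trans ?_
    gcongr
    exact hdist p p'
  · refine ((h2 _ (hmem' p hp) _ (hmem' p' hp')).2.2 z v).trans ?_
    have : 0 ≤ k (δ.T p'.2) z v := metric_zero_le (h1 _ (hmem' p' hp')).2.2.2 z v
    gcongr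
    exact hdist p p'
  · have hX : c.d = X.n := by have := δ.D_eq; change δ.D = _ at h; omega
    ext ⟨v₀, v⟩
    rw [δ.pullTip_eq hX hV h g hy, ho, zero_add, h3 hX _ (hmem y hy).1 _ (hmem y hy).2]
    rfl
  · have hX : c.d + 1 + Z.n = X.n := by have := δ.D_eq; change δ.D + _ + _ = _ at h; omega
    have hr' : r ∈ Ioo 0 c.R := by have := δ.mem_Ioo hr; rwa [hμ, one_mul] at this
    rintro ⟨v₀, v, t, ζ⟩
    rw [δ.pull_eq hX hV h g hy hr, ho, hμ, zero_add, one_mul, one_mul]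
    have h5 := (h4 hX _ (hmem y hy).1 _ (hmem y hy).2 r hr').1 z ((δ.T v).1, ((δ.T v).2, (t, ζ)))
    refine h5.trans (mul_le_mul_of_nonneg_right (mul_le_mul_of_nonneg_right hCC
      (Real.rpow_nonneg hr.1.le _)) ?_)
    have h6 := h1 _ (hmem y hy)
    exact model_nonneg (fun v => le_trans (by positivity) (h6.1 v).1)
      (le_trans (by positivity) h6.2.1) (fun v => metric_zero_le h6.2.2.2 z v) _
  · have hX : c.d + 1 + Z.n = X.n := by have := δ.D_eq; change δ.D + _ + _ = _ at h; omega
    have hr' : r ∈ Ioo 0 c.R := by have := δ.mem_Ioo hr; rwa [hμ, one_mul] at this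
    let L : E 0 × (E δ.D × ℝ) →L[ℝ] V × (E c.d × ℝ) :=
      (ContinuousLinearEquiv.prodAssoc ℝ V (E c.d) ℝ : _ →L[ℝ] _).comp
        (((δ.T : E δ.D →L[ℝ] V × E c.d).prodMap (ContinuousLinearMap.id ℝ ℝ)).comp
          (ContinuousLinearMap.snd ℝ (E 0) (E δ.D × ℝ)))
    have hL : ∀ u, L u = ((δ.T u.2.1).1, ((δ.T u.2.1).2, u.2.2)) := fun u => rfl
    have hLn : ∀ u, ‖L u‖ = max ‖δ.T u.2.1‖ ‖u.2.2‖ := fun u => by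
      rw [hL]; simp only [Prod.norm_def]; rw [max_assoc]
    have hn : ∀ u : E 0 × (E δ.D × ℝ), ‖u‖ = max ‖u.2.1‖ ‖u.2.2‖ := fun u => by
      rw [norm_pair_zero u, Prod.norm_def]
    have hLle : ∀ u, ‖L u‖ ≤ ‖u‖ := fun u => by
      rw [hLn, hn]; exact max_le_max (hT _) le_rfl
    have hw : WarpBound γ (c0 ^ 2) L (δ.chart.box univ b y r) (fun _ => 0) (fun _ => 1) := by
      refine ⟨hLle, by simp, fun w _ v => ?_, fun w _ v => ?_, fun w _ => inv_le_one_of_one_le₀ hc02,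
        fun _ _ => hc02, fun w _ w' _ v => ?_, fun w _ w' _ => ?_⟩
      · simpa using by positivity
      · have h6 : ‖v‖ ≤ c0 * ‖L v‖ := by
          rw [hLn, hn]
          refine max_le ((hTs _).trans (by gcongr; exact le_max_left _ _)) ?_
          nlinarith [le_max_right ‖δ.T v.2.1‖ ‖v.2.2‖, norm_nonneg v.2.2]
        rw [zero_apply, zero_add, inv_mul_le_iff₀ (by positivity), ← mul_pow]
        gcongr
      · simpa using by positivity
      · simpa using by positivity
    have hbox : ∀ u, u ∈ δ.chart.box univ b y r → L u ∈ c.box Q (δ.T y).1 (δ.T y).2 r := by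
      rintro u ⟨hu1, -, hu3, hu4⟩
      have h5 := hmem _ hu3
      rw [map_add, map_smul] at h5
      refine ⟨(hLle u).trans_lt hu1, h5.1, h5.2, hu4.trans_le ?_⟩
      have := δ.R_le; rwa [hμ, one_mul] at this
    have h5 := hwarp (V × (E c.d × ℝ)) (E 0 × (E δ.D × ℝ)) L (c.box Q (δ.T y).1 (δ.T y).2 r) (δ.chart.box univ b y r) hbox _ _ hw _
      (h4 hX _ (hmem y hy).1 _ (hmem y hy).2 r hr').2
    refine IsEdgeOn.mono (by linarith) (by nlinarith : C₁ ≤ C') _ (IsEdgeOn.congr _ (fun u hu => ?_) h5)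
    funext z
    ext ⟨w, ζ⟩
    rw [warp_apply, ConeChart.rescale_apply, zero_apply, zero_add, one_mul]
    rw [ConeChart.rescale_apply]
    have h7 : r * (1 + u.2.2) ∈ Ioo 0 δ.R := δ.chart.box_radius hr.1 hu
    rw [δ.pull_eq hX hV h g hu.2.2.1 h7, ho, hμ, zero_add, one_mul, one_mul, map_add, map_smul,
      map_smul]
    rfl

end

section

theorem le_mul_rpow {γ d s : ℝ} (hγ : 0 < γ) (hγ1 : γ ≤ 1) (hd : 0 ≤ d) (hs : 1 ≤ s) (hds : d ≤ s) :
    d ≤ s * d ^ γ := by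
  rcases hd.eq_or_lt with rfl | hd
  · rw [Real.zero_rpow hγ.ne', mul_zero]
  · rcases le_or_gt d 1 with h | h
    · have : d ≤ d ^ γ := by
        conv_lhs => rw [← Real.rpow_one d]
        exact Real.rpow_le_rpow_of_exponent_ge hd h hγ1
      nlinarith [Real.rpow_nonneg hd.le γ]
    · have := Real.one_le_rpow h.le hγ.le
      nlinarith

theorem cf_holder {F : Type*} [NormedAddCommGroup F] {γ ρ s : ℝ} (hγ : 0 < γ) (hγ1 : γ ≤ 1)
    (hs : 1 ≤ s) {x y : F} (hx : ‖x‖ ≤ ρ) (hy : ‖y‖ ≤ ρ) (hxy : ‖x - y‖ ≤ s) :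
    |cf x - cf y| ≤ 2 * ρ * s * ‖x - y‖ ^ γ * cf y := by
  have hρ : 0 ≤ ρ := (norm_nonneg x).trans hx
  refine (abs_cf_sub_le hx hy).trans ?_
  rw [mul_assoc _ s]
  have := (cf_pos y).le
  gcongr
  exact le_mul_rpow hγ hγ1 (norm_nonneg _) hs hxy

theorem cf_holder' {F : Type*} [NormedAddCommGroup F] {γ ρ s : ℝ} (hγ : 0 < γ) (hγ1 : γ ≤ 1)
    (hs : 1 ≤ s) {x y : F} (hx : ‖x‖ ≤ ρ) (hy : ‖y‖ ≤ ρ) (hxy : ‖x - y‖ ≤ s) :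
    |cf x - cf y| ≤ 2 * ρ * s * ‖x - y‖ ^ γ := by
  have hρ : 0 ≤ ρ := (norm_nonneg x).trans hx
  refine (cf_holder hγ hγ1 hs hx hy hxy).trans (mul_le_of_le_one_right ?_ (cf_le_one y))
  have := Real.rpow_nonneg (norm_nonneg (x - y)) γ
  positivity

variable {F : Type*} [NormedAddCommGroup F] [InnerProductSpace ℝ F]

theorem roundForm_holder {γ ρ s : ℝ} (hγ : 0 < γ) (hγ1 : γ ≤ 1) (hs : 1 ≤ s) {x y : F} (hx : ‖x‖ ≤ ρ)
    (hy : ‖y‖ ≤ ρ) (hxy : ‖x - y‖ ≤ s) (v : F) :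
    |roundForm x v - roundForm y v| ≤ (4 * ρ + 4 * ρ ^ 3) * s * ‖x - y‖ ^ γ * ‖v‖ ^ 2 := by
  have hρ : 0 ≤ ρ := (norm_nonneg x).trans hx
  refine (roundForm_sub_le hx hy v).trans ?_
  rw [mul_assoc _ s]
  gcongr
  exact le_mul_rpow hγ hγ1 (norm_nonneg _) hs hxy

theorem cf_sq_lower {x : F} {ρ : ℝ} (hx : ‖x‖ ≤ ρ) (v : F) :
    ((1 + ρ ^ 2) ^ 2)⁻¹ * ‖v‖ ^ 2 ≤ roundForm x v := by
  refine le_trans ?_ (roundForm_lower x v)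
  rw [← inv_pow]
  gcongr
  exact cf_lower hx

end

section

variable {D : ℕ} {Z : StratSpace.{u}} {n : ℕ} {K : ℕ}

/-- The coefficients of the metric of the tangent sphere on a ball, in affine coordinates. -/
theorem warpBound_round {γ ρ : ℝ} (hγ : 0 < γ) (hγ1 : γ ≤ 1) (hρ : 0 < ρ) : ∃ c ≥ 1,
    WarpBound γ c (0 : E D →L[ℝ] E 0) (Metric.ball 0 ρ) roundForm cf := by
  have hb : ∀ w ∈ Metric.ball (0 : E D) ρ, ‖w‖ ≤ ρ := fun w hw => (mem_ball_zero_iff.1 hw).le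
  have hd : ∀ w ∈ Metric.ball (0 : E D) ρ, ∀ w' ∈ Metric.ball (0 : E D) ρ, ‖w - w'‖ ≤ 1 + 2 * ρ :=
    fun w hw w' hw' => (norm_sub_le _ _).trans (by linarith [hb w hw, hb w' hw'])
  set c := (1 + ρ ^ 2) ^ 2 + (4 * ρ + 4 * ρ ^ 3) * (1 + 2 * ρ) + 2 * ρ * (1 + 2 * ρ) with hc
  have h0 : 0 ≤ (4 * ρ + 4 * ρ ^ 3) * (1 + 2 * ρ) := by positivity
  have h0' : 0 ≤ 2 * ρ * (1 + 2 * ρ) := by positivity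
  have hle : (1 + ρ ^ 2) ^ 2 ≤ c := by linarith
  have hle2 : 1 + ρ ^ 2 ≤ (1 + ρ ^ 2) ^ 2 := by nlinarith [sq_nonneg ρ]
  have h1 : 1 ≤ c := by nlinarith [sq_nonneg ρ]
  refine ⟨c, h1, ?_, fun w _ v => roundForm_nonneg w v, fun w _ v => ?_, fun w hw v => ?_,
    fun w hw => ?_, fun w _ => (cf_le_one w).trans h1, fun w hw w' hw' v => ?_,
    fun w hw w' hw' => ?_⟩
  · intro w; simp
  · nlinarith [roundForm_upper w v, sq_nonneg ‖v‖]
  · rw [zero_apply, norm_zero, zero_pow two_ne_zero, add_zero]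
    refine le_trans ?_ (cf_sq_lower (hb w hw) v)
    gcongr
  · exact (inv_anti₀ (by positivity) (hle2.trans hle)).trans (cf_lower (hb w hw))
  · refine (roundForm_holder hγ hγ1 (by linarith) (hb w hw) (hb w' hw') (hd w hw w' hw') v).trans ?_
    gcongr
    linarith [sq_nonneg (1 + ρ ^ 2)]
  · refine (cf_holder' hγ hγ1 (by linarith) (hb w hw) (hb w' hw') (hd w hw w' hw')).trans ?_
    have := Real.rpow_nonneg (norm_nonneg (w - w')) γ
    gcongr
    linarith [sq_nonneg (1 + ρ ^ 2)]

/-- The metric of the tangent sphere, in the charts induced from `Z`. -/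
theorem suspCompose_chartEdge {γ C : ℝ} (hγ : 0 < γ) (hγ1 : γ ≤ 1) (hC : 1 ≤ C) (A : IterAtlas Z)
    [Nonempty Z.carrier] (h : D + Z.n = n) {k : Metric Z} (hk : IsEdgeOn γ C A (E 0) univ k.lift)
    (i : Fin A.size) {ρ : ℝ} (hρ : 0 < ρ) : ∃ C' ≥ 1,
    ChartEdge γ C' (suspCompose D n (A.chart i) hρ).chart (A.sub i) (E 0) univ
      (suspMetric D n k).lift := by
  obtain ⟨c, hc, hw⟩ := warpBound_round (D := D) hγ hγ1 hρ
  obtain ⟨C₁, hC₁, hwarp⟩ := warp_edge hγ hγ1 A C c hC hc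
  have hV : Module.finrank ℝ (E D) + Z.n = (Susp D Z n).n := by
    rw [finrank_euclideanSpace_fin]; exact h
  have h1 := hwarp _ _ _ univ _ (mapsTo_univ _ _) _ _ hw _ hk
  rw [← suspProd_pull k h hV] at h1
  refine (suspCompose D n (A.chart i) hρ).chartEdge hγ hγ1 hC₁ rfl rfl
    (suspCompose_norm_le D n (A.chart i) hρ) (A.sub i) (Q := Metric.ball 0 ρ) (fun e he => ?_) hV
    (((isEdgeOn_iff A).1 h1).2 i)
  exact mem_ball_zero_iff.2 he.1

set_option maxHeartbeats 1000000 in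
/-- The coefficients of the metric of the tangent sphere, in a dilated gnomonic chart. -/
theorem warpBound_gnomonic {γ : ℝ} (hγ : 0 < γ) (hγ1 : γ ≤ 1) (y : E K) {r : ℝ} (hr : r ∈ Ioo 0 1)
    {Q : Set (E 0 × (E K × ℝ))} (hQ : ∀ u ∈ Q, ‖u‖ < 1 / 2 ∧ ‖y + r • u.2.1‖ < 1 ∧
      r * (1 + u.2.2) ∈ Ioo 0 1) :
    WarpBound γ 500 (0 : (E 0 × (E K × ℝ)) →L[ℝ] E 0) Q
      (fun u => (roundForm (euc (y + r • u.2.1) (r * (1 + u.2.2)))).comp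
        ((WithLp.linearEquiv 2 ℝ (E K × ℝ)).symm.toLinearMap ∘ₗ LinearMap.snd ℝ (E 0) (E K × ℝ)))
      (fun u => cf (euc (y + r • u.2.1) (r * (1 + u.2.2))) * (1 + u.2.2) ^ 2) := by
  let x : E 0 × (E K × ℝ) → WithLp 2 (E K × ℝ) := fun u => euc (y + r • u.2.1) (r * (1 + u.2.2))
  have hx : ∀ u ∈ Q, ‖x u‖ ≤ 2 := by
    rintro u hu
    obtain ⟨-, h1, h2⟩ := hQ u hu
    have h3 := norm_euc_sq (y + r • u.2.1) (r * (1 + u.2.2))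
    refine abs_le_of_sq_le_sq' ?_ (by norm_num) |>.2
    rw [h3]
    nlinarith [norm_nonneg (y + r • u.2.1), h2.1, h2.2]
  have hu2 : ∀ u ∈ Q, |u.2.2| ≤ 1 / 2 := fun u hu =>
    ((norm_snd_le u.2).trans (norm_snd_le u)).trans (hQ u hu).1.le
  have hsub : ∀ u u', x u - x u' = r • euc (u - u').2.1 (u - u').2.2 := fun u u' => by
    simp only [x, euc_sub, euc_smul]
    congr 1
    · rw [Prod.snd_sub, Prod.fst_sub, smul_sub]; abel
    · rw [Prod.snd_sub, Prod.snd_sub]; ring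
  have hd : ∀ u u', ‖x u - x u'‖ ≤ 2 * ‖u - u'‖ := fun u u' => by
    rw [hsub, norm_smul, Real.norm_of_nonneg hr.1.le]
    have := norm_euc_le (u - u').2.1 (u - u').2.2
    have h5 : ‖((u - u').2.1, (u - u').2.2)‖ = ‖u - u'‖ := (norm_pair_zero (u - u')).symm
    rw [h5] at this
    nlinarith [norm_nonneg (euc (u - u').2.1 (u - u').2.2), hr.1, hr.2]
  have hd1 : ∀ u ∈ Q, ∀ u' ∈ Q, ‖u - u'‖ ≤ 1 := fun u hu u' hu' =>
    (norm_sub_le _ _).trans (by linarith [(hQ u hu).1, (hQ u' hu').1])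
  have hd2 : ∀ u ∈ Q, ∀ u' ∈ Q, ‖x u - x u'‖ ≤ 2 * ‖u - u'‖ ^ γ := fun u hu u' hu' => by
    refine (hd u u').trans ?_
    have := le_mul_rpow hγ hγ1 (norm_nonneg (u - u')) le_rfl (hd1 u hu u' hu')
    linarith
  have hn : ∀ v : E 0 × (E K × ℝ), ‖v‖ ≤ ‖euc v.2.1 v.2.2‖ ∧ ‖euc v.2.1 v.2.2‖ ≤ 2 * ‖v‖ :=
    fun v => by
    rw [norm_pair_zero v]; exact ⟨le_norm_euc _ _, norm_euc_le _ _⟩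
  refine ⟨fun w => by simp, fun w _ v => roundForm_nonneg _ _, fun w _ v => ?_, fun w hw v => ?_,
    fun w hw => ?_, fun w hw => ?_, fun w hw w' hw' v => ?_, fun w hw w' hw' => ?_⟩
  · refine (roundForm_upper (x w) (euc v.2.1 v.2.2)).trans ?_
    nlinarith [hn v, norm_nonneg v, norm_nonneg (euc v.2.1 v.2.2)]
  · rw [zero_apply, norm_zero, zero_pow two_ne_zero, add_zero]
    refine le_trans ?_ (cf_sq_lower (hx w hw) (euc v.2.1 v.2.2))
    have := (hn v).1
    gcongr
    norm_num
  · have h1 := cf_lower (hx w hw)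
    have h2 := hu2 w hw
    rw [abs_le] at h2
    have h3 : (1 / 4 : ℝ) ≤ (1 + w.2.2) ^ 2 := by nlinarith
    have : (1 + 2 ^ 2 : ℝ)⁻¹ * (1 / 4) ≤ cf (x w) * (1 + w.2.2) ^ 2 := by
      have := (cf_pos (x w)).le
      gcongr
    exact le_trans (by norm_num) this
  · have h2 := hu2 w hw
    rw [abs_le] at h2
    have h3 : (1 + w.2.2) ^ 2 ≤ 4 := by nlinarith
    have := cf_le_one (x w)
    have := cf_pos (x w)
    change cf (x w) * _ ≤ _
    nlinarith
  · refine (roundForm_sub_le (hx w hw) (hx w' hw') (euc v.2.1 v.2.2)).trans ?_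
    have h1 := hd2 w hw w' hw'
    have h2 : ‖euc v.2.1 v.2.2‖ ^ 2 ≤ 4 * ‖v‖ ^ 2 := by
      nlinarith [hn v, norm_nonneg v, norm_nonneg (euc v.2.1 v.2.2)]
    have h3 := Real.rpow_nonneg (norm_nonneg (w - w')) γ
    calc (4 * 2 + 4 * 2 ^ 3) * ‖x w - x w'‖ * ‖euc v.2.1 v.2.2‖ ^ 2
        ≤ (4 * 2 + 4 * 2 ^ 3) * (2 * ‖w - w'‖ ^ γ) * (4 * ‖v‖ ^ 2) := by gcongr
      _ ≤ _ := by nlinarith [mul_nonneg h3 (sq_nonneg ‖v‖)]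
  · have h1 : |cf (x w) - cf (x w')| ≤ 2 * 2 * (2 * ‖w - w'‖ ^ γ) := by
      refine (abs_cf_sub_le (hx w hw) (hx w' hw')).trans ?_
      refine (mul_le_of_le_one_right (by positivity) (cf_le_one _)).trans ?_
      have := hd2 w hw w' hw'
      gcongr
    have h2 := hu2 w hw
    have h2' := hu2 w' hw'
    have h3 : |w.2.2 - w'.2.2| ≤ ‖w - w'‖ ^ γ := by
      refine le_trans ((norm_snd_le (w - w').2).trans (norm_snd_le (w - w'))) ?_
      have := le_mul_rpow hγ hγ1 (norm_nonneg (w - w')) le_rfl (hd1 w hw w' hw')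
      linarith
    have e : cf (x w) * (1 + w.2.2) ^ 2 - cf (x w') * (1 + w'.2.2) ^ 2 =
      (cf (x w) - cf (x w')) * (1 + w.2.2) ^ 2 +
        cf (x w') * ((2 + w.2.2 + w'.2.2) * (w.2.2 - w'.2.2)) := by ring
    change |cf (x w) * (1 + w.2.2) ^ 2 - cf (x w') * (1 + w'.2.2) ^ 2| ≤ _
    rw [e]
    refine (abs_add_le _ _).trans ?_
    rw [abs_mul, abs_mul, abs_mul, abs_of_pos (cf_pos (x w'))]
    rw [abs_le] at h2 h2'
    have h4 : |(1 + w.2.2) ^ 2| ≤ 4 := by rw [abs_of_nonneg (sq_nonneg _)]; nlinarith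
    have h5 : |2 + w.2.2 + w'.2.2| ≤ 3 := by rw [abs_le]; constructor <;> linarith
    have h6 := Real.rpow_nonneg (norm_nonneg (w - w')) γ
    calc _ ≤ 2 * 2 * (2 * ‖w - w'‖ ^ γ) * 4 + 1 * (3 * ‖w - w'‖ ^ γ) := by
          gcongr
          exact cf_le_one _
      _ ≤ _ := by nlinarith

/-- The metric of the tangent sphere, in the gnomonic charts. -/
theorem gnomonic_chartEdge {γ C : ℝ} (hγ : 0 < γ) (hγ1 : γ ≤ 1) (hC : 1 ≤ C) (A : IterAtlas Z)
    {k : Metric Z} (hk : IsEdgeOn γ C A (E 0) univ k.lift) (σ : Split K D) (hK : K + 1 = D) :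
    ∃ C' ≥ 1, ChartEdge γ C' (σ.chart Z n hK) A (E 0) univ (suspMetric D n k).lift := by
  obtain ⟨C₁, hC₁, hwarp⟩ := warp_edge hγ hγ1 A C 500 hC (by norm_num)
  have hC' : 1 ≤ C₁ + 500 := by linarith
  have hb : ∀ p ∈ (univ : Set (E 0)) ×ˢ Metric.ball (0 : E K) 1, ‖p.2‖ ≤ 1 := fun p hp =>
    (mem_ball_zero_iff.1 hp.2).le
  have hk0 : ∀ z ζ, 0 ≤ k z ζ := metric_zero_le hk
  have hinv : (C₁ + 500)⁻¹ ≤ 500⁻¹ := inv_anti₀ (by norm_num) (by linarith)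
  have hcf : ∀ p ∈ (univ : Set (E 0)) ×ˢ Metric.ball (0 : E K) 1, (1 / 2 : ℝ) ≤ cf p.2 :=
    fun p hp => le_trans (by norm_num) (cf_lower (hb p hp))
  have hd : ∀ p ∈ (univ : Set (E 0)) ×ˢ Metric.ball (0 : E K) 1,
      ∀ p' ∈ (univ : Set (E 0)) ×ˢ Metric.ball (0 : E K) 1, ‖p.2 - p'.2‖ ≤ 2 :=
    fun p hp p' hp' => (norm_sub_le _ _).trans (by linarith [hb p hp, hb p' hp'])
  have hn : ∀ p p' : E 0 × E K, ‖p - p'‖ = ‖p.2 - p'.2‖ := fun p p' => norm_pair_zero (p - p')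
  refine ⟨C₁ + 500, hC', fun p => (roundForm p.2).comp (LinearMap.snd ℝ (E 0) (E K)),
    fun p => cf p.2, fun p z => cf p.2 • k z, fun p hp => ⟨fun v => ?_, ?_, ?_, ?_⟩,
    fun p hp p' hp' => ⟨fun v => ?_, ?_, fun z ζ => ?_⟩, fun h b _ y hy => ?_,
    fun h b _ y hy r hr => ⟨fun z => ?_, ?_⟩⟩
  · change (C₁ + 500)⁻¹ * ‖v‖ ^ 2 ≤ roundForm p.2 v.2 ∧ roundForm p.2 v.2 ≤ (C₁ + 500) * ‖v‖ ^ 2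
    rw [norm_pair_zero v]
    have h1 := cf_sq_lower (hb p hp) v.2
    have h2 := roundForm_upper p.2 v.2
    constructor
    · nlinarith [sq_nonneg ‖v.2‖]
    · nlinarith [sq_nonneg ‖v.2‖]
  · linarith [hcf p hp]
  · exact (cf_le_one _).trans hC'
  · rw [warp_const_lift]
    refine IsEdgeOn.mono (by linarith) (by linarith : C₁ ≤ C₁ + 500) _
      (hwarp _ _ _ univ _ (mapsTo_univ _ _) _ _ (warpBound_const (by norm_num) ?_ ?_) _ hk)
    · linarith [hcf p hp]
    · linarith [cf_le_one p.2]
  · change |roundForm p.2 v.2 - roundForm p'.2 v.2| ≤ _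
    rw [norm_pair_zero v, hn]
    refine (roundForm_holder hγ hγ1 one_le_two (hb p hp) (hb p' hp') (hd p hp p' hp') _).trans ?_
    gcongr
    linarith
  · rw [hn]
    refine (cf_holder' hγ hγ1 one_le_two (hb p hp) (hb p' hp') (hd p hp p' hp')).trans ?_
    gcongr
    linarith
  · change |cf p.2 * k z ζ - cf p'.2 * k z ζ| ≤ (C₁ + 500) * ‖p - p'‖ ^ γ * (cf p'.2 * k z ζ)
    rw [hn, ← sub_mul, abs_mul, abs_of_nonneg (hk0 z ζ), ← mul_assoc]
    refine mul_le_mul_of_nonneg_right ?_ (hk0 z ζ)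
    refine (cf_holder hγ hγ1 one_le_two (hb p hp) (hb p' hp') (hd p hp p' hp')).trans ?_
    have := (cf_pos p'.2).le
    gcongr
    linarith
  · ext ⟨v₀, y'⟩
    exact gnomonic_pullTip σ hK k h b v₀ y hy y'
  · rintro ⟨v₀, y', t, ζ⟩
    have hr1 : r < 1 := hr.2
    refine le_of_eq_of_le (congrArg (fun s => |s - _|)
      (gnomonic_pull σ hK k h b v₀ y hr.1 hr1 hy z y' t ζ)) ?_
    have e : model ((roundForm y).comp (LinearMap.snd ℝ (E 0) (E K))) (cf y) r (cf y • k z)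
        (v₀, (y', (t, ζ))) = roundForm (euc y 0) (euc y' t) + cf (euc y 0) * r ^ 2 * k z ζ := by
      have e1 : cf (euc y 0) = cf y := by
        rw [cf, cf, norm_euc_sq]; simp
      rw [roundForm_euc, e1]
      change roundForm y y' + cf y * t ^ 2 + r ^ 2 * (cf y * k z ζ) = _
      rw [roundForm_apply]; ring
    rw [e]
    have hy1 : ‖y‖ ≤ 1 := (mem_ball_zero_iff.1 hy).le
    have hr0 := hr.1
    have n1 : ‖euc y r‖ ≤ 2 := by
      refine abs_le_of_sq_le_sq' ?_ (by norm_num) |>.2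
      rw [norm_euc_sq]; nlinarith [norm_nonneg y]
    have n0 : ‖euc y 0‖ ≤ 1 := by
      refine abs_le_of_sq_le_sq' ?_ (by norm_num) |>.2
      rw [norm_euc_sq]; nlinarith [norm_nonneg y]
    have nd : ‖euc y r - euc y 0‖ ≤ r ^ γ := by
      rw [euc_sub, sub_self, sub_zero]
      have : ‖euc (0 : E K) r‖ ≤ r := by
        refine abs_le_of_sq_le_sq' ?_ hr0.le |>.2
        rw [norm_euc_sq]; simp
      have h5 := le_mul_rpow hγ hγ1 hr0.le le_rfl hr1.le
      linarith
    have h1 := roundForm_sub_le n1 (n0.trans one_le_two) (euc y' t)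
    have h2 := abs_cf_sub_le n1 (n0.trans one_le_two)
    have h3 := cf_sq_lower n0 (euc y' t)
    have hw := mul_nonneg (sq_nonneg r) (hk0 z ζ)
    have hrγ := Real.rpow_nonneg hr0.le γ
    have e2 : roundForm (euc y r) (euc y' t) + cf (euc y r) * r ^ 2 * k z ζ -
        (roundForm (euc y 0) (euc y' t) + cf (euc y 0) * r ^ 2 * k z ζ) =
        (roundForm (euc y r) (euc y' t) - roundForm (euc y 0) (euc y' t)) +
        (cf (euc y r) - cf (euc y 0)) * (r ^ 2 * k z ζ) := by ring
    rw [e2]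
    refine (abs_add_le _ _).trans ?_
    rw [abs_mul _ (r ^ 2 * k z ζ), abs_of_nonneg hw]
    have h4 := roundForm_nonneg (euc y 0) (euc y' t)
    have h5 := (cf_pos (euc y 0)).le
    calc _ ≤ (4 * 2 + 4 * 2 ^ 3) * r ^ γ * (4 * roundForm (euc y 0) (euc y' t)) +
          2 * 2 * r ^ γ * cf (euc y 0) * (r ^ 2 * k z ζ) := by
          refine add_le_add (h1.trans ?_) (mul_le_mul_of_nonneg_right (h2.trans ?_) hw)
          · gcongr
            linarith
          · gcongr
      _ = 160 * (r ^ γ * roundForm (euc y 0) (euc y' t)) +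
          4 * (r ^ γ * (cf (euc y 0) * r ^ 2 * k z ζ)) := by ring
      _ ≤ (C₁ + 500) * (r ^ γ * roundForm (euc y 0) (euc y' t)) +
          (C₁ + 500) * (r ^ γ * (cf (euc y 0) * r ^ 2 * k z ζ)) := by
          have h6 : 0 ≤ r ^ γ * roundForm (euc y 0) (euc y' t) := mul_nonneg hrγ h4
          have h7 : 0 ≤ r ^ γ * (cf (euc y 0) * r ^ 2 * k z ζ) :=
            mul_nonneg hrγ (by rw [mul_assoc]; exact mul_nonneg h5 hw)
          gcongr <;> linarith
      _ = _ := by ring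
  · have h1 := hwarp _ _ _ univ _ (mapsTo_univ _ _) _ _
      (warpBound_gnomonic hγ hγ1 y hr (Q := (σ.chart Z n hK).box univ b y r) fun u hu =>
        ⟨hu.1, mem_ball_zero_iff.1 hu.2.2.1, (σ.chart Z n hK).box_radius hr.1 hu⟩) _ hk
    refine IsEdgeOn.mono (by linarith) (by linarith : C₁ ≤ C₁ + 500) _
      (IsEdgeOn.congr _ (fun u hu => ?_) h1)
    funext z
    ext ⟨w, ζ⟩
    have hr0 := hr.1.ne'
    have h2 := (σ.chart Z n hK).box_radius hr.1 hu
    have key := gnomonic_pull σ hK k h (b + r • u.1) (r • w.1) (y + r • u.2.1) h2.1 h2.2 hu.2.2.1 z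
      (r • w.2.1) (r * w.2.2) ζ
    refine Eq.symm (((σ.chart Z n hK).rescale_apply h _ b y r u z (w, ζ)).trans ?_)
    refine (congrArg (fun s => (r ^ 2)⁻¹ * s) key).trans ?_
    rw [warp_apply, ← euc_smul, QuadraticMap.map_smul]
    change _ = roundForm _ (euc w.2.1 w.2.2) + _ * k z ζ
    rw [smul_eq_mul]
    field_simp

/-- The metric of the tangent sphere is an iterated edge metric. -/
theorem exists_susp_edge {γ C : ℝ} (hγ : 0 < γ) (hγ1 : γ ≤ 1) (hC : 1 ≤ C) (A : IterAtlas Z)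
    (h : SuspDim D Z n) {k : Metric Z} (hk : IsEdgeOn γ C A (E 0) univ k.lift) :
    ∃ B : IterAtlas (Susp D Z n), IsIteratedEdge γ B (suspMetric D n k) := by
  obtain ⟨B, hB⟩ := exists_susp_atlas A h
  have h1 := hB (fun Z' c A' => ∃ C' ≥ 1, ChartEdge γ C' c A' (E 0) univ (suspMetric D n k).lift)
    (fun K hK σ => gnomonic_chartEdge hγ hγ1 hC A hk σ hK)
    (fun hne i ρ hρ => suspCompose_chartEdge hγ hγ1 hC A (by
      rcases h with ⟨h0, -⟩ | ⟨-, h, -⟩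
      · exact absurd hne (not_nonempty_iff.2 h0)
      · exact h) hk i hρ)
  choose Cf hCf hedge using h1
  have hle : ∀ i, Cf i ≤ 1 + ∑ j, Cf j := fun i => by
    have := Finset.single_le_sum (f := Cf) (fun j _ => zero_le_one.trans (hCf j)) (Finset.mem_univ i)
    linarith
  have hpos : 0 < 1 + ∑ j, Cf j := by
    have := Finset.sum_nonneg (f := Cf) (s := Finset.univ) (fun j _ => zero_le_one.trans (hCf j))
    linarith
  exact ⟨B, _, hpos, isEdgeOn_of_charts hpos B fun i =>
    (hedge i).mono (by linarith [hCf i]) (hle i)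
      fun V _ _ Q G => IsEdgeOn.mono (by linarith [hCf i]) (hle i) _⟩

end

/-! ### The geodesic distance -/

section

variable {X : StratSpace.{u}} (g : Metric X)

theorem segLength_le_lintegral {σ : ℝ → X.Reg}
    (hσ : ContMDiffOn 𝓘(ℝ, ℝ) 𝓘(ℝ, E X.n) 1 σ (Ioo 0 1))
    {x y : X.carrier} (h0 : Tendsto (fun t => (σ t).1) (𝓝[>] 0) (𝓝 x))
    (h1 : Tendsto (fun t => (σ t).1) (𝓝[<] 1) (𝓝 y)) : segLength g x y ≤ ∫⁻ t in Ioo (0 : ℝ) 1,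
      ENNReal.ofReal (√(g (σ t) (mfderiv 𝓘(ℝ, ℝ) 𝓘(ℝ, E X.n) σ t (1 : ℝ)))) := by
  unfold segLength
  exact iInf_le_of_le σ (iInf_le_of_le hσ (iInf_le_of_le h0 (iInf_le_of_le h1 le_rfl)))

theorem segLength_le {σ : ℝ → X.Reg} (hσ : ContMDiffOn 𝓘(ℝ, ℝ) 𝓘(ℝ, E X.n) 1 σ (Ioo 0 1))
    {x y : X.carrier} (h0 : Tendsto (fun t => (σ t).1) (𝓝[>] 0) (𝓝 x))
    (h1 : Tendsto (fun t => (σ t).1) (𝓝[<] 1) (𝓝 y)) {K : ℝ} (hK : 0 ≤ K)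
    (h : ∀ t ∈ Ioo (0 : ℝ) 1,
      g (σ t) ((mfderiv 𝓘(ℝ, ℝ) 𝓘(ℝ, E X.n) σ t : ℝ →L[ℝ] E X.n) 1) ≤ K ^ 2) :
    segLength g x y ≤ ENNReal.ofReal K := by
  refine (segLength_le_lintegral g hσ h0 h1).trans ?_
  refine (setLIntegral_mono' measurableSet_Ioo fun t ht => ENNReal.ofReal_le_ofReal
    (Real.sqrt_le_sqrt (h t ht))).trans ?_
  rw [Real.sqrt_sq hK]
  simp

/-- The length of a straight line in a parametrization of the regular set. -/
theorem segLength_line_le {W : Type*} [NormedAddCommGroup W] [NormedSpace ℝ W] {f : W → X.Reg}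
    {O : Set W} (hO : IsOpen O) (hf : ContMDiffOn 𝓘(ℝ, W) 𝓘(ℝ, E X.n) 1 f O) {w v : W}
    (hmem : ∀ t ∈ Ioo (0 : ℝ) 1, w + t • v ∈ O) {x y : X.carrier}
    (h0 : Tendsto (fun t : ℝ => (f (w + t • v)).1) (𝓝[>] 0) (𝓝 x))
    (h1 : Tendsto (fun t : ℝ => (f (w + t • v)).1) (𝓝[<] 1) (𝓝 y)) {K : ℝ} (hK : 0 ≤ K)
    (h : ∀ w ∈ O, g (f w) ((mfderiv 𝓘(ℝ, W) 𝓘(ℝ, E X.n) f w : W →L[ℝ] E X.n) v) ≤ K ^ 2) :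
    segLength g x y ≤ ENNReal.ofReal K := by
  have hl : ContDiff ℝ 1 fun t : ℝ => w + t • v := by fun_prop
  refine segLength_le g (hf.comp hl.contMDiff.contMDiffOn hmem) h0 h1 hK fun t ht => ?_
  have h2 : HasFDerivAt (fun t : ℝ => w + t • v) ((1 : ℝ →L[ℝ] ℝ).smulRight v) t :=
    (((hasDerivAt_id t).smul_const v).const_add w).hasFDerivAt.congr_fderiv (by ext; simp)
  have h3 := ((hf.contMDiffAt (hO.mem_nhds (hmem t ht))).mdifferentiableAt
    one_ne_zero).hasMFDerivAt.comp t h2.hasMFDerivAt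
  refine le_trans (le_of_eq ?_) (h _ (hmem t ht))
  have h4 : (mfderiv 𝓘(ℝ, ℝ) 𝓘(ℝ, E X.n) (f ∘ fun t : ℝ => w + t • v) t : ℝ →L[ℝ] E X.n) 1 =
      (mfderiv 𝓘(ℝ, W) 𝓘(ℝ, E X.n) f (w + t • v) : W →L[ℝ] E X.n)
        (((1 : ℝ →L[ℝ] ℝ).smulRight v) 1) :=
    congrArg (fun L : ℝ →L[ℝ] E X.n => L 1) h3.mfderiv
  rw [h4]
  simp

theorem segLength_symm_le (x y : X.carrier) : segLength g y x ≤ segLength g x y := by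
  refine le_iInf fun σ => le_iInf fun hσ => le_iInf fun h0 => le_iInf fun h1 => ?_
  have hr : ContDiff ℝ 1 fun t : ℝ => 1 - t := by fun_prop
  have hmaps : MapsTo (fun t : ℝ => 1 - t) (Ioo 0 1) (Ioo 0 1) := fun t ht =>
    ⟨by linarith [ht.2], by linarith [ht.1]⟩
  have l0 : Tendsto (fun t : ℝ => 1 - t) (𝓝[>] 0) (𝓝[<] 1) := by
    refine tendsto_nhdsWithin_of_tendsto_nhds_of_eventually_within _ ?_ ?_
    · exact (Continuous.tendsto' (by fun_prop) _ _ (by norm_num)).mono_left nhdsWithin_le_nhds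
    · filter_upwards [self_mem_nhdsWithin] with t ht
      exact sub_lt_self (1 : ℝ) (show 0 < t from ht)
  have l1 : Tendsto (fun t : ℝ => 1 - t) (𝓝[<] 1) (𝓝[>] 0) := by
    refine tendsto_nhdsWithin_of_tendsto_nhds_of_eventually_within _ ?_ ?_
    · exact (Continuous.tendsto' (by fun_prop) _ _ (by norm_num)).mono_left nhdsWithin_le_nhds
    · filter_upwards [self_mem_nhdsWithin] with t ht
      exact sub_pos.2 (show t < 1 from ht)
  refine (segLength_le_lintegral g (hσ.comp hr.contMDiff.contMDiffOn hmaps) (h1.comp l0)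
    (h0.comp l1)).trans (le_of_eq ?_)
  rw [← lintegral_indicator measurableSet_Ioo, ← lintegral_indicator measurableSet_Ioo,
    ← lintegral_sub_left_eq_self _ (1 : ℝ)]
  refine lintegral_congr fun t => ?_
  by_cases ht : t ∈ Ioo (0 : ℝ) 1
  · have ht' := hmaps ht
    rw [indicator_of_mem ht', indicator_of_mem ht]
    congr 2
    have h2 : HasFDerivAt (fun t : ℝ => 1 - t) (-1 : ℝ →L[ℝ] ℝ) (1 - t) :=
      ((hasDerivAt_id (1 - t)).const_sub 1).hasFDerivAt.congr_fderiv (by ext; simp)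
    have e : 1 - (1 - t) = t := by ring
    have hd : MDifferentiableAt 𝓘(ℝ, ℝ) 𝓘(ℝ, E X.n) σ (1 - (1 - t)) :=
      (hσ.contMDiffAt (Ioo_mem_nhds (e ▸ ht).1 (e ▸ ht).2)).mdifferentiableAt one_ne_zero
    have h3 := hd.hasMFDerivAt.comp (1 - t) h2.hasMFDerivAt
    have h4 : (mfderiv 𝓘(ℝ, ℝ) 𝓘(ℝ, E X.n) (fun t => σ (1 - t)) (1 - t) : ℝ →L[ℝ] E X.n) 1 =
        -(mfderiv 𝓘(ℝ, ℝ) 𝓘(ℝ, E X.n) σ (1 - (1 - t)) : ℝ →L[ℝ] E X.n) 1 := by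
      refine (congrArg (fun L : ℝ →L[ℝ] E X.n => L 1) h3.mfderiv).trans ?_
      change (mfderiv 𝓘(ℝ, ℝ) 𝓘(ℝ, E X.n) σ (1 - (1 - t)) : ℝ →L[ℝ] E X.n) (-1) = _
      rw [map_neg]
    have h5 : g (σ (1 - (1 - t))) ((mfderiv 𝓘(ℝ, ℝ) 𝓘(ℝ, E X.n) (fun t => σ (1 - t)) (1 - t) :
        ℝ →L[ℝ] E X.n) 1) = g (σ t) ((mfderiv 𝓘(ℝ, ℝ) 𝓘(ℝ, E X.n) σ t : ℝ →L[ℝ] E X.n) 1) := by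
      refine (congrArg (g _) h4).trans ((QuadraticMap.map_neg (g (σ (1 - (1 - t))))
        ((mfderiv 𝓘(ℝ, ℝ) 𝓘(ℝ, E X.n) σ (1 - (1 - t)) : ℝ →L[ℝ] E X.n) 1)).trans ?_)
      rw [e]
    exact h5
  · have ht' : 1 - t ∉ Ioo (0 : ℝ) 1 := fun h => ht (by simpa using hmaps h)
    rw [indicator_of_notMem ht', indicator_of_notMem ht]

theorem segLength_comm (x y : X.carrier) : segLength g x y = segLength g y x :=
  le_antisymm (segLength_symm_le g y x) (segLength_symm_le g x y)

theorem geodEDist_le_segLength (x y : X.carrier) : geodEDist g x y ≤ segLength g x y :=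
  iInf_le_of_le 1 (iInf_le_of_le (fun i => if i = 0 then x else y)
    (iInf_le_of_le rfl (iInf_le_of_le rfl (by simp))))

theorem geodEDist_self (x : X.carrier) : geodEDist g x x = 0 :=
  le_antisymm (iInf_le_of_le 0 (iInf_le_of_le (fun _ => x)
    (iInf_le_of_le rfl (iInf_le_of_le rfl (by simp))))) bot_le

theorem geodEDist_symm_le (x y : X.carrier) : geodEDist g y x ≤ geodEDist g x y := by
  refine le_iInf fun N => le_iInf fun p => le_iInf fun h0 => le_iInf fun h1 => ?_
  refine iInf_le_of_le N (iInf_le_of_le (fun i => p (N - i)) (iInf_le_of_le (by simpa using h1)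
    (iInf_le_of_le (by simpa using h0) ?_)))
  rw [← Finset.sum_range_reflect]
  refine le_of_eq (Finset.sum_congr rfl fun i hi => ?_)
  rw [Finset.mem_range] at hi
  simp only []
  rw [segLength_comm, show N - (N - 1 - i + 1) = i by omega, show N - (N - 1 - i) = i + 1 by omega]

theorem geodEDist_comm (x y : X.carrier) : geodEDist g x y = geodEDist g y x :=
  le_antisymm (geodEDist_symm_le g y x) (geodEDist_symm_le g x y)

theorem geodEDist_triangle (x y z : X.carrier) :
    geodEDist g x z ≤ geodEDist g x y + geodEDist g y z := by
  unfold geodEDist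
  simp only [ENNReal.iInf_add, ENNReal.add_iInf]
  refine le_iInf fun N' => le_iInf fun q => le_iInf fun hq0 => le_iInf fun hq1 =>
    le_iInf fun N => le_iInf fun p => le_iInf fun hp0 => le_iInf fun hp1 => ?_
  refine iInf_le_of_le (N + N') (iInf_le_of_le (fun i => if i ≤ N then p i else q (i - N))
    (iInf_le_of_le (by simpa using hp0) (iInf_le_of_le ?_ ?_)))
  · rcases Nat.eq_zero_or_pos N' with h | h
    · subst h; simp [hp1, ← hq1, hq0]
    · simp [h.ne', hq1]
  · rw [Finset.sum_range_add]
    refine le_of_eq (congrArg₂ (· + ·) (Finset.sum_congr rfl fun i hi => ?_)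
      (Finset.sum_congr rfl fun i _ => ?_))
    · rw [Finset.mem_range] at hi
      simp [hi.le, Nat.succ_le_of_lt hi]
    · rcases Nat.eq_zero_or_pos i with h | h
      · subst h; simp [hp1, hq0]
      · simp [h.ne', add_assoc]

end

theorem exists_add_lt_of_add_lt {a b : ℝ≥0∞} {s : ℝ} (h : a + b < ENNReal.ofReal s) :
    ∃ s₁ s₂ : ℝ, a < ENNReal.ofReal s₁ ∧ b < ENNReal.ofReal s₂ ∧ s₁ + s₂ ≤ s := by
  have hab := h.ne_top
  rw [ENNReal.add_ne_top] at hab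
  have hs : a.toReal + b.toReal < s := by
    rw [← ENNReal.toReal_add hab.1 hab.2]
    exact (ENNReal.lt_ofReal_iff_toReal_lt (ENNReal.add_ne_top.2 hab)).1 h
  refine ⟨a.toReal + (s - (a.toReal + b.toReal)) / 2, b.toReal + (s - (a.toReal + b.toReal)) / 2,
    ?_, ?_, by linarith⟩
  · rw [ENNReal.lt_ofReal_iff_toReal_lt hab.1]; linarith
  · rw [ENNReal.lt_ofReal_iff_toReal_lt hab.2]; linarith

section region

variable {X : StratSpace.{u}} {g : Metric X} {W : Type*} [NormedAddCommGroup W] [NormedSpace ℝ W]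

/-- The derivative of the restriction of `F` to the regular set. -/
def regDeriv (F : X.carrier → W) (x : X.Reg) : E X.n →L[ℝ] W :=
  mfderiv 𝓘(ℝ, E X.n) 𝓘(ℝ, W) (fun x : X.Reg => F x.1) x

/-- A function `F`, with bounded gradient on an open set `N`, controls the curves that start in `N`
and are too short to leave the set where `F` is small. -/
structure IsBarrier (g : Metric X) (F : X.carrier → W) (N : Set X.carrier) (K t₀ : ℝ) : Prop where
  isOpen : IsOpen N
  continuousOn : ContinuousOn F N
  smooth : ∀ x : X.Reg, x.1 ∈ N → ContMDiffAt 𝓘(ℝ, E X.n) 𝓘(ℝ, W) 1 (fun x : X.Reg => F x.1) x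
  grad : ∀ x : X.Reg, x.1 ∈ N → ∀ ξ : E X.n, ‖regDeriv F x ξ‖ ≤ K * √(g x ξ)
  isClosed : ∀ t < t₀, IsClosed {x | x ∈ N ∧ ‖F x‖ ≤ t}

namespace IsBarrier

variable {F : X.carrier → W} {N : Set X.carrier} {K t₀ : ℝ}

theorem le_on_Icc (hB : IsBarrier g F N K t₀) (hK : 0 ≤ K) {σ : ℝ → X.Reg}
    (hσ : ContMDiffOn 𝓘(ℝ, ℝ) 𝓘(ℝ, E X.n) 1 σ (Ioo 0 1)) {a b : ℝ} (ha : 0 < a) (hab : a ≤ b)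
    (hb : b < 1) (hN : ∀ t ∈ Icc a b, (σ t).1 ∈ N) {s : ℝ} (hs : 0 ≤ s)
    (hlen : ∫⁻ t in Ioo (0 : ℝ) 1, ENNReal.ofReal
      (√(g (σ t) (mfderiv 𝓘(ℝ, ℝ) 𝓘(ℝ, E X.n) σ t (1 : ℝ)))) ≤ ENNReal.ofReal s) :
    ‖F (σ b).1‖ ≤ ‖F (σ a).1‖ + K * s := by
  have hsub : ∀ t ∈ Icc a b, t ∈ Ioo (0 : ℝ) 1 := fun t ht => ⟨ha.trans_le ht.1, ht.2.trans_lt hb⟩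
  have hat : ∀ t ∈ Icc a b, ContMDiffAt 𝓘(ℝ, ℝ) 𝓘(ℝ, E X.n) 1 σ t := fun t ht =>
    hσ.contMDiffAt (Ioo_mem_nhds (hsub t ht).1 (hsub t ht).2)
  have hc : ContDiffOn ℝ 1 (fun t => F (σ t).1) (Icc a b) := fun t ht =>
    ((hB.smooth (σ t) (hN t ht)).comp t (hat t ht)).contDiffAt.contDiffWithinAt
  have h1 := enorm_sub_le_lintegral_deriv_of_contDiffOn_Icc hc hab
  have h2 : ∀ t ∈ Icc a b, ‖deriv (fun t => F (σ t).1) t‖ₑ ≤ ENNReal.ofReal K * ENNReal.ofReal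
      (√(g (σ t) (mfderiv 𝓘(ℝ, ℝ) 𝓘(ℝ, E X.n) σ t (1 : ℝ)))) := fun t ht => by
    have h3 := ((hB.smooth (σ t) (hN t ht)).mdifferentiableAt one_ne_zero).hasMFDerivAt.comp t
      ((hat t ht).mdifferentiableAt one_ne_zero).hasMFDerivAt
    have h4 : deriv (fun t => F (σ t).1) t = regDeriv F (σ t)
        ((mfderiv 𝓘(ℝ, ℝ) 𝓘(ℝ, E X.n) σ t : ℝ →L[ℝ] E X.n) 1) := by
      have h3' : HasFDerivAt (fun t => F (σ t).1) ((regDeriv F (σ t)).comp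
          (mfderiv 𝓘(ℝ, ℝ) 𝓘(ℝ, E X.n) σ t : ℝ →L[ℝ] E X.n)) t := h3.hasFDerivAt
      exact h3'.hasDerivAt.deriv
    rw [h4, ← ENNReal.ofReal_mul hK, ← ofReal_norm]
    exact ENNReal.ofReal_le_ofReal (hB.grad _ (hN t ht) _)
  have h5 : ‖F (σ b).1 - F (σ a).1‖ₑ ≤ ENNReal.ofReal (K * s) := by
    refine (h1.trans (setLIntegral_mono' measurableSet_Icc h2)).trans ?_
    rw [lintegral_const_mul' _ _ ENNReal.ofReal_ne_top, ENNReal.ofReal_mul hK]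
    gcongr
    exact (lintegral_mono_set hsub).trans hlen
  rw [← ofReal_norm, ENNReal.ofReal_le_ofReal_iff (by positivity)] at h5
  linarith [norm_sub_norm_le (F (σ b).1) (F (σ a).1)]

theorem stays_on_Icc (hB : IsBarrier g F N K t₀) (hK : 0 ≤ K) {σ : ℝ → X.Reg}
    (hσ : ContMDiffOn 𝓘(ℝ, ℝ) 𝓘(ℝ, E X.n) 1 σ (Ioo 0 1)) {a b : ℝ} (ha : 0 < a)
    (hb : b < 1) (hN : (σ a).1 ∈ N) {s : ℝ} (hs : 0 ≤ s)
    (hlen : ∫⁻ t in Ioo (0 : ℝ) 1, ENNReal.ofReal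
      (√(g (σ t) (mfderiv 𝓘(ℝ, ℝ) 𝓘(ℝ, E X.n) σ t (1 : ℝ)))) ≤ ENNReal.ofReal s)
    (ht : ‖F (σ a).1‖ + K * s < t₀) : ∀ t ∈ Icc a b, (σ t).1 ∈ N := by
  have hcont : ContinuousOn (fun t => (σ t).1) (Icc a b) := fun t ht =>
    (continuous_subtype_val.continuousAt.comp (hσ.contMDiffAt (Ioo_mem_nhds (ha.trans_le ht.1)
      (ht.2.trans_lt hb))).continuousAt).continuousWithinAt
  by_contra! hne
  set B := Icc a b ∩ (fun t => (σ t).1) ⁻¹' Nᶜ with hBdef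
  have hBc : IsCompact B := isCompact_Icc.of_isClosed_subset
    (hcont.preimage_isClosed_of_isClosed isClosed_Icc hB.isOpen.isClosed_compl) inter_subset_left
  obtain ⟨t, ht1, ht2⟩ := hne
  have hmem := hBc.sInf_mem ⟨t, ht1, ht2⟩
  set t' := sInf B with ht'
  have hlt : ∀ u ∈ Ico a t', (σ u).1 ∈ N := fun u hu => by
    by_contra hu'
    exact absurd (csInf_le hBc.bddBelow (⟨⟨hu.1, hu.2.le.trans hmem.1.2⟩, hu'⟩ : u ∈ B))
      (not_le.2 hu.2)
  have hat : a < t' := lt_of_le_of_ne hmem.1.1 fun h => hmem.2 (h ▸ hN)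
  have hcl := (hB.isClosed _ ht).closure_subset
  refine hmem.2 (hcl (mem_closure_of_tendsto (b := 𝓝[<] t') (f := fun t => (σ t).1) ?_ ?_)).1
  · exact (continuous_subtype_val.continuousAt.comp (hσ.contMDiffAt (Ioo_mem_nhds
      (ha.trans_le hmem.1.1) (hmem.1.2.trans_lt hb))).continuousAt).mono_left nhdsWithin_le_nhds
  · filter_upwards [Ioo_mem_nhdsLT hat] with u hu
    exact ⟨hlt u ⟨hu.1.le, hu.2⟩, hB.le_on_Icc hK hσ ha hu.1.le (hu.2.trans_le hmem.1.2 |>.trans hb)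
      (fun v hv => hlt v ⟨hv.1, hv.2.trans_lt hu.2⟩) hs hlen⟩

theorem segLength_lt (hB : IsBarrier g F N K t₀) (hK : 0 ≤ K) {x y : X.carrier} (hx : x ∈ N) {s : ℝ}
    (hs : segLength g x y < ENNReal.ofReal s) (ht : ‖F x‖ + K * s < t₀) :
    y ∈ N ∧ ‖F y‖ ≤ ‖F x‖ + K * s := by
  simp only [segLength, iInf_lt_iff] at hs
  obtain ⟨σ, hσ, h0, h1, hlen⟩ := hs
  have hs0 : 0 ≤ s := by
    by_contra h
    rw [ENNReal.ofReal_of_nonpos (by linarith)] at hlen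
    exact not_lt_bot hlen
  have hF0 : Tendsto (fun t => ‖F (σ t).1‖) (𝓝[>] 0) (𝓝 ‖F x‖) :=
    ((hB.continuousOn.continuousAt (hB.isOpen.mem_nhds hx)).tendsto.comp h0).norm
  have key : ∀ t, ‖F x‖ + K * s < t → t < t₀ → y ∈ N ∧ ‖F y‖ ≤ t := fun t ht1 ht2 => by
    refine (hB.isClosed t ht2).closure_subset (mem_closure_of_tendsto h1 ?_)
    obtain ⟨a, ⟨ha1, ha2⟩, ha3⟩ := (((h0.eventually (hB.isOpen.mem_nhds hx)).and
      (hF0.eventually (gt_mem_nhds (lt_sub_iff_add_lt.2 ht1)))).and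
      (Ioo_mem_nhdsGT (zero_lt_one (α := ℝ)))).exists
    rw [lt_sub_iff_add_lt] at ha2
    have hst : ∀ b < 1, ∀ u ∈ Icc a b, (σ u).1 ∈ N := fun b hb =>
      hB.stays_on_Icc hK hσ ha3.1 hb ha1 hs0 hlen.le (by linarith)
    filter_upwards [Ioo_mem_nhdsLT ha3.2] with b hb
    exact ⟨hst b hb.2 b ⟨hb.1.le, le_rfl⟩, (hB.le_on_Icc hK hσ ha3.1 hb.1.le hb.2 (hst b hb.2) hs0
      hlen.le).trans (by linarith)⟩
  refine ⟨(key ((‖F x‖ + K * s + t₀) / 2) (by linarith) (by linarith)).1,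
    le_of_forall_gt_imp_ge_of_dense fun t ht => ?_⟩
  rcases lt_or_ge t t₀ with h | h
  · exact (key t ht h).2
  · exact (key ((‖F x‖ + K * s + t₀) / 2) (by linarith) (by linarith)).2.trans (by linarith)

theorem geodEDist_lt (hB : IsBarrier g F N K t₀) (hK : 0 ≤ K) {x y : X.carrier} (hx : x ∈ N) {s : ℝ}
    (hs : geodEDist g x y < ENNReal.ofReal s) (ht : ‖F x‖ + K * s < t₀) :
    y ∈ N ∧ ‖F y‖ ≤ ‖F x‖ + K * s := by
  simp only [geodEDist, iInf_lt_iff] at hs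
  obtain ⟨n, p, rfl, rfl, hs⟩ := hs
  induction n generalizing s with
  | zero =>
    have : 0 < s := by simpa using hs
    exact ⟨hx, by nlinarith⟩
  | succ n ih =>
    rw [Finset.sum_range_succ] at hs
    obtain ⟨s₁, s₂, h1, h2, h3⟩ : ∃ s₁ s₂ : ℝ, ∑ i ∈ Finset.range n, segLength g (p i) (p (i + 1)) <
        ENNReal.ofReal s₁ ∧ segLength g (p n) (p (n + 1)) < ENNReal.ofReal s₂ ∧ s₁ + s₂ ≤ s := by
      obtain ⟨A, B, hA, hB', hAB⟩ := exists_add_lt_of_add_lt hs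
      exact ⟨A, B, hA, hB', hAB⟩
    have h4 : K * s₁ + K * s₂ ≤ K * s := by rw [← mul_add]; gcongr
    have h5 : 0 ≤ s₂ := by
      by_contra h
      rw [ENNReal.ofReal_of_nonpos (by linarith)] at h2
      exact not_lt_bot h2
    have h6 := ih (by nlinarith) h1
    have h7 := hB.segLength_lt hK h6.1 h2 (by linarith [h6.2])
    exact ⟨h7.1, by linarith [h6.2, h7.2]⟩

end IsBarrier

end region

/-! ### Normal charts -/

theorem exists_normal_form {W : Type*} [NormedAddCommGroup W] [NormedSpace ℝ W]
    [FiniteDimensional ℝ W] {D : ℕ} (hD : D = Module.finrank ℝ W) {H : QuadraticForm ℝ W}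
    (hH : H.PosDef) : ∃ T : E D ≃L[ℝ] W, ∀ e, H (T e) = ‖e‖ ^ 2 := by
  subst hD
  obtain ⟨w, ⟨f⟩⟩ := H.equivalent_weightedSumSquares
  have hf : ∀ x, H (f.symm x) = ∑ i, w i * (x i * x i) := fun x => by
    rw [f.symm.map_app x, QuadraticMap.weightedSumSquares_apply]
    rfl
  have hw : ∀ i, 0 < w i := fun i => by
    have h1 := hH (f.symm (Pi.single i 1)) fun h => by
      have h2 := congrArg f h
      have h3 : f (f.symm (Pi.single i 1)) = Pi.single i (1 : ℝ) := f.toLinearEquiv.apply_symm_apply _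
      rw [h3] at h2
      have h4 := congrFun (h2.trans f.toLinearEquiv.map_zero) i
      simp at h4
    rw [hf, Finset.sum_eq_single i] at h1
    · simpa using h1
    · intro j _ hj; simp [hj]
    · simp
  let T : E (Module.finrank ℝ W) ≃ₗ[ℝ] W := (WithLp.linearEquiv 2 ℝ (Fin (Module.finrank ℝ W) → ℝ)).trans
    ((LinearEquiv.piCongrRight fun i => LinearEquiv.smulOfNeZero ℝ ℝ (√(w i))⁻¹
      (inv_ne_zero (Real.sqrt_pos.2 (hw i)).ne')).trans f.symm.toLinearEquiv)
  refine ⟨T.toContinuousLinearEquiv, fun e => (hf _).trans ?_⟩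
  rw [EuclideanSpace.real_norm_sq_eq]
  refine Finset.sum_congr rfl fun i _ => ?_
  change w i * (((√(w i))⁻¹ * e i) * ((√(w i))⁻¹ * e i)) = _
  have h5 := Real.sq_sqrt (hw i).le
  have h6 := (Real.sqrt_pos.2 (hw i)).ne'
  field_simp
  rw [h5]

section

variable {M X Z : StratSpace.{u}} {V : Type} [NormedAddCommGroup V] [NormedSpace ℝ V]

/-- At the scale `σ`, the metric `g` is an edge metric in the product chart `Ψ`. -/
def ProdChart.IsEdgeAt (γ C : ℝ) (A : IterAtlas X) (Ψ : ProdChart M X V)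
    (hV : Module.finrank ℝ V + X.n = M.n) (g : Metric M) (σ : ℝ) : Prop :=
  IsEdgeOn γ C A V Ψ.P ((σ ^ 2)⁻¹ • Ψ.pull hV g)

theorem ProdChart.isEdgeAt_refl {γ C : ℝ} {A : IterAtlas M} {g : Metric M}
    (hg : IsEdgeOn γ C A (E 0) univ g.lift) (hV : Module.finrank ℝ (E 0) + M.n = M.n) :
    (ProdChart.refl M).IsEdgeAt γ C A hV g 1 := by
  rw [ProdChart.IsEdgeAt, ProdChart.refl_pull, one_pow, inv_one, one_smul]
  exact hg

theorem ConeChart.pull_smul (c : ConeChart X Z) (h : c.d + 1 + Z.n = X.n) (s : ℝ) (G : Tensor V X)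
    (b : V) (y : E c.d) (r : ℝ) (z : Z.Reg) (v : V × (E c.d × (ℝ × E Z.n))) :
    c.pull h (s • G) b y r z v = s * c.pull h G b y r z v := rfl

theorem ProdChart.IsEdgeAt.step [FiniteDimensional ℝ V] {γ C : ℝ} {A : IterAtlas X}
    {Ψ : ProdChart M X V} {hV : Module.finrank ℝ V + X.n = M.n} {g : Metric M} {σ : ℝ}
    (hE : Ψ.IsEdgeAt γ C A hV g σ) (i : Fin A.size) [Nonempty (A.link i).carrier]
    (h : (A.chart i).d + 1 + (A.link i).n = X.n) {b : V} (hb : b ∈ Ψ.P) {y : E (A.chart i).d}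
    (hy : y ∈ (A.chart i).U) {r : ℝ} (hr : r ∈ Ioo 0 (A.chart i).R)
    (hV' : Module.finrank ℝ (V × (E (A.chart i).d × ℝ)) + (A.link i).n = M.n) :
    (Ψ.step (A.chart i).toConeChart b y r hr.1).IsEdgeAt γ C (A.sub i) hV' g (σ * r) := by
  obtain ⟨H, a, k, h1, h2, h3, h4⟩ := ((isEdgeOn_iff A).1 hE).2 i
  refine IsEdgeOn.congr _ (fun u hu => ?_) (h4 h b hb y hy r hr).2
  funext z
  ext v
  have := Ψ.step_pull (A.chart i).toConeChart b y r hr.1 h hV hV' g hu z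
  change _ = ((σ * r) ^ 2)⁻¹ • (Ψ.step (A.chart i).toConeChart b y r hr.1).pull hV' g u z v
  rw [this, smul_apply, ConeChart.rescale_apply, ConeChart.rescale_apply, ConeChart.pull_smul]
  have := hr.1.ne'
  simp only [smul_eq_mul]
  field_simp

/-- In the chart `c`, the metric `g` is close to `|dy|² + dr² + r² k`, up to `η |(y, r)| ^ γ`. -/
structure IsNormal (γ η : ℝ) (c : EdgeChart M Z) (g : Metric M) (k : Metric Z) : Prop where
  link : (c.d = M.n ∧ IsEmpty Z.carrier) ∨ (c.d + 1 + Z.n = M.n ∧ Nonempty Z.carrier)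
  k_nonneg : ∀ z ζ, 0 ≤ k z ζ
  tip : ∀ h : c.d = M.n, ∀ y ∈ c.U, ∀ v : E c.d,
    |c.pullTip h g.lift 0 y (0, v) - ‖v‖ ^ 2| ≤ η * ‖y‖ ^ γ * ‖v‖ ^ 2
  param : ∀ h : c.d + 1 + Z.n = M.n, ∀ y ∈ c.U, ∀ r ∈ Ioo 0 c.R, ∀ (z : Z.Reg) (v : E c.d) (t : ℝ)
    (ζ : E Z.n), |c.pull h g.lift 0 y r z (0, (v, (t, ζ))) - (‖v‖ ^ 2 + t ^ 2 + r ^ 2 * k z ζ)| ≤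
      η * (max ‖y‖ r) ^ γ * (‖v‖ ^ 2 + t ^ 2 + r ^ 2 * k z ζ)
  small_U : ∀ y ∈ c.U, η * ‖y‖ ^ γ ≤ 1 / 4
  small_R : ∀ y ∈ c.U, ∀ r ∈ Ioo 0 c.R, η * (max ‖y‖ r) ^ γ ≤ 1 / 4

end

theorem abs_sub_le_of_close {A M₁ M₀ e₁ e : ℝ} (h1 : |A - M₁| ≤ e₁ * M₁) (h2 : |M₁ - M₀| ≤ e * M₀)
    (he1 : e₁ ≤ e) (he : e ≤ 1) (he0 : 0 ≤ e) (hM₁ : 0 ≤ M₁) (hM₀ : 0 ≤ M₀) :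
    |A - M₀| ≤ 3 * e * M₀ := by
  have h3 : M₁ ≤ 2 * M₀ := by
    have := (abs_le.1 h2).2
    nlinarith
  calc |A - M₀| ≤ |A - M₁| + |M₁ - M₀| := abs_sub_le _ _ _
    _ ≤ e * (2 * M₀) + e * M₀ := add_le_add (h1.trans (by gcongr)) h2
    _ = _ := by ring

section

variable {M X Z : StratSpace.{u}}

/-- The data of a normal chart about the point `(b, y)` of the stratum of a chart. -/
structure NormalAt (γ C C₁ η σ s : ℝ) {V : Type} [NormedAddCommGroup V] [NormedSpace ℝ V]
    (A : IterAtlas Z) (Ψ : ProdChart M X V) (g : Metric M) (c : EdgeChart X Z) (b : V)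
    (y : E c.d) extends ComposeData Ψ c where
  o_eq : o = (b, y)
  T_le : ∀ e, ‖T e‖ ≤ C / σ * ‖e‖
  μ_le : μ ≤ C / σ
  le_μ : 1 ≤ C * σ * μ
  B_eq : B = {e | ‖e‖ < s ∧ (b, y) + T e ∈ Ψ.P ×ˢ c.U}
  R_eq : R = min s (c.R / μ)
  k : Metric Z
  k_edge : IsEdgeOn γ C₁ A (E 0) univ k.lift
  normal : IsNormal γ (η / σ ^ γ) toComposeData.chart g k

set_option maxHeartbeats 1000000 in
theorem exists_normalAt {γ C : ℝ} (hγ : 0 < γ) (hγ1 : γ ≤ 1) (hC : 1 ≤ C) (A : IterAtlas Z) :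
    ∃ C₁ ≥ 1, ∃ η > 0, ∃ s₀ > 0, ∀ (M X : StratSpace.{u}) (V : Type) [NormedAddCommGroup V]
      [NormedSpace ℝ V] [FiniteDimensional ℝ V] (Ψ : ProdChart M X V)
      (hV : Module.finrank ℝ V + X.n = M.n) (g : Metric M) (σ : ℝ) (c : EdgeChart X Z), 0 < σ →
      ((c.d = X.n ∧ IsEmpty Z.carrier) ∨ (c.d + 1 + Z.n = X.n ∧ Nonempty Z.carrier)) →
      ChartEdge γ C c A V Ψ.P ((σ ^ 2)⁻¹ • Ψ.pull hV g) → ∀ b ∈ Ψ.P, ∀ y ∈ c.U, ∀ s > 0,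
      s ≤ s₀ * σ → Nonempty (NormalAt γ C C₁ η σ s A Ψ g c b y) := by
  obtain ⟨C₁, hC₁, hwarp⟩ := warp_edge hγ hγ1 A C C hC hC
  have hC0 : 0 < C := by linarith
  set η := 3 * C ^ 2 * C ^ γ with hη
  have hCγ : 0 < C ^ γ := Real.rpow_pos_of_pos hC0 _
  have hη0 : 0 < η := by positivity
  obtain ⟨s₀, hs₀, hsmall⟩ := exists_rpow_le hγ η (by norm_num : (0 : ℝ) < 1 / 4)
  refine ⟨C₁, hC₁, η, hη0, s₀, hs₀, ?_⟩
  intro M X V _ _ _ Ψ hV g σ c hσ hX hE b hb y hy s hs hsσ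
  obtain ⟨H, a, k, h1, h2, h3, h4⟩ := hE
  have hby : ((b, y) : V × E c.d) ∈ Ψ.P ×ˢ c.U := ⟨hb, hy⟩
  obtain ⟨hH, ha1, ha2, hk⟩ := h1 _ hby
  set H₀ := H (b, y)
  set a₀ := a (b, y)
  set k₀ := k (b, y)
  have ha0 : 0 < a₀ := (inv_pos.2 hC0).trans_le ha1
  have hpos : (σ ^ 2 • H₀).PosDef := fun v hv => by
    rw [smul_apply, smul_eq_mul]
    exact mul_pos (by positivity) ((by positivity : 0 < C⁻¹ * ‖v‖ ^ 2).trans_le (hH v).1)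
  obtain ⟨T, hT⟩ := exists_normal_form (D := Module.finrank ℝ V + c.d) (by simp) hpos
  have hT' : ∀ e, σ ^ 2 * H₀ (T e) = ‖e‖ ^ 2 := hT
  have hT1 : ∀ e, ‖T e‖ ≤ C / σ * ‖e‖ := fun e => by
    refine abs_le_of_sq_le_sq' ?_ (by positivity) |>.2
    rw [mul_pow, ← hT', div_pow]
    have h5 : ‖T e‖ ^ 2 ≤ C * H₀ (T e) := by
      rw [← inv_mul_le_iff₀ hC0]; exact (hH (T e)).1
    have h6 : 0 ≤ H₀ (T e) := le_trans (by positivity) (hH (T e)).1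
    calc ‖T e‖ ^ 2 ≤ C * H₀ (T e) := h5
      _ ≤ C ^ 2 * H₀ (T e) := by gcongr; nlinarith
      _ = _ := by field_simp
  set μ := (σ * √a₀)⁻¹ with hμ
  have hsq := Real.sq_sqrt ha0.le
  have hsqp := Real.sqrt_pos.2 ha0
  have hμ0 : 0 < μ := by positivity
  have hμ2 : σ ^ 2 * (a₀ * μ ^ 2) = 1 := by
    rw [hμ, inv_pow, mul_pow, hsq]; field_simp
  have hμ1 : μ ≤ C / σ := by
    rw [hμ, mul_inv, div_eq_inv_mul]
    gcongr
    refine inv_le_of_inv_le₀ hC0 (Real.le_sqrt_of_sq_le ?_)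
    exact le_trans (by nlinarith [inv_le_one_of_one_le₀ hC, inv_pos.2 hC0]) ha1
  have hμ3 : 1 ≤ C * σ * μ := by
    have : √a₀ ≤ C := Real.sqrt_le_iff.2 ⟨hC0.le, by nlinarith⟩
    rw [hμ, ← div_eq_mul_inv, le_div_iff₀ (by positivity)]
    nlinarith
  let δ : ComposeData Ψ c :=
    { D := Module.finrank ℝ V + c.d
      T := T
      o := (b, y)
      μ := μ
      μ_pos := hμ0
      B := {e | ‖e‖ < s ∧ (b, y) + T e ∈ Ψ.P ×ˢ c.U}
      isOpen_B := (isOpen_lt continuous_norm continuous_const).inter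
        ((Ψ.isOpen_P.prod c.isOpen_U).preimage (by fun_prop : Continuous fun e => (b, y) + T e))
      nonempty_B := ⟨0, by simpa using hs, by simpa using hby⟩
      bounded_B := Metric.isBounded_ball.subset fun e he => mem_ball_zero_iff.2 he.1
      mem_B := fun e he => he.2
      R := min s (c.R / μ)
      R_pos := lt_min hs (div_pos c.R_pos hμ0)
      R_le := by
        rw [mul_comm, ← le_div_iff₀ hμ0]; exact min_le_right _ _ }
  have hk₀ : ∀ z ζ, 0 ≤ k₀ z ζ := metric_zero_le hk
  have hσγ : 0 < σ ^ γ := Real.rpow_pos_of_pos hσ _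
  have hsmall' : ∀ m, 0 ≤ m → m ≤ s → η / σ ^ γ * m ^ γ ≤ 1 / 4 := fun m hm hms => by
    rw [div_mul_eq_mul_div, mul_div_assoc, ← Real.div_rpow hm hσ.le]
    exact hsmall _ (by positivity) ((div_le_iff₀ hσ).2 (hms.trans hsσ))
  have hq : ∀ m l, 0 ≤ m → 0 ≤ l → l ≤ C / σ * m → l ^ γ ≤ C ^ γ / σ ^ γ * m ^ γ :=
    fun m l hm hl h => by
    rw [← Real.div_rpow hC0.le hσ.le, ← Real.mul_rpow (by positivity) hm]
    exact Real.rpow_le_rpow hl h hγ.le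
  have hcomp : ∀ e ∈ δ.B, ∀ m, ‖e‖ ≤ m → (∀ v, |H ((b, y) + T e) v - H₀ v| ≤
      C ^ 2 * (C ^ γ / σ ^ γ * m ^ γ) * H₀ v) ∧ |a ((b, y) + T e) - a₀| ≤
      C ^ 2 * (C ^ γ / σ ^ γ * m ^ γ) * a₀ ∧ ∀ z, Close (C ^ 2 * (C ^ γ / σ ^ γ * m ^ γ))
        (k ((b, y) + T e) z) (k₀ z) := fun e he m hm => by
    obtain ⟨h5, h6, h7⟩ := h2 _ he.2 _ hby
    rw [add_sub_cancel_left] at h5 h6 h7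
    have hm0 : 0 ≤ m := (norm_nonneg e).trans hm
    have h8 := hq m ‖T e‖ hm0 (norm_nonneg _) ((hT1 e).trans (by gcongr))
    have h9 := Real.rpow_nonneg hm0 γ
    refine ⟨fun v => (h5 v).trans ?_, h6.trans ?_, fun z ζ => (h7 z ζ).trans ?_⟩
    · have h10 : ‖v‖ ^ 2 ≤ C * H₀ v := by rw [← inv_mul_le_iff₀ hC0]; exact (hH v).1
      calc _ ≤ C * (C ^ γ / σ ^ γ * m ^ γ) * (C * H₀ v) := by gcongr
        _ = _ := by ring
    · have h10 : 1 ≤ C * a₀ := by rw [← inv_mul_le_iff₀ hC0, mul_one]; exact ha1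
      calc C * ‖T e‖ ^ γ ≤ C * (C ^ γ / σ ^ γ * m ^ γ) * 1 := by rw [mul_one]; gcongr
        _ ≤ C * (C ^ γ / σ ^ γ * m ^ γ) * (C * a₀) := by gcongr
        _ = _ := by ring
    · have h10 := hk₀ z ζ
      gcongr
      nlinarith
  have hN : IsNormal γ (η / σ ^ γ) δ.chart g fun z => a₀⁻¹ • k₀ z := by
    refine ⟨?_, fun z ζ => mul_nonneg (inv_nonneg.2 ha0.le) (hk₀ z ζ), fun h e he v => ?_,
      fun h e he r hr z v t ζ => ?_, fun e he => hsmall' _ (norm_nonneg _) he.1.le, fun e he r hr =>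
      hsmall' _ (le_max_of_le_left (norm_nonneg _)) (max_le he.1.le (hr.2.le.trans (min_le_left _ _)))⟩
    · rcases hX with ⟨h5, h6⟩ | ⟨h5, h6⟩
      · exact Or.inl ⟨by change Module.finrank ℝ V + c.d = _; omega, h6⟩
      · exact Or.inr ⟨by change Module.finrank ℝ V + c.d + 1 + _ = _; omega, h6⟩
    · have hX' : c.d = X.n := by change Module.finrank ℝ V + c.d = _ at h; omega
      have e1 : δ.chart.pullTip h g.lift 0 e (0, v) = σ ^ 2 * H ((b, y) + T e) (T v) := by
        rw [δ.pullTip_eq hX' hV h g he]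
        have h5 := congrArg (fun q : QuadraticForm ℝ _ => q (T v)) (h3 hX' _ he.2.1 _ he.2.2)
        have h6 : H ((b, y) + T e) (T v) = (σ ^ 2)⁻¹ * c.pullTip hX' (Ψ.pull hV g)
          ((b, y) + T e).1 ((b, y) + T e).2 (T v) := h5.symm
        rw [h6, mul_inv_cancel_left₀ (by positivity)]
      rw [e1, ← hT', ← mul_sub, abs_mul, abs_of_nonneg (sq_nonneg σ)]
      have h6 := (hcomp e he _ le_rfl).1 (T v)
      have h7 : 0 ≤ H₀ (T v) := le_trans (by positivity) (hH (T v)).1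
      have h8 := Real.rpow_nonneg (norm_nonneg e) γ
      calc _ ≤ σ ^ 2 * (C ^ 2 * (C ^ γ / σ ^ γ * ‖e‖ ^ γ) * H₀ (T v)) := by gcongr
        _ = 1 * (C ^ 2 * C ^ γ * (‖e‖ ^ γ / σ ^ γ * (σ ^ 2 * H₀ (T v)))) := by ring
        _ ≤ 3 * (C ^ 2 * C ^ γ * (‖e‖ ^ γ / σ ^ γ * (σ ^ 2 * H₀ (T v)))) := by gcongr; norm_num
        _ = _ := by rw [hη]; ring
    · have hX' : c.d + 1 + Z.n = X.n := by
        change Module.finrank ℝ V + c.d + 1 + _ = _ at h; omega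
      set m := max ‖e‖ r with hm
      have hm0 : 0 ≤ m := le_max_of_le_left (norm_nonneg _)
      have hr' : μ * r ∈ Ioo 0 c.R := δ.mem_Ioo hr
      set w : V × (E c.d × (ℝ × E Z.n)) := ((T v).1, ((T v).2, (μ * t, ζ))) with hw
      set p := (b, y) + T e with hp
      set Am := c.pull hX' ((σ ^ 2)⁻¹ • Ψ.pull hV g) p.1 p.2 (μ * r) z w with hAm
      have e1 : δ.chart.pull h g.lift 0 e r z (0, (v, (t, ζ))) = σ ^ 2 * Am := by
        rw [δ.pull_eq hX' hV h g he hr, hAm, ConeChart.pull_smul,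
          mul_inv_cancel_left₀ (by positivity)]
      set M₀ := model H₀ a₀ (μ * r) (k₀ z) w with hM₀
      have e2 : σ ^ 2 * M₀ = ‖v‖ ^ 2 + t ^ 2 + r ^ 2 * (a₀⁻¹ • k₀ z) ζ := by
        have e3 : σ ^ 2 * μ ^ 2 = a₀⁻¹ := by
          field_simp
          linarith
        rw [hM₀, model, smul_apply, smul_eq_mul, ← e3]
        simp only [hw, Prod.mk.eta]
        have h5 := hT' v
        linear_combination h5 + t ^ 2 * hμ2
      have h5 := (h4 hX' p.1 he.2.1 p.2 he.2.2 (μ * r) hr').1 z w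
      obtain ⟨h6, h7, h8⟩ := hcomp e he m (le_max_left _ _)
      have h9 := model_close (r := μ * r) h6 h7 (h8 z) w
      have hM0 : 0 ≤ M₀ := model_nonneg (fun v => le_trans (by positivity) (hH v).1) ha0.le
        (hk₀ z) w
      have h10 := hq m (μ * r) hm0 hr'.1.le (mul_le_mul hμ1 (le_max_right _ _) hr.1.le
        (by positivity))
      have hmγ := Real.rpow_nonneg hm0 γ
      set q := C ^ γ / σ ^ γ * m ^ γ with hq'
      have hq0 : 0 ≤ q := by positivity
      have hηq : η / σ ^ γ * m ^ γ = 3 * C ^ 2 * q := by rw [hη, hq']; ring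
      have hq4 : 3 * C ^ 2 * q ≤ 1 / 4 := by
        rw [← hηq]
        exact hsmall' m hm0 (max_le he.1.le (hr.2.le.trans (min_le_left _ _)))
      rw [e1, ← e2, ← mul_sub, abs_mul, abs_of_nonneg (sq_nonneg σ), hηq]
      set M₁ := model (H p) (a p) (μ * r) (k p z) w with hM₁
      change |Am - M₁| ≤ _ at h5
      change |M₁ - M₀| ≤ C ^ 2 * q * M₀ at h9
      have h13 := model_nonneg (r := μ * r) (fun v => le_trans (by positivity) ((h1 p he.2).1 v).1)
        (le_trans (by positivity) (h1 p he.2).2.1) (metric_zero_le (h1 p he.2).2.2.2 z) w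
      have h14 : C ^ 2 * q ≤ 1 := by linarith
      have h15 : C * (μ * r) ^ γ ≤ C ^ 2 * q := by
        calc C * (μ * r) ^ γ ≤ C * (C * q) := by
              gcongr
              nlinarith
          _ = _ := by ring
      have h12 := abs_sub_le_of_close h5 h9 h15 h14 (by positivity) h13 hM0
      rw [← mul_assoc] at h12
      calc σ ^ 2 * |Am - M₀| ≤ σ ^ 2 * (3 * C ^ 2 * q * M₀) := by gcongr
        _ = _ := by ring
  refine ⟨{ toComposeData := δ, o_eq := rfl, T_le := hT1, μ_le := hμ1, le_μ := hμ3,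
            B_eq := rfl, R_eq := rfl, k := fun z => a₀⁻¹ • k₀ z, k_edge := ?_, normal := hN }⟩
  rw [warp_const_lift]
  refine hwarp _ _ _ univ _ (mapsTo_univ _ _) _ _
    (warpBound_const hC (inv_anti₀ ha0 ha2) (inv_le_of_inv_le₀ hC0 ha1)) _ hk

end

/-! ### The geometry of normal charts -/

/-- A function is smooth if its composition with a local diffeomorphism is. -/
theorem contMDiffAt_of_comp_localDiffeo {E₁ H₁ M₁ E₂ H₂ M₂ W : Type*}
    [NormedAddCommGroup E₁] [NormedSpace ℝ E₁] [TopologicalSpace H₁] {I : ModelWithCorners ℝ E₁ H₁}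
    [TopologicalSpace M₁] [ChartedSpace H₁ M₁] [NormedAddCommGroup E₂] [NormedSpace ℝ E₂]
    [TopologicalSpace H₂] {J : ModelWithCorners ℝ E₂ H₂} [TopologicalSpace M₂] [ChartedSpace H₂ M₂]
    [NormedAddCommGroup W] [NormedSpace ℝ W] {f : M₁ → M₂} {p : M₁}
    (hf : IsLocalDiffeomorphAt I J ∞ f p) {F : M₂ → W} {G : M₁ → W}
    (hG : ContMDiffAt I 𝓘(ℝ, W) ∞ G p) (h : ∀ᶠ q in 𝓝 p, F (f q) = G q) :
    ContMDiffAt J 𝓘(ℝ, W) ∞ F (f p) := by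
  have h1 := hf.localInverse_contMDiffAt
  have h2 : hf.localInverse (f p) = p := hf.localInverse_left_inv hf.localInverse_mem_target
  have h3 : ContMDiffAt J 𝓘(ℝ, W) ∞ (G ∘ hf.localInverse) (f p) :=
    ContMDiffAt.comp (f p) (by rwa [h2]) h1
  refine h3.congr_of_eventuallyEq ?_
  have h4 : Tendsto hf.localInverse (𝓝 (f p)) (𝓝 p) := by
    have := h1.continuousAt.tendsto
    rwa [h2] at this
  filter_upwards [h4.eventually h, hf.localInverse_eventuallyEq_right] with q hq1 hq2
  have hq3 : f (hf.localInverse q) = q := hq2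
  rw [Function.comp_apply, ← hq1, hq3]

section

variable {K m : ℕ} {S : Type u} [TopologicalSpace S] [ChartedSpace (E m) S]

theorem hasMFDerivAt_fst_pair (y : E K) (r : ℝ) (z : S) :
    HasMFDerivAt (𝓘(ℝ, E K).prod (𝓘(ℝ, ℝ).prod 𝓘(ℝ, E m))) 𝓘(ℝ, E K × ℝ)
      (fun p : E K × (ℝ × S) => (p.1, p.2.1)) (y, (r, z))
      ((ContinuousLinearMap.fst ℝ (E K) (ℝ × E m)).prod
        ((ContinuousLinearMap.fst ℝ ℝ (E m)).comp
          (ContinuousLinearMap.snd ℝ (E K) (ℝ × E m)))) := by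
  have h1 := hasMFDerivAt_fst (I := 𝓘(ℝ, E K)) (I' := 𝓘(ℝ, ℝ).prod 𝓘(ℝ, E m))
    ((y, (r, z)) : E K × (ℝ × S))
  have h2 := hasMFDerivAt_snd (I := 𝓘(ℝ, E K)) (I' := 𝓘(ℝ, ℝ).prod 𝓘(ℝ, E m))
    ((y, (r, z)) : E K × (ℝ × S))
  have h3 := (hasMFDerivAt_fst (I := 𝓘(ℝ, ℝ)) (I' := 𝓘(ℝ, E m))
    ((r, z) : ℝ × S)).comp ((y, (r, z)) : E K × (ℝ × S)) h2
  have h4 := h1.prodMk h3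
  rw [modelWithCornersSelf_prod, ← chartedSpaceSelf_prod]
  exact h4

theorem hasMFDerivAt_pair (q : E K × ℝ) (z : S) :
    HasMFDerivAt 𝓘(ℝ, E K × ℝ) (𝓘(ℝ, E K).prod (𝓘(ℝ, ℝ).prod 𝓘(ℝ, E m)))
      (fun p : E K × ℝ => ((p.1, (p.2, z)) : E K × (ℝ × S))) q
      ((ContinuousLinearMap.fst ℝ (E K) ℝ).prod ((ContinuousLinearMap.snd ℝ (E K) ℝ).prod
        (0 : E K × ℝ →L[ℝ] E m))) :=
  (hasFDerivAt_fst (𝕜 := ℝ) (p := q)).hasMFDerivAt.prodMk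
    ((hasFDerivAt_snd (𝕜 := ℝ) (p := q)).hasMFDerivAt.prodMk (hasMFDerivAt_const z q))

end

section

variable {M Z : StratSpace.{u}}

/-- The linear and the radial coordinate of a chart. -/
def ConeChart.coord (c : ConeChart M Z) (x : M.carrier) : E c.d × ℝ := ((c.φ x).1, (c.φ x).2.radius)

theorem ConeChart.coord_param (c : ConeChart M Z) {j i : ℕ} (h : c.d + 1 + j = i) {y : E c.d}
    (hy : y ∈ c.U) {r : ℝ} (hr : r ∈ Ioo 0 c.R) (z : Z.Stratum j) :
    c.φ (c.param h (y, (r, z))).1 = (y, Cone.pt r z.1) := by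
  rw [c.param_eq h y hy r hr, c.φ.right_inv]
  exact c.mem_target.2 ⟨hy, by rw [Cone.radius_pt hr.1.le]; exact hr.2⟩

theorem EdgeChart.coord_tip (c : EdgeChart M Z) {i : ℕ} (h : c.d = i) {y : E c.d} (hy : y ∈ c.U) :
    c.φ (c.tip h y).1 = (y, Cone.vertex) := by
  rw [c.tip_eq h y hy, c.φ.right_inv]
  exact c.mem_target.2 ⟨hy, c.R_pos⟩

theorem Cone.isCompact_radius_le {Y : Type u} [TopologicalSpace Y] [CompactSpace Y] (t : ℝ) :
    IsCompact {c : Cone Y | c.radius ≤ t} := by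
  rcases lt_or_ge t 0 with ht | ht
  · convert isCompact_empty
    ext c
    simpa using ht.trans_le (Cone.radius_nonneg c)
  have h1 : IsCompact ((fun p : ℝ × Y => Cone.pt p.1 p.2) '' (Icc 0 t ×ˢ univ)) :=
    (isCompact_Icc.prod isCompact_univ).image Cone.continuous_pt
  convert h1.union (isCompact_singleton (x := (Cone.vertex : Cone Y))) using 1
  ext c
  rcases c with _ | ⟨⟨r, hr⟩, y⟩
  · refine ⟨fun _ => Or.inr rfl, fun _ => ht⟩
  · constructor
    · exact fun h => Or.inl ⟨(r, y), ⟨⟨hr.le, h⟩, mem_univ _⟩, Cone.pt_of_pos hr y⟩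
    · rintro (⟨⟨r', y'⟩, ⟨⟨h1, h2⟩, -⟩, h3⟩ | h)
      · change Cone.radius _ ≤ t
        rw [← h3, Cone.radius_pt h1]
        exact h2
      · exact absurd (mem_singleton_iff.1 h) (Option.some_ne_none _)

namespace IsNormal

variable {γ η : ℝ} {c : EdgeChart M Z} {g : Metric M} {k : Metric Z}

theorem tip_lower (hN : IsNormal γ η c g k) (h : c.d = M.n) {y : E c.d} (hy : y ∈ c.U) (v : E c.d) :
    3 / 4 * ‖v‖ ^ 2 ≤ c.pullTip h g.lift 0 y (0, v) ∧
      c.pullTip h g.lift 0 y (0, v) ≤ 5 / 4 * ‖v‖ ^ 2 := by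
  have h1 := abs_le.1 (hN.tip h y hy v)
  have h2 := hN.small_U y hy
  constructor <;> nlinarith [sq_nonneg ‖v‖]

theorem param_bounds (hN : IsNormal γ η c g k) (h : c.d + 1 + Z.n = M.n) {y : E c.d} (hy : y ∈ c.U) {r : ℝ}
    (hr : r ∈ Ioo 0 c.R) (z : Z.Reg) (v : E c.d) (t : ℝ) (ζ : E Z.n) :
    3 / 4 * (‖v‖ ^ 2 + t ^ 2 + r ^ 2 * k z ζ) ≤ c.pull h g.lift 0 y r z (0, (v, (t, ζ))) ∧
      c.pull h g.lift 0 y r z (0, (v, (t, ζ))) ≤ 5 / 4 * (‖v‖ ^ 2 + t ^ 2 + r ^ 2 * k z ζ) := by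
  have h1 := abs_le.1 (hN.param h y hy r hr z v t ζ)
  have h2 := hN.small_R y hy r hr
  have h3 : 0 ≤ ‖v‖ ^ 2 + t ^ 2 + r ^ 2 * k z ζ := by have := hN.k_nonneg z ζ; positivity
  constructor <;> nlinarith

/-- The coordinates of a normal chart are a barrier. -/
theorem isBarrier (hN : IsNormal γ η c g k) [CompactSpace Z.carrier] [T2Space M.carrier] {t₀ : ℝ}
    (hfit : ∀ p : E c.d × Cone Z.carrier, ‖p.1‖ < t₀ → p.2.radius < t₀ → p ∈ c.φ.target) :
    IsBarrier g c.coord c.φ.source 2 t₀ := by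
  have hcont : ContinuousOn c.coord c.φ.source :=
    (continuous_fst.prodMk (Cone.continuous_radius.comp continuous_snd)).comp_continuousOn
      c.φ.continuousOn
  have key : ∀ x : M.Reg, x.1 ∈ c.φ.source →
      ContMDiffAt 𝓘(ℝ, E M.n) 𝓘(ℝ, E c.d × ℝ) ∞ (fun x : M.Reg => c.coord x.1) x ∧
      ∀ ξ : E M.n, ‖regDeriv c.coord x ξ‖ ≤ 2 * √(g x ξ) := by
    intro x hx
    rcases c.reg_cases hN.link x hx with ⟨h, -, y, hy, rfl⟩ | ⟨h, y, hy, r, hr, z, rfl⟩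
    · have hG : ContDiff ℝ ∞ fun y : E c.d => (y, (0 : ℝ)) := by fun_prop
      have hev : ∀ᶠ q in 𝓝 y, c.coord (c.tip h q).1 = (q, 0) := by
        filter_upwards [c.isOpen_U.mem_nhds hy] with q hq
        rw [ConeChart.coord, c.coord_tip h hq]
        rfl
      have h1 := contMDiffAt_of_comp_localDiffeo (F := fun x : M.Reg => c.coord x.1)
        (c.tip_diffeo h ⟨y, hy⟩) hG.contMDiff.contMDiffAt hev
      refine ⟨h1, fun ξ => ?_⟩
      obtain ⟨v, rfl⟩ := c.tip_mfderiv_surj h hy ξ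
      have h2 := (h1.mdifferentiableAt (by simp)).hasMFDerivAt.comp y
        ((c.tip_diffeo h ⟨y, hy⟩).mdifferentiableAt (by simp)).hasMFDerivAt
      have h3 : HasFDerivAt (fun y : E c.d => (y, (0 : ℝ)))
          (ContinuousLinearMap.inl ℝ (E c.d) ℝ) y := (ContinuousLinearMap.inl ℝ (E c.d) ℝ).hasFDerivAt
      have h4 : regDeriv c.coord (c.tip h y) ((mfderiv 𝓘(ℝ, E c.d) 𝓘(ℝ, E M.n) (c.tip h) y :
          E c.d →L[ℝ] E M.n) v) = (v, 0) := congrArg (fun L : E c.d →L[ℝ] E c.d × ℝ => L v)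
        (hasMFDerivAt_unique h2 (h3.hasMFDerivAt.congr_of_eventuallyEq hev))
      have h5 : 3 / 4 * ‖v‖ ^ 2 ≤ g (c.tip h y) ((mfderiv 𝓘(ℝ, E c.d) 𝓘(ℝ, E M.n) (c.tip h) y :
          E c.d →L[ℝ] E M.n) v) := (hN.tip_lower h hy v).1
      refine le_of_eq_of_le (congrArg norm h4) ?_
      have h6 : ‖((v, 0) : E c.d × ℝ)‖ = ‖v‖ := by simp [Prod.norm_def]
      rw [h6, ← div_le_iff₀' two_pos]
      refine Real.le_sqrt_of_sq_le (le_trans ?_ h5)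
      nlinarith [sq_nonneg ‖v‖]
    · have hG : ContMDiff (𝓘(ℝ, E c.d).prod (𝓘(ℝ, ℝ).prod 𝓘(ℝ, E Z.n))) 𝓘(ℝ, E c.d × ℝ) ∞
          fun p : E c.d × (ℝ × Z.Reg) => (p.1, p.2.1) :=
        contMDiff_fst.prodMk_space (contMDiff_fst.comp contMDiff_snd)
      have hmem : ((y, (r, z)) : E c.d × (ℝ × Z.Reg)) ∈
          {p : E c.d × (ℝ × Z.Reg) | p.1 ∈ c.U ∧ p.2.1 ∈ Ioo 0 c.R} := ⟨hy, hr⟩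
      have hop : IsOpen {p : E c.d × (ℝ × Z.Reg) | p.1 ∈ c.U ∧ p.2.1 ∈ Ioo 0 c.R} :=
        (c.isOpen_U.preimage continuous_fst).inter
          (isOpen_Ioo.preimage (continuous_fst.comp continuous_snd))
      have hev : ∀ᶠ q in 𝓝 ((y, (r, z)) : E c.d × (ℝ × Z.Reg)),
          c.coord (c.param h q).1 = (q.1, q.2.1) := by
        filter_upwards [hop.mem_nhds hmem] with q hq
        rw [ConeChart.coord, c.coord_param h hq.1 hq.2, Cone.radius_pt hq.2.1.le]
      have h1 := contMDiffAt_of_comp_localDiffeo (F := fun x : M.Reg => c.coord x.1)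
        (c.param_diffeo h ⟨_, hmem⟩) hG.contMDiffAt hev
      refine ⟨h1, fun ξ => ?_⟩
      obtain ⟨⟨v, t, ζ⟩, rfl⟩ := c.param_mfderiv_surj h hy hr z ξ
      have h2 := (h1.mdifferentiableAt (by simp)).hasMFDerivAt.comp (y, (r, z))
        ((c.param_diffeo h ⟨_, hmem⟩).mdifferentiableAt (by simp)).hasMFDerivAt
      have h4 : regDeriv c.coord (c.param h (y, (r, z))) ((mfderiv (𝓘(ℝ, E c.d).prod
          (𝓘(ℝ, ℝ).prod 𝓘(ℝ, E Z.n))) 𝓘(ℝ, E M.n) (c.param h) (y, (r, z)) :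
          E c.d × (ℝ × E Z.n) →L[ℝ] E M.n) (v, (t, ζ))) = (v, t) :=
        congrArg (fun L : E c.d × (ℝ × E Z.n) →L[ℝ] E c.d × ℝ => L (v, (t, ζ)))
          (hasMFDerivAt_unique h2 ((hasMFDerivAt_fst_pair y r z).congr_of_eventuallyEq hev))
      have h5 : 3 / 4 * (‖v‖ ^ 2 + t ^ 2 + r ^ 2 * k z ζ) ≤ g (c.param h (y, (r, z)))
          ((mfderiv (𝓘(ℝ, E c.d).prod
          (𝓘(ℝ, ℝ).prod 𝓘(ℝ, E Z.n))) 𝓘(ℝ, E M.n) (c.param h) (y, (r, z)) :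
          E c.d × (ℝ × E Z.n) →L[ℝ] E M.n) (v, (t, ζ))) := (hN.param_bounds h hy hr z v t ζ).1
      refine le_of_eq_of_le (congrArg norm h4) ?_
      rw [← div_le_iff₀' two_pos]
      refine Real.le_sqrt_of_sq_le (le_trans ?_ h5)
      have h6 := le_norm_euc v t
      have h7 := norm_euc_sq v t
      have h8 := mul_nonneg (sq_nonneg r) (hN.k_nonneg z ζ)
      nlinarith [norm_nonneg (v, t), norm_nonneg (euc v t)]
  refine ⟨c.φ.open_source, hcont, fun x hx => (key x hx).1.of_le (by simp), fun x hx => (key x hx).2,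
    fun t ht => ?_⟩
  have hcomp : IsCompact (c.φ.symm '' (Metric.closedBall 0 t ×ˢ {q | q.radius ≤ t})) := by
    refine ((isCompact_closedBall 0 t).prod (Cone.isCompact_radius_le t)).image_of_continuousOn
      (c.φ.continuousOn_symm.mono fun p hp => ?_)
    exact hfit p ((mem_closedBall_zero_iff.1 hp.1).trans_lt ht) (lt_of_le_of_lt hp.2 ht)
  convert hcomp.isClosed
  ext x
  constructor
  · rintro ⟨h1, h2⟩
    refine ⟨c.φ x, ⟨mem_closedBall_zero_iff.2 ((norm_fst_le (c.coord x)).trans h2), ?_⟩, c.φ.left_inv h1⟩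
    exact (le_abs_self _).trans ((norm_snd_le (c.coord x)).trans h2)
  · rintro ⟨p, ⟨hp1, hp2⟩, rfl⟩
    have hp := hfit p ((mem_closedBall_zero_iff.1 hp1).trans_lt ht) (lt_of_le_of_lt hp2 ht)
    refine ⟨c.φ.map_target hp, ?_⟩
    rw [ConeChart.coord, c.φ.right_inv hp, Prod.norm_def]
    exact max_le (mem_closedBall_zero_iff.1 hp1)
      (by rw [Real.norm_of_nonneg (Cone.radius_nonneg _)]; exact hp2)

/-- The distance from the centre of a normal chart to a regular point. -/
theorem segLength_le (hN : IsNormal γ η c g k) (h0 : (0 : E c.d) ∈ c.U) (x : M.Reg) (hx : x.1 ∈ c.φ.source)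
    (hseg : ∀ t ∈ Ioo (0 : ℝ) 1, t • (c.φ x.1).1 ∈ c.U) :
    segLength g (c.φ.symm (0, Cone.vertex)) x.1 ≤
      ENNReal.ofReal (√(5 / 4) * Sus.size (c.φ x.1)) := by
  have hK : 0 ≤ √(5 / 4) * Sus.size (c.φ x.1) := mul_nonneg (Real.sqrt_nonneg _) (Sus.size_nonneg _)
  have hK2 : (√(5 / 4) * Sus.size (c.φ x.1)) ^ 2 =
      5 / 4 * (‖(c.φ x.1).1‖ ^ 2 + (c.φ x.1).2.radius ^ 2) := by
    rw [mul_pow, Real.sq_sqrt (by norm_num), Sus.size_sq]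
  have hcv : ContinuousAt c.φ.symm (0, Cone.vertex) :=
    c.φ.continuousAt_symm (c.mem_target.2 ⟨h0, c.R_pos⟩)
  have hc1 : ContinuousAt c.φ.symm (c.φ x.1) := c.φ.continuousAt_symm (c.φ.map_source hx)
  rcases c.reg_cases hN.link x hx with ⟨h, -, y, hy, rfl⟩ | ⟨h, y, hy, r, hr, z, rfl⟩
  · rw [c.coord_tip h hy] at hseg hK2 hc1 ⊢
    have hev : ∀ t ∈ Ioo (0 : ℝ) 1, (c.tip h (0 + t • y)).1 = c.φ.symm (t • y, Cone.vertex) :=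
      fun t ht => by rw [zero_add, c.tip_eq h _ (hseg t ht)]
    have hl : Continuous fun t : ℝ => ((t • y, Cone.vertex) : E c.d × Cone Z.carrier) := by fun_prop
    refine segLength_line_le g c.isOpen_U (fun q hq => ((c.tip_diffeo h ⟨q, hq⟩).contMDiffAt.of_le
      (by simp)).contMDiffWithinAt) (w := 0) (v := y) (fun t ht => by rw [zero_add]; exact hseg t ht)
      ?_ ?_ (by rwa [c.coord_tip h hy] at hK) fun q hq => ?_
    · refine Tendsto.congr' (Filter.eventually_of_mem (Ioo_mem_nhdsGT zero_lt_one)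
        fun t ht => (hev t ht).symm) ?_
      refine hcv.tendsto.comp ((hl.tendsto' 0 _ (by simp)).mono_left nhdsWithin_le_nhds)
    · refine Tendsto.congr' (Filter.eventually_of_mem (Ioo_mem_nhdsLT zero_lt_one)
        fun t ht => (hev t ht).symm) ?_
      rw [c.tip_eq h y hy]
      refine hc1.tendsto.comp ((hl.tendsto' 1 _ (by simp)).mono_left nhdsWithin_le_nhds)
    · rw [hK2]
      refine (hN.tip_lower h hq y).2.trans ?_
      simp [Cone.radius_vertex]
  · rw [c.coord_param h hy hr] at hseg hK2 hc1 ⊢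
    simp only [Cone.radius_pt hr.1.le] at hK2
    have htr : ∀ t ∈ Ioo (0 : ℝ) 1, t * r ∈ Ioo 0 c.R := fun t ht =>
      ⟨mul_pos ht.1 hr.1, by nlinarith [ht.1, ht.2, hr.1, hr.2]⟩
    let f : E c.d × ℝ → M.Reg := fun p => c.param h (p.1, (p.2, z))
    have hev : ∀ t ∈ Ioo (0 : ℝ) 1, (f (0 + t • (y, r))).1 = c.φ.symm (t • y, Cone.pt (t * r) z.1) :=
      fun t ht => by
        rw [zero_add]
        exact c.param_eq h _ (hseg t ht) _ (htr t ht) z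
    have hl : Continuous fun t : ℝ => ((t • y, Cone.pt (t * r) z.1) : E c.d × Cone Z.carrier) :=
      (by fun_prop : Continuous fun t : ℝ => t • y).prodMk (Cone.continuous_pt.comp
        ((by fun_prop : Continuous fun t : ℝ => t * r).prodMk continuous_const))
    have hin : ContMDiff 𝓘(ℝ, E c.d × ℝ) (𝓘(ℝ, E c.d).prod (𝓘(ℝ, ℝ).prod 𝓘(ℝ, E Z.n))) ∞
        fun p : E c.d × ℝ => ((p.1, (p.2, z)) : E c.d × (ℝ × Z.Reg)) :=
      contDiff_fst.contMDiff.prodMk (contDiff_snd.contMDiff.prodMk contMDiff_const)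
    refine segLength_line_le g (f := f) (c.isOpen_U.prod (isOpen_Ioo (a := (0 : ℝ)) (b := c.R)))
      (fun q hq => ?_) (w := 0) (v := (y, r))
      (fun t ht => by rw [zero_add]; exact ⟨hseg t ht, htr t ht⟩)
      ?_ ?_ (by rwa [c.coord_param h hy hr] at hK) fun q hq => ?_
    · exact (((c.param_diffeo h ⟨(q.1, (q.2, z)), hq⟩).contMDiffAt.comp q hin.contMDiffAt).of_le
        (by simp)).contMDiffWithinAt
    · refine Tendsto.congr' (Filter.eventually_of_mem (Ioo_mem_nhdsGT zero_lt_one)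
        fun t ht => (hev t ht).symm) ?_
      refine hcv.tendsto.comp ((hl.tendsto' 0 _ ?_).mono_left nhdsWithin_le_nhds)
      rw [zero_smul, zero_mul, Cone.pt_of_nonpos le_rfl]
    · refine Tendsto.congr' (Filter.eventually_of_mem (Ioo_mem_nhdsLT zero_lt_one)
        fun t ht => (hev t ht).symm) ?_
      rw [c.param_eq h y hy r hr]
      refine hc1.tendsto.comp ((hl.tendsto' 1 _ (by simp)).mono_left nhdsWithin_le_nhds)
    · have h1 := ((c.param_diffeo h ⟨(q.1, (q.2, z)), hq⟩).mdifferentiableAt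
        (by simp)).hasMFDerivAt.comp q (hasMFDerivAt_pair q z)
      have h2 : (mfderiv 𝓘(ℝ, E c.d × ℝ) 𝓘(ℝ, E M.n) f q : E c.d × ℝ →L[ℝ] E M.n) (y, r) =
          (mfderiv (𝓘(ℝ, E c.d).prod (𝓘(ℝ, ℝ).prod 𝓘(ℝ, E Z.n))) 𝓘(ℝ, E M.n) (c.param h)
            (q.1, (q.2, z)) : E c.d × (ℝ × E Z.n) →L[ℝ] E M.n) (y, (r, 0)) :=
        congrArg (fun L : E c.d × ℝ →L[ℝ] E M.n => L (y, r)) h1.mfderiv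
      rw [h2, hK2]
      refine (hN.param_bounds h hq.1 hq.2 z y r 0).2.trans (le_of_eq ?_)
      rw [QuadraticMap.map_zero, mul_zero, add_zero]

end IsNormal

end

/-! ### The topology of the geodesic distance -/

/-- The metric `g` has a normal chart centred at the point `x`. -/
def HasNormalChart (γ : ℝ) {M : StratSpace.{u}} (g : Metric M) (x : M.carrier) : Prop :=
  ∃ (Z : StratSpace.{u}) (c : EdgeChart M Z) (k : Metric Z) (η : ℝ), CompactSpace Z.carrier ∧
    IsNormal γ η c g k ∧ 0 ∈ c.U ∧ c.φ.symm (0, Cone.vertex) = x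

theorem ProdChart.IsEdgeAt.hasNormalChart {γ C : ℝ} (hγ : 0 < γ) (hγ1 : γ ≤ 1) (hC : 1 ≤ C)
    {X : StratSpace.{u}} (A : IterAtlas X) : ∀ {M : StratSpace.{u}} (V : Type)
    [NormedAddCommGroup V] [NormedSpace ℝ V] [FiniteDimensional ℝ V] (Ψ : ProdChart M X V)
    (hV : Module.finrank ℝ V + X.n = M.n) (g : Metric M) (σ : ℝ), 0 < σ →
    Ψ.IsEdgeAt γ C A hV g σ → ∀ b ∈ Ψ.P, ∀ x, HasNormalChart γ g (Ψ.e (b, x)) := by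
  refine IterAtlas.ind (P := fun X A => ∀ {M : StratSpace.{u}} (V : Type)
    [NormedAddCommGroup V] [NormedSpace ℝ V] [FiniteDimensional ℝ V] (Ψ : ProdChart M X V)
    (hV : Module.finrank ℝ V + X.n = M.n) (g : Metric M) (σ : ℝ), 0 < σ →
    Ψ.IsEdgeAt γ C A hV g σ → ∀ b ∈ Ψ.P, ∀ x, HasNormalChart γ g (Ψ.e (b, x))) ?_ A
  intro X A ih M V _ _ _ Ψ hV g σ hσ hE b hb x
  obtain ⟨i, hi⟩ := A.isAtlas.cover x
  have hlink := A.isAtlas.link i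
  rcases (A.chart i).point_cases hi with ⟨y, hy, rfl⟩ | ⟨y, hy, r, hr, z, rfl⟩
  · obtain ⟨C₁, -, η, -, s₀, hs₀, h⟩ := exists_normalAt hγ hγ1 hC (A.sub i)
    obtain ⟨N⟩ := h M X V Ψ hV g σ (A.chart i) hσ hlink (((isEdgeOn_iff A).1 hE).2 i) b hb y hy
      (s₀ * σ) (by positivity) le_rfl
    refine ⟨_, _, N.k, _, (A.sub i).isAtlas.compact, N.normal, ?_, ?_⟩
    · change (0 : E N.D) ∈ N.B
      rw [N.B_eq]
      exact ⟨by rw [norm_zero]; positivity, by simpa using ⟨hb, hy⟩⟩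
    · refine (N.inv_apply _).trans ?_
      simp [N.o_eq]
  · have : Nonempty (A.link i).carrier := ⟨z⟩
    have h : (A.chart i).d + 1 + (A.link i).n = X.n := by
      rcases hlink with ⟨-, h⟩ | ⟨h, -⟩
      · exact (h.false z).elim
      · exact h
    have hV' : Module.finrank ℝ (V × (E (A.chart i).d × ℝ)) + (A.link i).n = M.n := by
      simp; omega
    have h0 : (0 : V × (E (A.chart i).d × ℝ)) ∈ (A.chart i).box Ψ.P b y r := by
      simp [ConeChart.box, hb, hy, hr.2]
    have h1 := ih i _ _ hV' g (σ * r) (mul_pos hσ hr.1) (hE.step i h hb hy hr hV') 0 h0 z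
    have h2 : (Ψ.step (A.chart i).toConeChart b y r hr.1).e (0, z) =
        Ψ.e (b, (A.chart i).φ.symm (y, Cone.ptHomeo _ (r, z))) := by
      change Ψ.e (b + r • (0 : V), (A.chart i).φ.symm (y + r • (0 : E (A.chart i).d),
        Cone.ptHomeo _ (r * (1 + (0 : ℝ)), z))) = _
      simp
    rwa [h2, Cone.ptHomeo_apply _ hr.1] at h1

theorem IsIteratedEdge.exists_one_le {γ : ℝ} {X : StratSpace.{u}} {A : IterAtlas X} {g : Metric X}
    (hg : IsIteratedEdge γ A g) : ∃ C ≥ 1, IsEdgeOn γ C A (E 0) univ g.lift := by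
  obtain ⟨C, hC, h⟩ := hg
  exact ⟨max C 1, le_max_right _ _, h.mono hC (le_max_left _ _) A⟩

theorem IsIteratedEdge.hasNormalChart {γ : ℝ} (hγ : 0 < γ) (hγ1 : γ ≤ 1) {X : StratSpace.{u}}
    {A : IterAtlas X} {g : Metric X} (hg : IsIteratedEdge γ A g) (x : X.carrier) :
    HasNormalChart γ g x := by
  obtain ⟨C, hC, h⟩ := hg.exists_one_le
  have hV : Module.finrank ℝ (E 0) + X.n = X.n := by simp
  exact (ProdChart.isEdgeAt_refl h hV).hasNormalChart hγ hγ1 hC A _ _ hV g 1 one_pos 0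
    (mem_univ _) x

section

variable {γ : ℝ} {M Z : StratSpace.{u}} {g : Metric M}

theorem ConeChart.exists_fit (c : ConeChart M Z) (h0 : (0 : E c.d) ∈ c.U) : ∃ t₀ > 0,
    Metric.ball 0 t₀ ⊆ c.U ∧
    ∀ p : E c.d × Cone Z.carrier, ‖p.1‖ < t₀ → p.2.radius < t₀ → p ∈ c.φ.target := by
  obtain ⟨t, ht, h⟩ := Metric.isOpen_iff.1 c.isOpen_U 0 h0
  refine ⟨min t c.R, lt_min ht c.R_pos, (Metric.ball_subset_ball (min_le_left _ _)).trans h,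
    fun p h1 h2 => c.mem_target.2 ⟨h ?_, ?_⟩⟩
  · exact mem_ball_zero_iff.2 (h1.trans_le (min_le_left _ _))
  · exact h2.trans_le (min_le_right _ _)

theorem HasNormalChart.eventually_reg {x : M.carrier} (hx : HasNormalChart γ g x) {ε : ℝ}
    (hε : 0 < ε) : ∀ᶠ y in 𝓝 x, M.dim y = M.n → geodEDist g x y ≤ ENNReal.ofReal ε := by
  obtain ⟨Z, c, k, η, -, hN, h0, rfl⟩ := hx
  obtain ⟨t₀, ht₀, hball, hfit⟩ := c.exists_fit h0
  have hv : ((0, Cone.vertex) : E c.d × Cone Z.carrier) ∈ c.φ.target :=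
    c.mem_target.2 ⟨h0, c.R_pos⟩
  have h1 : ContinuousAt (fun y => Sus.size (c.φ y)) (c.φ.symm (0, Cone.vertex)) :=
    Sus.continuous_size.continuousAt.comp (c.φ.continuousAt (c.φ.map_target hv))
  have h2 : Sus.size (c.φ (c.φ.symm (0, Cone.vertex))) < min t₀ (ε / 2) := by
    rw [c.φ.right_inv hv]
    simpa [Sus.size, Cone.radius_vertex] using ⟨ht₀, hε⟩
  filter_upwards [h1.eventually_lt_const h2, c.φ.open_source.mem_nhds (c.φ.map_target hv)]
    with y hy hys hreg
  refine (geodEDist_le_segLength _ _ _).trans ((hN.segLength_le h0 ⟨y, hreg⟩ hys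
    fun t ht => hball (mem_ball_zero_iff.2 ?_)).trans (ENNReal.ofReal_le_ofReal ?_))
  · rw [norm_smul, Real.norm_of_nonneg ht.1.le]
    exact (mul_le_of_le_one_left (norm_nonneg _) ht.2.le).trans_lt
      ((Sus.norm_le_size _).trans_lt (hy.trans_le (min_le_left _ _)))
  · have h3 : √(5 / 4) ≤ 2 := Real.sqrt_le_iff.2 (by norm_num)
    have h4 := hy.trans_le (min_le_right _ _)
    have h5 := Sus.size_nonneg (c.φ y)
    change √(5 / 4) * Sus.size (c.φ y) ≤ ε
    nlinarith

theorem geodEDist_le_of_eventually (hd : Dense {x | M.dim x = M.n}) {x y : M.carrier}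
    (hy : HasNormalChart γ g y) {a : ℝ≥0∞}
    (h : ∀ᶠ y' in 𝓝 y, M.dim y' = M.n → geodEDist g x y' ≤ a) : geodEDist g x y ≤ a := by
  refine ENNReal.le_of_forall_pos_le_add fun ε hε _ => ?_
  obtain ⟨y', ⟨h1, h2⟩, h3⟩ := mem_closure_iff_nhds.1 (hd y) _
    (h.and (hy.eventually_reg (NNReal.coe_pos.2 hε)))
  refine (geodEDist_triangle g x y' y).trans (add_le_add (h1 h3) ?_)
  rw [geodEDist_comm]
  simpa using h2 h3

theorem eventually_geodEDist_lt (hd : Dense {x | M.dim x = M.n})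
    (hN : ∀ x, HasNormalChart γ g x) (x : M.carrier) {ε : ℝ} (hε : 0 < ε) :
    ∀ᶠ y in 𝓝 x, geodEDist g x y < ENNReal.ofReal ε := by
  filter_upwards [((hN x).eventually_reg (half_pos hε)).eventually_nhds] with y hy
  exact (geodEDist_le_of_eventually hd (hN y) hy).trans_lt
    ((ENNReal.ofReal_lt_ofReal_iff hε).2 (by linarith))

theorem HasNormalChart.eq_of_geodEDist [T2Space M.carrier] {x y : M.carrier}
    (hx : HasNormalChart γ g x) (h : geodEDist g x y = 0) : x = y := by
  obtain ⟨Z, c, k, η, hZ, hN, h0, rfl⟩ := hx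
  obtain ⟨t₀, ht₀, -, hfit⟩ := c.exists_fit h0
  have hv : ((0, Cone.vertex) : E c.d × Cone Z.carrier) ∈ c.φ.target :=
    c.mem_target.2 ⟨h0, c.R_pos⟩
  have hB := hN.isBarrier hfit
  have hF : ‖c.coord (c.φ.symm (0, Cone.vertex))‖ = 0 := by
    rw [ConeChart.coord, c.φ.right_inv hv, Cone.radius_vertex]
    exact norm_zero
  have key : ∀ s > 0, 2 * s < t₀ → y ∈ c.φ.source ∧ ‖c.coord y‖ ≤ 2 * s := fun s hs hst => by
    have := hB.geodEDist_lt zero_le_two (c.φ.map_target hv) (s := s)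
      (by rw [h]; exact ENNReal.ofReal_pos.2 hs) (by rwa [hF, zero_add])
    rwa [hF, zero_add] at this
  have hys := (key (t₀ / 4) (by linarith) (by linarith)).1
  have h1 : ‖c.coord y‖ ≤ 0 := by
    by_contra hne
    push Not at hne
    have h2 := (key (min (t₀ / 4) (‖c.coord y‖ / 4)) (by positivity)
      (by linarith [min_le_left (t₀ / 4) (‖c.coord y‖ / 4)])).2
    linarith [min_le_right (t₀ / 4) (‖c.coord y‖ / 4)]
  have h2 := norm_le_zero_iff.1 h1
  have h3 : c.φ y = (0, Cone.vertex) :=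
    Prod.ext (congrArg (Prod.fst : E c.d × ℝ → E c.d) h2)
      (Cone.eq_vertex_of_radius (congrArg (Prod.snd : E c.d × ℝ → ℝ) h2))
  rw [← h3, c.φ.left_inv hys]

/-- The underlying space, with the geodesic distance. -/
def GeodSpace (_ : Metric M) : Type u := M.carrier

theorem exists_isMetricSpaceOf [CompactSpace M.carrier] [T2Space M.carrier]
    [ConnectedSpace M.carrier] (hd : Dense {x | M.dim x = M.n}) (hN : ∀ x, HasNormalChart γ g x) :
    ∃ Y : CompactMet.{u}, IsMetricSpaceOf Y g := by
  have hfin : ∀ x y : M.carrier, geodEDist g x y ≠ ⊤ := fun x => by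
    have hcl : IsClopen {y | geodEDist g x y < ⊤} := by
      refine ⟨⟨isOpen_iff_mem_nhds.2 fun y hy => ?_⟩, isOpen_iff_mem_nhds.2 fun y hy => ?_⟩
      · filter_upwards [eventually_geodEDist_lt hd hN y one_pos] with y' hy' h
        refine hy ((geodEDist_triangle g x y' y).trans_lt (ENNReal.add_lt_top.2 ⟨h, ?_⟩))
        rw [geodEDist_comm]
        exact hy'.trans ENNReal.ofReal_lt_top
      · filter_upwards [eventually_geodEDist_lt hd hN y one_pos] with y' hy'
        exact (geodEDist_triangle g x y y').trans_lt
          (ENNReal.add_lt_top.2 ⟨hy, hy'.trans ENNReal.ofReal_lt_top⟩)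
    have h1 := hcl.eq_univ ⟨x, by simp [geodEDist_self]⟩
    exact fun y => ((eq_univ_iff_forall.1 h1) y).ne
  let _ : EMetricSpace (GeodSpace g) :=
    { edist := fun x y => geodEDist g x y
      edist_self := geodEDist_self g
      edist_comm := geodEDist_comm g
      edist_triangle := geodEDist_triangle g
      eq_of_edist_eq_zero := fun h => (hN _).eq_of_geodEDist h }
  let _ : MetricSpace (GeodSpace g) := EMetricSpace.toMetricSpace hfin
  let e : M.carrier ≃ GeodSpace g := Equiv.refl _
  have he : Continuous e := continuous_iff_continuousAt.2 fun x => EMetric.tendsto_nhds.2 fun ε hε => by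
    obtain ⟨s, hs, hsε⟩ := ENNReal.lt_iff_exists_nnreal_btwn.1 hε
    filter_upwards [eventually_geodEDist_lt hd hN x (NNReal.coe_pos.2 (by simpa using hs))] with y hy
    rw [edist_comm]
    exact (show geodEDist g x y < ε from hy.trans (by simpa using hsε))
  have : CompactSpace (GeodSpace g) := e.surjective.compactSpace he
  exact ⟨⟨GeodSpace g⟩, (he.homeoOfEquivCompactToT2 (f := e)).symm, fun a b => rfl⟩

theorem geodEDist_le_of_le {g' : Metric M} {K : ℝ} (hK : 0 < K)
    (h : ∀ x v, g x v ≤ K ^ 2 * g' x v) (x y : M.carrier) :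
    geodEDist g x y ≤ ENNReal.ofReal K * geodEDist g' x y := by
  have hK0 : ENNReal.ofReal K ≠ 0 := by simpa using hK
  have hseg : ∀ x y, segLength g x y ≤ ENNReal.ofReal K * segLength g' x y := fun x y => by
    rw [mul_comm, ← ENNReal.div_le_iff_le_mul (Or.inl hK0) (Or.inl ENNReal.ofReal_ne_top)]
    refine le_iInf fun σ => le_iInf fun h1 => le_iInf fun h2 => le_iInf fun h3 => ?_
    rw [ENNReal.div_le_iff_le_mul (Or.inl hK0) (Or.inl ENNReal.ofReal_ne_top), mul_comm,
      ← lintegral_const_mul' _ _ ENNReal.ofReal_ne_top]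
    refine (segLength_le_lintegral g h1 h2 h3).trans (lintegral_mono fun t => ?_)
    rw [← ENNReal.ofReal_mul hK.le]
    refine ENNReal.ofReal_le_ofReal (Real.sqrt_le_iff.2 ⟨by positivity, (h _ _).trans ?_⟩)
    rw [mul_pow]
    gcongr
    rcases le_total 0 (g' (σ t) (mfderiv 𝓘(ℝ, ℝ) 𝓘(ℝ, E M.n) σ t (1 : ℝ))) with h4 | h4
    · exact (Real.sq_sqrt h4).ge
    · exact h4.trans (sq_nonneg _)
  rw [mul_comm, ← ENNReal.div_le_iff_le_mul (Or.inl hK0) (Or.inl ENNReal.ofReal_ne_top)]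
  refine le_iInf fun N => le_iInf fun p => le_iInf fun h1 => le_iInf fun h2 => ?_
  rw [ENNReal.div_le_iff_le_mul (Or.inl hK0) (Or.inl ENNReal.ofReal_ne_top), mul_comm, Finset.mul_sum]
  unfold geodEDist
  exact iInf_le_of_le N (iInf_le_of_le p (iInf_le_of_le h1 (iInf_le_of_le h2
    (Finset.sum_le_sum fun i _ => hseg _ _))))

theorem biLip_of_le {g' : Metric M} {K : ℝ} (hK : 0 < K) (h : ∀ x v, g x v ≤ K ^ 2 * g' x v)
    (h' : ∀ x v, g' x v ≤ K ^ 2 * g x v) {Y Y' : CompactMet.{u}} (hY : IsMetricSpaceOf Y g)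
    (hY' : IsMetricSpaceOf Y' g') : BiLip K Y Y' := by
  obtain ⟨e, he⟩ := hY
  obtain ⟨e', he'⟩ := hY'
  refine ⟨e.toEquiv.trans e'.symm.toEquiv, fun a b => ?_⟩
  have h1 : edist (e'.symm (e a)) (e'.symm (e b)) = geodEDist g' (e a) (e b) := by
    rw [he', e'.apply_symm_apply, e'.apply_symm_apply]
  have h2 := geodEDist_le_of_le hK h' (e a) (e b)
  have h3 := geodEDist_le_of_le hK h (e a) (e b)
  rw [← h1, ← he, edist_dist, edist_dist, ← ENNReal.ofReal_mul hK.le,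
    ENNReal.ofReal_le_ofReal_iff (by positivity)] at h2 h3
  exact ⟨h2, h3⟩

end

theorem suspMetric_close {D n : ℕ} {Z : StratSpace.{u}} {k k' : Metric Z} {ε : ℝ} (hε : 0 ≤ ε)
    (h : ∀ z, Close ε (k z) (k' z)) (s : (Susp D Z n).Stratum n) :
    Close ε (suspMetric D n k s) (suspMetric D n k' s) := fun ξ => by
  have e := suspMetric_apply k s ξ
  have e' := suspMetric_apply k' s ξ
  refine le_of_eq_of_le (congrArg₂ (fun a b => |a - b|) e e') (le_of_le_of_eq ?_
    (congrArg (ε * ·) e'.symm))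
  rw [add_sub_add_left_eq_sub]
  have h1 : 0 ≤ ‖Susp.dv s ξ‖ ^ 2 + Susp.dr s ξ ^ 2 := by positivity
  by_cases hn : D + Z.n = n
  · rw [linkPart_of_eq _ _ _ hn, linkPart_of_eq _ _ _ hn, ← mul_sub, abs_mul,
      abs_of_nonneg (sq_nonneg (Susp.r s))]
    have h2 := h (Susp.z hn s) (Susp.dz hn s ξ)
    nlinarith [mul_le_mul_of_nonneg_left h2 (sq_nonneg (Susp.r s)), mul_nonneg hε h1]
  · rw [linkPart_of_ne _ _ _ hn, linkPart_of_ne _ _ _ hn, sub_zero, abs_zero, add_zero]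
    positivity

/-! ### Normal charts in polar coordinates -/

section

variable {D : ℕ} {Z : StratSpace.{u}} {n : ℕ}

/-- The linear component in polar coordinates, with the radius dilated by `l`. -/
def linMap (l : ℝ) {i : ℕ} (p : E 0 × (ℝ × (Susp D Z n).Stratum i)) : E D :=
  (l * p.2.1) • Susp.v p.2.2

/-- The components in polar coordinates, with the radius dilated by `l`. -/
def polarMap (l : ℝ) {j i : ℕ} (h : D + j = i) (p : E 0 × (ℝ × (Susp D Z n).Stratum i)) :
    E D × (ℝ × Z.Stratum j) :=
  (linMap l p, ((l * p.2.1) • Susp.r p.2.2, Susp.z h p.2.2))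

theorem contMDiff_linMap (l : ℝ) {i : ℕ} : ContMDiff (𝓘(ℝ, E 0).prod (𝓘(ℝ, ℝ).prod 𝓘(ℝ, E i)))
    𝓘(ℝ, E D) ∞ (linMap (D := D) (Z := Z) (n := n) l (i := i)) := by
  have h : ContDiff ℝ ∞ fun t : ℝ => l * t := by fun_prop
  exact (h.contMDiff.comp (contMDiff_fst.comp contMDiff_snd)).smul
    (Susp.contMDiff_v.comp (contMDiff_snd.comp contMDiff_snd))

theorem linMap_diffeo {l : ℝ} (hl : 0 < l) {i : ℕ} (h : i + 1 = D) :
    IsLocalDiffeomorphOn (𝓘(ℝ, E 0).prod (𝓘(ℝ, ℝ).prod 𝓘(ℝ, E i))) 𝓘(ℝ, E D) ∞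
      (linMap (D := D) (Z := Z) (n := n) l (i := i)) {p | 0 < p.2.1} := by
  refine isLocalDiffeomorphOn_of_inverse (t := {0}ᶜ)
    (g := fun u => (0, (l⁻¹ * ‖u‖, Susp.dir h u)))
    (isOpen_lt continuous_const (continuous_fst.comp continuous_snd)) isOpen_compl_singleton
    ?_ ?_ ?_ ?_ (contMDiff_linMap l).contMDiffOn ?_
  · rintro ⟨y, t, s⟩ (ht : 0 < t) h0
    have h1 : ‖linMap l (y, (t, s))‖ = 0 := by rw [mem_singleton_iff.1 h0, norm_zero]
    rw [linMap, norm_smul, Susp.norm_v h, mul_one, Real.norm_of_nonneg (by positivity)] at h1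
    exact (mul_pos hl ht).ne' h1
  · intro u hu
    exact mul_pos (inv_pos.2 hl) (norm_pos_iff.2 hu)
  · rintro ⟨y, t, s⟩ (ht : 0 < t)
    have hlt := mul_pos hl ht
    refine Prod.ext (Subsingleton.elim _ _) (Prod.ext ?_ (Susp.dir_v h s hlt))
    change l⁻¹ * ‖(l * t) • Susp.v s‖ = t
    rw [norm_smul, Susp.norm_v h, mul_one, Real.norm_of_nonneg hlt.le, inv_mul_cancel_left₀ hl.ne']
  · intro u hu
    change (l * (l⁻¹ * ‖u‖)) • Susp.v (Susp.dir h u) = u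
    rw [Susp.v_dir h hu, mul_inv_cancel_left₀ hl.ne', smul_inv_smul₀ (norm_ne_zero_iff.2 hu)]
  · have h1 : ContDiffOn ℝ ∞ (fun u : E D => l⁻¹ * ‖u‖) {0}ᶜ := fun u hu =>
      (contDiffAt_const.mul (contDiffAt_norm ℝ hu)).contDiffWithinAt
    exact contMDiffOn_const.prodMk (h1.contMDiffOn.prodMk (Susp.contMDiffOn_dir h))

theorem polarMap_diffeo {l : ℝ} (hl : 0 < l) {j i : ℕ} (h : D + j = i) :
    IsLocalDiffeomorphOn (𝓘(ℝ, E 0).prod (𝓘(ℝ, ℝ).prod 𝓘(ℝ, E i)))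
      (𝓘(ℝ, E D).prod (𝓘(ℝ, ℝ).prod 𝓘(ℝ, E j))) ∞ (polarMap (Z := Z) (n := n) l h)
      {p | 0 < p.2.1} := by
  refine isLocalDiffeomorphOn_of_inverse (t := {p | 0 < p.2.1})
    (g := fun p => (0, (l⁻¹ * √(‖p.1‖ ^ 2 + p.2.1 ^ 2), Susp.mk h (p.2.1⁻¹ • p.1, p.2.2))))
    (isOpen_lt continuous_const (continuous_fst.comp continuous_snd))
    (isOpen_lt continuous_const (continuous_fst.comp continuous_snd)) ?_ ?_ ?_ ?_ ?_ ?_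
  · rintro ⟨y, t, s⟩ (ht : 0 < t)
    exact mul_pos (mul_pos hl ht) (Susp.r_pos h s)
  · rintro ⟨w, ρ, z⟩ (hρ : 0 < ρ)
    exact mul_pos (inv_pos.2 hl) (Real.sqrt_pos.2 (by positivity))
  · rintro ⟨y, t, s⟩ (ht : 0 < t)
    have hlt := mul_pos hl ht
    have hr := Susp.r_pos h s
    refine Prod.ext (Subsingleton.elim _ _) (Prod.ext ?_ ?_)
    · change l⁻¹ * √(‖(l * t) • Susp.v s‖ ^ 2 + (l * t * Susp.r s) ^ 2) = t
      rw [norm_smul, mul_pow, mul_pow, Real.norm_eq_abs, sq_abs, ← mul_add, Susp.v_r, mul_one,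
        Real.sqrt_sq hlt.le, inv_mul_cancel_left₀ hl.ne']
    · change Susp.mk h ((l * t * Susp.r s)⁻¹ • (l * t) • Susp.v s, Susp.z h s) = s
      rw [smul_smul, mul_inv, mul_comm (l * t)⁻¹, mul_assoc, inv_mul_cancel₀ hlt.ne', mul_one]
      exact Susp.mk_v_r_z h s
  · rintro ⟨w, ρ, z⟩ (hρ : 0 < ρ)
    have e1 : √(‖w‖ ^ 2 + ρ ^ 2) = ρ * √(1 + ‖ρ⁻¹ • w‖ ^ 2) := by
      rw [← Real.sqrt_sq hρ.le, ← Real.sqrt_mul (sq_nonneg ρ), norm_smul, Real.sqrt_sq hρ.le,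
        Real.norm_of_nonneg (inv_nonneg.2 hρ.le)]
      congr 1
      field_simp
      ring
    have e2 := (Sus.sqrt_pos (ρ⁻¹ • w)).ne'
    have e3 : l * (l⁻¹ * √(‖w‖ ^ 2 + ρ ^ 2)) = ρ * √(1 + ‖ρ⁻¹ • w‖ ^ 2) := by
      rw [mul_inv_cancel_left₀ hl.ne', e1]
    refine Prod.ext ?_ (Prod.ext ?_ (Susp.z_mk (n := n) h _))
    · change (l * (l⁻¹ * √(‖w‖ ^ 2 + ρ ^ 2))) • Susp.v (Susp.mk (n := n) h (ρ⁻¹ • w, z)) = w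
      rw [e3, Susp.v_mk, mul_smul, smul_inv_smul₀ e2, smul_inv_smul₀ hρ.ne']
    · change (l * (l⁻¹ * √(‖w‖ ^ 2 + ρ ^ 2))) * Susp.r (Susp.mk (n := n) h (ρ⁻¹ • w, z)) = ρ
      rw [e3, Susp.r_mk, mul_assoc, mul_inv_cancel₀ e2, mul_one]
  · have h1 : ContDiff ℝ ∞ fun t : ℝ => l * t := by fun_prop
    exact ((contMDiff_linMap l).prodMk (((h1.contMDiff.comp (contMDiff_fst.comp contMDiff_snd)).smul
      (Susp.contMDiff_r.comp (contMDiff_snd.comp contMDiff_snd))).prodMk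
      ((Susp.contMDiff_z h).comp (contMDiff_snd.comp contMDiff_snd)))).contMDiffOn
  · have h0 : ContMDiff (𝓘(ℝ, E D).prod (𝓘(ℝ, ℝ).prod 𝓘(ℝ, E j))) 𝓘(ℝ, E D × ℝ) ∞
        fun p : E D × (ℝ × Z.Stratum j) => (p.1, p.2.1) :=
      contMDiff_fst.prodMk_space (contMDiff_fst.comp contMDiff_snd)
    have hm : MapsTo (fun p : E D × (ℝ × Z.Stratum j) => (p.1, p.2.1)) {p | 0 < p.2.1}
        {q : E D × ℝ | 0 < q.2} := fun p hp => hp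
    have h1 : ContDiffOn ℝ ∞ (fun q : E D × ℝ => l⁻¹ * √(‖q.1‖ ^ 2 + q.2 ^ 2)) {q | 0 < q.2} :=
      contDiffOn_const.mul (ContDiffOn.sqrt
        (((contDiff_norm_sq ℝ).comp contDiff_fst).add (contDiff_snd.pow 2)).contDiffOn
        fun q (hq : 0 < q.2) => by positivity)
    have h2 : ContDiffOn ℝ ∞ (fun q : E D × ℝ => q.2⁻¹ • q.1) {q | 0 < q.2} :=
      (contDiffOn_snd.inv fun q (hq : 0 < q.2) => hq.ne').smul contDiffOn_fst
    exact contMDiffOn_const.prodMk ((h1.contMDiffOn.comp h0.contMDiffOn hm).prodMk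
      ((Susp.contMDiff_mk h).comp_contMDiffOn ((h2.contMDiffOn.comp h0.contMDiffOn hm).prodMk
        (contMDiff_snd.comp contMDiff_snd).contMDiffOn)))

theorem hasMFDerivAt_dilated {W S : Type*} [NormedAddCommGroup W] [NormedSpace ℝ W] {m : ℕ}
    [TopologicalSpace S] [ChartedSpace (E m) S] (l : ℝ) {F : S → W} {F' : E m →L[ℝ] W} {s : S}
    (hF : HasMFDerivAt 𝓘(ℝ, E m) 𝓘(ℝ, W) F s F') (y : E 0) (t : ℝ) :
    ∃ L : E 0 × (ℝ × E m) →L[ℝ] W, HasMFDerivAt (𝓘(ℝ, E 0).prod (𝓘(ℝ, ℝ).prod 𝓘(ℝ, E m))) 𝓘(ℝ, W)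
      (fun p : E 0 × (ℝ × S) => (l * p.2.1) • F p.2.2) (y, (t, s)) L ∧
      ∀ y' t' ξ, L (y', (t', ξ)) = l • (t • F' ξ + t' • F s) := by
  have h1 : HasFDerivAt (fun q : ℝ × W => (l * q.1) • q.2) _ (t, F s) :=
    ((hasFDerivAt_fst (𝕜 := ℝ) (p := (t, F s))).const_mul l).smul
      (hasFDerivAt_snd (𝕜 := ℝ) (p := (t, F s)))
  have h2 := hasMFDerivAt_snd (I := 𝓘(ℝ, E 0)) (I' := 𝓘(ℝ, ℝ).prod 𝓘(ℝ, E m))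
    ((y, (t, s)) : E 0 × (ℝ × S))
  have h3 := (hasMFDerivAt_fst (I := 𝓘(ℝ, ℝ)) (I' := 𝓘(ℝ, E m)) ((t, s) : ℝ × S)).prodMk
    (hF.comp (t, s) (hasMFDerivAt_snd (I := 𝓘(ℝ, ℝ)) (I' := 𝓘(ℝ, E m)) ((t, s) : ℝ × S)))
  have h4 := h1.hasMFDerivAt
  rw [modelWithCornersSelf_prod, ← chartedSpaceSelf_prod] at h4
  refine ⟨_, (h4.comp (t, s) h3).comp (y, (t, s)) h2, fun y' t' ξ => ?_⟩
  change (l * t) • F' ξ + (l • t') • F s = _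
  rw [smul_add, smul_smul, smul_smul, smul_eq_mul]

end

section

variable {M Z : StratSpace.{u}} (c : EdgeChart M Z) (n : ℕ) (l : ℝ)

/-- The parametrization of a stratum of `M` by polar coordinates in a chart. -/
def EdgeChart.polarParam {j i : ℕ} (h : 0 + 1 + j = i)
    (p : E 0 × (ℝ × (Susp c.d Z n).Stratum j)) : M.Stratum i :=
  if h1 : j + 1 = c.d then c.tip (by omega) (linMap l p)
  else if h2 : c.d ≤ j then c.param (j := j - c.d) (by omega)
    (polarMap l (by omega : c.d + (j - c.d) = j) p)
  else ((Susp.dim_cases p.2.2).elim h1 fun ⟨_, h⟩ => h2 (by omega) : False).elim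

theorem EdgeChart.polarParam_tip {j i : ℕ} (h : 0 + 1 + j = i) (h1 : j + 1 = c.d)
    (h' : c.d = i) : c.polarParam n l h = fun p => c.tip h' (linMap l p) := by
  funext p
  rw [EdgeChart.polarParam, dif_pos h1]

theorem EdgeChart.polarParam_param {j' j i : ℕ} (h : 0 + 1 + j = i) (h2 : c.d + j' = j)
    (h' : c.d + 1 + j' = i) : c.polarParam n l h = fun p => c.param h' (polarMap l h2 p) := by
  funext p
  obtain rfl : j - c.d = j' := by omega
  rw [EdgeChart.polarParam, dif_neg (by omega), dif_pos (by omega)]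

variable {l} (hl : 0 < l)

/-- Polar coordinates, with the radius dilated by `l`. -/
def polarHomeo (D : ℕ) (Y : Type u) [TopologicalSpace Y] (hl : 0 < l) :
    E 0 × Cone (Sus D Y) ≃ₜ E D × Cone Y :=
  (Homeomorph.uniqueProd (E 0) _).trans ((Cone.dilHomeo l hl).trans (Sus.polar D Y).symm)

theorem size_polarHomeo (D : ℕ) (Y : Type u) [TopologicalSpace Y] (p : E 0 × Cone (Sus D Y)) :
    Sus.size (polarHomeo D Y hl p) = l * p.2.radius := by
  rw [← Sus.radius_polar]
  change (Sus.polar D Y ((Sus.polar D Y).symm (Cone.dil l p.2))).radius = _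
  rw [Homeomorph.apply_symm_apply, Cone.radius_dil hl.le]

theorem polarHomeo_pt (D : ℕ) (Y : Type u) [TopologicalSpace Y] (y : E 0) {t : ℝ} (ht : 0 < t)
    (s : Sus D Y) : polarHomeo D Y hl (y, Cone.pt t s) =
      ((l * t) • s.1.1, Cone.dil (l * t) s.1.2) := by
  change (Sus.polar D Y).symm (Cone.dil l (Cone.pt t s)) = _
  rw [Cone.dil_pt hl.le, Sus.polar_symm_pt (mul_pos hl ht)]
  rfl

variable {t : ℝ} (ht : 0 < t)
  (hfit : ∀ p : E c.d × Cone Z.carrier, Sus.size p < l * t → p ∈ c.φ.target)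

/-- The inverse of the chart in polar coordinates. -/
def EdgeChart.polarInv (t : ℝ) :
    OpenPartialHomeomorph (E 0 × Cone (Sus c.d Z.carrier)) M.carrier :=
  ((polarHomeo c.d Z.carrier hl).toOpenPartialHomeomorph ≫ₕ c.φ.symm).restrOpen
    (univ ×ˢ {q | q.radius < t}) (isOpen_univ.prod (Cone.isOpen_radius_lt _))

theorem EdgeChart.polarInv_source
    (hfit : ∀ p : E c.d × Cone Z.carrier, Sus.size p < l * t → p ∈ c.φ.target) :
    (c.polarInv hl t).source = {p | p.2.radius < t} := by
  ext p
  refine ⟨fun h => h.2.2, fun h => ⟨⟨mem_univ _, hfit _ ?_⟩, mem_univ _, h⟩⟩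
  change Sus.size (polarHomeo c.d Z.carrier hl p) < _
  rw [size_polarHomeo]
  exact mul_lt_mul_of_pos_left h hl

theorem EdgeChart.lin_mem (hl : 0 < l)
    (hfit : ∀ p : E c.d × Cone Z.carrier, Sus.size p < l * t → p ∈ c.φ.target) {y : E 0} {r : ℝ} (hr : r ∈ Ioo 0 t) {i : ℕ}
    (s : (Susp c.d Z n).Stratum i) : linMap l (y, (r, s)) ∈ c.U ∧
      (0 < Susp.r s → (l * r) • Susp.r s ∈ Ioo 0 c.R) := by
  have hlr := mul_pos hl hr.1
  have h1 := hfit (Sus.scale (l * r) s.1)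
    ((Sus.size_scale hlr.le _).trans_lt (mul_lt_mul_of_pos_left hr.2 hl))
  have h2 := c.mem_target.1 h1
  refine ⟨h2.1, fun h0 => ⟨mul_pos hlr h0, ?_⟩⟩
  have h3 : ((Sus.scale (l * r) s.1).2).radius = (l * r) • Susp.r s := Cone.radius_dil hlr.le _
  rw [← h3]; exact h2.2

/-- A chart `U × C_R(Z)` in polar coordinates, as a chart `C_t(S)`. -/
def EdgeChart.polarChart : ConeChart M (Susp c.d Z n) where
  d := 0
  U := univ
  isOpen_U := isOpen_univ
  nonempty_U := ⟨0, mem_univ _⟩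
  bounded_U := (Set.subsingleton_of_subsingleton).finite.isBounded
  R := t
  R_pos := ht
  φ := (c.polarInv hl t).symm
  target_eq := by
    refine (c.polarInv_source hl hfit).trans ?_
    ext p
    exact ⟨fun h => ⟨mem_univ _, h⟩, fun h => h.2⟩
  param {j i} h p := c.polarParam n l h p
  param_eq {j i} h y _ r hr s := by
    have hlr := mul_pos hl hr.1
    have key : (c.polarInv hl t) (y, Cone.pt r s.1) =
        c.φ.symm (polarHomeo c.d Z.carrier hl (y, Cone.pt r s.1)) := rfl
    have h1 := c.lin_mem n hl hfit (y := y) hr s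
    refine Eq.trans ?_ key.symm
    rw [polarHomeo_pt hl _ _ y hr.1 s.1]
    rcases Susp.dim_cases s with h2 | ⟨j', h2⟩
    · rw [c.polarParam_tip n l h h2 (by omega), c.tip_eq _ _ h1.1, Susp.val_eq_vertex h2 s]
      rfl
    · rw [c.polarParam_param n l h h2 (by omega)]
      refine (c.param_eq _ _ h1.1 _ (h1.2 (Susp.r_pos h2 s)) _).trans ?_
      rw [Susp.val_eq h2 s]
      simp only [Cone.dil_pt hlr.le]
      rfl
  param_diffeo {j i} h := fun ⟨⟨y, r, s⟩, _, hr⟩ => by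
    have h1 := c.lin_mem n hl hfit (y := y) hr s
    rcases Susp.dim_cases s with h2 | ⟨j', h2⟩
    · rw [c.polarParam_tip n l h h2 (by omega)]
      exact (linMap_diffeo hl h2 ⟨(y, (r, s)), hr.1⟩).comp _ _ (c.tip_diffeo _ ⟨_, h1.1⟩)
    · rw [c.polarParam_param n l h h2 (by omega)]
      exact (polarMap_diffeo hl h2 ⟨(y, (r, s)), hr.1⟩).comp _ _
        (c.param_diffeo _ ⟨polarMap l h2 (y, (r, s)), h1.1, h1.2 (Susp.r_pos h2 s)⟩)


theorem abs_sub_le_of_dilated {P Q e ε l : ℝ} (h : |P - l ^ 2 * Q| ≤ e * (l ^ 2 * Q)) (hQ : 0 ≤ Q)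
    (hl : 0 ≤ l) (hl1 : l ≤ 1) (he : 0 ≤ e) (hε : e + (1 - l ^ 2) ≤ ε) : |P - Q| ≤ ε * Q := by
  have hl2 : l ^ 2 ≤ 1 := pow_le_one₀ hl hl1
  have h1 : |l ^ 2 * Q - Q| = (1 - l ^ 2) * Q := by
    rw [abs_sub_comm, abs_of_nonneg (by nlinarith)]; ring
  have h2 := abs_sub_le P (l ^ 2 * Q) Q
  have h3 : e * (l ^ 2 * Q) ≤ e * Q := by gcongr; nlinarith
  nlinarith

/-- Polar coordinates on the product of a Euclidean space and a cone. -/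
theorem polar_norm_sq {F : Type*} [NormedAddCommGroup F] [InnerProductSpace ℝ F] (l t t' : ℝ)
    (v v' : F) (r r' κ : ℝ) (h1 : ‖v‖ ^ 2 + r ^ 2 = 1) (h2 : inner ℝ v v' + r * r' = 0) :
    ‖l • (t • v' + t' • v)‖ ^ 2 + (l • (t • r' + t' • r)) ^ 2 + ((l * t) • r) ^ 2 * κ =
      l ^ 2 * (t' ^ 2 + t ^ 2 * (‖v'‖ ^ 2 + r' ^ 2 + r ^ 2 * κ)) := by
  rw [norm_smul, mul_pow, Real.norm_eq_abs, sq_abs, norm_add_sq_real, norm_smul, norm_smul,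
    inner_smul_left, inner_smul_right, real_inner_comm, mul_pow, mul_pow, Real.norm_eq_abs,
    Real.norm_eq_abs, sq_abs, sq_abs]
  simp only [smul_eq_mul, conj_trivial]
  linear_combination l ^ 2 * t' ^ 2 * h1 + 2 * l ^ 2 * t * t' * h2

theorem Susp.inner_dv {D : ℕ} (s : (Susp D Z n).Stratum n) (ξ : E n) :
    inner ℝ (Susp.v s) (Susp.dv s ξ) + Susp.r s * Susp.dr s ξ = 0 := by
  have h1 := ((Susp.contMDiff_v s).mdifferentiableAt (by simp)).hasMFDerivAt
  have h2 := ((Susp.contMDiff_r s).mdifferentiableAt (by simp)).hasMFDerivAt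
  have h3 := ((hasFDerivAt_id (Susp.v s)).norm_sq).hasMFDerivAt.comp s h1
  have h4 := ((hasFDerivAt_id (𝕜 := ℝ) (Susp.r s)).pow 2).hasMFDerivAt.comp s h2
  have h5 : HasMFDerivAt 𝓘(ℝ, E n) 𝓘(ℝ, ℝ)
      (fun s : (Susp D Z n).Stratum n => ‖Susp.v s‖ ^ 2 + Susp.r s ^ 2) s (0 : E n →L[ℝ] ℝ) :=
    (hasMFDerivAt_const (1 : ℝ) s).congr_of_eventuallyEq (Eventually.of_forall Susp.v_r)
  have h6 := congrArg (fun L : E n →L[ℝ] ℝ => L ξ) (hasMFDerivAt_unique (h3.add h4) h5)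
  have h7 : 2 * inner ℝ (Susp.v s) (Susp.dv s ξ) + 2 * Susp.r s * Susp.dr s ξ = 0 := by
    refine Eq.trans ?_ h6
    change _ = 2 • inner ℝ (Susp.v s) (Susp.dv s ξ) + (2 • Susp.r s ^ (2 - 1)) • Susp.dr s ξ
    simp
  linarith

variable {c n} in
theorem IsNormal.isConeApprox {γ η ε : ℝ} {g : Metric M} {k : Metric Z} (hN : IsNormal γ η c g k)
    (hγ : 0 < γ) (hη : 0 ≤ η) (hn : 0 + 1 + n = M.n) (hl1 : l ≤ 1)
    (hε : η * (l * t) ^ γ + (1 - l ^ 2) ≤ ε) :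
    IsConeApprox (c.polarChart n hl ht hfit) t ε g (suspMetric c.d n k) := by
  refine ⟨rfl, rfl, hn, fun y _ r hr s => ?_⟩
  rintro ⟨v₀, y', t', ξ⟩
  change (Susp c.d Z n).Stratum n at s
  change E n at ξ
  change E 0 at y y'
  have hlr := mul_pos hl hr.1
  have hmem := c.lin_mem n hl hfit (y := y) hr s
  have hnorm : ‖linMap l (y, (r, s))‖ ≤ l * r ∧ (l * r) • Susp.r s ≤ l * r := by
    have h1 := Susp.v_r s
    have h2 : ‖Susp.v s‖ ≤ 1 := by nlinarith [norm_nonneg (Susp.v s), sq_nonneg (Susp.r s)]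
    have h3 : Susp.r s ≤ 1 := by nlinarith [sq_nonneg ‖Susp.v s‖]
    constructor
    · rw [linMap, norm_smul, Real.norm_of_nonneg hlr.le]
      exact mul_le_of_le_one_right hlr.le h2
    · exact mul_le_of_le_one_right hlr.le h3
  have hpow : ∀ m, 0 ≤ m → m ≤ l * r → η * m ^ γ ≤ η * (l * t) ^ γ := fun m h0 hm => by
    have := hm.trans (mul_le_mul_of_nonneg_left hr.2.le hl.le)
    gcongr
  have he0 : 0 ≤ η * (l * t) ^ γ := mul_nonneg hη (Real.rpow_nonneg (by positivity) _)
  obtain ⟨L, hL, hL'⟩ := hasMFDerivAt_dilated (m := n) (S := (Susp c.d Z n).Stratum n) l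
    ((Susp.contMDiff_v s).mdifferentiableAt (by simp)).hasMFDerivAt y r
  obtain ⟨L₁, hL₁, hL₁'⟩ := hasMFDerivAt_dilated (m := n) (S := (Susp c.d Z n).Stratum n) l
    ((Susp.contMDiff_r s).mdifferentiableAt (by simp)).hasMFDerivAt y r
  have hLv : L (y', (t', ξ)) = l • (r • Susp.dv s ξ + t' • Susp.v s) := hL' y' t' ξ
  have hLr : L₁ (y', (t', ξ)) = l • (r • Susp.dr s ξ + t' • Susp.r s) := hL₁' y' t' ξ
  have hsus := suspMetric_apply k s ξ
  have hin := Susp.inner_dv n s ξ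
  have hmod : model (0 : QuadraticForm ℝ (E 0 × E 0)) 1 r (suspMetric c.d n k s)
      (v₀, (y', (t', ξ))) = t' ^ 2 + r ^ 2 * (‖Susp.dv s ξ‖ ^ 2 + Susp.dr s ξ ^ 2 +
        linkPart k s fun h => Susp.dz h s ξ) := by
    rw [← hsus]
    change 0 + 1 * t' ^ 2 + r ^ 2 * _ = _
    rw [zero_add, one_mul]
  have hlink : 0 ≤ linkPart k s fun h => Susp.dz h s ξ := by
    by_cases h : c.d + Z.n = n
    · rw [linkPart_of_eq _ _ _ h]
      exact mul_nonneg (sq_nonneg _) (hN.k_nonneg _ _)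
    · exact (linkPart_of_ne _ _ _ h).ge
  refine le_of_le_of_eq ?_ (congrArg (ε * ·) hmod.symm)
  refine le_of_eq_of_le (congrArg (fun q => |_ - q|) hmod) ?_
  refine abs_sub_le_of_dilated (e := η * (l * t) ^ γ) ?_ (by positivity) hl.le hl1 he0 hε
  have hpull : ∀ {F : E 0 × (ℝ × (Susp c.d Z n).Stratum n) → M.Stratum M.n}
      {F' : E 0 × (ℝ × E n) →L[ℝ] E M.n}, c.polarParam n l hn = F →
      HasMFDerivAt (𝓘(ℝ, E 0).prod (𝓘(ℝ, ℝ).prod 𝓘(ℝ, E n))) 𝓘(ℝ, E M.n) F (y, (r, s)) F' →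
      (c.polarChart n hl ht hfit).pull hn g.lift 0 y r s (v₀, (y', (t', ξ))) =
        g (F (y, (r, s))) (F' (y', (t', ξ))) := by
    rintro _ F' rfl hF
    exact congrArg (fun L : E 0 × (ℝ × E n) →L[ℝ] E M.n =>
      g (c.polarParam n l hn (y, (r, s))) (L (y', (t', ξ)))) hF.mfderiv
  rcases hN.link with ⟨h, -⟩ | ⟨h, -⟩
  · have h1 : n + 1 = c.d := by omega
    have hP : (c.polarChart n hl ht hfit).pull hn g.lift 0 y r s (v₀, (y', (t', ξ))) =
        c.pullTip h g.lift 0 (linMap l (y, (r, s))) (0, L (y', (t', ξ))) := by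
      exact (hpull (c.polarParam_tip n l hn h1 h) (((c.tip_diffeo h ⟨_, hmem.1⟩).mdifferentiableAt
        (by simp)).hasMFDerivAt.comp (y, (r, s)) hL)).trans rfl
    rw [hP, linkPart_of_ne _ _ _ (by omega)]
    have e3 := polar_norm_sq l r t' (Susp.v s) (Susp.dv s ξ) (Susp.r s) (Susp.dr s ξ) 0
      (Susp.v_r s) hin
    have e4 : Susp.dr s ξ = 0 := by
      have h5 : HasMFDerivAt 𝓘(ℝ, E n) 𝓘(ℝ, ℝ) (Susp.r : (Susp c.d Z n).Stratum n → ℝ) s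
          (0 : E n →L[ℝ] ℝ) := (hasMFDerivAt_const (0 : ℝ) s).congr_of_eventuallyEq
        (Eventually.of_forall (Susp.r_zero h1))
      exact congrArg (fun L : E n →L[ℝ] ℝ => L ξ) h5.mfderiv
    rw [e4] at e3 ⊢
    rw [Susp.r_zero h1 s] at e3
    simp only [smul_zero, add_zero, mul_zero, zero_pow two_ne_zero] at e3 ⊢
    have h2 := hN.tip h _ hmem.1 (L (y', (t', ξ)))
    rw [hLv] at h2 ⊢
    rw [← e3]
    exact h2.trans (mul_le_mul_of_nonneg_right (hpow _ (norm_nonneg _) hnorm.1) (sq_nonneg _))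
  · have h1 : c.d + Z.n = n := by omega
    have hr0 := hmem.2 (Susp.r_pos h1 s)
    have hP : (c.polarChart n hl ht hfit).pull hn g.lift 0 y r s (v₀, (y', (t', ξ))) =
        c.pull h g.lift 0 (linMap l (y, (r, s))) ((l * r) • Susp.r s) (Susp.z h1 s)
          (0, (L (y', (t', ξ)), (L₁ (y', (t', ξ)), Susp.dz h1 s ξ))) := by
      have hz := ((Susp.contMDiff_z h1 s).mdifferentiableAt (by simp)).hasMFDerivAt
      have hz' := (hz.comp (r, s) (hasMFDerivAt_snd (I := 𝓘(ℝ, ℝ)) (I' := 𝓘(ℝ, E n))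
        ((r, s) : ℝ × (Susp c.d Z n).Stratum n))).comp (y, (r, s))
        (hasMFDerivAt_snd (I := 𝓘(ℝ, E 0)) (I' := 𝓘(ℝ, ℝ).prod 𝓘(ℝ, E n))
        ((y, (r, s)) : E 0 × (ℝ × (Susp c.d Z n).Stratum n)))
      exact (hpull (c.polarParam_param n l hn h1 h) (((c.param_diffeo h
        ⟨polarMap l h1 (y, (r, s)), hmem.1, hr0⟩).mdifferentiableAt (by simp)).hasMFDerivAt.comp
        (y, (r, s)) (hL.prodMk (hL₁.prodMk hz')))).trans rfl
    have e3 := polar_norm_sq l r t' (Susp.v s) (Susp.dv s ξ) (Susp.r s) (Susp.dr s ξ)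
      (k (Susp.z h1 s) (Susp.dz h1 s ξ)) (Susp.v_r s) hin
    rw [hP, linkPart_of_eq _ _ _ h1, ← e3, ← hLv, ← hLr]
    refine (hN.param h _ hmem.1 _ hr0 _ _ _ _).trans (mul_le_mul_of_nonneg_right
      (hpow _ (le_max_of_le_left (norm_nonneg _)) (max_le hnorm.1 hnorm.2)) ?_)
    have := hN.k_nonneg (Susp.z h1 s) (Susp.dz h1 s ξ)
    positivity

end

/-! ### Conical neighbourhoods -/

theorem Sus.size_smul {D : ℕ} {Y : Type u} {t : ℝ} (ht : 0 ≤ t) (p : E D × Cone Y) :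
    Sus.size ((t • p.1, Cone.dil t p.2) : E D × Cone Y) = t * Sus.size p := by
  rw [Sus.size, Sus.size, Cone.radius_dil ht, norm_smul, Real.norm_of_nonneg ht, mul_pow, mul_pow,
    ← mul_add, Real.sqrt_mul (sq_nonneg t), Real.sqrt_sq ht]

theorem sqrt_five_quarters : √(5 / 4) ≤ 9 / 8 := Real.sqrt_le_iff.2 (by norm_num)

section

variable {M Z : StratSpace.{u}} {γ η : ℝ} {c : EdgeChart M Z} {g : Metric M} {k : Metric Z}

theorem IsNormal.geodEDist_le (hN : IsNormal γ η c g k) (hd : Dense {x | M.dim x = M.n})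
    (hM : ∀ x, HasNormalChart γ g x) {ε : ℝ} (hε : 0 < ε) (hU : Metric.ball 0 ε ⊆ c.U)
    {x : M.carrier} (hx : x ∈ c.φ.source) (h1 : ‖(c.φ x).1‖ < ε) {L : ℝ}
    (hL : Sus.size (c.φ x) < L) :
    geodEDist g (c.φ.symm (0, Cone.vertex)) x ≤ ENNReal.ofReal (√(5 / 4) * L) := by
  have hc := c.φ.continuousAt hx
  have hc1 : ContinuousAt (fun y => ‖(c.φ y).1‖) x :=
    (continuous_norm.comp continuous_fst).continuousAt.comp hc
  have hc2 : ContinuousAt (fun y => Sus.size (c.φ y)) x := Sus.continuous_size.continuousAt.comp hc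
  refine geodEDist_le_of_eventually hd (hM x) ?_
  filter_upwards [hc1.eventually_lt_const h1, hc2.eventually_lt_const hL,
    c.φ.open_source.mem_nhds hx] with y h2 h3 h4 hreg
  refine (geodEDist_le_segLength _ _ _).trans ((hN.segLength_le (hU (Metric.mem_ball_self hε))
    ⟨y, hreg⟩ h4 fun t ht => hU (mem_ball_zero_iff.2 ?_)).trans (ENNReal.ofReal_le_ofReal ?_))
  · rw [norm_smul, Real.norm_of_nonneg ht.1.le]
    exact (mul_le_of_le_one_left (norm_nonneg _) ht.2.le).trans_lt h2
  · exact mul_le_mul_of_nonneg_left h3.le (Real.sqrt_nonneg _)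

/-- A chart contains the points of size less than `t₀` if no line issuing from its centre leaves
it within the set `W`. -/
def NoExit (c : EdgeChart M Z) (t₀ : ℝ) (W : Set M.carrier) : Prop :=
  ∀ p : E c.d × Cone Z.carrier, Sus.size p < t₀ →
    (∀ t ∈ Ioo (0 : ℝ) 1, (t • p.1, Cone.dil t p.2) ∈ c.φ.target) → ∀ l : Filter ℝ, l.NeBot →
    l ≤ 𝓝[<] 1 → ∀ x ∈ W, Tendsto (fun t : ℝ => c.φ.symm (t • p.1, Cone.dil t p.2)) l (𝓝 x) →
    p ∈ c.φ.target

theorem IsNormal.fits_of_reg [CompactSpace M.carrier] (hN : IsNormal γ η c g k)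
    (hd : Dense {x | M.dim x = M.n}) (hM : ∀ x, HasNormalChart γ g x) (h0 : (0 : E c.d) ∈ c.U)
    {t₀ a δ : ℝ} (ha : 0 ≤ a) {m : M.carrier} {W : Set M.carrier}
    (hm : geodEDist g m (c.φ.symm (0, Cone.vertex)) ≤ ENNReal.ofReal a)
    (hδ : a + √(5 / 4) * t₀ < δ) (hW : geodBall g m δ ⊆ W) (hex : NoExit c t₀ W)
    {p : E c.d × Cone Z.carrier} (hp : Sus.size p < t₀)
    (hreg : ∀ t > 0, (t • p.1, Cone.dil t p.2) ∈ c.φ.target →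
      M.dim (c.φ.symm (t • p.1, Cone.dil t p.2)) = M.n) : p ∈ c.φ.target := by
  by_contra hpt
  set f : ℝ → E c.d × Cone Z.carrier := fun t => (t • p.1, Cone.dil t p.2) with hf
  have hfc : Continuous f := (continuous_id.smul continuous_const).prodMk
    (Cone.continuous_dil.comp (continuous_id.prodMk continuous_const))
  have hf0 : f 0 = (0, Cone.vertex) := Prod.ext (zero_smul _ _) (Cone.eq_vertex_of_radius
    (by rw [Cone.radius_dil le_rfl, zero_mul]))
  have hf1 : f 1 = p := Prod.ext (one_smul _ _) (Cone.dil_one _)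
  have hJ : IsCompact (Icc (0 : ℝ) 1 ∩ {t | f t ∉ c.φ.target}) :=
    isCompact_Icc.inter_right (c.φ.open_target.preimage hfc).isClosed_compl
  obtain ⟨s, ⟨⟨hs, hsf⟩, hleast⟩⟩ := hJ.exists_isLeast ⟨1, by simp, by simpa [hf1] using hpt⟩
  have hs0 : 0 < s := by
    refine lt_of_le_of_ne hs.1 fun h => hsf ?_
    rw [← h, hf0]
    exact c.mem_target.2 ⟨h0, c.R_pos⟩
  have hlt : ∀ t, 0 ≤ t → t < s → f t ∈ c.φ.target := fun t ht hts => by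
    by_contra h
    exact (hleast ⟨⟨ht, hts.le.trans hs.2⟩, h⟩).not_gt hts
  have hmul : ∀ t, 0 ≤ t → ((t • (f s).1, Cone.dil t (f s).2) : E c.d × Cone Z.carrier) =
      f (t * s) := fun t ht => Prod.ext (smul_smul _ _ _) (Cone.dil_dil ht _)
  have hmem : ∀ t ∈ Ioo (0 : ℝ) 1, f (t * s) ∈ c.φ.target := fun t ht =>
    hlt _ (mul_nonneg ht.1.le hs0.le) (mul_lt_of_lt_one_left hs0 ht.2)
  have hsize : ∀ t, 0 ≤ t → t ≤ 1 → Sus.size (f t) < t₀ := fun t h1 h2 => by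
    rw [Sus.size_smul h1]
    exact (mul_le_of_le_one_left (Sus.size_nonneg _) h2).trans_lt hp
  let l := Ultrafilter.of (𝓝[<] (1 : ℝ))
  have hl : (l : Filter ℝ) ≤ 𝓝[<] 1 := Ultrafilter.of_le _
  have hI : ∀ᶠ t in (l : Filter ℝ), t ∈ Ioo (0 : ℝ) 1 := hl (Ioo_mem_nhdsLT one_pos)
  set x := (l.map fun t => c.φ.symm (f (t * s))).lim
  have hx : Tendsto (fun t => c.φ.symm (f (t * s))) l (𝓝 x) :=
    (l.map fun t => c.φ.symm (f (t * s))).le_nhds_lim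
  refine hsf (hex (f s) (hsize s hs.1 hs.2) (fun t ht => ?_) l inferInstance hl x (hW ?_) ?_)
  · rw [hmul t ht.1.le]; exact hmem t ht
  · obtain ⟨ε, hε, hε'⟩ : ∃ ε > 0, a + √(5 / 4) * t₀ + ε < δ :=
      ⟨(δ - (a + √(5 / 4) * t₀)) / 2, by linarith, by linarith⟩
    obtain ⟨t, h1, ht⟩ := ((hx.eventually (eventually_geodEDist_lt hd hM x hε)).and hI).exists
    have ht1 := hmem t ht
    have hts : 0 < t * s := mul_pos ht.1 hs0
    have h2 : geodEDist g (c.φ.symm (0, Cone.vertex)) (c.φ.symm (f (t * s))) ≤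
        ENNReal.ofReal (√(5 / 4) * t₀) := by
      refine (geodEDist_le_segLength _ _ _).trans ((hN.segLength_le h0 ⟨_, hreg _ hts ht1⟩
        (c.φ.map_target ht1) fun t' ht' => ?_).trans (ENNReal.ofReal_le_ofReal ?_))
      · have h3 := c.φ.right_inv ht1
        change t' • (c.φ (c.φ.symm (f (t * s)))).1 ∈ _
        rw [h3]
        have h4 := (c.mem_target.1 (hmem (t' * t) ⟨mul_pos ht'.1 ht.1,
          mul_lt_one_of_nonneg_of_lt_one_left ht'.1.le ht'.2 ht.2.le⟩)).1
        change (t' * t * s) • p.1 ∈ c.U at h4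
        change t' • (t * s) • p.1 ∈ c.U
        rwa [smul_smul, ← mul_assoc]
      · change √(5 / 4) * Sus.size (c.φ (c.φ.symm (f (t * s)))) ≤ _
        rw [c.φ.right_inv ht1]
        exact mul_le_mul_of_nonneg_left
          (hsize _ hts.le (mul_le_one₀ ht.2.le hs0.le hs.2)).le (Real.sqrt_nonneg _)
    have ht₀ : 0 ≤ √(5 / 4) * t₀ :=
      mul_nonneg (Real.sqrt_nonneg _) ((Sus.size_nonneg p).trans hp.le)
    rw [geodEDist_comm] at h1
    refine lt_of_le_of_lt ?_ ((ENNReal.ofReal_lt_ofReal_iff (by linarith)).2 hε')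
    rw [ENNReal.ofReal_add (by positivity) hε.le, ENNReal.ofReal_add ha ht₀]
    exact (geodEDist_triangle _ _ _ _).trans (add_le_add ((geodEDist_triangle _ _ _ _).trans
      (add_le_add hm h2)) h1.le)
  · refine hx.congr' (hI.mono fun t ht => ?_)
    simp only [hmul t ht.1.le]

theorem IsNormal.fits [CompactSpace M.carrier] (hN : IsNormal γ η c g k)
    (hd : Dense {x | M.dim x = M.n}) (hM : ∀ x, HasNormalChart γ g x)
    (hZ : Dense {z | Z.dim z = Z.n}) (h0 : (0 : E c.d) ∈ c.U)
    {t₀ a δ : ℝ} (ha : 0 ≤ a) {m : M.carrier} {W : Set M.carrier}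
    (hm : geodEDist g m (c.φ.symm (0, Cone.vertex)) ≤ ENNReal.ofReal a)
    (hδ : a + √(5 / 4) * t₀ < δ) (hW : geodBall g m δ ⊆ W) (hex : NoExit c t₀ W)
    (p : E c.d × Cone Z.carrier) (hp : Sus.size p < t₀) : p ∈ c.φ.target := by
  rcases hN.link with ⟨hn, hemp⟩ | ⟨hn, ⟨z₀⟩⟩
  · refine hN.fits_of_reg hd hM h0 ha hm hδ hW hex hp fun t ht htt => ?_
    obtain ⟨y, q⟩ := p
    obtain rfl : q = Cone.vertex := by
      rcases Cone.cases q with h | ⟨_, _, z, _⟩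
      · exact h
      · exact (hemp.false z).elim
    rw [Cone.dil_vertex] at htt ⊢
    rw [c.dim_vertex (c.mem_target.1 htt).1, hn]
  · obtain ⟨z, hz⟩ := hZ.nonempty_iff.2 ⟨z₀⟩
    have h1 : p.2.radius < √(t₀ ^ 2 - ‖p.1‖ ^ 2) := by
      refine Real.lt_sqrt_of_sq_lt ?_
      have := Sus.size_sq p
      nlinarith [Sus.size_nonneg p]
    obtain ⟨ρ, hρ1, hρ2⟩ := exists_between h1
    have hρ0 : 0 < ρ := (Cone.radius_nonneg _).trans_lt hρ1
    have h2 : Sus.size ((p.1, Cone.pt ρ z) : E c.d × Cone Z.carrier) < t₀ := by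
      refine (Real.sqrt_lt' ((Sus.size_nonneg p).trans_lt hp)).2 ?_
      simp only [Cone.radius_pt hρ0.le]
      linarith [(Real.lt_sqrt hρ0.le).1 hρ2]
    have h3 := hN.fits_of_reg hd hM h0 ha hm hδ hW hex h2 fun t ht htt => by
      rw [Cone.dil_pt ht.le] at htt ⊢
      have h4 := c.mem_target.1 htt
      simp only [Cone.radius_pt (mul_pos ht hρ0).le] at h4
      rw [c.dim_pt h4.1 ⟨mul_pos ht hρ0, h4.2⟩, hz, hn]
    have h4 := c.mem_target.1 h3
    simp only [Cone.radius_pt hρ0.le] at h4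
    exact c.mem_target.2 ⟨h4.1, hρ1.trans h4.2⟩

theorem EdgeChart.mem_polarChart_source (c : EdgeChart M Z) (n : ℕ) {l t : ℝ} (hl : 0 < l)
    (ht : 0 < t) (hfit : ∀ p : E c.d × Cone Z.carrier, Sus.size p < l * t → p ∈ c.φ.target)
    {x : M.carrier} : x ∈ (c.polarChart n hl ht hfit).φ.source ↔
      x ∈ c.φ.source ∧ Sus.size (c.φ x) < l * t := by
  change x ∈ (c.polarInv hl t).target ↔ _
  rw [← (c.polarInv hl t).image_source_eq_target, c.polarInv_source hl hfit]
  constructor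
  · rintro ⟨p, hp, rfl⟩
    have h1 : Sus.size (polarHomeo c.d Z.carrier hl p) < l * t := by
      rw [size_polarHomeo]; exact mul_lt_mul_of_pos_left hp hl
    change c.φ.symm (polarHomeo c.d Z.carrier hl p) ∈ _ ∧
      Sus.size (c.φ (c.φ.symm (polarHomeo c.d Z.carrier hl p))) < _
    rw [c.φ.right_inv (hfit _ h1)]
    exact ⟨c.φ.map_target (hfit _ h1), h1⟩
  · rintro ⟨h1, h2⟩
    refine ⟨(polarHomeo c.d Z.carrier hl).symm (c.φ x), ?_, ?_⟩
    · have h3 := size_polarHomeo hl c.d Z.carrier ((polarHomeo c.d Z.carrier hl).symm (c.φ x))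
      rw [Homeomorph.apply_symm_apply] at h3
      rw [h3] at h2
      exact lt_of_mul_lt_mul_left h2 hl.le
    · change c.φ.symm (polarHomeo c.d Z.carrier hl ((polarHomeo c.d Z.carrier hl).symm (c.φ x))) = x
      rw [Homeomorph.apply_symm_apply, c.φ.left_inv h1]

/-- The conical neighbourhood of the centre of a normal chart. -/
theorem IsNormal.exists_coneApprox [CompactSpace M.carrier] [T2Space M.carrier]
    [CompactSpace Z.carrier] (hN : IsNormal γ η c g k) (hγ : 0 < γ) (hη : 0 ≤ η)
    (hd : Dense {x | M.dim x = M.n}) (hM : ∀ x, HasNormalChart γ g x)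
    (hZ : Dense {z | Z.dim z = Z.n}) (h0 : (0 : E c.d) ∈ c.U) {n : ℕ} (hn : 0 + 1 + n = M.n)
    {t t₀ τ ε δ : ℝ} (hτ : 0 < τ) (htt : t₀ ≤ t) (hδ : 2 * t ≤ δ) {q : Cone Z.carrier}
    (hqR : q.radius < c.R) (hq : q.radius + 2 * τ < t₀ / 2) {W : Set M.carrier}
    (hW : geodBall g (c.φ.symm (0, q)) δ ⊆ W) (hex : NoExit c t₀ W)
    (hε : η * t₀ ^ γ + (1 - (t₀ / t) ^ 2) ≤ ε) :
    ∃ Φ : ConeChart M (Susp c.d Z n), geodBall g (c.φ.symm (0, q)) τ ⊆ Φ.φ.source ∧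
      Φ.φ.source ⊆ geodBall g (c.φ.symm (0, q)) (2 * t) ∧
      IsConeApprox Φ t ε g (suspMetric c.d n k) := by
  have hq0 := Cone.radius_nonneg q
  have ht₀ : 0 < t₀ := by linarith
  have ht : 0 < t := ht₀.trans_le htt
  have hl : 0 < t₀ / t := div_pos ht₀ ht
  have hlt : t₀ / t * t = t₀ := div_mul_cancel₀ _ ht.ne'
  have hmt : ((0, q) : E c.d × Cone Z.carrier) ∈ c.φ.target := c.mem_target.2 ⟨h0, hqR⟩
  have hms := c.φ.map_target hmt
  have hm : geodEDist g (c.φ.symm (0, q)) (c.φ.symm (0, Cone.vertex)) ≤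
      ENNReal.ofReal (√(5 / 4) * (t₀ / 2)) := by
    obtain ⟨ε', hε', hb⟩ := Metric.isOpen_iff.1 c.isOpen_U 0 h0
    rw [geodEDist_comm]
    refine hN.geodEDist_le hd hM hε' hb hms (by rwa [c.φ.right_inv hmt, norm_zero]) ?_
    rw [c.φ.right_inv hmt]
    refine (Sus.size_le _).trans_lt ?_
    rw [norm_zero, zero_add]
    linarith
  have h5 := sqrt_five_quarters
  have hfit := hN.fits hd hM hZ h0 (by positivity) hm (δ := δ) (by nlinarith) hW hex
  have hB := hN.isBarrier (t₀ := t₀ / 2) fun p h1 h2 =>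
    hfit p ((Sus.size_le p).trans_lt (by linarith))
  have hcoord : ‖c.coord (c.φ.symm (0, q))‖ = q.radius := by
    rw [ConeChart.coord, c.φ.right_inv hmt, Prod.norm_def, norm_zero,
      Real.norm_of_nonneg hq0, max_eq_right hq0]
  refine ⟨c.polarChart n hl ht (by rwa [hlt]), fun y hy => ?_, fun y hy => ?_,
    hN.isConeApprox hl ht _ hγ hη hn ((div_le_one ht).2 htt) (by rwa [hlt])⟩
  · obtain ⟨h1, h2⟩ := hB.geodEDist_lt zero_le_two hms hy (by rwa [hcoord])
    rw [hcoord] at h2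
    refine (c.mem_polarChart_source n hl ht _).2 ⟨h1, (Sus.size_le _).trans_lt ?_⟩
    have h3 := (norm_fst_le (c.coord y)).trans h2
    have h4 := (le_abs_self _).trans ((norm_snd_le (c.coord y)).trans h2)
    change ‖(c.φ y).1‖ ≤ _ at h3
    change (c.φ y).2.radius ≤ _ at h4
    linarith
  · obtain ⟨h1, h2⟩ := (c.mem_polarChart_source n hl ht _).1 hy
    rw [hlt] at h2
    have h3 := hN.geodEDist_le hd hM ht₀ (fun y hy => (c.mem_target.1 (hfit (y, Cone.vertex)
      ((Sus.size_le _).trans_lt (by simpa [Cone.radius_vertex] using hy)))).1) h1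
      ((Sus.norm_le_size _).trans_lt h2) h2
    refine ((geodEDist_triangle _ _ _ _).trans (add_le_add hm h3)).trans_lt ?_
    rw [← ENNReal.ofReal_add (by positivity) (by positivity)]
    exact (ENNReal.ofReal_lt_ofReal_iff (by linarith)).2 (by nlinarith)

end

/-! ### Uniformity -/

/-- For every `K > 1` the set is the union of finitely many sets of spaces that are mutually
`K`-bi-Lipschitz. -/
def BiLipColored (𝒮 : Set CompactMet.{u}) : Prop :=
  ∀ K : ℝ, 1 < K → FinColor fun X Y : 𝒮 => BiLip K X Y

theorem BiLipColored.iUnion {ι : Type} [Finite ι] {𝒮 : ι → Set CompactMet.{u}}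
    (h : ∀ i, BiLipColored (𝒮 i)) : BiLipColored (⋃ i, 𝒮 i) := fun K hK => by
  choose κ hκ col hcol using fun i => h i K hK
  choose j hj using fun X : ⋃ i, 𝒮 i => mem_iUnion.1 X.2
  refine ⟨Σ i, κ i, inferInstance, fun X => (⟨j X, col (j X) ⟨X, hj X⟩⟩ : Σ i, κ i), fun X Y hXY => ?_⟩
  have key : ∀ i, ∀ hi : Y.1 ∈ 𝒮 i, (⟨j X, col (j X) ⟨X, hj X⟩⟩ : Σ i, κ i) =
      ⟨i, col i ⟨Y, hi⟩⟩ → BiLip K X.1 Y.1 := by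
    rintro i hi hXi
    obtain rfl : j X = i := congrArg Sigma.fst hXi
    exact hcol _ _ _ (eq_of_heq (Sigma.mk.inj hXi).2)
  exact key _ (hj Y) hXY

/-- The metric spaces of the tangent spheres with link metrics bounded by `C`. -/
def suspSpaces (γ C : ℝ) {Z : StratSpace.{u}} (A : IterAtlas Z) (n : ℕ) : Set CompactMet.{u} :=
  {Y | ∃ (D : Fin (n + 2)) (k : Metric Z), IsEdgeOn γ C A (E 0) univ k.lift ∧
    IsMetricSpaceOf Y (suspMetric D n k)}

theorem biLipColored_suspSpaces {γ C : ℝ} (hγ : 0 < γ) (hC : 1 ≤ C) {Z : StratSpace.{u}}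
    (A : IterAtlas Z) (n : ℕ) : BiLipColored (suspSpaces γ C A n) := fun K hK => by
  have hK2 : 0 < K ^ 2 - 1 := by nlinarith
  obtain ⟨κ, hκ, col, hcol⟩ := finColor_edge (V := E 0) hγ hC A hK2 (Q := univ)
    (Set.subsingleton_of_subsingleton).finite.isBounded
  choose D k hk hY using fun Y : suspSpaces γ C A n => Y.2
  refine ⟨Fin (n + 2) × κ, inferInstance, fun Y => (D Y, col ⟨_, hk Y⟩), fun X Y hXY => ?_⟩
  have hle : ∀ X Y : suspSpaces γ C A n, col ⟨_, hk X⟩ = col ⟨_, hk Y⟩ →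
      ∀ D s ξ, suspMetric D n (k X) s ξ ≤ K ^ 2 * suspMetric D n (k Y) s ξ := by
    intro X Y h D s ξ
    have h1 := suspMetric_close (D := D) (n := n) hK2.le
      (fun z ζ => hcol _ _ h 0 (mem_univ _) z (0, ζ)) s ξ
    linarith [(abs_le.1 h1).2]
  have h1 := hY X
  have h2 := congrArg Prod.snd hXY
  rw [show D X = D Y from congrArg Prod.fst hXY] at h1
  exact biLip_of_le (by linarith) (hle X Y h2 _) (hle Y X h2.symm _) h1 (hY Y)

/-- The property `P E κ Λ 𝒮` holds for some `E`, for `κ` large, for `Λ` large in terms of `κ`, and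
for all `𝒮` that contain a certain set. -/
def Uniformly (P : ℝ → ℝ → ℝ → Set CompactMet.{u} → Prop) : Prop :=
  ∃ E > 0, ∃ κ₀ : ℝ, ∃ 𝒮₀ : Set CompactMet.{u}, BiLipColored 𝒮₀ ∧
    ∀ κ ≥ κ₀, ∃ Λ₀ : ℝ, ∀ Λ ≥ Λ₀, ∀ 𝒮, 𝒮₀ ⊆ 𝒮 → P E κ Λ 𝒮

theorem Uniformly.forall {ι : Type} [Finite ι] {P : ι → ℝ → ℝ → ℝ → Set CompactMet.{u} → Prop}
    (h : ∀ i, Uniformly (P i))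
    (hP : ∀ i E E' κ Λ 𝒮, E' ≤ E → P i E κ Λ 𝒮 → P i E' κ Λ 𝒮) :
    Uniformly fun E κ Λ 𝒮 => ∀ i, P i E κ Λ 𝒮 := by
  choose E hE κ₀ 𝒮₀ h𝒮 hκ using h
  obtain ⟨E', hE', hEE⟩ : ∃ E' > 0, ∀ i, E' ≤ E i := by
    rcases isEmpty_or_nonempty ι with hι | hι
    · exact ⟨1, one_pos, fun i => hι.elim i⟩
    · obtain ⟨i, hi⟩ := Finite.exists_min E
      exact ⟨E i, hE i, hi⟩
  obtain ⟨κ₁, hκ₁⟩ := (Set.finite_range κ₀).bddAbove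
  refine ⟨E', hE', κ₁, ⋃ i, 𝒮₀ i, BiLipColored.iUnion h𝒮, fun κ hκκ => ?_⟩
  choose Λ₀ hΛ using fun i => hκ i κ ((hκ₁ (mem_range_self i)).trans hκκ)
  obtain ⟨Λ₁, hΛ₁⟩ := (Set.finite_range Λ₀).bddAbove
  exact ⟨Λ₁, fun Λ hΛΛ 𝒮 hS i => hP i _ _ _ _ _ (hEE i) (hΛ i Λ
    ((hΛ₁ (mem_range_self i)).trans hΛΛ) 𝒮 ((subset_iUnion _ i).trans hS))⟩

/-! ### Levels -/

section

variable {M : StratSpace.{u}}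

/-- At the scales from `lo` to `T` the space `M` is conical near `m`, with the same cone. -/
def ConicalBetween (γ κ Λ δ : ℝ) (𝒮 : Set CompactMet.{u}) (g : Metric M) (m : M.carrier)
    (T lo : ℝ) : Prop :=
  ∃ (S : StratSpace.{u}) (ℬ : IterAtlas S) (h : Metric S), ConnectedSpace S.carrier ∧
    IsIteratedEdge γ ℬ h ∧ (∃ Y ∈ 𝒮, IsMetricSpaceOf Y h) ∧
    ∀ τ : ℝ, 0 < τ → 2 * κ * τ ≤ δ → lo ≤ τ → τ < T →
      ∃ Φ : ConeChart M S, geodBall g m τ ⊆ Φ.φ.source ∧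
        Φ.φ.source ⊆ geodBall g m (2 * κ * τ) ∧ IsConeApprox Φ (κ * τ) (Λ * (τ / T) ^ γ) g h

theorem IsConeApprox.mono {S : StratSpace.{u}} {Φ : ConeChart M S} {t ε ε' : ℝ} {g : Metric M}
    {h : Metric S} (hΦ : IsConeApprox Φ t ε g h) (hε : ε ≤ ε') (hh : ∀ z ζ, 0 ≤ h z ζ) :
    IsConeApprox Φ t ε' g h := by
  obtain ⟨h1, h2, h3, h4⟩ := hΦ
  refine ⟨h1, h2, h3, fun y hy r hr z v => (h4 y hy r hr z v).trans
    (mul_le_mul_of_nonneg_right hε ?_)⟩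
  exact model_nonneg (fun _ => le_rfl) zero_le_one (hh z) v

theorem ConicalBetween.mono {γ κ Λ Λ' δ : ℝ} {𝒮 : Set CompactMet.{u}} {g : Metric M}
    {m : M.carrier} {T lo T' lo' : ℝ} (h : ConicalBetween γ κ Λ δ 𝒮 g m T lo) (hlo : lo ≤ lo')
    (hT : ∀ τ, 0 < τ → 2 * κ * τ ≤ δ → τ < T' → τ < T ∧ Λ * (τ / T) ^ γ ≤ Λ' * (τ / T') ^ γ) :
    ConicalBetween γ κ Λ' δ 𝒮 g m T' lo' := by
  obtain ⟨S, ℬ, h, h1, h2, h3, h4⟩ := h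
  refine ⟨S, ℬ, h, h1, h2, h3, fun τ hτ hδ h5 h6 => ?_⟩
  obtain ⟨h7, h8⟩ := hT τ hτ hδ h6
  obtain ⟨Φ, h9, h10, h11⟩ := h4 τ hτ hδ (hlo.trans h5) h7
  obtain ⟨C, -, hC⟩ := h2
  exact ⟨Φ, h9, h10, h11.mono h8 (metric_zero_le hC)⟩

/-- The scales below `T` are divided into `d + 1` intervals, in each of which `M` is conical. -/
def Levels (γ κ Λ δ : ℝ) (𝒮 : Set CompactMet.{u}) (g : Metric M) (m : M.carrier) (d : ℕ)
    (T : ℝ) : Prop :=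
  ∃ τ : ℕ → ℝ, τ 0 = T ∧ (∀ i < d, 0 < τ (i + 1) ∧ τ (i + 1) < τ i) ∧ τ (d + 1) = 0 ∧
    ∀ i ≤ d, ConicalBetween γ κ Λ δ 𝒮 g m (τ i) (τ (i + 1))

variable {γ κ Λ δ : ℝ} {𝒮 : Set CompactMet.{u}} {g : Metric M} {m : M.carrier}

theorem Levels.cons {d : ℕ} {T T' : ℝ} (hT' : 0 < T') (hT : T' < T)
    (h : ConicalBetween γ κ Λ δ 𝒮 g m T T') (hL : Levels γ κ Λ δ 𝒮 g m d T') :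
    Levels γ κ Λ δ 𝒮 g m (d + 1) T := by
  obtain ⟨τ, rfl, h1, h2, h3⟩ := hL
  refine ⟨fun i => Nat.casesOn i T τ, rfl, fun i hi => ?_, h2, fun i hi => ?_⟩
  · cases i with
    | zero => exact ⟨hT', hT⟩
    | succ i => exact h1 i (by omega)
  · cases i with
    | zero => exact h
    | succ i => exact h3 i (by omega)

theorem Levels.single (hγ : 0 < γ) (hΛ : 0 ≤ Λ) (d : ℕ) : ∀ {T : ℝ}, 0 < T →
    ConicalBetween γ κ Λ δ 𝒮 g m T 0 → Levels γ κ Λ δ 𝒮 g m d T := by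
  induction d with
  | zero =>
    intro T hT h
    refine ⟨fun i => Nat.casesOn i T fun _ => 0, rfl, fun i hi => absurd hi (by omega), rfl, ?_⟩
    rintro i hi
    obtain rfl : i = 0 := by omega
    exact h
  | succ d ih =>
    intro T hT h
    refine Levels.cons (half_pos hT) (half_lt_self hT) (h.mono (half_pos hT).le fun τ h1 h2 h3 =>
      ⟨h3, le_rfl⟩) (ih (half_pos hT) (h.mono le_rfl fun τ h1 h2 h3 =>
      ⟨h3.trans (half_lt_self hT), ?_⟩))
    gcongr
    exact half_le_self hT.le

end

/-! ### Exits -/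

section

variable {M X Z : StratSpace.{u}} {V : Type} [NormedAddCommGroup V] [NormedSpace ℝ V]

/-- In the composition of a product chart and a chart, the curves that stay at a distance less than
`s` from the point with coordinates `(b, y, r)` can leave the domain of the coordinates
only by leaving `W`. -/
def ExitFree (Ψ : ProdChart M X V) (c : ConeChart X Z) (W : Set M.carrier) (b : V) (y : E c.d)
    (r s : ℝ) : Prop :=
  ∀ F : Filter (V × (E c.d × Cone Z.carrier)), F.NeBot →
    (∀ᶠ p in F, p.1 ∈ Ψ.P ∧ p.2 ∈ c.φ.target) → ∀ b₁ y₁ r₁, Tendsto (fun p => p.1) F (𝓝 b₁) →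
    Tendsto (fun p => p.2.1) F (𝓝 y₁) → Tendsto (fun p => p.2.2.radius) F (𝓝 r₁) →
    ‖b₁ - b‖ < s → ‖y₁ - y‖ < s → |r₁ - r| < s →
    ∀ x ∈ W, Tendsto (fun p => Ψ.e (p.1, c.φ.symm p.2)) F (𝓝 x) →
    b₁ ∈ Ψ.P ∧ y₁ ∈ c.U ∧ r₁ < c.R

theorem exitFree_refl (c : ConeChart M Z) (b : E 0) (y : E c.d) (r s : ℝ) :
    ExitFree (ProdChart.refl M) c c.φ.source b y r s := by
  rintro F hF hev b₁ y₁ r₁ - hy hr - - - x hx hxt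
  have h1 : Tendsto (fun p : E 0 × (E c.d × Cone Z.carrier) => p.2) F (𝓝 (c.φ x)) := by
    refine ((c.φ.continuousAt hx).tendsto.comp hxt).congr' (hev.mono fun p hp => ?_)
    exact c.φ.right_inv hp.2
  have h2 := c.mem_target.1 (c.φ.map_source hx)
  rw [tendsto_nhds_unique hy ((continuous_fst.tendsto _).comp h1),
    tendsto_nhds_unique hr (((Cone.continuous_radius.comp continuous_snd).tendsto _).comp h1)]
  exact ⟨mem_univ _, h2⟩

theorem ProdChart.step_e [FiniteDimensional ℝ V] (Ψ : ProdChart M X V) (c : ConeChart X Z)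
    [Nonempty Z.carrier] (b : V) (y : E c.d) {r : ℝ} (hr : 0 < r) {u : V × (E c.d × ℝ)}
    (hu : 0 < r * (1 + u.2.2)) (z : Z.carrier) : (Ψ.step c b y r hr).e (u, z) =
      Ψ.e (b + r • u.1, c.φ.symm (y + r • u.2.1, Cone.pt (r * (1 + u.2.2)) z)) := by
  rw [← Cone.ptHomeo_apply _ hu]
  rfl

theorem ExitFree.step [FiniteDimensional ℝ V] {Z' : StratSpace.{u}} [Nonempty Z.carrier]
    {Ψ : ProdChart M X V} {c : ConeChart X Z} {W : Set M.carrier} {b : V} {y : E c.d} {r s s' : ℝ}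
    (hE : ExitFree Ψ c W b y r s) (hr : 0 < r) (hs' : s' ≤ 1 / 2) (hs : r * s' ≤ s)
    (c' : ConeChart Z Z') {y' : E c'.d} {r' : ℝ} (hy' : Metric.ball y' s' ⊆ c'.U)
    (hr' : r' + s' ≤ c'.R) : ExitFree (Ψ.step c b y r hr) c' W 0 y' r' s' := by
  intro F hF hev u₁ y₁ r₁ hu hy hr₁ hus hys hrs x hx hxt
  rw [sub_zero] at hus
  refine ⟨?_, hy' (by rwa [mem_ball_iff_norm]), by linarith [(abs_lt.1 hrs).2]⟩
  let f : (V × (E c.d × ℝ)) × (E c'.d × Cone Z'.carrier) → V × (E c.d × Cone Z.carrier) := fun p =>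
    (b + r • p.1.1, (y + r • p.1.2.1, Cone.pt (r * (1 + p.1.2.2)) (c'.φ.symm p.2)))
  have hpos : ∀ᶠ p in F, r * (1 + p.1.2.2) ∈ Ioo 0 c.R := hev.mono fun p hp =>
    c.box_radius hr hp.1
  have ht : ∀ {W' : Type} [TopologicalSpace W'] (G : V × (E c.d × ℝ) → W'), Continuous G →
      Tendsto (fun p : (V × (E c.d × ℝ)) × (E c'.d × Cone Z'.carrier) => G p.1) F (𝓝 (G u₁)) :=
    fun G hG => (hG.tendsto u₁).comp hu
  have hnorm : ∀ {W' : Type} [NormedAddCommGroup W'] [NormedSpace ℝ W'] (w v : W'), ‖v‖ ≤ ‖u₁‖ →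
      ‖w + r • v - w‖ < s := fun w v hv => by
    rw [add_sub_cancel_left, norm_smul, Real.norm_of_nonneg hr.le]
    exact (mul_lt_mul_of_pos_left (hv.trans_lt hus) hr).trans_le hs
  have h1 : ‖u₁.2.2‖ ≤ ‖u₁‖ := (norm_snd_le u₁.2).trans (norm_snd_le u₁)
  suffices h : b + r • u₁.1 ∈ Ψ.P ∧ y + r • u₁.2.1 ∈ c.U ∧ r * (1 + u₁.2.2) < c.R from
    ⟨by linarith, h⟩
  refine hE (F.map f) inferInstance (eventually_map.2 (hev.and hpos |>.mono
    fun p hp => ⟨hp.1.1.2.1, c.mem_target.2 ⟨hp.1.1.2.2.1, ?_⟩⟩)) (b + r • u₁.1) (y + r • u₁.2.1)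
    (r * (1 + u₁.2.2)) (tendsto_map'_iff.2 (ht (fun u => b + r • u.1) (by fun_prop)))
    (tendsto_map'_iff.2 (ht (fun u => y + r • u.2.1) (by fun_prop)))
    (tendsto_map'_iff.2 ((ht (fun u => r * (1 + u.2.2)) (by fun_prop)).congr' (hpos.mono
      fun p hp => ?_))) (hnorm _ _ (norm_fst_le u₁))
    (hnorm _ _ ((norm_fst_le u₁.2).trans (norm_snd_le u₁)))
    (by have := hnorm r u₁.2.2 h1; rwa [smul_eq_mul, Real.norm_eq_abs, ← mul_one_add] at this) x hx
    (tendsto_map'_iff.2 (hxt.congr' (hpos.mono fun p hp => ?_)))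
  · change Cone.radius (Cone.pt _ _) < _
    rw [Cone.radius_pt hp.2.1.le]
    exact hp.2.2
  · exact (Cone.radius_pt hp.1.le _).symm
  · exact Ψ.step_e c b y hr hp.1 _

theorem NormalAt.noExit {γ C C₁ η σ s s' r t₀ : ℝ} {A : IterAtlas Z} {Ψ : ProdChart M X V}
    {g : Metric M} {c : EdgeChart X Z} {b : V} {y : E c.d} {W : Set M.carrier}
    (N : NormalAt γ C C₁ η σ s' A Ψ g c b y) (hC : 0 < C) (hσ : 0 < σ)
    (hE : ExitFree Ψ c.toConeChart W b y r s) (ht₀ : t₀ ≤ s') (hs : C / σ * t₀ ≤ s) (hr0 : 0 ≤ r)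
    (hr : r < s) : NoExit N.chart t₀ W := by
  intro p hp hmem l hl hl1 x hx hxt
  have hCσ := div_pos hC hσ
  have hT : ‖N.T p.1‖ < s := (N.T_le p.1).trans_lt ((mul_lt_mul_of_pos_left
    ((Sus.norm_le_size p).trans_lt hp) hCσ).trans_le hs)
  have hμ : N.μ * p.2.radius < s := (mul_le_mul_of_nonneg_right N.μ_le
    (Cone.radius_nonneg _)).trans_lt ((mul_lt_mul_of_pos_left
    ((Sus.radius_le_size p).trans_lt hp) hCσ).trans_le hs)
  have hμ0 := mul_nonneg N.μ_pos.le (Cone.radius_nonneg p.2)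
  have hI : ∀ᶠ t in l, t ∈ Ioo (0 : ℝ) 1 := hl1 (Ioo_mem_nhdsLT one_pos)
  have hlim : ∀ {W' : Type} [TopologicalSpace W'] (G : ℝ → W'), Continuous G →
      Tendsto G l (𝓝 (G 1)) := fun G hG => (hG.tendsto 1).mono_left (hl1.trans nhdsWithin_le_nhds)
  let f : ℝ → V × (E c.d × Cone Z.carrier) := fun t =>
    affHomeo Z.carrier N.T N.o N.μ N.μ_pos (t • p.1, Cone.dil t p.2)
  have hsub : (N.o + N.T p.1).1 - b = (N.T p.1).1 ∧ (N.o + N.T p.1).2 - y = (N.T p.1).2 := by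
    simp [N.o_eq]
  suffices h : (N.o + N.T p.1).1 ∈ Ψ.P ∧ (N.o + N.T p.1).2 ∈ c.U ∧ N.μ * p.2.radius < c.R by
    obtain ⟨h1, h2, h3⟩ := h
    refine N.chart.mem_target.2 ⟨?_, ?_⟩
    · change p.1 ∈ N.B
      rw [N.B_eq, ← N.o_eq]
      exact ⟨(Sus.norm_le_size p).trans_lt (hp.trans_le ht₀), h1, h2⟩
    · change _ < N.R
      rw [N.R_eq]
      exact lt_min ((Sus.radius_le_size p).trans_lt (hp.trans_le ht₀))
        ((lt_div_iff₀' N.μ_pos).2 h3)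
  refine hE (l.map f) inferInstance (eventually_map.2 (hI.mono fun t ht => ?_))
    (N.o + N.T p.1).1 (N.o + N.T p.1).2 (N.μ * p.2.radius) ?_ ?_ ?_
    (by rw [hsub.1]; exact (norm_fst_le _).trans_lt hT)
    (by rw [hsub.2]; exact (norm_snd_le _).trans_lt hT)
    (abs_sub_lt_of_nonneg_of_lt hμ0 hμ hr0 hr) x hx (tendsto_map'_iff.2 hxt)
  · have h4 := N.chart.mem_target.1 (hmem t ht)
    exact ⟨(N.mem_B _ h4.1).1, N.mem_target h4.1 h4.2⟩
  · refine tendsto_map'_iff.2 ?_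
    have := hlim (fun t => (N.o + N.T (t • p.1)).1) (by fun_prop)
    rwa [one_smul] at this
  · refine tendsto_map'_iff.2 ?_
    have := hlim (fun t => (N.o + N.T (t • p.1)).2) (by fun_prop)
    rwa [one_smul] at this
  · refine tendsto_map'_iff.2 ?_
    have := hlim (fun t => N.μ * (t * p.2.radius)) (by fun_prop)
    rw [one_mul] at this
    refine this.congr' (hI.mono fun t ht => ?_)
    change _ = (Cone.dil N.μ (Cone.dil t p.2)).radius
    rw [Cone.radius_dil N.μ_pos.le, Cone.radius_dil ht.1.le]

/-- The charts of an atlas contain balls of a uniform size. -/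
theorem IterAtlas.exists_margin (A : IterAtlas Z) : ∃ s > 0, ∀ z, ∃ i,
    z ∈ (A.chart i).φ.source ∧ Metric.ball ((A.chart i).φ z).1 s ⊆ (A.chart i).U ∧
      ((A.chart i).φ z).2.radius + s ≤ (A.chart i).R := by
  have := A.isAtlas.compact
  suffices h : ∃ s > 0, ∀ z ∈ univ, ∃ i, z ∈ (A.chart i).φ.source ∧
      Metric.ball ((A.chart i).φ z).1 s ⊆ (A.chart i).U ∧
      ((A.chart i).φ z).2.radius + s ≤ (A.chart i).R by simpa using h
  refine isCompact_univ.induction_on (p := fun K => ∃ s > 0, ∀ z ∈ K, ∃ i,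
      z ∈ (A.chart i).φ.source ∧ Metric.ball ((A.chart i).φ z).1 s ⊆ (A.chart i).U ∧
      ((A.chart i).φ z).2.radius + s ≤ (A.chart i).R) ⟨1, one_pos, by simp⟩
    (fun K K' hK ⟨s, hs, h⟩ => ⟨s, hs, fun z hz => h z (hK hz)⟩) ?_ ?_
  · rintro K K' ⟨s, hs, h⟩ ⟨s', hs', h'⟩
    refine ⟨min s s', lt_min hs hs', ?_⟩
    rintro z (hz | hz)
    · obtain ⟨i, h1, h2, h3⟩ := h z hz
      exact ⟨i, h1, (Metric.ball_subset_ball (min_le_left _ _)).trans h2,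
        by linarith [min_le_left s s']⟩
    · obtain ⟨i, h1, h2, h3⟩ := h' z hz
      exact ⟨i, h1, (Metric.ball_subset_ball (min_le_right _ _)).trans h2,
        by linarith [min_le_right s s']⟩
  · intro z _
    obtain ⟨i, hi⟩ := A.isAtlas.cover z
    have h1 := (A.chart i).mem_target.1 ((A.chart i).φ.map_source hi)
    obtain ⟨ε, hε, hball⟩ := Metric.isOpen_iff.1 (A.chart i).isOpen_U _ h1.1
    have hc := (A.chart i).φ.continuousAt hi
    have hc1 := (continuous_fst.continuousAt.comp hc).tendsto.eventually
      (Metric.ball_mem_nhds _ (half_pos hε))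
    have hc2 : ∀ᶠ z' in 𝓝 z, ((A.chart i).φ z').2.radius <
        (((A.chart i).φ z).2.radius + (A.chart i).R) / 2 :=
      ((Cone.continuous_radius.comp continuous_snd).continuousAt.comp hc).tendsto.eventually_lt_const
        (by change Cone.radius _ < _; linarith [h1.2])
    refine ⟨_, mem_nhdsWithin_of_mem_nhds (inter_mem (inter_mem hc1 hc2)
      ((A.chart i).φ.open_source.mem_nhds hi)), min (ε / 2)
      (((A.chart i).R - ((A.chart i).φ z).2.radius) / 2), lt_min (half_pos hε)
      (by linarith [h1.2]), fun z' hz' => ⟨i, hz'.2, ?_, ?_⟩⟩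
    · refine ((Metric.ball_subset_ball (min_le_left _ _)).trans
        (Metric.ball_subset_ball' ?_)).trans hball
      have : dist ((A.chart i).φ z').1 ((A.chart i).φ z).1 < ε / 2 := hz'.1.1
      linarith
    · have : ((A.chart i).φ z').2.radius < _ := hz'.1.2
      linarith [min_le_right (ε / 2) (((A.chart i).R - ((A.chart i).φ z).2.radius) / 2)]

end

/-! ### The levels at a point -/

section

variable {M X : StratSpace.{u}} {V : Type} [NormedAddCommGroup V] [NormedSpace ℝ V]

/-- The point with coordinates `(b, y, q)` in the composition of a product chart and the chart `i`,
in which `g` is an edge metric at the scale `σ`. -/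
structure Placed (γ C s : ℝ) (g : Metric M) (A : IterAtlas X) (i : Fin A.size) (W : Set M.carrier)
    (Ψ : ProdChart M X V) (σ : ℝ) (b : V) (y : E (A.chart i).d) (q : Cone (A.link i).carrier) :
    Prop where
  dim : Module.finrank ℝ V + X.n = M.n
  pos : 0 < σ
  edge : Ψ.IsEdgeAt γ C A dim g σ
  mem_P : b ∈ Ψ.P
  mem_U : y ∈ (A.chart i).U
  lt_R : q.radius < (A.chart i).R
  exit : ExitFree Ψ (A.chart i).toConeChart W b y q.radius s
  conn : IsConnected (tangentSphere (Module.finrank ℝ V + (A.chart i).d) (A.link i).carrier)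

theorem IterAtlas.link_n_ne_zero (A : IterAtlas X) (i : Fin A.size)
    (h : (A.chart i).d + 1 + (A.link i).n = X.n) : (A.link i).n ≠ 0 := fun h0 => by
  obtain ⟨y, hy⟩ := (A.chart i).nonempty_U
  refine A.isAtlas.no_codim_one ((A.chart i).φ.symm (y, Cone.vertex)) ?_
  rw [(A.chart i).dim_vertex hy]
  omega

theorem tangentSphere_dim_ne_zero {D : ℕ} {Y : StratSpace.{u}} [IsEmpty Y.carrier]
    (h : IsConnected (tangentSphere D Y.carrier)) : D ≠ 0 := by
  rintro rfl
  obtain ⟨⟨v, q⟩, hq⟩ := h.nonempty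
  obtain rfl : q = Cone.vertex := by
    rcases Cone.cases q with h | ⟨_, _, z, _⟩
    · exact h
    · exact isEmptyElim z
  have h1 : ‖v‖ ^ 2 + (0 : ℝ) ^ 2 = 1 := hq
  rw [Subsingleton.elim v 0, norm_zero] at h1
  norm_num at h1

/-- The next chart at a point. -/
theorem Placed.step [FiniteDimensional ℝ V] {γ C s s' : ℝ} {g : Metric M} {A : IterAtlas X}
    {i : Fin A.size} {W : Set M.carrier} {Ψ : ProdChart M X V} {σ : ℝ} {b : V}
    {y : E (A.chart i).d} {r : ℝ} (hr : 0 < r) {z : (A.link i).carrier} [Nonempty (A.link i).carrier]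
    (hp : Placed γ C s g A i W Ψ σ b y (Cone.pt r z)) (hs' : s' ≤ 1 / 2)
    (hs : (A.chart i).R * s' ≤ s) (hs0 : 0 ≤ s') {j : Fin (A.sub i).size}
    (hball : Metric.ball (((A.sub i).chart j).φ z).1 s' ⊆ ((A.sub i).chart j).U)
    (hR : (((A.sub i).chart j).φ z).2.radius + s' ≤ ((A.sub i).chart j).R)
    (hz : z ∈ ((A.sub i).chart j).φ.source) :
    Placed γ C s' g (A.sub i) j W (Ψ.step (A.chart i).toConeChart b y r hr) (σ * r) 0
      (((A.sub i).chart j).φ z).1 (((A.sub i).chart j).φ z).2 := by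
  have hrad : (Cone.pt r z).radius = r := Cone.radius_pt hr.le z
  have hrR : r ∈ Ioo 0 (A.chart i).R := ⟨hr, hrad ▸ hp.lt_R⟩
  have hn : (A.chart i).d + 1 + (A.link i).n = X.n := by
    rcases A.isAtlas.link i with ⟨-, h⟩ | ⟨h, -⟩
    · exact (h.false z).elim
    · exact h
  have hdim := hp.dim
  have hfr : Module.finrank ℝ (V × (E (A.chart i).d × ℝ)) =
      Module.finrank ℝ V + ((A.chart i).d + 1) := by simp
  have hV : Module.finrank ℝ (V × (E (A.chart i).d × ℝ)) + (A.link i).n = M.n := by omega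
  have hmem := ((A.sub i).chart j).mem_target.1 (((A.sub i).chart j).φ.map_source hz)
  have hex := hp.exit
  rw [hrad] at hex
  refine ⟨hV, mul_pos hp.pos hr, hp.edge.step i hn hp.mem_P hp.mem_U hrR hV,
    (A.chart i).zero_mem_box hp.mem_P hp.mem_U hrR, hmem.1, hmem.2,
    hex.step hr hs' ((mul_le_mul_of_nonneg_right hrR.2.le hs0).trans hs)
      ((A.sub i).chart j).toConeChart hball hR, ?_⟩
  rcases (A.sub i).isAtlas.link j with ⟨h1, h2⟩ | ⟨h1, h2⟩
  · have := A.link_n_ne_zero i hn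
    exact Sus.isConnected_of_isEmpty (by omega)
  · exact Sus.isConnected_of_nonempty (by omega)

theorem ProdChart.step_e_zero [FiniteDimensional ℝ V] {Z : StratSpace.{u}} (Ψ : ProdChart M X V)
    (c : ConeChart X Z) [Nonempty Z.carrier] (b : V) (y : E c.d) {r : ℝ} (hr : 0 < r)
    (z : Z.carrier) :
    (Ψ.step c b y r hr).e (0, z) = Ψ.e (b, c.φ.symm (y, Cone.pt r z)) := by
  rw [Ψ.step_e c b y hr (by simpa using hr)]
  simp

theorem error_le {γ η s₁ σ τ T E κ Λ : ℝ} (hγ : 0 < γ) (hη : 0 < η) (hs₁ : 0 < s₁) (hσ : 0 < σ)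
    (hτ : 0 < τ) (hT : 0 < T) (hTE : T ≤ E * σ) (hE : 0 < E) (hκ : 0 < κ)
    (hΛ : (η * s₁ ^ γ + 1) * (κ * E / s₁) ^ γ ≤ Λ) :
    η / σ ^ γ * (min (κ * τ) (s₁ * σ)) ^ γ + (1 - (min (κ * τ) (s₁ * σ) / (κ * τ)) ^ 2) ≤
      Λ * (τ / T) ^ γ := by
  have hκτ := mul_pos hκ hτ
  have h1 : κ * τ / (s₁ * σ) ≤ κ * E / s₁ * (τ / T) := by
    rw [div_mul_div_comm, div_le_div_iff₀ (by positivity) (by positivity)]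
    calc κ * τ * (s₁ * T) ≤ κ * τ * (s₁ * (E * σ)) := by gcongr
      _ = _ := by ring
  have h2 : (κ * τ / (s₁ * σ)) ^ γ ≤ (κ * E / s₁) ^ γ * (τ / T) ^ γ := by
    rw [← Real.mul_rpow (by positivity) (by positivity)]
    gcongr
  have h3 : (η * s₁ ^ γ + 1) * (κ * τ / (s₁ * σ)) ^ γ ≤ Λ * (τ / T) ^ γ :=
    calc (η * s₁ ^ γ + 1) * (κ * τ / (s₁ * σ)) ^ γ
        ≤ (η * s₁ ^ γ + 1) * ((κ * E / s₁) ^ γ * (τ / T) ^ γ) := by gcongr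
      _ = (η * s₁ ^ γ + 1) * (κ * E / s₁) ^ γ * (τ / T) ^ γ := by ring
      _ ≤ _ := by gcongr
  have hs := Real.rpow_pos_of_pos hs₁ γ
  have hσγ := Real.rpow_pos_of_pos hσ γ
  refine le_trans ?_ h3
  rcases le_total (κ * τ) (s₁ * σ) with h | h
  · rw [min_eq_left h, div_self hκτ.ne', one_pow, sub_self, add_zero,
      Real.div_rpow hκτ.le (by positivity), Real.mul_rpow hs₁.le hσ.le]
    have h4 := Real.rpow_nonneg hκτ.le γ
    calc η / σ ^ γ * (κ * τ) ^ γ = η * s₁ ^ γ * ((κ * τ) ^ γ / (s₁ ^ γ * σ ^ γ)) := by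
          field_simp
      _ ≤ _ := by gcongr; linarith
  · rw [min_eq_right h, Real.mul_rpow hs₁.le hσ.le]
    have h4 : 1 ≤ (κ * τ / (s₁ * σ)) ^ γ :=
      Real.one_le_rpow ((one_le_div (by positivity)).2 h) hγ.le
    calc η / σ ^ γ * (s₁ ^ γ * σ ^ γ) + (1 - (s₁ * σ / (κ * τ)) ^ 2)
        ≤ (η * s₁ ^ γ + 1) * 1 := by
          have : η / σ ^ γ * (s₁ ^ γ * σ ^ γ) = η * s₁ ^ γ := by field_simp
          rw [this]
          nlinarith [sq_nonneg (s₁ * σ / (κ * τ))]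
      _ ≤ _ := by gcongr

set_option maxHeartbeats 1000000 in
/-- The scales at which the cone of the chart `i` is visible. -/
theorem Placed.conicalBetween [FiniteDimensional ℝ V] {γ C C₁ η s s₁ E₁ E₂ κ Λ δ T lo : ℝ}
    {g : Metric M} {A : IterAtlas X} {i : Fin A.size} {W : Set M.carrier} {Ψ : ProdChart M X V}
    {σ : ℝ} {b : V} {y : E (A.chart i).d} {q : Cone (A.link i).carrier} {𝒮 : Set CompactMet.{u}}
    (hp : Placed γ C s g A i W Ψ σ b y q) (B : IterAtlas M) (hM : ∀ x, HasNormalChart γ g x)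
    (hγ : 0 < γ) (hγ1 : γ ≤ 1) (hC : 1 ≤ C) (hC₁ : 1 ≤ C₁) (hη : 0 < η) (hs₁ : 0 < s₁)
    (hN : Nonempty (NormalAt γ C C₁ η σ (s₁ * σ) (A.sub i) Ψ g (A.chart i) b y))
    (hs₁s : C * s₁ ≤ s) (hq : 8 * C * q.radius < s₁) (hE₁ : 0 < E₁) (hlo : E₁ * (σ * q.radius) ≤ lo)
    (hE : 0 < E₂) (hE' : 16 * E₂ ≤ s₁) (hT : 0 < T) (hTE : T ≤ E₂ * σ)
    (hκ : 2 * (C / E₁ + 2) < κ) (hΛ : (η * s₁ ^ γ + 1) * (κ * E₂ / s₁) ^ γ ≤ Λ)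
    (h𝒮 : suspSpaces γ C₁ (A.sub i) (M.n - 1) ⊆ 𝒮)
    (hW : geodBall g (Ψ.e (b, (A.chart i).φ.symm (y, q))) δ ⊆ W) :
    ConicalBetween γ κ Λ δ 𝒮 g (Ψ.e (b, (A.chart i).φ.symm (y, q))) T lo := by
  obtain ⟨N⟩ := hN
  have hC0 : 0 < C := by linarith
  have hσ := hp.pos
  have hD : N.D = Module.finrank ℝ V + (A.chart i).d := N.D_eq
  have hdim := hp.dim
  have hconn := hp.conn
  rw [← hD] at hconn
  have hM0 : M.n ≠ 0 ∧ N.D ≤ M.n := by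
    rcases A.isAtlas.link i with ⟨h1, h2⟩ | ⟨h1, h2⟩
    · have := tangentSphere_dim_ne_zero hconn
      omega
    · omega
  obtain ⟨n, hn⟩ : ∃ n, M.n = n + 1 := Nat.exists_eq_succ_of_ne_zero hM0.1
  have hsd : SuspDim N.D (A.link i) n := by
    rcases A.isAtlas.link i with ⟨h1, h2⟩ | ⟨h1, h2⟩
    · exact Or.inl ⟨h2, by omega⟩
    · exact Or.inr ⟨h2, by omega, A.link_n_ne_zero i h1⟩
  obtain ⟨ℬ, hℬ⟩ := exists_susp_edge hγ hγ1 hC₁ (A.sub i) hsd N.k_edge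
  have hcs : ConnectedSpace (Susp N.D (A.link i) n).carrier := isConnected_iff_connectedSpace.1 hconn
  have hcomp := ℬ.isAtlas.compact
  have ht2 := ℬ.isAtlas.t2
  obtain ⟨Y, hY⟩ := exists_isMetricSpaceOf ℬ.isAtlas.dense_reg fun x => hℬ.hasNormalChart hγ hγ1 x
  have hYS : Y ∈ 𝒮 := h𝒮 (by
    rw [hn, Nat.add_sub_cancel]
    exact ⟨⟨N.D, by omega⟩, N.k, N.k_edge, hY⟩)
  refine ⟨Susp N.D (A.link i) n, ℬ, suspMetric N.D n N.k, hcs, hℬ, ⟨Y, hYS, hY⟩, ?_⟩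
  intro τ hτ hδ hloτ hτT
  have hMc := B.isAtlas.compact
  have hMt := B.isAtlas.t2
  have hZc := (A.sub i).isAtlas.compact
  have hr0 := Cone.radius_nonneg q
  have hCE : 0 < C / E₁ := by positivity
  have hκ0 : 0 < κ := by linarith
  have hrad : (Cone.dil N.μ⁻¹ q).radius = q.radius / N.μ := by
    rw [Cone.radius_dil (inv_nonneg.2 N.μ_pos.le), inv_mul_eq_div]
  have hradle : q.radius / N.μ ≤ C * σ * q.radius := by
    rw [div_le_iff₀ N.μ_pos]
    nlinarith [N.le_μ]
  have hm : N.chart.φ.symm (0, Cone.dil N.μ⁻¹ q) = Ψ.e (b, (A.chart i).φ.symm (y, q)) := by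
    refine (N.inv_apply _).trans ?_
    simp only [N.o_eq, map_zero, add_zero]
    rw [Cone.dil_dil N.μ_pos.le, mul_inv_cancel₀ N.μ_pos.ne', Cone.dil_one]
  have h0 : (0 : E N.D) ∈ N.B := by
    rw [N.B_eq]
    exact ⟨by rw [norm_zero]; positivity, by simpa using ⟨hp.mem_P, hp.mem_U⟩⟩
  have hσr : C * σ * q.radius < s₁ * σ / 8 := by nlinarith
  have hτσ : 2 * τ < s₁ * σ / 8 := by nlinarith
  have hτκ : C * σ * q.radius + 2 * τ < κ * τ / 2 := by
    have h1 : C * σ * q.radius ≤ C / E₁ * τ := by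
      rw [div_mul_eq_mul_div, le_div_iff₀ hE₁]
      nlinarith [hlo.trans hloτ]
    nlinarith
  have hη' : 0 ≤ η / σ ^ γ := (div_pos hη (Real.rpow_pos_of_pos hσ γ)).le
  rw [← hm] at hW ⊢
  have ht₀s : min (κ * τ) (s₁ * σ) ≤ s₁ * σ := min_le_right _ _
  have key := N.normal.exists_coneApprox (n := n) (t := κ * τ) (t₀ := min (κ * τ) (s₁ * σ))
    (τ := τ) (ε := Λ * (τ / T) ^ γ) (δ := δ) (q := Cone.dil N.μ⁻¹ q) hγ hη' B.isAtlas.dense_reg hM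
    (A.sub i).isAtlas.dense_reg h0 (by omega) hτ (min_le_left _ _) (by linarith) ?_ ?_ hW
    (N.noExit hC0 hσ hp.exit ht₀s ?_ hr0 (by nlinarith))
    (error_le hγ hη hs₁ hσ hτ hT hTE hE hκ0 hΛ)
  · rwa [← mul_assoc] at key
  · rw [hrad]
    change _ < N.R
    rw [N.R_eq]
    exact lt_min (by nlinarith) ((div_lt_div_iff_of_pos_right N.μ_pos).2 hp.lt_R)
  · rw [hrad]
    rcases min_choice (κ * τ) (s₁ * σ) with h | h <;> rw [h] <;> nlinarith
  · calc C / σ * min (κ * τ) (s₁ * σ) ≤ C / σ * (s₁ * σ) := by gcongr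
      _ = C * s₁ := by field_simp
      _ ≤ s := hs₁s

end

/-- The levels of the points placed in the chart `i`. -/
def PlacedLevels (γ C s : ℝ) {M X : StratSpace.{u}} (g : Metric M) (A : IterAtlas X)
    (i : Fin A.size) (E₀ κ Λ : ℝ) (𝒮 : Set CompactMet.{u}) : Prop :=
  ∀ (V : Type) [NormedAddCommGroup V] [NormedSpace ℝ V] [FiniteDimensional ℝ V]
    (Ψ : ProdChart M X V) (W : Set M.carrier) (σ : ℝ) (b : V) (y : E (A.chart i).d)
    (q : Cone (A.link i).carrier) (T δ : ℝ) (d : ℕ), Placed γ C s g A i W Ψ σ b y q → 0 < T →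
    T ≤ E₀ * σ → geodBall g (Ψ.e (b, (A.chart i).φ.symm (y, q))) δ ⊆ W → (A.sub i).depth ≤ d →
    Levels γ κ Λ δ 𝒮 g (Ψ.e (b, (A.chart i).φ.symm (y, q))) d T

theorem PlacedLevels.anti {γ C s : ℝ} {M X : StratSpace.{u}} {g : Metric M} {A : IterAtlas X}
    {i : Fin A.size} {E₀ E₁ κ Λ : ℝ} {𝒮 : Set CompactMet.{u}} (hE : E₁ ≤ E₀)
    (h : PlacedLevels γ C s g A i E₀ κ Λ 𝒮) : PlacedLevels γ C s g A i E₁ κ Λ 𝒮 :=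
  fun V _ _ _ Ψ W σ b y q T δ d hp hT hTE hW hd =>
    h V Ψ W σ b y q T δ d hp hT (hTE.trans (mul_le_mul_of_nonneg_right hE hp.pos.le)) hW hd

set_option maxHeartbeats 1000000 in
theorem uniformly_placedLevels {γ C : ℝ} (hγ : 0 < γ) (hγ1 : γ ≤ 1) (hC : 1 ≤ C)
    {M : StratSpace.{u}} (B : IterAtlas M) {g : Metric M} (hM : ∀ x, HasNormalChart γ g x)
    {X : StratSpace.{u}} (A : IterAtlas X) : ∀ s > 0, ∀ i,
      Uniformly fun E₀ κ Λ 𝒮 => PlacedLevels γ C s g A i E₀ κ Λ 𝒮 := by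
  refine IterAtlas.ind (P := fun X A => ∀ s > 0, ∀ i,
      Uniformly fun E₀ κ Λ 𝒮 => PlacedLevels γ C s g A i E₀ κ Λ 𝒮) ?_ A
  intro X A ih s hs i
  have hC0 : 0 < C := by linarith
  obtain ⟨C₁, hC₁, η, hη, s₀, hs₀, hnormal⟩ := exists_normalAt hγ hγ1 hC (A.sub i)
  obtain ⟨s', hs', hmargin⟩ := (A.sub i).exists_margin
  have hR := (A.chart i).R_pos
  obtain ⟨E₁, hE₁, κ₁, 𝒮₁, h𝒮₁, hκ₁⟩ := Uniformly.forall
    (ih i (min (min s' (1 / 2)) (s / (A.chart i).R)) (by positivity))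
    fun j E E' κ Λ 𝒮 hE h => h.anti hE
  set s'' := min (min s' (1 / 2)) (s / (A.chart i).R) with hs''
  have hs''0 : 0 < s'' := by positivity
  have hs''1 : s'' ≤ s' := (min_le_left _ _).trans (min_le_left _ _)
  have hs''2 : (A.chart i).R * s'' ≤ s := by
    have : s'' ≤ s / (A.chart i).R := min_le_right _ _
    rwa [le_div_iff₀' hR] at this
  set s₁ := min s₀ (s / C) with hs₁
  have hs₁0 : 0 < s₁ := by positivity
  have hs₁C : C * s₁ ≤ s := by
    have : s₁ ≤ s / C := min_le_right _ _
    rwa [le_div_iff₀' hC0] at this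
  set r₁ := s₁ / (8 * C) with hr₁
  have hr₁0 : 0 < r₁ := by positivity
  set E₀ := min (s₁ / 16) (E₁ * r₁) with hE₀
  have hE₀0 : 0 < E₀ := by positivity
  have hE₀1 : 16 * E₀ ≤ s₁ := by linarith [min_le_left (s₁ / 16) (E₁ * r₁)]
  have hE₀2 : E₀ ≤ E₁ * r₁ := min_le_right _ _
  refine ⟨E₀, hE₀0, max κ₁ (2 * (C / E₁ + 2) + 1),
    ⋃ j : Bool, if j then 𝒮₁ else suspSpaces γ C₁ (A.sub i) (M.n - 1),
    BiLipColored.iUnion fun j => ?_, fun κ hκ => ?_⟩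
  · cases j
    · exact biLipColored_suspSpaces hγ hC₁ _ _
    · exact h𝒮₁
  have hκ2 : 2 * (C / E₁ + 2) < κ := by linarith [(le_max_right _ _).trans hκ]
  obtain ⟨Λ₁, hΛ₁⟩ := hκ₁ κ ((le_max_left _ _).trans hκ)
  refine ⟨max Λ₁ (max 0 ((η * s₁ ^ γ + 1) * (κ * E₀ / s₁) ^ γ)), fun Λ hΛ 𝒮 h𝒮 => ?_⟩
  have hS₁ : 𝒮₁ ⊆ 𝒮 := (subset_iUnion_of_subset true (by simp)).trans h𝒮
  have hS₂ : suspSpaces γ C₁ (A.sub i) (M.n - 1) ⊆ 𝒮 :=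
    (subset_iUnion_of_subset false (by simp)).trans h𝒮
  have hΛ0 : 0 ≤ Λ := ((le_max_left _ _).trans (le_max_right _ _)).trans hΛ
  have hsub := hΛ₁ Λ ((le_max_left _ _).trans hΛ) 𝒮 hS₁
  intro V _ _ _ Ψ W σ b y q T δ d hp hT hTE hW hd
  have hσ := hp.pos
  have hr0 := Cone.radius_nonneg q
  have hcon : ∀ lo, q.radius < r₁ → E₁ * (σ * q.radius) ≤ lo →
      ConicalBetween γ κ Λ δ 𝒮 g (Ψ.e (b, (A.chart i).φ.symm (y, q))) T lo := fun lo hq hlo => by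
    refine hp.conicalBetween B hM hγ hγ1 hC hC₁ hη hs₁0 (hnormal M X V Ψ hp.dim g σ (A.chart i) hσ
      (A.isAtlas.link i) (((isEdgeOn_iff A).1 hp.edge).2 i) b hp.mem_P y hp.mem_U (s₁ * σ)
      (by positivity) (mul_le_mul_of_nonneg_right (min_le_left _ _) hσ.le)) hs₁C ?_ hE₁ hlo hE₀0
      hE₀1 hT hTE hκ2 (((le_max_right _ _).trans (le_max_right _ _)).trans hΛ) hS₂ hW
    rwa [hr₁, lt_div_iff₀' (by positivity)] at hq
  have hnext : 0 < q.radius → ∀ T' > 0, T' ≤ E₁ * (σ * q.radius) → ∀ d', (A.sub i).depth ≤ d' + 1 →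
      Levels γ κ Λ δ 𝒮 g (Ψ.e (b, (A.chart i).φ.symm (y, q))) d' T' := by
    intro hq T' hT' hTE' d' hd'
    rcases Cone.cases q with rfl | ⟨r, hr, z, rfl⟩
    · exact absurd hq (lt_irrefl _)
    have : Nonempty (A.link i).carrier := ⟨z⟩
    obtain ⟨j, hz, hball, hjR⟩ := hmargin z
    have hp' := hp.step hr (s' := s'') ((min_le_left _ _).trans (min_le_right _ _)) hs''2 hs''0.le
      ((Metric.ball_subset_ball hs''1).trans hball) (by linarith) hz
    have he : (Ψ.step (A.chart i).toConeChart b y r hr).e (0, ((A.sub i).chart j).φ.symm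
        ((((A.sub i).chart j).φ z).1, (((A.sub i).chart j).φ z).2)) =
        Ψ.e (b, (A.chart i).φ.symm (y, Cone.pt r z)) := by
      rw [Prod.mk.eta, ((A.sub i).chart j).φ.left_inv hz]
      exact Ψ.step_e_zero _ b y hr z
    have hdep := (A.sub i).depth_sub_lt j
    rw [Cone.radius_pt hr.le] at hTE'
    have := hsub j _ _ W (σ * r) 0 _ _ T' δ d' hp' hT' hTE' (by rwa [he]) (by omega)
    rwa [he] at this
  have hcase : 0 < q.radius → T ≤ E₁ * (σ * q.radius) →
      Levels γ κ Λ δ 𝒮 g (Ψ.e (b, (A.chart i).φ.symm (y, q))) d T := fun hq h =>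
    hnext hq T hT h d (by omega)
  rcases lt_or_ge q.radius r₁ with hq | hq
  · rcases hr0.eq_or_lt with h0 | h0
    · exact Levels.single hγ hΛ0 d hT (hcon 0 hq (by rw [← h0]; simp))
    · rcases le_or_gt T (E₁ * (σ * q.radius)) with h | h
      · exact hcase h0 h
      · have hpos : 0 < E₁ * (σ * q.radius) := by positivity
        obtain ⟨d', rfl⟩ : ∃ d', d = d' + 1 := by
          refine Nat.exists_eq_succ_of_ne_zero fun h1 => ?_
          rcases Cone.cases q with rfl | ⟨r, hr, z, rfl⟩
          · exact absurd h0 (lt_irrefl _)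
          · obtain ⟨j, -⟩ := hmargin z
            have := (A.sub i).depth_sub_lt j
            omega
        exact Levels.cons hpos h (hcon _ hq le_rfl) (hnext h0 _ hpos le_rfl d' hd)
  · refine hcase (hr₁0.trans_le hq) (hTE.trans ?_)
    calc E₀ * σ ≤ E₁ * r₁ * σ := by gcongr
      _ ≤ E₁ * q.radius * σ := by gcongr
      _ = _ := by ring

/-- The levels as products of ratios. -/
theorem Levels.exists_ratio {M : StratSpace.{u}} {γ κ Λ δ : ℝ} {𝒮 : Set CompactMet.{u}}
    {g : Metric M} {m : M.carrier} {d : ℕ} {T : ℝ} (h : Levels γ κ Λ δ 𝒮 g m d T) (hγ : 0 < γ)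
    (hT : 0 < T) (hT1 : T ≤ 1) (hΛ : 0 ≤ Λ) (hδ : ∀ τ, 2 * κ * τ ≤ δ → τ < T) :
    ∃ ρ : ℕ → ℝ, (∀ i ∈ Finset.Icc 1 d, 0 < ρ i ∧ ρ i < 1) ∧ ρ (d + 1) = 0 ∧
      ∀ j ∈ Finset.Icc 1 (d + 1), ConicalBetween γ κ (Λ / T ^ γ) δ 𝒮 g m
        (∏ i ∈ Finset.Icc 1 (j - 1), ρ i) (∏ i ∈ Finset.Icc 1 j, ρ i) := by
  obtain ⟨τ, h0, hlt, hend, hcon⟩ := h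
  have hTγ := Real.rpow_pos_of_pos hT γ
  have hΛΛ : Λ ≤ Λ / T ^ γ :=
    le_div_self hΛ hTγ (Real.rpow_le_one hT.le hT1 hγ.le)
  let θ : ℕ → ℝ := fun i => if i = 0 then 1 else τ i
  have hθs : ∀ i, θ (i + 1) = τ (i + 1) := fun i => if_neg i.succ_ne_zero
  have hθτ : ∀ i, τ i ≤ θ i := by
    rintro (_ | i)
    · exact h0.trans_le hT1
    · exact (hθs i).ge
  have hθpos : ∀ i ≤ d, 0 < θ i := by
    rintro (_ | i) hi
    · exact one_pos
    · exact (hlt i hi).1.trans_eq (hθs i).symm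
  have hprod : ∀ j ≤ d + 1, ∏ i ∈ Finset.Icc 1 j, θ i / θ (i - 1) = θ j := by
    intro j
    induction j with
    | zero => intro; simp [θ]
    | succ j ih =>
      intro hj
      rw [Finset.prod_Icc_succ_top (by omega), ih (by omega), Nat.add_sub_cancel,
        mul_div_cancel₀ _ (hθpos j (by omega)).ne']
  refine ⟨fun i => θ i / θ (i - 1), ?_, ?_, ?_⟩
  · intro i hi
    obtain ⟨i, rfl⟩ := Nat.exists_eq_add_of_le' (Finset.mem_Icc.1 hi).1
    have hi := (Finset.mem_Icc.1 hi).2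
    have hp := hθpos i (by omega)
    exact ⟨div_pos (hθpos _ hi) hp, (div_lt_one hp).2
      ((hθs i).trans_lt ((hlt i (by omega)).2.trans_le (hθτ i)))⟩
  · simp only [hθs, hend, zero_div]
  · intro j hj
    obtain ⟨i, rfl⟩ := Nat.exists_eq_add_of_le' (Finset.mem_Icc.1 hj).1
    have hi := (Finset.mem_Icc.1 hj).2
    rw [hprod _ hi, hprod _ (by omega), Nat.add_sub_cancel, hθs]
    refine (hcon i (by omega)).mono le_rfl fun t ht htδ hti => ?_
    rcases i with _ | i
    · rw [h0]
      refine ⟨hδ t htδ, le_of_eq ?_⟩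
      rw [Real.div_rpow ht.le hT.le]
      simp only [θ, if_true, div_one]
      ring
    · rw [hθs] at hti ⊢
      exact ⟨hti, mul_le_mul_of_nonneg_right hΛΛ
        (Real.rpow_nonneg (div_nonneg ht.le (ht.trans hti).le) _)⟩

theorem placed_refl {M : StratSpace.{u}} {γ C s : ℝ} {g : Metric M} {A : IterAtlas M}
    (hg : IsEdgeOn γ C A (E 0) univ g.lift) {i : Fin A.size}
    (hconn : IsConnected (tangentSphere (A.chart i).d (A.link i).carrier)) {m : M.carrier}
    (hm : m ∈ (A.chart i).φ.source) :
    Placed γ C s g A i (A.chart i).φ.source (ProdChart.refl M) 1 0 ((A.chart i).φ m).1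
      ((A.chart i).φ m).2 := by
  have hV : Module.finrank ℝ (E 0) + M.n = M.n := by simp
  have hmem := (A.chart i).mem_target.1 ((A.chart i).φ.map_source hm)
  refine ⟨hV, one_pos, ProdChart.isEdgeAt_refl hg hV, mem_univ _, hmem.1, hmem.2,
    exitFree_refl _ _ _ _ _, ?_⟩
  rwa [finrank_euclideanSpace_fin, zero_add]

/-- The cones at all scales around the points of a space with an iterated edge metric. -/
theorem IsIteratedEdge.exists_conicalBetween {M : StratSpace.{u}} {𝒜 : IterAtlas M} {g : Metric M}
    {γ : ℝ} (hγ : 0 < γ) (hγ1 : γ ≤ 1) (hg : IsIteratedEdge γ 𝒜 g)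
    (hconn : ∀ α, IsConnected (tangentSphere (𝒜.chart α).d (𝒜.link α).carrier)) :
    ∃ (Λ δ₀ κ : ℝ) (𝒮 : Set CompactMet.{u}), 0 < Λ ∧ 0 < δ₀ ∧ δ₀ ≤ 1 ∧ 1 ≤ κ ∧ Λ * δ₀ < 1 ∧
      (∀ δ ∈ Ioo 0 δ₀, ∀ m α, geodBall g m δ ⊆ (𝒜.chart α).φ.source → ∃ ρ : ℕ → ℝ,
        (∀ i ∈ Finset.Icc 1 (𝒜.sub α).depth, 0 < ρ i ∧ ρ i < 1) ∧ ρ ((𝒜.sub α).depth + 1) = 0 ∧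
        ∀ j ∈ Finset.Icc 1 ((𝒜.sub α).depth + 1), ConicalBetween γ κ Λ δ 𝒮 g m
          (∏ i ∈ Finset.Icc 1 (j - 1), ρ i) (∏ i ∈ Finset.Icc 1 j, ρ i)) ∧ BiLipColored 𝒮 := by
  have hM := hg.hasNormalChart hγ hγ1
  obtain ⟨C, hC, hE⟩ := hg.exists_one_le
  obtain ⟨E₀, hE₀, κ₀, 𝒮, h𝒮, hκ⟩ := Uniformly.forall
    (P := fun i E₀ κ Λ 𝒮 => PlacedLevels γ C 1 g 𝒜 i E₀ κ Λ 𝒮)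
    (uniformly_placedLevels hγ hγ1 hC 𝒜 hM 𝒜 1 one_pos) fun j E E' κ Λ 𝒮 hE h => h.anti hE
  obtain ⟨Λ₀, hΛ⟩ := hκ (max κ₀ 1) (le_max_left _ _)
  obtain ⟨T, hT, hT1, hTE⟩ : ∃ T > 0, T ≤ 1 ∧ T ≤ E₀ :=
    ⟨min 1 E₀, lt_min one_pos hE₀, min_le_left _ _, min_le_right _ _⟩
  have hΛ₁ : 0 < max Λ₀ 1 := one_pos.trans_le (le_max_right _ _)
  have hΛT : 0 < max Λ₀ 1 / T ^ γ := div_pos hΛ₁ (Real.rpow_pos_of_pos hT γ)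
  have hκ1 : 1 ≤ max κ₀ 1 := le_max_right _ _
  refine ⟨max Λ₀ 1 / T ^ γ, min T (2 * (max Λ₀ 1 / T ^ γ))⁻¹, max κ₀ 1, 𝒮, hΛT,
    lt_min hT (by positivity), (min_le_left _ _).trans hT1, hκ1, ?_, ?_, h𝒮⟩
  · refine (mul_le_mul_of_nonneg_left (min_le_right _ _) hΛT.le).trans_lt ?_
    rw [mul_inv, mul_left_comm, mul_inv_cancel₀ hΛT.ne']
    norm_num
  · rintro δ ⟨hδ, hδ₀⟩ m α hball
    have hm : m ∈ (𝒜.chart α).φ.source := hball (by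
      change geodEDist g m m < _
      rw [geodEDist_self]
      exact ENNReal.ofReal_pos.2 hδ)
    have he : (ProdChart.refl M).e (0, (𝒜.chart α).φ.symm
        (((𝒜.chart α).φ m).1, ((𝒜.chart α).φ m).2)) = m := (𝒜.chart α).φ.left_inv hm
    have hL := hΛ (max Λ₀ 1) (le_max_left _ _) 𝒮 subset_rfl α (E 0) (ProdChart.refl M) _ 1 0 _ _ T δ
      _ (placed_refl hE (hconn α) hm) hT (by rwa [mul_one]) (by rwa [he]) le_rfl
    rw [he] at hL
    refine hL.exists_ratio hγ hT hT1 hΛ₁.le fun τ hτ => ?_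
    have := hδ₀.trans_le (min_le_left _ _)
    rcases le_or_gt τ 0 with h | h
    · exact h.trans_lt hT
    · nlinarith

end Stratified

end
theorem proposition2p1 (M : Stratified.StratSpace.{u}) (𝒜 : Stratified.IterAtlas M)
    (g : Stratified.Metric M) (γ : ℝ) (hγ : 0 < γ) (hγ1 : γ ≤ 1)
    (hg : Stratified.IsIteratedEdge γ 𝒜 g)
    (hconn : ∀ α : Fin 𝒜.size,
      IsConnected (Stratified.tangentSphere (𝒜.chart α).d (𝒜.link α).carrier)) :
    ∃ (Λ δ₀ κ : ℝ) (𝒮 : Set Stratified.CompactMet.{u}),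
      0 < Λ ∧ 0 < δ₀ ∧ δ₀ ≤ 1 ∧ 1 ≤ κ ∧ Λ * δ₀ < 1 ∧
      (∀ δ ∈ Set.Ioo 0 δ₀, ∀ (m : M.carrier) (α : Fin 𝒜.size),
        Stratified.geodBall g m δ ⊆ (𝒜.chart α).φ.source →
        ∃ ρ : ℕ → ℝ,
          (∀ i ∈ Finset.Icc 1 (𝒜.sub α).depth, 0 < ρ i ∧ ρ i < 1) ∧
          ρ ((𝒜.sub α).depth + 1) = 0 ∧
          ∀ j ∈ Finset.Icc 1 ((𝒜.sub α).depth + 1),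
            ∃ (S : Stratified.StratSpace.{u}) (ℬ : Stratified.IterAtlas S)
              (h : Stratified.Metric S),
              ConnectedSpace S.carrier ∧
              Stratified.IsIteratedEdge γ ℬ h ∧
              (∃ Y ∈ 𝒮, Stratified.IsMetricSpaceOf Y h) ∧
              ∀ τ : ℝ, 0 < τ → 2 * κ * τ ≤ δ →
                ∏ i ∈ Finset.Icc 1 j, ρ i ≤ τ → τ < ∏ i ∈ Finset.Icc 1 (j - 1), ρ i →
                ∃ Φ : Stratified.ConeChart M S,
                  Stratified.geodBall g m τ ⊆ Φ.φ.source ∧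
                  Φ.φ.source ⊆ Stratified.geodBall g m (2 * κ * τ) ∧
                  Stratified.IsConeApprox Φ (κ * τ)
                    (Λ * (τ / ∏ i ∈ Finset.Icc 1 (j - 1), ρ i) ^ γ) g h) ∧
      Stratified.BiLipPrecompact 𝒮 ∧
      ∃ (N : ℕ) (Y : Fin N → Stratified.CompactMet.{u}) (K : ℝ), 1 < K ∧
        ∀ X ∈ 𝒮, ∃ β : Fin N, Stratified.BiLip K X (Y β) := by
  obtain ⟨Λ, δ₀, κ, 𝒮, h1, h2, h3, h4, h5, h6, h7⟩ := hg.exists_conicalBetween hγ hγ1 hconn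
  obtain ⟨N, Y, hY⟩ := Stratified.finite_cover_of_finColor (h7 2 one_lt_two)
  exact ⟨Λ, δ₀, κ, 𝒮, h1, h2, h3, h4, h5, h6, Stratified.biLipPrecompact_of_finColor h7,
    N, Y, 2, one_lt_two, hY⟩
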